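/- **Setting.** Let $G$ be a real (Hausdorff, finite-dimensional) Lie group with Lie algebra $\mathfrak g$, with fixed norms on $\mathfrak g$ and its dual, and let $\mathfrak g_1,\mathfrak g_2\subseteq\mathfrak g$ be Lie subalgebras with $\mathfrak g_1+\mathfrak g_2=\mathfrak g$. Identify the Pontryagin dual $\mathfrak g^\wedge$ with $i\mathfrak g^*=\mathrm{Hom}_{\mathbb R}(\mathfrak g,i\mathbb R)$, so that $\xi$ corresponds to the character $x\mapsto e^{x\xi}$, where $x\xi:=\xi(x)$; similarly for $\mathfrak g_1,\mathfrak g_2$. For $\zeta\in\mathfrak g^\wedge$ let $\zeta_k\in\mathfrak g_k^\wedge$ be its restriction. Fix an open neighborhood $\mathcal G$ of $0\in\mathfrak g$ which $\exp$ maps by an analytic isomorphism onto an open subset of $G$, with inverse $\log$, and for $x\in\mathfrak g_1$, $y\in\mathfrak g_2$ near $0$ put $\{x,y\}:=\log(\exp(x)\exp(y))-x-y$ and $$\Omega(x,y,\zeta):=e^{\{x,y\}\zeta}=\sum_{|\gamma|\le\min(|\alpha|,|\beta|)}c_{\alpha\beta\gamma}\,x^\alpha y^\beta\zeta^\gamma$$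 (Taylor expansion at the origin in linear coordinates). Fix Haar measures on $\mathfrak g_1,\mathfrak g_2$ and give $\mathfrak g_k^\wedge$ the dual measures, so that $a^\vee(x)=\int a(\xi)e^{-x\xi}\,d\xi$ is the inverse Fourier transform. Let $\chi_k\in C_c^\infty(\mathfrak g_k)$ be even, $[0,1]$-valued and equal to $1$ near $0$. For Schwartz functions $a$ on $\mathfrak g_1^\wedge$, $b$ on $\mathfrak g_2^\wedge$ define $$a\star b(\zeta)=\int_{\mathfrak g_1\times\mathfrak g_2}a^\vee(x)b^\vee(y)e^{x\zeta_1}e^{y\zeta_2}e^{\{x,y\}\zeta}\chi_1(x)\chi_2(y)\,dx\,dy ,$$ and for smooth $a,b$ and $j\ge0$ define $$a\star^jb(\zeta)=\sum_{\substack{|\gamma|\le\min(|\alpha|,|\beta|)\\|\alpha|+|\beta|-|\gamma|=j}}c_{\alpha\beta\gamma}\,\zeta^\gamma\,\partial^\alpha a(\zeta_1)\,\partial^\beta b(\zeta_2),$$ where $\partial^\alpha$ is normalized by $(\partial^\alpha a)^\vee(x)=x^\alpha a^\vee(x)$. **Symbol classes.** Let $\langle\xi\rangle=(1+|\xi|^2)^{1/2}$.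 For $m\in\mathbb Z$, $S^m$ is the space of smooth functions $a$ with $\sup_\xi\langle\xi\rangle^{|\alpha|-m}|\partial^\alpha a(\xi)|<\infty$ for all $\alpha$. Let $\mathrm h$ range over a fixed subset of $(0,1]$. For $\delta\in[0,1)$ and $c\in\mathbb R$, $\mathrm h^cS^m[\mathrm h^\delta]$ is the space of $\mathrm h$-dependent smooth functions $a(\xi)=a(\xi;\mathrm h)$ with $\sup_{\mathrm h,\xi}\mathrm h^{-c+\delta|\alpha|}\langle\xi\rangle^{|\alpha|-m}|\partial^\alpha a(\xi;\mathrm h)|<\infty$ for all $\alpha$, and $S^m[\mathrm h^\delta]$ is the case $c=0$. These are topologized by the displayed seminorms. One sets $S^{-\infty}=\bigcap_mS^m$ (the Schwartz space), topologized by all these seminorms, and $S^{\infty}=\bigcup_mS^m$, with the locally convex inductive limit topology; likewise for the $\mathrm h$-dependent classes. A map defined on a product of such spaces in which one or both factors have order $+\infty$ is called continuous if its restrictions to the products obtained by replacing each such factor by any of its subspaces of smaller order are continuous. By convention $\infty+(-\infty)=-\infty$. A pair $(m_1,m_2)$ in $(\mathbb Z\cup\{\pm\infty\})^2$ is *admissible*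 if ($\mathfrak g_1\ne\mathfrak g\Rightarrow m_2=-\infty$) and ($\mathfrak g_2\neq\mathfrak g\Rightarrow m_1=-\infty$). **Theorem.** There is a neighborhood $U$ of $0$ in $\mathfrak g$ such that for all choices of the Haar measures and all cutoffs $\chi_1,\chi_2$ as above with support in $U$ the following holds. (1) The star product on Schwartz functions extends uniquely to a compatible family (any two members agree on the common part of their domains) of continuous maps $$\star:S^{m_1}(\mathfrak g_1^\wedge)\times S^{m_2}(\mathfrak g_2^\wedge)\to S^{m_1+m_2}(\mathfrak g^\wedge),$$ indexed by the admissible pairs $(m_1,m_2)$. These maps are bilinear. (2) For $\mathrm h$-dependent symbols $a,b$ let $a\star_{\mathrm h}b$ be defined by $(a\star_{\mathrm h}b)_{\mathrm h}=a_{\mathrm h}\star b_{\mathrm h}$, where $f_{\mathrm h}(\xi):=f(\mathrm h\xi;\mathrm h)$. Let $\delta_1,\delta_2\in[0,1)$ with $\delta_1+\delta_2<1$, let $J\in\mathbb Z_{\ge0}$, and let $(m_1,m_2)$ be admissible. Then for all $a\in S^{m_1}(\mathfrak g_1^\wedge)[\mathrm h^{\delta_1}]$ and $b\in S^{m_2}(\mathfrak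 g_2^\wedge)[\mathrm h^{\delta_2}]$, $$a\star_{\mathrm h}b-\sum_{0\le j<J}\mathrm h^j\,a\star^jb\ \in\ \mathrm h^{(1-\delta_1-\delta_2)J}\,S^{m_1+m_2-J}(\mathfrak g^\wedge)[\mathrm h^{\max(\delta_1,\delta_2)}],$$ and this remainder depends continuously on $(a,b)$. -/

import Mathlib

open scoped Topology ContDiff Manifold ENNReal

noncomputable section

namespace StarProduct

/-! ### Scales of spaces indexed by `ℤ ∪ {±∞}` and their evident topologies

Orders are elements of `WithBot (WithTop ℤ)`, i.e. of `ℤ ∪ {-∞, +∞}`.  The addition of this type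
satisfies `⊥ + m = m + ⊥ = ⊥` for every `m`, so `∞ + (-∞) = -∞`. -/

/-- The set of orders `ℤ ∪ {-∞, +∞}`. -/
abbrev Order : Type := WithBot (WithTop ℤ)

/-- An integer regarded as an order. -/
abbrev ofInt (n : ℤ) : Order := ((n : WithTop ℤ) : WithBot (WithTop ℤ))

section Scale

variable {X : Type*} [AddCommGroup X] [Module ℂ X]

/-- An increasing scale `F n` (`n ∈ ℤ`) is extended to `m = -∞` by taking intersections and to
`m = +∞` by taking unions (the supremum of an increasing family of subspaces is its union). -/
def scaleSpace (F : ℤ → Submodule ℂ X) : Order → Submodule ℂ X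
  | none => ⨅ n, F n
  | some none => ⨆ n, F n
  | some (some n) => F n

theorem scaleSpace_bot (F : ℤ → Submodule ℂ X) : scaleSpace F ⊥ = ⨅ n, F n := rfl

theorem scaleSpace_top (F : ℤ → Submodule ℂ X) : scaleSpace F ⊤ = ⨆ n, F n := rfl

theorem scaleSpace_ofInt (F : ℤ → Submodule ℂ X) (n : ℤ) : scaleSpace F (ofInt n) = F n := rfl

theorem scaleSpace_mono {F : ℤ → Submodule ℂ X} (hF : Monotone F) : Monotone (scaleSpace F) := by
  intro m m' h
  induction m using WithBot.recBotCoe with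
  | bot =>
    change (⨅ n, F n) ≤ scaleSpace F m'
    induction m' using WithBot.recBotCoe with
    | bot => exact le_rfl
    | coe m' =>
      induction m' using WithTop.recTopCoe with
      | top => exact (iInf_le F 0).trans (le_iSup F 0)
      | coe n' => exact iInf_le F n'
  | coe m =>
    induction m' using WithBot.recBotCoe with
    | bot => simp at h
    | coe m' =>
      have h' : m ≤ m' := WithBot.coe_le_coe.1 h
      induction m' using WithTop.recTopCoe with
      | top =>
        change scaleSpace F (m : Order) ≤ ⨆ n, F n
        induction m using WithTop.recTopCoe with
        | top => exact le_rfl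
        | coe n => exact le_iSup F n
      | coe n' =>
        induction m using WithTop.recTopCoe with
        | top => simp at h'
        | coe n => exact hF (WithTop.coe_le_coe.1 h')

theorem scaleSpace_le_comap {Y : Type*} [AddCommGroup Y] [Module ℂ Y] {F : ℤ → Submodule ℂ X}
    {F' : ℤ → Submodule ℂ Y} (R : X →ₗ[ℂ] Y) (h : ∀ n, F n ≤ (F' n).comap R) (m : Order) :
    scaleSpace F m ≤ (scaleSpace F' m).comap R := by
  induction m using WithBot.recBotCoe with
  | bot =>
    intro a ha
    change R a ∈ ⨅ n, F' n
    have ha' : a ∈ ⨅ n, F n := ha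
    rw [Submodule.mem_iInf] at ha' ⊢
    exact fun n => h n (ha' n)
  | coe m =>
    induction m using WithTop.recTopCoe with
    | top =>
      change (⨆ n, F n) ≤ (⨆ n, F' n).comap R
      exact iSup_le fun n => (h n).trans (Submodule.comap_mono (le_iSup F' n))
    | coe n => exact h n

/-- The topology on a subspace `S` defined by the `[0,∞]`-valued seminorms `N i`, `i ∈ I`, (finite
on `S`): it is generated by the balls `{v ∈ S : N i (v - v₀) < ε}`. -/
@[reducible] def seminormTopology {ι : Type*} (S : Submodule ℂ X) (I : Set ι) (N : ι → X → ℝ≥0∞) :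
    TopologicalSpace S :=
  TopologicalSpace.generateFrom
    {s | ∃ v₀ : S, ∃ i ∈ I, ∃ ε > 0, s = {v : S | N i ((v : X) - v₀) < ε}}

/-- The evident topology on the spaces of a scale.  Here `N (n, k)`, `k ∈ ℕ`, are the seminorms
defining `F n`.  For finite `m` one uses the seminorms of order `m`, for `m = -∞` the seminorms of
all orders, and for `m = +∞` the locally convex inductive limit topology, i.e. the finest locally
convex vector space topology for which the inclusions of the spaces `F n` are continuous. -/
@[reducible] def scaleTopology (F : ℤ → Submodule ℂ X) (N : ℤ × ℕ → X → ℝ≥0∞) :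
    ∀ m : Order, TopologicalSpace (scaleSpace F m)
  | none => seminormTopology (⨅ n, F n) Set.univ N
  | some (some n) => seminormTopology (F n) {i | i.1 = n} N
  | some none => sInf {t : TopologicalSpace (⨆ n, F n : Submodule ℂ X) |
      @IsTopologicalAddGroup _ t _ ∧ @ContinuousSMul ℂ _ _ _ t ∧
      @LocallyConvexSpace ℝ (⨆ n, F n : Submodule ℂ X) _ _ _ _ t ∧
      ∀ n : ℤ, @Continuous _ _ (seminormTopology (F n) {i | i.1 = n} N) t
        (Submodule.inclusion (le_iSup F n))}

variable {X₁ X₂ : Type*} [AddCommGroup X₁] [Module ℂ X₁] [AddCommGroup X₂] [Module ℂ X₂]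

/-- Continuity of a map of two variables between spaces of three scales.  If `m₁, m₂ < ∞` this is
joint continuity for the evident topologies (take `n₁ = m₁` and `n₂ = m₂`).  A map of which one
argument runs over an increasing union is continuous if its restrictions to the steps of the union
are. -/
def ContinuousOnSteps {F₁ : ℤ → Submodule ℂ X₁} (hF₁ : Monotone F₁) (N₁ : ℤ × ℕ → X₁ → ℝ≥0∞)
    {F₂ : ℤ → Submodule ℂ X₂} (hF₂ : Monotone F₂) (N₂ : ℤ × ℕ → X₂ → ℝ≥0∞)
    (F : ℤ → Submodule ℂ X) (N : ℤ × ℕ → X → ℝ≥0∞) {m₁ m₂ m : Order}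
    (T : scaleSpace F₁ m₁ → scaleSpace F₂ m₂ → scaleSpace F m) : Prop :=
  ∀ (n₁ n₂ : Order) (h₁ : n₁ ≤ m₁) (h₂ : n₂ ≤ m₂), n₁ ≠ ⊤ → n₂ ≠ ⊤ →
    @Continuous _ _
      (@instTopologicalSpaceProd _ _ (scaleTopology F₁ N₁ n₁) (scaleTopology F₂ N₂ n₂))
      (scaleTopology F N m)
      (fun p : scaleSpace F₁ n₁ × scaleSpace F₂ n₂ =>
        T (Submodule.inclusion (scaleSpace_mono hF₁ h₁) p.1)
          (Submodule.inclusion (scaleSpace_mono hF₂ h₂) p.2))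

end Scale

/-! ### Symbol classes -/

section Symbols

set_option linter.unusedSectionVars false

variable {D : Type*} [NormedAddCommGroup D] [NormedSpace ℝ D]

/-- `⟨ξ⟩ = (1 + |ξ|²)^{1/2}`. -/
def japaneseBracket (ξ : D) : ℝ := Real.sqrt (1 + ‖ξ‖ ^ 2)

theorem one_le_japaneseBracket (ξ : D) : 1 ≤ japaneseBracket ξ :=
  Real.one_le_sqrt.2 (by nlinarith [sq_nonneg ‖ξ‖])

/-- The seminorm `sup_ξ ⟨ξ⟩^{k-n} |∂^k a(ξ)|`, with values in `[0,∞]`; here `∂^k a(ξ)` is the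
total derivative of order `k`, whose norm is equivalent to the maximum of `|∂^α a(ξ)|` over
the multi-indices with `|α| = k`. -/
def symbolSeminorm (i : ℤ × ℕ) (a : D → ℂ) : ℝ≥0∞ :=
  ⨆ ξ, ENNReal.ofReal (japaneseBracket ξ ^ ((i.2 : ℤ) - i.1) * ‖iteratedFDeriv ℝ i.2 a ξ‖)

theorem japaneseBracket_pos (ξ : D) : 0 < japaneseBracket ξ :=
  one_pos.trans_le (one_le_japaneseBracket ξ)

theorem le_symbolSeminorm (i : ℤ × ℕ) (a : D → ℂ) (ξ : D) :
    ENNReal.ofReal (japaneseBracket ξ ^ ((i.2 : ℤ) - i.1) * ‖iteratedFDeriv ℝ i.2 a ξ‖) ≤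
      symbolSeminorm i a :=
  le_iSup (fun ξ => ENNReal.ofReal (japaneseBracket ξ ^ ((i.2 : ℤ) - i.1) *
    ‖iteratedFDeriv ℝ i.2 a ξ‖)) ξ

theorem symbolSeminorm_add (i : ℤ × ℕ) {a b : D → ℂ} (ha : ContDiff ℝ ∞ a)
    (hb : ContDiff ℝ ∞ b) : symbolSeminorm i (a + b) ≤ symbolSeminorm i a + symbolSeminorm i b := by
  refine iSup_le fun ξ => ?_
  have h : ((i.2 : ℕ) : ℕ∞ω) ≤ (∞ : ℕ∞ω) := by exact_mod_cast le_top
  have p := zpow_pos (japaneseBracket_pos ξ) ((i.2 : ℤ) - i.1)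
  rw [iteratedFDeriv_add_apply ((ha.of_le h).contDiffAt) ((hb.of_le h).contDiffAt)]
  refine le_trans ?_ (add_le_add (le_symbolSeminorm i a ξ) (le_symbolSeminorm i b ξ))
  rw [← ENNReal.ofReal_add (by positivity) (by positivity), ← mul_add]
  exact ENNReal.ofReal_le_ofReal (mul_le_mul_of_nonneg_left (norm_add_le _ _) p.le)

theorem symbolSeminorm_smul (i : ℤ × ℕ) (c : ℂ) {a : D → ℂ} (ha : ContDiff ℝ ∞ a) :
    symbolSeminorm i (c • a) ≤ ENNReal.ofReal ‖c‖ * symbolSeminorm i a := by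
  refine iSup_le fun ξ => ?_
  have h : ((i.2 : ℕ) : ℕ∞ω) ≤ (∞ : ℕ∞ω) := by exact_mod_cast le_top
  rw [iteratedFDeriv_const_smul_apply ((ha.of_le h).contDiffAt), norm_smul, mul_left_comm,
    ENNReal.ofReal_mul (norm_nonneg c)]
  gcongr
  exact le_symbolSeminorm i a ξ

theorem symbolSeminorm_mono {n n' : ℤ} (h : n ≤ n') (k : ℕ) (a : D → ℂ) :
    symbolSeminorm (n', k) a ≤ symbolSeminorm (n, k) a := by
  refine iSup_mono fun ξ => ?_
  gcongr
  exact one_le_japaneseBracket ξ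

theorem symbolSeminorm_zero (i : ℤ × ℕ) : symbolSeminorm i (0 : D → ℂ) = 0 := by
  simp [symbolSeminorm]

/-- The symbol class `S^n`, for an integer `n`, of functions on `D`. -/
def symbolsOfInt (D : Type*) [NormedAddCommGroup D] [NormedSpace ℝ D] (n : ℤ) :
    Submodule ℂ (D → ℂ) where
  carrier := {a | ContDiff ℝ ∞ a ∧ ∀ k, symbolSeminorm (n, k) a < ⊤}
  add_mem' := fun ha hb => ⟨ha.1.add hb.1, fun k =>
    (symbolSeminorm_add _ ha.1 hb.1).trans_lt (ENNReal.add_lt_top.2 ⟨ha.2 k, hb.2 k⟩)⟩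
  zero_mem' := ⟨contDiff_const, fun k => by simp [symbolSeminorm_zero]⟩
  smul_mem' := fun c _ ha => ⟨ha.1.const_smul c, fun k =>
    (symbolSeminorm_smul _ c ha.1).trans_lt (ENNReal.mul_lt_top ENNReal.ofReal_lt_top (ha.2 k))⟩

theorem symbolsOfInt_mono (D : Type*) [NormedAddCommGroup D] [NormedSpace ℝ D] :
    Monotone (symbolsOfInt D) :=
  fun _ _ h a ha => ⟨ha.1, fun k => (symbolSeminorm_mono h k a).trans_lt (ha.2 k)⟩

/-- The symbol class `S^m`, `m ∈ ℤ ∪ {±∞}`, of functions on `D`.  Note that `S^{-∞}` is the Schwartz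
space. -/
abbrev Symbols (D : Type*) [NormedAddCommGroup D] [NormedSpace ℝ D] (m : Order) :
    Submodule ℂ (D → ℂ) :=
  scaleSpace (symbolsOfInt D) m

/-- The seminorm `sup_{h,ξ} h^{-c} h^{δk} ⟨ξ⟩^{k-n} |∂^k a(ξ;h)|` of `h`-dependent functions, where
`h` ranges over the subset `H` of `(0,1]`. -/
def hSymbolSeminorm (H : Set ℝ) (c δ : ℝ) (i : ℤ × ℕ) (a : H → D → ℂ) : ℝ≥0∞ :=
  ⨆ h : H, ENNReal.ofReal ((h : ℝ) ^ (δ * i.2 - c)) * symbolSeminorm i (a h)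

/-- The class `h^c S^n[h^δ]` of `h`-dependent symbols, for an integer `n`. -/
def hSymbolsOfInt (D : Type*) [NormedAddCommGroup D] [NormedSpace ℝ D] (H : Set ℝ) (c δ : ℝ)
    (n : ℤ) : Submodule ℂ (H → D → ℂ) where
  carrier := {a | (∀ h, ContDiff ℝ ∞ (a h)) ∧ ∀ k, hSymbolSeminorm H c δ (n, k) a < ⊤}
  add_mem' := by
    intro a b ha hb
    refine ⟨fun h => (ha.1 h).add (hb.1 h), fun k => lt_of_le_of_lt (iSup_le fun h => ?_)
      (ENNReal.add_lt_top.2 ⟨ha.2 k, hb.2 k⟩)⟩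
    refine le_trans (mul_le_mul_right (symbolSeminorm_add _ (ha.1 h) (hb.1 h)) _) ?_
    rw [mul_add]
    exact add_le_add
      (le_iSup (fun h : H => ENNReal.ofReal ((h : ℝ) ^ (δ * k - c)) * symbolSeminorm (n, k) (a h)) h)
      (le_iSup (fun h : H => ENNReal.ofReal ((h : ℝ) ^ (δ * k - c)) * symbolSeminorm (n, k) (b h)) h)
  zero_mem' := ⟨fun _ => contDiff_const, fun k => by
    simp [hSymbolSeminorm, symbolSeminorm_zero]⟩
  smul_mem' := by
    intro z a ha
    refine ⟨fun h => (ha.1 h).const_smul z, fun k => lt_of_le_of_lt (iSup_le fun h => ?_)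
      (ENNReal.mul_lt_top (ENNReal.ofReal_lt_top (r := ‖z‖)) (ha.2 k))⟩
    refine le_trans (mul_le_mul_right (symbolSeminorm_smul _ z (ha.1 h)) _) ?_
    rw [mul_left_comm]
    gcongr
    exact le_iSup
      (fun h : H => ENNReal.ofReal ((h : ℝ) ^ (δ * k - c)) * symbolSeminorm (n, k) (a h)) h

theorem hSymbolsOfInt_mono (D : Type*) [NormedAddCommGroup D] [NormedSpace ℝ D] (H : Set ℝ)
    (c δ : ℝ) : Monotone (hSymbolsOfInt D H c δ) := by
  intro n n' hn a ha
  refine ⟨ha.1, fun k => lt_of_le_of_lt (iSup_mono fun h => ?_) (ha.2 k)⟩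
  gcongr
  exact symbolSeminorm_mono hn k (a h)

/-- The class `h^c S^m[h^δ]` of `h`-dependent symbols, `m ∈ ℤ ∪ {±∞}`. -/
abbrev HSymbols (D : Type*) [NormedAddCommGroup D] [NormedSpace ℝ D] (H : Set ℝ) (c δ : ℝ)
    (m : Order) : Submodule ℂ (H → D → ℂ) :=
  scaleSpace (hSymbolsOfInt D H c δ) m

/-- The map sending an `h`-dependent function `a` to `a_h`, `a_h(ξ) = a(hξ; h)`. -/
def rescaleLinear (D : Type*) [NormedAddCommGroup D] [NormedSpace ℝ D] (H : Set ℝ) (h : H) :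
    (H → D → ℂ) →ₗ[ℂ] (D → ℂ) where
  toFun a := fun ξ => a h ((h : ℝ) • ξ)
  map_add' _ _ := rfl
  map_smul' _ _ := rfl

theorem japaneseBracket_smul_le {h : ℝ} (h0 : 0 < h) (h1 : h ≤ 1) (ξ : D) :
    japaneseBracket (h • ξ) ≤ japaneseBracket ξ := by
  refine Real.sqrt_le_sqrt ?_
  rw [norm_smul, Real.norm_of_nonneg h0.le, mul_pow]
  nlinarith [sq_nonneg ‖ξ‖, mul_le_one₀ h1 h0.le h1]

theorem mul_japaneseBracket_le {h : ℝ} (h0 : 0 < h) (h1 : h ≤ 1) (ξ : D) :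
    h * japaneseBracket ξ ≤ japaneseBracket (h • ξ) := by
  unfold japaneseBracket
  rw [← Real.sqrt_sq h0.le, ← Real.sqrt_mul (sq_nonneg h), Real.sqrt_sq h0.le]
  refine Real.sqrt_le_sqrt ?_
  rw [norm_smul, Real.norm_of_nonneg h0.le, mul_pow]
  nlinarith [mul_le_one₀ h1 h0.le h1]

theorem japaneseBracket_zpow_le {h : ℝ} (h0 : 0 < h) (h1 : h ≤ 1) (s : ℤ) (ξ : D) :
    japaneseBracket ξ ^ s ≤ h⁻¹ ^ s.natAbs * japaneseBracket (h • ξ) ^ s := by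
  have p1 : 0 < japaneseBracket ξ := one_pos.trans_le (one_le_japaneseBracket ξ)
  have p2 : 0 < japaneseBracket (h • ξ) := one_pos.trans_le (one_le_japaneseBracket _)
  have hinv : 1 ≤ h⁻¹ := (one_le_inv₀ h0).2 h1
  rcases le_total 0 s with hs | hs
  · obtain ⟨t, rfl⟩ := Int.eq_ofNat_of_zero_le hs
    simp only [Int.natAbs_natCast, zpow_natCast]
    rw [← mul_pow]
    refine pow_le_pow_left₀ p1.le ?_ t
    rw [inv_mul_eq_div, le_div_iff₀ h0, mul_comm]
    exact mul_japaneseBracket_le h0 h1 ξ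
  · obtain ⟨t, ht⟩ := Int.eq_ofNat_of_zero_le (neg_nonneg.2 hs)
    obtain rfl : s = -(t : ℤ) := by rw [← neg_neg s, ht]
    simp only [Int.natAbs_neg, Int.natAbs_natCast, zpow_neg, zpow_natCast]
    calc (japaneseBracket ξ ^ t)⁻¹ ≤ (japaneseBracket (h • ξ) ^ t)⁻¹ := by
          gcongr
          exact japaneseBracket_smul_le h0 h1 ξ
      _ ≤ _ := le_mul_of_one_le_left (by positivity) (one_le_pow₀ hinv)

theorem rescale_le_comap {H : Set ℝ} (hH : H ⊆ Set.Ioc 0 1) (c δ : ℝ) (h : H) (n : ℤ) :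
    hSymbolsOfInt D H c δ n ≤ (symbolsOfInt D n).comap (rescaleLinear D H h) := by
  intro a ha
  have h0 : 0 < (h : ℝ) := (hH h.2).1
  have h1 : (h : ℝ) ≤ 1 := (hH h.2).2
  have hsm : ContDiff ℝ ∞ (rescaleLinear D H h a) :=
    (ha.1 h).comp (contDiff_id.const_smul (h : ℝ))
  refine ⟨hsm, fun k => ?_⟩
  have hk : ((k : ℕ) : ℕ∞ω) ≤ (∞ : ℕ∞ω) := by exact_mod_cast le_top
  have hfin : symbolSeminorm (n, k) (a h) < ⊤ := by
    have h2 := lt_of_le_of_lt (le_iSup (fun h : H => ENNReal.ofReal ((h : ℝ) ^ (δ * k - c)) *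
      symbolSeminorm (n, k) (a h)) h) (ha.2 k)
    have h3 : ENNReal.ofReal ((h : ℝ) ^ (δ * k - c)) ≠ 0 := by
      simpa using Real.rpow_pos_of_pos h0 _
    exact (ENNReal.mul_lt_top_iff.1 h2).elim (fun h4 => h4.2)
      (fun h4 => h4.elim (fun h5 => absurd h5 h3) (fun h5 => by simp [h5]))
  refine lt_of_le_of_lt (iSup_le fun ξ => ?_) (ENNReal.mul_lt_top (ENNReal.mul_lt_top
    (ENNReal.ofReal_lt_top (r := (h : ℝ)⁻¹ ^ ((k : ℤ) - n).natAbs))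
    (ENNReal.ofReal_lt_top (r := (h : ℝ) ^ k))) hfin)
  have e1 : iteratedFDeriv ℝ k (rescaleLinear D H h a) ξ
      = (h : ℝ) ^ k • iteratedFDeriv ℝ k (a h) ((h : ℝ) • ξ) :=
    congrFun (iteratedFDeriv_comp_const_smul (h : ℝ) ((ha.1 h).of_le hk)) ξ
  dsimp only
  rw [e1, norm_smul, Real.norm_of_nonneg (by positivity)]
  refine le_trans ?_ (mul_le_mul_right (le_symbolSeminorm (n, k) (a h) ((h : ℝ) • ξ)) _)
  rw [← ENNReal.ofReal_mul (by positivity), ← ENNReal.ofReal_mul (by positivity)]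
  refine ENNReal.ofReal_le_ofReal ?_
  calc _ ≤ (h : ℝ)⁻¹ ^ ((k : ℤ) - n).natAbs * japaneseBracket ((h : ℝ) • ξ) ^ ((k : ℤ) - n) *
        ((h : ℝ) ^ k * ‖iteratedFDeriv ℝ k (a h) ((h : ℝ) • ξ)‖) := by
        gcongr
        exact japaneseBracket_zpow_le h0 h1 _ ξ
    _ = _ := by ring

/-- For an `h`-dependent symbol `a ∈ S^m[h^δ]` and `h ∈ H`, the symbol `a_h ∈ S^m`,
`a_h(ξ) = a(hξ; h)`. -/
def rescale {H : Set ℝ} (hH : H ⊆ Set.Ioc 0 1) {c δ : ℝ} {m : Order}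
    (a : HSymbols D H c δ m) (h : H) : Symbols D m :=
  ⟨fun ξ => (a : H → D → ℂ) h ((h : ℝ) • ξ),
    scaleSpace_le_comap (rescaleLinear D H h) (rescale_le_comap hH c δ h) m a.2⟩

end Symbols

/-! ### The exponential map of a Lie group -/

section LieGroups

variable {E : Type*} [NormedAddCommGroup E] [NormedSpace ℝ E]
  {G : Type*} [TopologicalSpace G] [ChartedSpace E G] [Group G]

/-- The exponential map: `exp x = γ(1)`, where `γ : ℝ → G` is the integral curve through the identity
of the left-invariant vector field attached to `x`. -/
def lieExp (x : GroupLieAlgebra 𝓘(ℝ, E) G) : G :=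
  Classical.epsilon fun g : G => ∃ γ : ℝ → G, γ 0 = 1 ∧
    IsMIntegralCurve (I := 𝓘(ℝ, E)) γ (mulInvariantVectorField x) ∧ γ 1 = g

variable {V : Type*} [NormedAddCommGroup V] [NormedSpace ℝ V]

/-- In these definitions the Lie algebra of `G` is equipped with a norm by means of a linear
isomorphism `L` from a normed space `V`.  This is the exponential map on `V`. -/
def expMap (L : V ≃L[ℝ] GroupLieAlgebra 𝓘(ℝ, E) G) (x : V) : G := lieExp (L x)

/-- The logarithm, inverse to the restriction of `exp` to `𝒢`. -/
def logMap (L : V ≃L[ℝ] GroupLieAlgebra 𝓘(ℝ, E) G) (𝒢 : Set V) : G → V :=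
  Function.invFunOn (expMap L) 𝒢

/-- `𝒢` is an open neighborhood of the origin such that `exp` is an analytic isomorphism from `𝒢`
onto its (open) image. -/
structure IsExpNeighborhood (L : V ≃L[ℝ] GroupLieAlgebra 𝓘(ℝ, E) G) (𝒢 : Set V) : Prop where
  isOpen : IsOpen 𝒢
  zero_mem : (0 : V) ∈ 𝒢
  injOn : Set.InjOn (expMap L) 𝒢
  analytic_exp : ContMDiffOn 𝓘(ℝ, V) 𝓘(ℝ, E) ω (expMap L) 𝒢
  isOpen_image : IsOpen (expMap L '' 𝒢)
  analytic_log : ContMDiffOn 𝓘(ℝ, E) 𝓘(ℝ, V) ω (logMap L 𝒢) (expMap L '' 𝒢)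

/-- `{x, y} = x * y - x - y`, where `x * y = log(exp(x) exp(y))`. -/
def bchRemainder (L : V ≃L[ℝ] GroupLieAlgebra 𝓘(ℝ, E) G) (𝒢 : Set V) (x y : V) : V :=
  logMap L 𝒢 (expMap L x * expMap L y) - x - y

end LieGroups

/-! ### Fourier transforms, cutoffs, and the star product

The Pontryagin dual of `W` is identified with the real dual `StrongDual ℝ W`: a functional `ξ`
corresponds to the character `x ↦ exp(i ξ(x))`. -/

section Star

variable {W : Type*} [NormedAddCommGroup W] [NormedSpace ℝ W] [FiniteDimensional ℝ W]

/-- The basis of `StrongDual ℝ W` dual to the standard basis `Module.finBasis ℝ W` of `W`. -/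
def dualFinBasis (W : Type*) [NormedAddCommGroup W] [NormedSpace ℝ W] [FiniteDimensional ℝ W] :
    Module.Basis (Fin (Module.finrank ℝ W)) ℝ (StrongDual ℝ W) :=
  (Module.finBasis ℝ W).dualBasis.map LinearMap.toContinuousLinearMap

/-- The Haar measure on the dual of `W` which is dual to the Haar measure `μ` on `W`, i.e. for which
the Fourier transforms `φ ↦ ∫ φ(x) e^{iξ(x)} dμ(x)` and `a ↦ ∫ a(ξ) e^{-iξ(x)} dξ` are mutually
inverse: if a basis of `W` spans a parallelepiped of volume `v`, then the parallelepiped spanned by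
the dual basis has volume `((2π)^{dim W} v)⁻¹`. -/
def dualHaar [MeasurableSpace W] [BorelSpace W] (μ : MeasureTheory.Measure W) :
    MeasureTheory.Measure (StrongDual ℝ W) :=
  (ENNReal.ofReal ((2 * Real.pi) ^ Module.finrank ℝ W) *
    μ (parallelepiped (Module.finBasis ℝ W)))⁻¹ • (dualFinBasis W).addHaar

/-- The inverse Fourier transform `a^∨(x) = ∫ a(ξ) e^{-xξ} dξ`. -/
def invFourier [MeasurableSpace W] [BorelSpace W] (μ : MeasureTheory.Measure W)
    (a : StrongDual ℝ W → ℂ) (x : W) : ℂ :=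
  ∫ ξ, a ξ * Complex.exp (-(Complex.I * (ξ x : ℝ))) ∂(dualHaar μ)

/-- Cutoffs on `W` supported in the neighborhood `U` of the origin. -/
structure IsCutoff {W : Type*} [NormedAddCommGroup W] [NormedSpace ℝ W] (χ : W → ℝ) (U : Set W) :
    Prop where
  smooth : ContDiff ℝ ∞ χ
  hasCompactSupport : HasCompactSupport χ
  tsupport_subset : tsupport χ ⊆ U
  even : ∀ x, χ (-x) = χ x
  mem_Icc : ∀ x, χ x ∈ Set.Icc (0 : ℝ) 1
  eventually_eq_one : ∀ᶠ x in 𝓝 0, χ x = 1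

variable {V : Type*} [NormedAddCommGroup V] [NormedSpace ℝ V]

/-- The restriction of a functional on `V` to the subspace `W`. -/
def restrict (W : Submodule ℝ V) (ζ : StrongDual ℝ V) : StrongDual ℝ W := ζ.comp W.subtypeL

/-- `Ω(x, y, ζ) = e^{{x,y}ζ}` for `x ∈ W₁`, `y ∈ W₂`; the map `{·,·}` is denoted `br`. -/
def Omega (W₁ W₂ : Submodule ℝ V) (br : V → V → V) (p : W₁ × W₂ × StrongDual ℝ V) : ℂ :=
  Complex.exp (Complex.I * (p.2.2 (br p.1 p.2.1) : ℝ))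

/-- The star product of Schwartz functions `a` on `W₁^∧` and `b` on `W₂^∧`:
`a ⋆ b(ζ) = ∫ a^∨(x) b^∨(y) e^{xζ₁} e^{yζ₂} e^{{x,y}ζ} χ₁(x) χ₂(y)`. -/
def starSchwartz [MeasurableSpace V] [BorelSpace V] [FiniteDimensional ℝ V]
    (W₁ W₂ : Submodule ℝ V) (br : V → V → V)
    (μ₁ : MeasureTheory.Measure W₁) (μ₂ : MeasureTheory.Measure W₂)
    (χ₁ : W₁ → ℝ) (χ₂ : W₂ → ℝ)
    (a : StrongDual ℝ W₁ → ℂ) (b : StrongDual ℝ W₂ → ℂ) (ζ : StrongDual ℝ V) : ℂ :=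
  ∫ p : W₁ × W₂, invFourier μ₁ a p.1 * invFourier μ₂ b p.2 *
    Complex.exp (Complex.I * (restrict W₁ ζ p.1 : ℝ)) *
    Complex.exp (Complex.I * (restrict W₂ ζ p.2 : ℝ)) *
    Omega W₁ W₂ br (p.1, p.2, ζ) * (χ₁ p.1 : ℂ) * (χ₂ p.2 : ℂ) ∂(μ₁.prod μ₂)

/-- The contribution to the formal expansion of `a ⋆ b` of the part of the Taylor expansion
`Ω(x,y,ζ) = ∑ c_{αβγ} x^α y^β ζ^γ` with `|α| = p`, `|β| = q`, `|γ| = r`, namely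
`∑ c_{αβγ} ζ^γ ∂^α a(ζ₁) ∂^β b(ζ₂)`.

In terms of the `p+q+r`-th derivative of `Ω` at the origin, this part of the Taylor expansion is
`D^{p+q+r}Ω(0)(x,…,x,y,…,y,ζ,…,ζ) / (p! q! r!)`.  We expand `x` and `y` in bases `e` and `f` of `W₁`
and `W₂`, and replace each coordinate of `x` (resp. `y`) by the corresponding partial derivative of
`a` (resp. `b`).  The normalization `(∂^α a)^∨(x) = x^α a^∨(x)` means that the operator
corresponding to a coordinate is `-i` times the derivative along the dual basis vector. -/
def starTerm [FiniteDimensional ℝ V] (W₁ W₂ : Submodule ℝ V) (br : V → V → V) (p q r : ℕ)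
    (a : StrongDual ℝ W₁ → ℂ) (b : StrongDual ℝ W₂ → ℂ) (ζ : StrongDual ℝ V) : ℂ :=
  ((-Complex.I) ^ (p + q) / ((p.factorial * q.factorial * r.factorial : ℕ) : ℂ)) *
    ∑ i : Fin p → Fin (Module.finrank ℝ W₁), ∑ j : Fin q → Fin (Module.finrank ℝ W₂),
      iteratedFDeriv ℝ (p + q + r) (Omega W₁ W₂ br) 0
        (Fin.append
          (Fin.append
            (fun k => ((Module.finBasis ℝ W₁ (i k), 0, 0) : W₁ × W₂ × StrongDual ℝ V))
            (fun k => ((0, Module.finBasis ℝ W₂ (j k), 0) : W₁ × W₂ × StrongDual ℝ V)))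
          (fun _ : Fin r => ((0, 0, ζ) : W₁ × W₂ × StrongDual ℝ V))) *
      iteratedFDeriv ℝ p a (restrict W₁ ζ) (fun k => dualFinBasis W₁ (i k)) *
      iteratedFDeriv ℝ q b (restrict W₂ ζ) (fun k => dualFinBasis W₂ (j k))

/-- The homogeneous component `a ⋆^j b`: the sum of the contributions with `|α| + |β| - |γ| = j` and
`|γ| ≤ min(|α|, |β|)` (which force `|α|, |β| ≤ j`). -/
def starComponent [FiniteDimensional ℝ V] (W₁ W₂ : Submodule ℝ V) (br : V → V → V) (j : ℕ)
    (a : StrongDual ℝ W₁ → ℂ) (b : StrongDual ℝ W₂ → ℂ) (ζ : StrongDual ℝ V) : ℂ :=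
  ∑ p ∈ Finset.range (j + 1), ∑ q ∈ Finset.range (j + 1), ∑ r ∈ Finset.range (min p q + 1),
    if p + q = r + j then starTerm W₁ W₂ br p q r a b ζ else 0

/-- Admissible pairs of orders, relative to the subspaces `W₁`, `W₂` of `V`. -/
def Admissible (W₁ W₂ : Submodule ℝ V) (m₁ m₂ : Order) : Prop :=
  (W₁ ≠ ⊤ → m₂ = ⊥) ∧ (W₂ ≠ ⊤ → m₁ = ⊥)

/-- A family of maps `S^{m₁}(W₁^∧) × S^{m₂}(W₂^∧) → S^{m₁+m₂}(V^∧)`, one for each admissible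
pair. -/
abbrev StarFamily (W₁ W₂ : Submodule ℝ V) : Type _ :=
  ∀ m₁ m₂ : Order, Admissible W₁ W₂ m₁ m₂ →
    Symbols (StrongDual ℝ W₁) m₁ → Symbols (StrongDual ℝ W₂) m₂ →
      Symbols (StrongDual ℝ V) (m₁ + m₂)

theorem admissible_bot (W₁ W₂ : Submodule ℝ V) : Admissible W₁ W₂ ⊥ ⊥ :=
  ⟨fun _ => rfl, fun _ => rfl⟩

/-- `T` is a compatible family of continuous maps extending the product `star` of Schwartz functions.
Compatible means that any two members of the family agree on the common part of their domains. -/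
structure IsContinuousExtension {W₁ W₂ : Submodule ℝ V}
    (star : (StrongDual ℝ W₁ → ℂ) → (StrongDual ℝ W₂ → ℂ) → StrongDual ℝ V → ℂ)
    (T : StarFamily W₁ W₂) : Prop where
  extends_star : ∀ (a : Symbols (StrongDual ℝ W₁) ⊥) (b : Symbols (StrongDual ℝ W₂) ⊥),
    (T ⊥ ⊥ (admissible_bot W₁ W₂) a b : StrongDual ℝ V → ℂ) = star a b
  compatible : ∀ (m₁ m₂ m₁' m₂' : Order) (hm : Admissible W₁ W₂ m₁ m₂)
    (hm' : Admissible W₁ W₂ m₁' m₂')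
    (a : Symbols (StrongDual ℝ W₁) m₁) (b : Symbols (StrongDual ℝ W₂) m₂)
    (a' : Symbols (StrongDual ℝ W₁) m₁') (b' : Symbols (StrongDual ℝ W₂) m₂'),
    (a : StrongDual ℝ W₁ → ℂ) = a' → (b : StrongDual ℝ W₂ → ℂ) = b' →
    (T m₁ m₂ hm a b : StrongDual ℝ V → ℂ) = T m₁' m₂' hm' a' b'
  continuous : ∀ (m₁ m₂ : Order) (hm : Admissible W₁ W₂ m₁ m₂),
    ContinuousOnSteps (symbolsOfInt_mono (StrongDual ℝ W₁)) symbolSeminorm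
      (symbolsOfInt_mono (StrongDual ℝ W₂)) symbolSeminorm
      (symbolsOfInt (StrongDual ℝ V)) symbolSeminorm (T m₁ m₂ hm)

/-- All the maps of the family `T` are bilinear. -/
def IsBilinearFamily {W₁ W₂ : Submodule ℝ V} (T : StarFamily W₁ W₂) : Prop :=
  ∀ (m₁ m₂ : Order) (hm : Admissible W₁ W₂ m₁ m₂),
    ∃ B : Symbols (StrongDual ℝ W₁) m₁ →ₗ[ℂ] Symbols (StrongDual ℝ W₂) m₂ →ₗ[ℂ]
      Symbols (StrongDual ℝ V) (m₁ + m₂), ∀ a b, T m₁ m₂ hm a b = B a b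

/-- The rescaled star product `a ⋆_h b`, defined by `(a ⋆_h b)_h = a_h ⋆ b_h`. -/
def starRescaled {W₁ W₂ : Submodule ℝ V} (T : StarFamily W₁ W₂) {H : Set ℝ}
    (hH : H ⊆ Set.Ioc 0 1) {m₁ m₂ : Order} (hm : Admissible W₁ W₂ m₁ m₂) {c₁ δ₁ c₂ δ₂ : ℝ}
    (a : HSymbols (StrongDual ℝ W₁) H c₁ δ₁ m₁) (b : HSymbols (StrongDual ℝ W₂) H c₂ δ₂ m₂)
    (h : H) (ζ : StrongDual ℝ V) : ℂ :=
  (T m₁ m₂ hm (rescale hH a h) (rescale hH b h) : StrongDual ℝ V → ℂ) ((h : ℝ)⁻¹ • ζ)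

/-- The remainder `a ⋆_h b - ∑_{0 ≤ j < J} h^j a ⋆^j b`. -/
def starRemainder [FiniteDimensional ℝ V] {W₁ W₂ : Submodule ℝ V} (br : V → V → V)
    (T : StarFamily W₁ W₂) {H : Set ℝ}
    (hH : H ⊆ Set.Ioc 0 1) {m₁ m₂ : Order} (hm : Admissible W₁ W₂ m₁ m₂) {c₁ δ₁ c₂ δ₂ : ℝ} (J : ℕ)
    (a : HSymbols (StrongDual ℝ W₁) H c₁ δ₁ m₁) (b : HSymbols (StrongDual ℝ W₂) H c₂ δ₂ m₂)
    (h : H) (ζ : StrongDual ℝ V) : ℂ :=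
  starRescaled T hH hm a b h ζ - ∑ j ∈ Finset.range J, ((h : ℝ) : ℂ) ^ j *
    starComponent W₁ W₂ br j ((a : H → StrongDual ℝ W₁ → ℂ) h)
      ((b : H → StrongDual ℝ W₂ → ℂ) h) ζ

end Star

end StarProduct

end

/-! Let β be a smooth map that agrees near the origin with {x, y} and vanishes for x = 0 and for y =
0. Put f = χ₁χ₂ and F_λ = f e^{iλ(β)}. For Schwartz functions, Fubini and a translation of the
frequencies (`integral_invFourier_mul`) give a ⋆ b(ζ) = ∫ a(ζ₁ + ξ) b(ζ₂ + η) F̂_ζ(ξ, η) dξ dη.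
Since F_ζ is a test function, its Fourier transform decays rapidly, and the right side makes sense
for all symbols: it is the extension (`starExt`). Passing to a_h, b_h and evaluating at ζ/h turns it
into ∫ a(ζ₁ + hξ) b(ζ₂ + hη) F̂_{ζ/h}(ξ, η), so both parts of the theorem concern one integral, and
part (1) is the case h = 1, J = 0.

Crude bound. The differential of β vanishes at the origin, so on a small support nonstationary phase
shows that F̂_λ(w) is bounded uniformly in λ and w, and rapidly decreasing once |w| ≥ ε|λ|
(`fhat_phase_decay`). For λ = ζ/h, smaller frequencies displace ζ₁ and ζ₂ by at most ε|ζ|, where the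
weights of a and b can be compared with that of ζ. This comparison (`WeightOK`) is where g₁ + g₂ = g
and admissibility enter. The result is the expected bound with a loss ⟨ζ/h⟩^M for a fixed M
(`symbol_pair_integral_bound`).

Expansion. Taylor expansion of a(ζ₁ + sξ) b(ζ₂ + tη) in s and in t trades derivatives of the symbols
for derivatives of F_λ. The coefficients are evaluated by Fourier inversion at the origin; the
remainders contain P derivatives in one of the variables. An x-derivative of the phase brings down
λ, but together with a factor y, because β vanishes for y = 0, and that factor can be traded for a
derivative of b, which costs hθ₂/⟨ζ⟩. Here θ₁, θ₂ are the costs of differentiating a, b. Keeping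
count (`Good`, `Good.unifBound`), the remainder gains (hθ₁θ₂/⟨ζ⟩)^P.

Symbol estimates. A ζ-derivative of the remainder is a sum of remainders of the same order for other
data (`pd_remainder`), with loss at most h⁻¹. Neither this loss nor M depends on P, so P can be
taken so large that they are absorbed (`semiBound_remainder`). The explicit terms of degree at least
J that are put back are estimated directly: the jets of F_{ζ/h} at the origin of order (p, q) are
polynomials in ζ/h of degree at most min(p, q), again because β vanishes on both axes
(`ampJet_eq_sum`, `semiBound_term`).

Finally, a bilinear map between scales of seminormed spaces that satisfies such estimates is
continuous (`ScaleBilinear.continuousOnSteps`). Uniqueness holds because a symbol of order n is a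
limit of Schwartz functions in order n + 1 and the members of the family are compatible
(`IsContinuousExtension.unique`). -/

noncomputable section

namespace StarProduct

open MeasureTheory

set_option linter.unusedSectionVars false

/-! ### Iterated directional derivatives -/

section DirectionalDerivatives

variable {E F : Type*} [NormedAddCommGroup E] [NormedSpace ℝ E]
  [NormedAddCommGroup F] [NormedSpace ℝ F]

/-- The derivative of `f` in the direction `v`. -/
def pd (v : E) (f : E → F) : E → F := fun x => fderiv ℝ f x v

/-- The iterated derivative of `f` in the directions of the list `l`. -/
def pds (l : List E) (f : E → F) : E → F := l.foldr pd f

@[simp] theorem pds_nil (f : E → F) : pds [] f = f := rfl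

@[simp] theorem pds_cons (v : E) (l : List E) (f : E → F) : pds (v :: l) f = pd v (pds l f) := rfl

theorem pds_append (l l' : List E) (f : E → F) : pds (l ++ l') f = pds l (pds l' f) := by
  simp [pds, List.foldr_append]

theorem ContDiff.pd {f : E → F} (hf : ContDiff ℝ ∞ f) (v : E) : ContDiff ℝ ∞ (pd v f) :=
  (hf.fderiv_right (m := ∞) (by simp)).clm_apply contDiff_const

theorem ContDiff.pds {f : E → F} (hf : ContDiff ℝ ∞ f) (l : List E) : ContDiff ℝ ∞ (pds l f) := by
  induction l with
  | nil => exact hf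
  | cons v l ih => exact ContDiff.pd ih v

theorem differentiable_of_smooth {f : E → F} (hf : ContDiff ℝ ∞ f) : Differentiable ℝ f :=
  hf.differentiable (by simp)

theorem smooth_of_le {f : E → F} (hf : ContDiff ℝ ∞ f) (n : ℕ) : ContDiff ℝ n f :=
  hf.of_le (by exact_mod_cast le_top)

theorem pd_comm {f : E → F} (hf : ContDiff ℝ ∞ f) (v w : E) : pd v (pd w f) = pd w (pd v f) := by
  have hd : Differentiable ℝ (fderiv ℝ f) :=
    differentiable_of_smooth (hf.fderiv_right (m := ∞) (by simp))
  have key : ∀ v w x, pd v (pd w f) x = fderiv ℝ (fderiv ℝ f) x v w := by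
    intro v w x
    change fderiv ℝ (fun y => fderiv ℝ f y w) x v = _
    rw [fderiv_clm_apply (hd x) (differentiableAt_const w)]
    simp
  ext x
  rw [key, key]
  have h2 : ∀ n : ℕ, (n : ℕ∞ω) ≤ (∞ : ℕ∞ω) := fun n => by exact_mod_cast le_top
  exact (hf.contDiffAt.isSymmSndFDerivAt (by simpa using h2 2)).eq v w

theorem pds_perm {f : E → F} (hf : ContDiff ℝ ∞ f) {l l' : List E} (h : l.Perm l') :
    pds l f = pds l' f := by
  induction h with
  | nil => rfl
  | cons v _ ih => simp [ih]
  | swap v w l => exact pd_comm (ContDiff.pds hf l) _ _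
  | trans _ _ ih ih' => exact ih.trans ih'

theorem pds_pd {f : E → F} (hf : ContDiff ℝ ∞ f) (l : List E) (v : E) :
    pds l (pd v f) = pd v (pds l f) := by
  have := pds_perm hf (List.perm_append_comm (l₁ := l) (l₂ := [v]))
  rwa [pds_append, pds_append] at this

/-- Derivatives are handled as lists of directions, for which the Leibniz rule and symmetry are
inductions on the list; this is the bridge to the total derivatives that define the seminorms. -/
theorem iteratedFDeriv_eq_pds {f : E → F} (hf : ContDiff ℝ ∞ f) (n : ℕ) (m : Fin n → E) (x : E) :
    iteratedFDeriv ℝ n f x m = pds (List.ofFn m) f x := by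
  induction n generalizing x with
  | zero => simp
  | succ n ih =>
    rw [iteratedFDeriv_succ_apply_left, List.ofFn_succ, pds_cons]
    have h1 : Differentiable ℝ (iteratedFDeriv ℝ n f) :=
      hf.differentiable_iteratedFDeriv (by exact_mod_cast ENat.natCast_lt_top n)
    have h2 : pds (List.ofFn fun i : Fin n => m i.succ) f
        = fun y => iteratedFDeriv ℝ n f y (Fin.tail m) := by
      ext y
      exact (ih (Fin.tail m) y).symm
    rw [h2, pd]
    rw [fderiv_continuousMultilinear_apply_const_apply (h1 x)]

theorem pd_add {f g : E → F} (hf : ContDiff ℝ ∞ f) (hg : ContDiff ℝ ∞ g) (v : E) :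
    pd v (fun x => f x + g x) = fun x => pd v f x + pd v g x := by
  ext x
  simp only [pd]
  rw [fderiv_fun_add (differentiable_of_smooth hf x) (differentiable_of_smooth hg x)]
  rfl

theorem pd_sum {ι : Type*} (s : Finset ι) {f : ι → E → F} (hf : ∀ i, ContDiff ℝ ∞ (f i)) (v : E) :
    pd v (fun x => ∑ i ∈ s, f i x) = fun x => ∑ i ∈ s, pd v (f i) x := by
  ext x
  simp only [pd]
  rw [fderiv_fun_sum fun i _ => differentiable_of_smooth (hf i) x]
  simp

theorem pd_const (v : E) (c : F) : pd v (fun _ : E => c) = fun _ => 0 := by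
  ext x; simp [pd]

theorem pd_mul {f g : E → ℂ} (hf : ContDiff ℝ ∞ f) (hg : ContDiff ℝ ∞ g) (v : E) :
    pd v (fun x => f x * g x) = fun x => pd v f x * g x + f x * pd v g x := by
  ext x
  simp only [pd]
  rw [fderiv_fun_mul (differentiable_of_smooth hf x) (differentiable_of_smooth hg x)]
  simp
  ring

theorem pd_const_mul {f : E → ℂ} (hf : ContDiff ℝ ∞ f) (c : ℂ) (v : E) :
    pd v (fun x => c * f x) = fun x => c * pd v f x := by
  rw [pd_mul contDiff_const hf, pd_const]
  simp

theorem pds_add {f g : E → F} (hf : ContDiff ℝ ∞ f) (hg : ContDiff ℝ ∞ g) (l : List E) :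
    pds l (fun x => f x + g x) = fun x => pds l f x + pds l g x := by
  induction l with
  | nil => rfl
  | cons v l ih => rw [pds_cons, ih, pd_add (ContDiff.pds hf l) (ContDiff.pds hg l)]; rfl

theorem pds_const_mul {f : E → ℂ} (hf : ContDiff ℝ ∞ f) (c : ℂ) (l : List E) :
    pds l (fun x => c * f x) = fun x => c * pds l f x := by
  induction l with
  | nil => rfl
  | cons v l ih => rw [pds_cons, ih, pd_const_mul (ContDiff.pds hf l)]; rfl

theorem pd_comp_affine {P : Type*} [NormedAddCommGroup P] [NormedSpace ℝ P] {f : E → F}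
    (hf : ContDiff ℝ ∞ f) (A : P →L[ℝ] E) (c : E) (v : P) :
    pd v (fun p => f (A p + c)) = fun p => pd (A v) f (A p + c) := by
  ext p
  have h : HasFDerivAt (fun p => A p + c) A p := A.hasFDerivAt.add_const c
  have := ((differentiable_of_smooth hf (A p + c)).hasFDerivAt.comp p h).fderiv
  simp only [Function.comp_def] at this
  simp only [pd]
  rw [this]
  rfl

theorem pd_comp_clm {P : Type*} [NormedAddCommGroup P] [NormedSpace ℝ P] {f : E → F}
    (hf : ContDiff ℝ ∞ f) (A : P →L[ℝ] E) (v : P) :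
    pd v (fun p => f (A p)) = fun p => pd (A v) f (A p) := by
  simpa using pd_comp_affine hf A 0 v

theorem pds_comp_affine {P : Type*} [NormedAddCommGroup P] [NormedSpace ℝ P] {f : E → F}
    (hf : ContDiff ℝ ∞ f) (A : P →L[ℝ] E) (c : E) (l : List P) :
    pds l (fun p => f (A p + c)) = fun p => pds (l.map A) f (A p + c) := by
  induction l with
  | nil => rfl
  | cons v l ih =>
    rw [pds_cons, ih, pd_comp_affine (ContDiff.pds hf _)]; rfl

/-- The derivative of a function which factors through a real-valued affine function. -/
theorem pd_cexp {φ : E → ℝ} (hφ : ContDiff ℝ ∞ φ) (v : E) :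
    pd v (fun x => Complex.exp (Complex.I * (φ x : ℝ)))
      = fun x => Complex.I * (pd v φ x : ℝ) * Complex.exp (Complex.I * (φ x : ℝ)) := by
  ext x
  have h1 : HasFDerivAt φ (fderiv ℝ φ x) x := (differentiable_of_smooth hφ x).hasFDerivAt
  have h2 : HasFDerivAt (fun x => (φ x : ℂ)) (Complex.ofRealCLM.comp (fderiv ℝ φ x)) x :=
    Complex.ofRealCLM.hasFDerivAt.comp x h1
  have h3 := ((h2.const_mul Complex.I).cexp).fderiv
  simp only [pd]
  rw [h3]
  simp
  ring

theorem pd_clm {G : Type*} [NormedAddCommGroup G] [NormedSpace ℝ G] (A : F →L[ℝ] G) {f : E → F}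
    (hf : ContDiff ℝ ∞ f) (v : E) : pd v (fun x => A (f x)) = fun x => A (pd v f x) := by
  ext x
  have := (A.hasFDerivAt.comp x (differentiable_of_smooth hf x).hasFDerivAt).fderiv
  simp only [Function.comp_def] at this
  simp only [pd]
  rw [this]
  rfl

theorem contDiff_cexp_I {φ : E → ℝ} (hφ : ContDiff ℝ ∞ φ) :
    ContDiff ℝ ∞ (fun x => Complex.exp (Complex.I * (φ x : ℝ))) :=
  (contDiff_const.mul (Complex.ofRealCLM.contDiff.comp hφ)).cexp

theorem norm_cexp_I (t : ℝ) : ‖Complex.exp (Complex.I * (t : ℝ))‖ = 1 := by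
  rw [mul_comm, Complex.norm_exp_ofReal_mul_I]

/-- The directional derivative vanishes where the function vanishes identically. -/
theorem pd_eq_zero_of_notMem {f : E → F} {K : Set E} (hK : IsClosed K) (hf : ∀ x ∉ K, f x = 0)
    (v : E) : ∀ x ∉ K, pd v f x = 0 := by
  intro x hx
  have : f =ᶠ[𝓝 x] fun _ => 0 := by
    filter_upwards [hK.isOpen_compl.mem_nhds hx] with y hy using hf y hy
  simp only [pd]
  rw [this.fderiv_eq]
  simp

/-- A smooth function is bounded on `ball × K` together with its derivative. -/
theorem exists_bound_of_continuous {P Z : Type*} [NormedAddCommGroup P] [NormedSpace ℝ P]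
    [FiniteDimensional ℝ P] [NormedAddCommGroup Z] {F : Type*} [NormedAddCommGroup F]
    {f : P × Z → F} (hf : Continuous f) {K : Set Z} (hK : IsCompact K) (p : P) (r : ℝ) :
    ∃ C, 0 ≤ C ∧ ∀ q ∈ Metric.closedBall p r, ∀ z ∈ K, ‖f (q, z)‖ ≤ C := by
  obtain ⟨C, hC⟩ := ((isCompact_closedBall p r).prod hK).exists_bound_of_continuousOn hf.continuousOn
  exact ⟨max C 0, le_max_right _ _, fun q hq z hz => (hC (q, z) ⟨hq, hz⟩).trans (le_max_left _ _)⟩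

end DirectionalDerivatives

/-! ### Smooth dependence of integrals over compact sets on parameters -/

section ParametricIntegral

variable {P Z F : Type*} [NormedAddCommGroup P] [NormedSpace ℝ P] [FiniteDimensional ℝ P]
  [NormedAddCommGroup Z] [NormedSpace ℝ Z] [FiniteDimensional ℝ Z] [MeasurableSpace Z] [BorelSpace Z]
  [NormedAddCommGroup F] [NormedSpace ℝ F]

/-- Differentiation under the integral sign, with a bound on the total derivative which is locally
uniform in the parameter. -/
theorem hasFDerivAt_integral_of_smooth [CompleteSpace F] (μ : Measure Z)
    {f : P × Z → F} (hf : ContDiff ℝ ∞ f) (p : P) {r : ℝ} (hr : 0 < r) {bound : Z → ℝ}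
    (hint : Integrable (fun z => f (p, z)) μ) (hb : Integrable bound μ)
    (hbound : ∀ᵐ z ∂μ, ∀ q ∈ Metric.ball p r, ‖fderiv ℝ f (q, z)‖ ≤ bound z) :
    HasFDerivAt (fun p => ∫ z, f (p, z) ∂μ)
      (∫ z, (fderiv ℝ f (p, z)).comp (ContinuousLinearMap.inl ℝ P Z) ∂μ) p ∧
    ∀ v, (∫ z, (fderiv ℝ f (p, z)).comp (ContinuousLinearMap.inl ℝ P Z) ∂μ) v
      = ∫ z, pd (v, 0) f (p, z) ∂μ := by
  have hcf : Continuous (fderiv ℝ f) := hf.continuous_fderiv (by simp)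
  have hc : Continuous fun q : P × Z => (fderiv ℝ f q).comp (ContinuousLinearMap.inl ℝ P Z) :=
    hcf.clm_comp continuous_const
  have hle : ∀ q : P × Z, ‖(fderiv ℝ f q).comp (ContinuousLinearMap.inl ℝ P Z)‖
      ≤ ‖fderiv ℝ f q‖ := by
    intro q
    refine (ContinuousLinearMap.opNorm_comp_le _ _).trans ?_
    exact mul_le_of_le_one_right (norm_nonneg _) (ContinuousLinearMap.norm_inl_le_one ℝ P Z)
  have hb' : ∀ᵐ z ∂μ, ∀ q ∈ Metric.ball p r,
      ‖(fderiv ℝ f (q, z)).comp (ContinuousLinearMap.inl ℝ P Z)‖ ≤ bound z := by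
    filter_upwards [hbound] with z hz q hq using (hle _).trans (hz q hq)
  have hmeas : AEStronglyMeasurable
      (fun z => (fderiv ℝ f (p, z)).comp (ContinuousLinearMap.inl ℝ P Z)) μ :=
    (hc.comp (by fun_prop : Continuous fun z : Z => (p, z))).aestronglyMeasurable
  refine ⟨hasFDerivAt_integral_of_dominated_of_fderiv_le (s := Metric.ball p r)
    (F := fun p z => f (p, z))
    (F' := fun p z => (fderiv ℝ f (p, z)).comp (ContinuousLinearMap.inl ℝ P Z)) (bound := bound)
    (Metric.ball_mem_nhds p hr) ?_ hint hmeas hb' hb ?_, ?_⟩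
  · exact Filter.Eventually.of_forall fun q =>
      (hf.continuous.comp (by fun_prop : Continuous fun z : Z => (q, z))).aestronglyMeasurable
  · refine Filter.Eventually.of_forall fun z q _ => ?_
    have h1 := (differentiable_of_smooth hf (q, z)).hasFDerivAt
    exact h1.comp q (hasFDerivAt_prodMk_left q z)
  · intro v
    have hi : Integrable (fun z => (fderiv ℝ f (p, z)).comp (ContinuousLinearMap.inl ℝ P Z)) μ := by
      refine hb.mono' hmeas ?_
      filter_upwards [hb'] with z hz using hz p (Metric.mem_ball_self hr)
    rw [ContinuousLinearMap.integral_apply hi]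
    rfl

theorem hasFDerivAt_setIntegral [CompleteSpace F] (μ : Measure Z) [IsFiniteMeasureOnCompacts μ]
    {K : Set Z} (hK : IsCompact K) {f : P × Z → F} (hf : ContDiff ℝ ∞ f) (p : P) :
    HasFDerivAt (fun p => ∫ z in K, f (p, z) ∂μ)
      (∫ z in K, (fderiv ℝ f (p, z)).comp (ContinuousLinearMap.inl ℝ P Z) ∂μ) p ∧
    ∀ v, (∫ z in K, (fderiv ℝ f (p, z)).comp (ContinuousLinearMap.inl ℝ P Z) ∂μ) v
      = ∫ z in K, pd (v, 0) f (p, z) ∂μ := by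
  have hcf : Continuous (fderiv ℝ f) := hf.continuous_fderiv (by simp)
  obtain ⟨C, _, hC⟩ := exists_bound_of_continuous hcf hK p 1
  refine hasFDerivAt_integral_of_smooth (μ.restrict K) hf p one_pos (bound := fun _ => C) ?_ ?_ ?_
  · exact (hf.continuous.comp (by fun_prop : Continuous fun z : Z => (p, z))).continuousOn.integrableOn_compact hK
  · exact integrableOn_const hK.measure_ne_top
  · filter_upwards [ae_restrict_mem hK.measurableSet] with z hz q hq
    exact hC q (Metric.ball_subset_closedBall hq) z hz

theorem pd_setIntegral [CompleteSpace F] (μ : Measure Z) [IsFiniteMeasureOnCompacts μ]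
    {K : Set Z} (hK : IsCompact K) {f : P × Z → F} (hf : ContDiff ℝ ∞ f) (v : P) :
    pd v (fun p => ∫ z in K, f (p, z) ∂μ) = fun p => ∫ z in K, pd (v, 0) f (p, z) ∂μ := by
  ext p
  obtain ⟨h1, h2⟩ := hasFDerivAt_setIntegral μ hK hf p
  simp only [pd]
  rw [h1.fderiv, h2 v]
  rfl

/-- Every directional derivative of such an integral is again one of the same kind, so the order of
differentiability climbs by induction over all integrands at once. -/
theorem contDiff_setIntegral [CompleteSpace F] (μ : Measure Z) [IsFiniteMeasureOnCompacts μ]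
    {K : Set Z} (hK : IsCompact K) {f : P × Z → F} (hf : ContDiff ℝ ∞ f) :
    ContDiff ℝ ∞ (fun p => ∫ z in K, f (p, z) ∂μ) := by
  rw [contDiff_infty]
  intro n
  induction n generalizing f with
  | zero =>
    exact contDiff_zero.2 (continuous_iff_continuousAt.2 fun p =>
      (hasFDerivAt_setIntegral μ hK hf p).1.continuousAt)
  | succ n ih =>
    push_cast
    rw [contDiff_succ_iff_fderiv_apply]
    refine ⟨fun p => (hasFDerivAt_setIntegral μ hK hf p).1.differentiableAt, by simp, fun v => ?_⟩
    change ContDiff ℝ n (pd v fun p => ∫ z in K, f (p, z) ∂μ)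
    rw [pd_setIntegral μ hK hf]
    exact ih (ContDiff.pd hf _)

end ParametricIntegral

/-! ### Nonstationary phase -/

section NonstationaryPhase

/-- A smooth function on the line which equals `1 / t` for `|t| ≥ c`. -/
theorem exists_smooth_inv {c : ℝ} (hc : 0 < c) :
    ∃ m : ℝ → ℝ, ContDiff ℝ ∞ m ∧ ∀ t, c ≤ |t| → m t * t = 1 := by
  -- The function t/(t² + φ(t)) is smooth because φ is positive where t² vanishes, and equals 1/t
  -- where φ vanishes, that is, for |t| ≥ c.
  let φ : ContDiffBump (0 : ℝ) := ⟨c / 2, c, by positivity, by linarith⟩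
  have hpos : ∀ t, 0 < t ^ 2 + φ t := by
    intro t
    rcases eq_or_ne t 0 with rfl | ht
    · have : φ 0 = 1 := φ.one_of_mem_closedBall (Metric.mem_closedBall_self (by positivity))
      simp [this]
    · have := φ.nonneg (x := t)
      positivity
  refine ⟨fun t => t / (t ^ 2 + φ t), ?_, fun t ht => ?_⟩
  · exact contDiff_id.div ((contDiff_id.pow 2).add φ.contDiff) fun t => (hpos t).ne'
  · have h0 : φ t = 0 := by
      apply φ.zero_of_le_dist
      simpa using ht
    have ht0 : t ≠ 0 := by
      rintro rfl
      simp at ht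
      linarith
    simp only [h0, add_zero]
    field_simp

variable {Θ Z : Type*} [NormedAddCommGroup Θ] [NormedSpace ℝ Θ]
  [NormedAddCommGroup Z] [NormedSpace ℝ Z] [FiniteDimensional ℝ Z] [MeasurableSpace Z] [BorelSpace Z]

theorem integral_pd_mul (μ : Measure Z) [μ.IsAddHaarMeasure] {f g : Z → ℂ} (hf : ContDiff ℝ ∞ f)
    (hg : ContDiff ℝ ∞ g) (hs : HasCompactSupport f) (v : Z) :
    ∫ z, f z * pd v g z ∂μ = - ∫ z, pd v f z * g z ∂μ := by
  have h1 : HasCompactSupport (pd v f) := hs.fderiv_apply ℝ v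
  refine integral_mul_fderiv_eq_neg_fderiv_mul_of_integrable ?_ ?_ ?_ ?_ ?_
  · exact ((ContDiff.pd hf v).continuous.mul hg.continuous).integrable_of_hasCompactSupport
      (h1.mul_right)
  · exact (hf.continuous.mul (ContDiff.pd hg v).continuous).integrable_of_hasCompactSupport
      (hs.mul_right)
  · exact (hf.continuous.mul hg.continuous).integrable_of_hasCompactSupport hs.mul_right
  · exact fun x _ => differentiable_of_smooth hf x
  · exact fun x _ => differentiable_of_smooth hg x

theorem hasCompactSupport_of_zero {f : Z → ℂ} {K : Set Z} (hK : IsCompact K)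
    (h : ∀ z ∉ K, f z = 0) : HasCompactSupport f :=
  HasCompactSupport.intro hK h

/-- The principle of nonstationary phase, uniformly in parameters. -/
theorem nonstationary_phase (μ : Measure Z) [μ.IsAddHaarMeasure] {K : Set Z} (hK : IsCompact K)
    {Θ₀ : Set Θ} (hΘ : IsCompact Θ₀) (e : Z) {ψ : Z × Θ → ℝ} (hψ : ContDiff ℝ ∞ ψ) {c : ℝ}
    (hc : 0 < c) (hlow : ∀ z ∈ K, ∀ θ ∈ Θ₀, c ≤ |pd (e, 0) ψ (z, θ)|) (N : ℕ) {f : Z × Θ → ℂ}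
    (hf : ContDiff ℝ ∞ f) (hfK : ∀ z θ, z ∉ K → f (z, θ) = 0) :
    ∃ C, 0 ≤ C ∧ ∀ θ ∈ Θ₀, ∀ R : ℝ, 0 < R →
      ‖∫ z, f (z, θ) * Complex.exp (Complex.I * ((R * ψ (z, θ) : ℝ))) ∂μ‖ * R ^ N ≤ C := by
  obtain ⟨m, hm, hm1⟩ := exists_smooth_inv hc
  -- On K one has e^{iRψ} = (iR ∂ψ)⁻¹ ∂e^{iRψ}. Integration by parts therefore gains R⁻¹ and
  -- replaces f by the derivative of f·m(∂ψ), again an amplitude vanishing off K.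
  induction N generalizing f with
  | zero =>
    obtain ⟨C, hC⟩ := (hK.prod hΘ).exists_bound_of_continuousOn hf.continuous.continuousOn
    refine ⟨max C 0 * μ.real K, by positivity, fun θ hθ R _ => ?_⟩
    rw [pow_zero, mul_one]
    have h0 : ∀ z ∉ K, f (z, θ) * Complex.exp (Complex.I * ((R * ψ (z, θ) : ℝ))) = 0 := by
      intro z hz
      rw [hfK z θ hz, zero_mul]
    rw [← setIntegral_eq_integral_of_forall_compl_eq_zero h0]
    refine norm_setIntegral_le_of_norm_le_const hK.measure_lt_top fun z hz => ?_
    rw [norm_mul, norm_cexp_I, mul_one]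
    exact (hC (z, θ) ⟨hz, hθ⟩).trans (le_max_left _ _)
  | succ N ih =>
    have hψ' := ContDiff.pd hψ (e, (0 : Θ))
    have hg : ContDiff ℝ ∞ fun p : Z × Θ => f p * ((m (pd (e, 0) ψ p) : ℝ) : ℂ) :=
      hf.mul (Complex.ofRealCLM.contDiff.comp (hm.comp hψ'))
    have hK' : IsClosed (K ×ˢ (Set.univ : Set Θ)) := hK.isClosed.prod isClosed_univ
    obtain ⟨C, hC0, hC⟩ := ih (ContDiff.pd hg (e, (0 : Θ))) (fun z θ hz =>
      pd_eq_zero_of_notMem hK' (fun p hp => by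
        have : p.1 ∉ K := fun h => hp ⟨h, trivial⟩
        have h0 := hfK p.1 p.2 this
        simp only [Prod.mk.eta] at h0
        simp only [h0, zero_mul]) (e, (0 : Θ)) (z, θ) (fun h => hz h.1))
    refine ⟨C, hC0, fun θ hθ R hR => ?_⟩
    refine le_trans (le_of_eq ?_) (hC θ hθ R hR)
    have hι : ∀ {F : Type _} [NormedAddCommGroup F] [NormedSpace ℝ F] {k : Z × Θ → F},
        ContDiff ℝ ∞ k → ContDiff ℝ ∞ fun z => k (z, θ) := fun hk =>
      hk.comp (contDiff_id.prodMk contDiff_const)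
    have hpd : ∀ {F : Type _} [NormedAddCommGroup F] [NormedSpace ℝ F] {k : Z × Θ → F},
        ContDiff ℝ ∞ k → pd e (fun z => k (z, θ)) = fun z => pd (e, 0) k (z, θ) := by
      intro F _ _ k hk
      simpa using pd_comp_affine hk (ContinuousLinearMap.inl ℝ Z Θ) (0, θ) e
    have hR' : ContDiff ℝ ∞ fun p : Z × Θ => R * ψ p := contDiff_const.mul hψ
    have hpR : pd (e, 0) (fun p : Z × Θ => R * ψ p) = fun p => R * pd (e, 0) ψ p := by
      ext p
      simp only [pd]
      rw [fderiv_const_mul (differentiable_of_smooth hψ p)]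
      rfl
    have hE := contDiff_cexp_I hR'
    have hs : HasCompactSupport fun z => f (z, θ) * ((m (pd (e, 0) ψ (z, θ)) : ℝ) : ℂ) :=
      hasCompactSupport_of_zero hK fun z hz => by simp [hfK z θ hz]
    have key := integral_pd_mul μ (hι hg) (hι hE) hs e
    rw [hpd hg, hpd hE, pd_cexp hR', hpR] at key
    have e1 : ∀ z, f (z, θ) * ((m (pd (e, 0) ψ (z, θ)) : ℝ) : ℂ) *
        (Complex.I * ((R * pd (e, 0) ψ (z, θ) : ℝ) : ℂ) *
          Complex.exp (Complex.I * ((R * ψ (z, θ) : ℝ) : ℂ)))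
        = (Complex.I * R) *
          (f (z, θ) * Complex.exp (Complex.I * ((R * ψ (z, θ) : ℝ) : ℂ))) := by
      intro z
      by_cases hz : z ∈ K
      · have h1 : ((m (pd (e, 0) ψ (z, θ)) : ℝ) : ℂ) * ((pd (e, 0) ψ (z, θ) : ℝ) : ℂ) = 1 := by
          exact_mod_cast hm1 _ (hlow z hz θ hθ)
        rw [Complex.ofReal_mul R]
        linear_combination (f (z, θ) * Complex.I * R *
          Complex.exp (Complex.I * ((R * ψ (z, θ) : ℝ) : ℂ))) * h1
      · simp [hfK z θ hz]
    simp only [e1] at key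
    rw [integral_const_mul] at key
    have key2 := congrArg norm key
    rw [norm_neg, norm_mul, norm_mul, Complex.norm_I, one_mul, Complex.norm_real,
      Real.norm_of_nonneg hR.le] at key2
    rw [← key2, pow_succ]
    ring

end NonstationaryPhase

end StarProduct

namespace StarProduct

open MeasureTheory

set_option linter.unusedSectionVars false

/-! ### Fourier transforms of test functions -/

section Fourier

variable {Z D P V : Type*} [NormedAddCommGroup Z] [NormedSpace ℝ Z] [FiniteDimensional ℝ Z]
  [MeasurableSpace Z] [BorelSpace Z]
  [NormedAddCommGroup D] [NormedSpace ℝ D] [FiniteDimensional ℝ D] [MeasurableSpace D] [BorelSpace D]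
  [NormedAddCommGroup P] [NormedSpace ℝ P] [FiniteDimensional ℝ P]
  [NormedAddCommGroup V] [NormedSpace ℝ V] [FiniteDimensional ℝ V]

/-- Smooth functions vanishing outside of `K`. -/
structure TestOn (K : Set Z) (G : Z → ℂ) : Prop where
  smooth : ContDiff ℝ ∞ G
  zero : ∀ z ∉ K, G z = 0

/-- The Fourier transform `Ĝ(w) = ∫ G(z) e^{-i B(z, w)} dz`. -/
def fhat (B : Z →L[ℝ] D →L[ℝ] ℝ) (μ : Measure Z) (G : Z → ℂ) (w : D) : ℂ :=
  ∫ z, G z * Complex.exp (Complex.I * ((-(B z w) : ℝ))) ∂μ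

/-- The pairing `∫ c(w) Ĝ(w) dw`. -/
def osc (B : Z →L[ℝ] D →L[ℝ] ℝ) (μ : Measure Z) (ν : Measure D) (G : Z → ℂ) (c : D → ℂ) : ℂ :=
  ∫ w, c w * fhat B μ G w ∂ν

theorem TestOn.pd {K : Set Z} (hK : IsCompact K) {G : Z → ℂ} (hG : TestOn K G) (v : Z) :
    TestOn K (pd v G) :=
  ⟨ContDiff.pd hG.smooth v, pd_eq_zero_of_notMem hK.isClosed hG.zero v⟩

theorem TestOn.pds {K : Set Z} (hK : IsCompact K) {G : Z → ℂ} (hG : TestOn K G) (l : List Z) :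
    TestOn K (pds l G) := by
  induction l with
  | nil => exact hG
  | cons v l ih => exact ih.pd hK v

theorem TestOn.mul_left {K : Set Z} {G : Z → ℂ} (hG : TestOn K G) {f : Z → ℂ}
    (hf : ContDiff ℝ ∞ f) : TestOn K (fun z => f z * G z) :=
  ⟨hf.mul hG.smooth, fun z hz => by simp [hG.zero z hz]⟩

theorem TestOn.hasCompactSupport {K : Set Z} (hK : IsCompact K) {G : Z → ℂ} (hG : TestOn K G) :
    HasCompactSupport G := HasCompactSupport.intro hK hG.zero

theorem TestOn.integrable {K : Set Z} (hK : IsCompact K) {G : Z → ℂ} (hG : TestOn K G)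
    (μ : Measure Z) [IsFiniteMeasureOnCompacts μ] : Integrable G μ :=
  hG.smooth.continuous.integrable_of_hasCompactSupport (hG.hasCompactSupport hK)

variable (B : Z →L[ℝ] D →L[ℝ] ℝ) (μ : Measure Z) [μ.IsAddHaarMeasure]
  (ν : Measure D) [ν.IsAddHaarMeasure]

theorem contDiff_pairing (w : D) : ContDiff ℝ ∞ fun z => B z w := (B.flip w).contDiff

theorem smooth_char (w : D) :
    ContDiff ℝ ∞ fun z => Complex.exp (Complex.I * ((-(B z w) : ℝ))) :=
  contDiff_cexp_I (contDiff_pairing B w).neg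

theorem fhat_integrable {K : Set Z} (hK : IsCompact K) {G : Z → ℂ} (hG : TestOn K G) (w : D) :
    Integrable (fun z => G z * Complex.exp (Complex.I * ((-(B z w) : ℝ)))) μ := by
  have := (hG.mul_left (smooth_char B w)).integrable hK μ
  refine this.congr (Filter.Eventually.of_forall fun z => mul_comm _ _)

theorem fhat_add {K : Set Z} (hK : IsCompact K) {G G' : Z → ℂ} (hG : TestOn K G)
    (hG' : TestOn K G') (w : D) :
    fhat B μ (fun z => G z + G' z) w = fhat B μ G w + fhat B μ G' w := by
  unfold fhat
  rw [← integral_add (fhat_integrable B μ hK hG w) (fhat_integrable B μ hK hG' w)]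
  simp only [add_mul]

theorem fhat_const_mul (a : ℂ) (G : Z → ℂ) (w : D) :
    fhat B μ (fun z => a * G z) w = a * fhat B μ G w := by
  unfold fhat
  rw [← integral_const_mul]
  simp only [mul_assoc]

/-- The directions of a basis detect the size of a frequency. -/
theorem exists_pairing_lower (hB : Function.Injective B.flip) :
    ∃ c > 0, ∀ σ : D, σ ≠ 0 → ∃ i, c * ‖σ‖ ≤ |B (Module.finBasis ℝ Z i) σ| := by
  set b := Module.finBasis ℝ Z
  let T : D →ₗ[ℝ] (Fin (Module.finrank ℝ Z) → ℝ) :=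
    LinearMap.pi fun i => (B (b i) : D →ₗ[ℝ] ℝ)
  have hT : LinearMap.ker T = ⊥ := by
    rw [LinearMap.ker_eq_bot']
    intro σ hσ
    apply hB
    rw [map_zero]
    have : ∀ i, (B.flip σ : Z →ₗ[ℝ] ℝ) (b i) = (0 : Z →ₗ[ℝ] ℝ) (b i) := fun i => congrFun hσ i
    have h := b.ext this
    ext z
    exact LinearMap.congr_fun h z
  obtain ⟨k, hk, hanti⟩ := T.exists_antilipschitzWith hT
  refine ⟨(k : ℝ)⁻¹, by positivity, fun σ hσ => ?_⟩
  have h1 := hanti.le_mul_dist σ 0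
  rw [map_zero, dist_zero_right, dist_zero_right] at h1
  by_contra hcon
  push Not at hcon
  have h2 : ‖T σ‖ < (k : ℝ)⁻¹ * ‖σ‖ := by
    refine (pi_norm_lt_iff (by have := norm_pos_iff.2 hσ; positivity)).2 fun i => ?_
    exact hcon i
  have : (k : ℝ) * ‖T σ‖ < k * ((k : ℝ)⁻¹ * ‖σ‖) := by gcongr
  rw [← mul_assoc, mul_inv_cancel₀ (by positivity), one_mul] at this
  linarith

/-- Merges a uniform bound, used for R ≤ 1, with a decay bound, used for R ≥ 1; the power of 2 comes
from 1 + R ≤ 2 max(1, R). -/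
theorem one_add_pow_bound {x R a b : ℝ} (N : ℕ) (hR : 0 ≤ R) (hx : 0 ≤ x) (ha : x ≤ a)
    (hb : 0 < R → x * R ^ N ≤ b) (hb0 : 0 ≤ b) : x * (1 + R) ^ N ≤ 2 ^ N * (a + b) := by
  rcases le_total R 1 with h | h
  · calc x * (1 + R) ^ N ≤ a * 2 ^ N := by
          have : 1 + R ≤ 2 := by linarith
          gcongr
          linarith
      _ ≤ _ := by nlinarith [pow_pos (two_pos : (0 : ℝ) < 2) N]
  · have h0 : 0 < R := by linarith
    calc x * (1 + R) ^ N ≤ x * (2 * R) ^ N := by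
          have : 1 + R ≤ 2 * R := by linarith
          gcongr
      _ = 2 ^ N * (x * R ^ N) := by ring
      _ ≤ 2 ^ N * (a + b) := by
          have := hb h0
          gcongr
          linarith

/-- Rapid decay of oscillatory integrals at frequencies which dominate the phase. -/
theorem oscillatory_decay {K : Set Z} (hK : IsCompact K) {c : ℝ}
    (hc : 0 < c) (hcB : ∀ σ : D, σ ≠ 0 → ∃ i, c * ‖σ‖ ≤ |B (Module.finBasis ℝ Z i) σ|)
    {P₀ : Set P} (hP : IsCompact P₀) {H : P × Z → ℂ} (hH : ContDiff ℝ ∞ H)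
    (hHK : ∀ p z, z ∉ K → H (p, z) = 0) {φ : P × Z → ℝ} (hφ : ContDiff ℝ ∞ φ)
    (hsmall : ∀ i, ∀ z ∈ K, ∀ p ∈ P₀, |pd (0, Module.finBasis ℝ Z i) φ (p, z)| ≤ c / 2) (N : ℕ) :
    ∃ C, 0 ≤ C ∧ ∀ p ∈ P₀, ∀ w : D, 0 < ‖w‖ →
      ‖fhat B μ (fun z => H (p, z) * Complex.exp (Complex.I * ((‖w‖ * φ (p, z) : ℝ)))) w‖ * ‖w‖ ^ N
        ≤ C := by
  set b := Module.finBasis ℝ Z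
  -- Polar decomposition w = ‖w‖σ makes ‖w‖ the large parameter, with (p, σ) as parameters. The sets
  -- S i are compact, and on each of them the i-th basis derivative of the phase φ − B(·, σ) has
  -- size at least c − c/2.
  let S : Fin (Module.finrank ℝ Z) → Set (P × D) := fun i =>
    P₀ ×ˢ (Metric.sphere 0 1 ∩ {σ : D | c ≤ |B (b i) σ|})
  have hS : ∀ i, IsCompact (S i) := fun i =>
    hP.prod ((isCompact_sphere _ _).inter_right
      (isClosed_le continuous_const (B (b i)).continuous.abs))
  let ψ : Z × (P × D) → ℝ := fun q => φ (q.2.1, q.1) - B q.1 q.2.2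
  have hBs : ContDiff ℝ ∞ fun q : Z × (P × D) => B q.1 q.2.2 :=
    (B.contDiff.comp contDiff_fst).clm_apply (contDiff_snd.comp contDiff_snd)
  have hφs : ContDiff ℝ ∞ fun q : Z × (P × D) => φ (q.2.1, q.1) :=
    hφ.comp ((contDiff_fst.comp contDiff_snd).prodMk contDiff_fst)
  have hψ : ContDiff ℝ ∞ ψ := hφs.sub hBs
  have hf : ContDiff ℝ ∞ fun q : Z × (P × D) => H (q.2.1, q.1) :=
    hH.comp ((contDiff_fst.comp contDiff_snd).prodMk contDiff_fst)
  have hpd : ∀ e z p σ, pd (e, 0) ψ (z, (p, σ)) = pd (0, e) φ (p, z) - B e σ := by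
    intro e z p σ
    have h1 : pd (e, (0 : P × D)) ψ (z, (p, σ)) = pd e (fun z => ψ (z, (p, σ))) z := by
      have := congrFun (pd_comp_affine hψ (ContinuousLinearMap.inl ℝ Z (P × D)) (0, (p, σ)) e) z
      simpa using this.symm
    have h2 : pd ((0 : P), e) φ (p, z) = pd e (fun z => φ (p, z)) z := by
      have := congrFun (pd_comp_affine hφ (ContinuousLinearMap.inr ℝ P Z) (p, 0) e) z
      simpa using this.symm
    rw [h1, h2]
    have h3 : ContDiff ℝ ∞ fun z => φ (p, z) := hφ.comp (contDiff_const.prodMk contDiff_id)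
    have h4 : HasFDerivAt (fun z => B z σ) (B.flip σ) z := (B.flip σ).hasFDerivAt
    have h5 := ((differentiable_of_smooth h3 z).hasFDerivAt.sub h4).fderiv
    simp only [pd, ψ]
    erw [h5]
    rfl
  have hlow : ∀ i, ∀ z ∈ K, ∀ θ ∈ S i, c / 2 ≤ |pd (b i, 0) ψ (z, θ)| := by
    rintro i z hz ⟨p, σ⟩ ⟨hp, hσ1, hσ2⟩
    rw [hpd]
    have h1 := hsmall i z hz p hp
    have h2 : c ≤ |B (b i) σ| := hσ2
    have h3 := abs_sub_abs_le_abs_sub (B (b i) σ) (pd (0, b i) φ (p, z))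
    rw [abs_sub_comm] at h3
    linarith
  have key := fun i => nonstationary_phase μ hK (hS i) (b i) hψ (half_pos hc) (hlow i) N hf
    (fun z θ hz => hHK θ.1 z hz)
  choose C hC0 hC using key
  refine ⟨∑ i, C i, Finset.sum_nonneg fun i _ => hC0 i, fun p hp w hw => ?_⟩
  have hw' : w ≠ 0 := norm_pos_iff.1 hw
  obtain ⟨i, hi⟩ := hcB w hw'
  refine le_trans ?_ (Finset.single_le_sum (fun i _ => hC0 i) (Finset.mem_univ i))
  have hmem : (p, ‖w‖⁻¹ • w) ∈ S i := by
    refine ⟨hp, ?_, ?_⟩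
    · simp [norm_smul, inv_mul_cancel₀ hw.ne']
    · have : B (b i) (‖w‖⁻¹ • w) = ‖w‖⁻¹ * B (b i) w := by simp
      simp only [Set.mem_ofPred_eq]
      rw [this, abs_mul, abs_of_pos (inv_pos.2 hw), inv_mul_eq_div, le_div_iff₀ hw]
      exact hi
  refine le_trans (le_of_eq ?_) (hC i _ hmem ‖w‖ hw)
  congr 2
  unfold fhat
  refine integral_congr_ae (Filter.Eventually.of_forall fun z => ?_)
  have h1 : ‖w‖ * B z (‖w‖⁻¹ • w) = B z w := by
    rw [map_smul, smul_eq_mul, mul_inv_cancel_left₀ hw.ne']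
  simp only [ψ]
  rw [mul_assoc, ← Complex.exp_add, mul_sub, h1]
  push_cast
  ring_nf

theorem norm_fhat_le {K : Set Z} (hK : IsCompact K) {G : Z → ℂ} (hG : ∀ z ∉ K, G z = 0) {C : ℝ}
    (hC : ∀ z ∈ K, ‖G z‖ ≤ C) (w : D) : ‖fhat B μ G w‖ ≤ C * μ.real K := by
  unfold fhat
  rw [← setIntegral_eq_integral_of_forall_compl_eq_zero (s := K)
    (fun z hz => by rw [hG z hz, zero_mul])]
  refine norm_setIntegral_le_of_norm_le_const hK.measure_lt_top fun z hz => ?_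
  rw [norm_mul, norm_cexp_I, mul_one]
  exact hC z hz

/-- Rapid decay of the Fourier transform, locally uniformly in parameters. -/
theorem fhat_decay (hB : Function.Injective B.flip) {K : Set Z} (hK : IsCompact K)
    {H : P × Z → ℂ} (hH : ContDiff ℝ ∞ H) (hHK : ∀ p z, z ∉ K → H (p, z) = 0) (p : P) (r : ℝ)
    (N : ℕ) :
    ∃ C, 0 ≤ C ∧ ∀ q ∈ Metric.closedBall p r, ∀ w : D,
      ‖fhat B μ (fun z => H (q, z)) w‖ * (1 + ‖w‖) ^ N ≤ C := by
  obtain ⟨c, hc, hcB⟩ := exists_pairing_lower B hB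
  obtain ⟨C, hC0, hC⟩ := oscillatory_decay B μ hK hc hcB (isCompact_closedBall p r) hH hHK
    (φ := fun _ => 0) contDiff_const (by intros; rw [pd_const]; simpa using (half_pos hc).le) N
  obtain ⟨C', hC'0, hC'⟩ := exists_bound_of_continuous hH.continuous hK p r
  refine ⟨2 ^ N * (C' * μ.real K + C), by positivity, fun q hq w => ?_⟩
  refine one_add_pow_bound N (norm_nonneg _) (norm_nonneg _)
    (norm_fhat_le B μ hK (hHK q) (hC' q hq) w) (fun hw => ?_) hC0
  simpa using hC q hq w hw

/-- Uniform bounds for the Fourier transform of `f e^{iλ(β)}`. -/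
theorem fhat_phase_decay {K : Set Z} (hK : IsCompact K)
    {β : Z → V} (hβ : ContDiff ℝ ∞ β) {c ε : ℝ} (hc : 0 < c)
    (hcB : ∀ σ : D, σ ≠ 0 → ∃ i, c * ‖σ‖ ≤ |B (Module.finBasis ℝ Z i) σ|) (hε : 0 < ε)
    (hsmall : ∀ i, ∀ z ∈ K, ‖pd (Module.finBasis ℝ Z i) β z‖ ≤ ε * c / 2) {f : Z → ℂ}
    (hf : TestOn K f) (N : ℕ) :
    ∃ C, 0 ≤ C ∧ ∀ (l : StrongDual ℝ V) (w : D),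
      ‖fhat B μ (fun z => f z * Complex.exp (Complex.I * ((l (β z) : ℝ)))) w‖ ≤ C ∧
      (ε * ‖l‖ ≤ ‖w‖ →
      ‖fhat B μ (fun z => f z * Complex.exp (Complex.I * ((l (β z) : ℝ)))) w‖ * (1 + ‖w‖) ^ N
        ≤ C) := by
  -- When ε‖l‖ ≤ ‖w‖, the phase l(β) is ‖w‖ times the phase of ‖w‖⁻¹l, which lies in the compact
  -- ball of radius ε⁻¹. With the rescaled functional as the parameter, one application of the decay
  -- estimate covers all l.
  let φ : StrongDual ℝ V × Z → ℝ := fun q => q.1 (β q.2)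
  have hφ : ContDiff ℝ ∞ φ := contDiff_fst.clm_apply (hβ.comp contDiff_snd)
  have hs : ∀ i, ∀ z ∈ K, ∀ p ∈ Metric.closedBall (0 : StrongDual ℝ V) ε⁻¹,
      |pd (0, Module.finBasis ℝ Z i) φ (p, z)| ≤ c / 2 := by
    intro i z hz p hp
    set e := Module.finBasis ℝ Z i
    have h2 : pd ((0 : StrongDual ℝ V), e) φ (p, z) = p (pd e β z) := by
      have h := congrFun (pd_comp_affine hφ (ContinuousLinearMap.inr ℝ (StrongDual ℝ V) Z) (p, 0) e) z
      have h' := congrFun (pd_clm p hβ e) z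
      simp [φ] at h
      rw [← h, ← h']
    rw [h2, ← Real.norm_eq_abs]
    have hp' : ‖p‖ ≤ ε⁻¹ := by simpa using hp
    calc ‖p (pd e β z)‖ ≤ ‖p‖ * ‖pd e β z‖ := p.le_opNorm _
      _ ≤ ε⁻¹ * (ε * c / 2) := by gcongr; exact hsmall i z hz
      _ = c / 2 := by field_simp
  obtain ⟨C, hC0, hC⟩ := oscillatory_decay B μ hK hc hcB
    (isCompact_closedBall (0 : StrongDual ℝ V) ε⁻¹) (H := fun q => f q.2)
    (hf.smooth.comp contDiff_snd) (fun _ z hz => hf.zero z hz) hφ hs N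
  obtain ⟨C', hC'⟩ := hK.exists_bound_of_continuousOn hf.smooth.continuous.continuousOn
  have htriv : ∀ (l : StrongDual ℝ V) (w : D),
      ‖fhat B μ (fun z => f z * Complex.exp (Complex.I * ((l (β z) : ℝ)))) w‖
        ≤ max C' 0 * μ.real K := by
    intro l w
    refine norm_fhat_le B μ hK (fun z hz => by rw [hf.zero z hz, zero_mul]) (fun z hz => ?_) w
    rw [norm_mul, norm_cexp_I, mul_one]
    exact (hC' z hz).trans (le_max_left _ _)
  have h2N : (1 : ℝ) ≤ 2 ^ N := one_le_pow₀ one_le_two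
  refine ⟨2 ^ N * (max C' 0 * μ.real K + C), by positivity, fun l w => ⟨?_, fun hl => ?_⟩⟩
  · refine (htriv l w).trans ?_
    have : 0 ≤ max C' 0 * μ.real K := by positivity
    nlinarith
  · refine one_add_pow_bound N (norm_nonneg _) (norm_nonneg _) (htriv l w) (fun hw => ?_) hC0
    have hp : ‖w‖⁻¹ • l ∈ Metric.closedBall (0 : StrongDual ℝ V) ε⁻¹ := by
      rw [mem_closedBall_zero_iff, norm_smul, norm_inv, norm_norm, inv_mul_eq_div, div_le_iff₀ hw,
        inv_mul_eq_div, le_div_iff₀ hε]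
      linarith
    have := hC _ hp w hw
    have e : ∀ z, ‖w‖ * φ (‖w‖⁻¹ • l, z) = l (β z) := by
      intro z
      simp [φ, mul_inv_cancel_left₀ hw.ne']
    simpa only [e] using this

theorem exists_integrable_weight : ∃ M : ℕ, Integrable (fun w : D => ((1 + ‖w‖) ^ M)⁻¹) ν := by
  refine ⟨Module.finrank ℝ D + 1, ?_⟩
  have := integrable_one_add_norm (E := D) (μ := ν) (r := (Module.finrank ℝ D + 1 : ℕ))
    (by exact_mod_cast Nat.lt_succ_self _)
  refine this.congr (Filter.Eventually.of_forall fun w => ?_)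
  simp only
  rw [Real.rpow_neg (by positivity), Real.rpow_natCast]

theorem le_mul_inv_of_mul_le {x a C : ℝ} (ha : 0 < a) (h : x * a ≤ C) : x ≤ C * a⁻¹ := by
  rwa [← div_eq_mul_inv, le_div_iff₀ ha]

theorem integrable_of_decay {F : Type*} [NormedAddCommGroup F] {M : ℕ}
    (hM : Integrable (fun w : D => ((1 + ‖w‖) ^ M)⁻¹) ν) {g : D → F} (hg : Continuous g) {C : ℝ}
    (h : ∀ w, ‖g w‖ * (1 + ‖w‖) ^ M ≤ C) : Integrable g ν := by
  refine (hM.const_mul C).mono' hg.aestronglyMeasurable (Filter.Eventually.of_forall fun w => ?_)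
  exact le_mul_inv_of_mul_le (by positivity) (h w)

end Fourier

end StarProduct

namespace StarProduct

open MeasureTheory

set_option linter.unusedSectionVars false

/-! ### Calculus of the pairing of a symbol with a Fourier transform -/

section Pairing

variable {Z D P V : Type*} [NormedAddCommGroup Z] [NormedSpace ℝ Z] [FiniteDimensional ℝ Z]
  [MeasurableSpace Z] [BorelSpace Z]
  [NormedAddCommGroup D] [NormedSpace ℝ D] [FiniteDimensional ℝ D] [MeasurableSpace D] [BorelSpace D]
  [NormedAddCommGroup P] [NormedSpace ℝ P] [FiniteDimensional ℝ P]

variable (B : Z →L[ℝ] D →L[ℝ] ℝ) (μ : Measure Z) [μ.IsAddHaarMeasure]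
  (ν : Measure D) [ν.IsAddHaarMeasure]

/-- Smooth families of functions vanishing outside of `K`. -/
structure TestFamilyOn (K : Set Z) (H : P × Z → ℂ) : Prop where
  smooth : ContDiff ℝ ∞ H
  zero : ∀ p z, z ∉ K → H (p, z) = 0

theorem TestFamilyOn.testOn {K : Set Z} {H : P × Z → ℂ} (hH : TestFamilyOn K H) (p : P) :
    TestOn K (fun z => H (p, z)) :=
  ⟨hH.smooth.comp (contDiff_const.prodMk contDiff_id), fun z hz => hH.zero p z hz⟩

theorem TestFamilyOn.pd {K : Set Z} (hK : IsCompact K) {H : P × Z → ℂ} (hH : TestFamilyOn K H)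
    (v : P × Z) : TestFamilyOn K (pd v H) := by
  refine ⟨ContDiff.pd hH.smooth v, fun p z hz => ?_⟩
  exact pd_eq_zero_of_notMem (K := (Set.univ : Set P) ×ˢ K) (isClosed_univ.prod hK.isClosed)
    (fun q hq => hH.zero q.1 q.2 fun h => hq ⟨trivial, h⟩) v (p, z) (fun h => hz h.2)

/-- The integrand of the Fourier transform of a family. -/
theorem smooth_fhat_integrand {H : P × Z → ℂ} (hH : ContDiff ℝ ∞ H) :
    ContDiff ℝ ∞ fun q : (P × D) × Z =>
      H (q.1.1, q.2) * Complex.exp (Complex.I * ((-(B q.2 q.1.2) : ℝ))) := by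
  have hB : ContDiff ℝ ∞ fun q : (P × D) × Z => -(B q.2 q.1.2) :=
    ((B.contDiff.comp contDiff_snd).clm_apply (contDiff_snd.comp contDiff_fst)).neg
  exact (hH.comp ((contDiff_fst.comp contDiff_fst).prodMk contDiff_snd)).mul (contDiff_cexp_I hB)

theorem fhat_eq_setIntegral {K : Set Z} {H : P × Z → ℂ} (hH : TestFamilyOn K H) (q : P × D) :
    fhat B μ (fun z => H (q.1, z)) q.2
      = ∫ z in K, H (q.1, z) * Complex.exp (Complex.I * ((-(B z q.2) : ℝ))) ∂μ := by
  unfold fhat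
  rw [setIntegral_eq_integral_of_forall_compl_eq_zero]
  intro z hz
  rw [hH.zero _ z hz, zero_mul]

theorem smooth_fhat {K : Set Z} (hK : IsCompact K) {H : P × Z → ℂ} (hH : TestFamilyOn K H) :
    ContDiff ℝ ∞ fun q : P × D => fhat B μ (fun z => H (q.1, z)) q.2 := by
  simp only [fhat_eq_setIntegral B μ hH]
  exact contDiff_setIntegral μ hK (smooth_fhat_integrand B hH.smooth)

/-- The family whose Fourier transform is the derivative of the Fourier transform of `H`. -/
def dualDeriv (H : P × Z → ℂ) (v : P) (w : D) : P × Z → ℂ :=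
  fun q => pd (v, 0) H q + -(Complex.I * (B q.2 w : ℝ)) * H q

theorem TestFamilyOn.dualDeriv {K : Set Z} (hK : IsCompact K) {H : P × Z → ℂ}
    (hH : TestFamilyOn K H) (v : P) (w : D) : TestFamilyOn K (dualDeriv B H v w) := by
  have h1 := hH.pd hK (v, 0)
  refine ⟨h1.smooth.add (ContDiff.mul ?_ hH.smooth), fun p z hz => ?_⟩
  · have : ContDiff ℝ ∞ fun q : P × Z => B q.2 w := (B.flip w).contDiff.comp contDiff_snd
    exact (contDiff_const.mul (Complex.ofRealCLM.contDiff.comp this)).neg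
  · simp [StarProduct.dualDeriv, h1.zero p z hz, hH.zero p z hz]

/-- Derivatives in the parameter and in the frequency are again Fourier transforms of a test family,
hence they inherit rapid decay. -/
theorem pd_fhat {K : Set Z} (hK : IsCompact K) {H : P × Z → ℂ} (hH : TestFamilyOn K H)
    (v : P) (w : D) :
    pd (v, w) (fun q : P × D => fhat B μ (fun z => H (q.1, z)) q.2)
      = fun q => fhat B μ (fun z => dualDeriv B H v w (q.1, z)) q.2 := by
  simp only [fhat_eq_setIntegral B μ hH]
  rw [pd_setIntegral μ hK (smooth_fhat_integrand B hH.smooth)]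
  ext q
  rw [fhat_eq_setIntegral B μ (hH.dualDeriv B hK v w)]
  refine setIntegral_congr_fun hK.measurableSet fun z _ => ?_
  have hB : ContDiff ℝ ∞ fun q : (P × D) × Z => -(B q.2 q.1.2) :=
    ((B.contDiff.comp contDiff_snd).clm_apply (contDiff_snd.comp contDiff_fst)).neg
  have hH' : ContDiff ℝ ∞ fun q : (P × D) × Z => H (q.1.1, q.2) :=
    hH.smooth.comp ((contDiff_fst.comp contDiff_fst).prodMk contDiff_snd)
  rw [pd_mul hH' (contDiff_cexp_I hB), pd_cexp hB]
  have e1 : pd ((v, w), (0 : Z)) (fun q : (P × D) × Z => H (q.1.1, q.2)) (q, z)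
      = pd (v, 0) H (q.1, z) := by
    have := pd_comp_clm hH.smooth (((ContinuousLinearMap.fst ℝ P D).comp
      (ContinuousLinearMap.fst ℝ (P × D) Z)).prod (ContinuousLinearMap.snd ℝ (P × D) Z))
      ((v, w), (0 : Z))
    exact congrFun this (q, z)
  have e2 : pd ((v, w), (0 : Z)) (fun q : (P × D) × Z => -(B q.2 q.1.2)) (q, z) = -(B z w) := by
    have h1 : HasFDerivAt (fun q : (P × D) × Z => B q.2)
        (B.comp (ContinuousLinearMap.snd ℝ (P × D) Z)) (q, z) :=
      (B.comp (ContinuousLinearMap.snd ℝ (P × D) Z)).hasFDerivAt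
    have h2 : HasFDerivAt (fun q : (P × D) × Z => q.1.2)
        ((ContinuousLinearMap.snd ℝ P D).comp (ContinuousLinearMap.fst ℝ (P × D) Z)) (q, z) :=
      ((ContinuousLinearMap.snd ℝ P D).comp (ContinuousLinearMap.fst ℝ (P × D) Z)).hasFDerivAt
    have := (h1.clm_apply h2).neg.fderiv
    simp only [pd]
    erw [this]
    simp
  beta_reduce
  rw [e1, e2, StarProduct.dualDeriv]
  push_cast
  ring

theorem fhat_family_decay (hB : Function.Injective B.flip) {K : Set Z} (hK : IsCompact K)
    {H : P × Z → ℂ} (hH : TestFamilyOn K H) (p : P) (r : ℝ) (N : ℕ) :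
    ∃ C, 0 ≤ C ∧ ∀ q ∈ Metric.closedBall p r, ∀ w : D,
      ‖fhat B μ (fun z => H (q, z)) w‖ * (1 + ‖w‖) ^ N ≤ C :=
  fhat_decay B μ hB hK hH.smooth hH.zero p r N

/-- Decay of the total derivative of the Fourier transform of a family. -/
theorem fderiv_fhat_decay (hB : Function.Injective B.flip) {K : Set Z} (hK : IsCompact K)
    {H : P × Z → ℂ} (hH : TestFamilyOn K H) (p : P) (r : ℝ) (N : ℕ) :
    ∃ C, 0 ≤ C ∧ ∀ q ∈ Metric.closedBall p r, ∀ w : D,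
      ‖fderiv ℝ (fun q : P × D => fhat B μ (fun z => H (q.1, z)) q.2) (q, w)‖ * (1 + ‖w‖) ^ N
        ≤ C := by
  let b := Module.finBasis ℝ (P × D)
  obtain ⟨C₀, hC₀, hle⟩ := b.exists_opNorm_le (F := ℂ)
  have key := fun i => fhat_family_decay B μ hB hK (hH.dualDeriv B hK (b i).1 (b i).2) p r N
  choose C hC0 hC using key
  refine ⟨C₀ * ∑ i, C i, mul_nonneg hC₀.le (Finset.sum_nonneg fun i _ => hC0 i),
    fun q hq w => ?_⟩
  have hpos : (0 : ℝ) < (1 + ‖w‖) ^ N := by positivity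
  have := hle (u := fderiv ℝ (fun q : P × D => fhat B μ (fun z => H (q.1, z)) q.2) (q, w))
    (M := (∑ i, C i) * ((1 + ‖w‖) ^ N)⁻¹)
    (mul_nonneg (Finset.sum_nonneg fun i _ => hC0 i) (by positivity)) (fun i => by
      have h1 := congrFun (pd_fhat B μ hK hH (b i).1 (b i).2) (q, w)
      simp only [pd, Prod.mk.eta] at h1
      rw [h1]
      refine le_mul_inv_of_mul_le hpos ((hC i q hq w).trans ?_)
      exact Finset.single_le_sum (fun i _ => hC0 i) (Finset.mem_univ i))
  rw [← le_div_iff₀ hpos]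
  refine this.trans (le_of_eq ?_)
  rw [div_eq_mul_inv, mul_assoc]

theorem testOn_toFamily {K : Set Z} {G : Z → ℂ} (hG : TestOn K G) :
    TestFamilyOn (P := P) K (fun q => G q.2) :=
  ⟨hG.smooth.comp contDiff_snd, fun _ z hz => hG.zero z hz⟩

theorem TestOn.smooth_fhat {K : Set Z} (hK : IsCompact K) {G : Z → ℂ} (hG : TestOn K G) :
    ContDiff ℝ ∞ (fhat B μ G) :=
  (StarProduct.smooth_fhat B μ hK (testOn_toFamily (P := ℝ) hG)).comp
    (contDiff_const (c := (0 : ℝ)).prodMk contDiff_id)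

theorem TestOn.fhat_decay (hB : Function.Injective B.flip) {K : Set Z} (hK : IsCompact K)
    {G : Z → ℂ} (hG : TestOn K G) (N : ℕ) :
    ∃ C, 0 ≤ C ∧ ∀ w : D, ‖fhat B μ G w‖ * (1 + ‖w‖) ^ N ≤ C := by
  obtain ⟨C, hC0, hC⟩ := fhat_family_decay B μ hB hK (testOn_toFamily (P := ℝ) hG) 0 1 N
  exact ⟨C, hC0, hC 0 (by simp)⟩

theorem pd_fhat_testOn {K : Set Z} (hK : IsCompact K) {G : Z → ℂ} (hG : TestOn K G) (w : D) :
    pd w (fhat B μ G) = fun w' => fhat B μ (fun z => -(Complex.I * (B z w : ℝ)) * G z) w' := by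
  have hF := testOn_toFamily (P := ℝ) hG
  have h1 := pd_comp_clm (StarProduct.smooth_fhat B μ hK hF) (ContinuousLinearMap.inr ℝ ℝ D) w
  have h2 : pd ((0 : ℝ), w) _ = _ := pd_fhat B μ hK hF 0 w
  have h3 : ∀ q : ℝ × Z, dualDeriv B (fun q : ℝ × Z => G q.2) 0 w q
      = -(Complex.I * (B q.2 w : ℝ)) * G q.2 := by
    intro q
    have : pd ((0 : ℝ), (0 : Z)) (fun q : ℝ × Z => G q.2) q = 0 := by
      have h0 : ((0 : ℝ), (0 : Z)) = 0 := rfl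
      simp [pd, h0]
    simp [dualDeriv, this]
  ext w'
  have h4 := congrFun h1 w'
  simp only [ContinuousLinearMap.inr_apply] at h4
  rw [h4, h2]
  simp only [h3]

theorem temperate_bound {E F : Type*} [NormedAddCommGroup E] [NormedSpace ℝ E]
    [NormedAddCommGroup F] [NormedSpace ℝ F] {c : E → F} (hc : c.HasTemperateGrowth) :
    ∃ (k : ℕ) (C : ℝ), 0 ≤ C ∧ (∀ x, ‖c x‖ ≤ C * (1 + ‖x‖) ^ k) ∧
      ∀ x, ‖fderiv ℝ c x‖ ≤ C * (1 + ‖x‖) ^ k := by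
  obtain ⟨k, C, hC, h⟩ := hc.norm_iteratedFDeriv_le_uniform 1
  exact ⟨k, C, hC, fun x => by simpa using h 0 (by norm_num) x, fun x => by
    simpa using h 1 le_rfl x⟩

theorem temperate_pd {E F : Type*} [NormedAddCommGroup E] [NormedSpace ℝ E]
    [NormedAddCommGroup F] [NormedSpace ℝ F] {c : E → F} (hc : c.HasTemperateGrowth) (v : E) :
    (pd v c).HasTemperateGrowth := by
  refine ⟨ContDiff.pd hc.1 v, fun n => ?_⟩
  obtain ⟨k, C, h⟩ := hc.2 (n + 1)
  refine ⟨k, ‖v‖ * C, fun x => ?_⟩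
  have h1 : ContDiffAt ℝ n (fderiv ℝ c) x :=
    (smooth_of_le (hc.1.fderiv_right (m := ∞) (by simp)) n).contDiffAt
  refine (norm_iteratedFDeriv_clm_apply_const h1 le_rfl).trans ?_
  rw [norm_iteratedFDeriv_fderiv, mul_assoc]
  gcongr
  exact h x

theorem temperate_section {c : P × D → ℂ} (hc : c.HasTemperateGrowth) (p : P) :
    Function.HasTemperateGrowth fun w => c (p, w) := by
  have h : Function.HasTemperateGrowth fun w : D => ((p, w) : P × D) := by
    have h1 : (fun w : D => ((p, w) : P × D))
        = fun w => (p, 0) + ContinuousLinearMap.inr ℝ P D w := by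
      ext w <;> simp
    rw [h1]
    exact (Function.HasTemperateGrowth.const _).fun_add (ContinuousLinearMap.hasTemperateGrowth _)
  exact hc.comp h

/-- Rapid decay of the Fourier transform absorbs the polynomial growth of the symbol. This is why
the pairing is defined for symbols whose own Fourier transforms are only distributions. -/
theorem osc_integrable (hB : Function.Injective B.flip) {K : Set Z} (hK : IsCompact K) {G : Z → ℂ}
    (hG : TestOn K G) {c : D → ℂ} (hc : c.HasTemperateGrowth) :
    Integrable (fun w => c w * fhat B μ G w) ν := by
  obtain ⟨M, hM⟩ := exists_integrable_weight ν
  obtain ⟨k, C, hC, h, -⟩ := temperate_bound hc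
  -- Of the M + k powers, k pay for the growth of `c` and M make the product integrable.
  obtain ⟨C', hC', h'⟩ := hG.fhat_decay B μ hB hK (M + k)
  refine integrable_of_decay ν hM (C := C * C')
    (hc.1.continuous.mul (hG.smooth_fhat B μ hK).continuous) fun w => ?_
  rw [norm_mul]
  calc ‖c w‖ * ‖fhat B μ G w‖ * (1 + ‖w‖) ^ M
      ≤ (C * (1 + ‖w‖) ^ k) * ‖fhat B μ G w‖ * (1 + ‖w‖) ^ M := by gcongr; exact h w
    _ = C * (‖fhat B μ G w‖ * (1 + ‖w‖) ^ (M + k)) := by ring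
    _ ≤ C * C' := by gcongr; exact h' w

theorem osc_add_left (hB : Function.Injective B.flip) {K : Set Z} (hK : IsCompact K) {G G' : Z → ℂ}
    (hG : TestOn K G) (hG' : TestOn K G') {c : D → ℂ} (hc : c.HasTemperateGrowth) :
    osc B μ ν (fun z => G z + G' z) c = osc B μ ν G c + osc B μ ν G' c := by
  unfold osc
  rw [← integral_add (osc_integrable B μ ν hB hK hG hc) (osc_integrable B μ ν hB hK hG' hc)]
  simp only [fhat_add B μ hK hG hG', mul_add]

theorem osc_const_mul_left (a : ℂ) (G : Z → ℂ) (c : D → ℂ) :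
    osc B μ ν (fun z => a * G z) c = a * osc B μ ν G c := by
  unfold osc
  rw [← integral_const_mul]
  simp only [fhat_const_mul, mul_left_comm]

theorem osc_add_right (hB : Function.Injective B.flip) {K : Set Z} (hK : IsCompact K) {G : Z → ℂ}
    (hG : TestOn K G) {c c' : D → ℂ} (hc : c.HasTemperateGrowth) (hc' : c'.HasTemperateGrowth) :
    osc B μ ν G (fun w => c w + c' w) = osc B μ ν G c + osc B μ ν G c' := by
  unfold osc
  rw [← integral_add (osc_integrable B μ ν hB hK hG hc) (osc_integrable B μ ν hB hK hG hc')]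
  simp only [add_mul]

theorem osc_const_mul_right (a : ℂ) (G : Z → ℂ) (c : D → ℂ) :
    osc B μ ν G (fun w => a * c w) = a * osc B μ ν G c := by
  unfold osc
  rw [← integral_const_mul]
  simp only [mul_assoc]

theorem osc_sum_right (hB : Function.Injective B.flip) {K : Set Z} (hK : IsCompact K) {G : Z → ℂ}
    (hG : TestOn K G) {ι : Type*} (s : Finset ι) {c : ι → D → ℂ}
    (hc : ∀ i, (c i).HasTemperateGrowth) :
    osc B μ ν G (fun w => ∑ i ∈ s, c i w) = ∑ i ∈ s, osc B μ ν G (c i) := by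
  unfold osc
  rw [← integral_finsetSum _ fun i _ => osc_integrable B μ ν hB hK hG (hc i)]
  simp only [Finset.sum_mul]

/-- Multiplication by a linear form corresponds to a derivative of the symbol. -/
theorem osc_linear_mul (hB : Function.Injective B.flip) {K : Set Z} (hK : IsCompact K) {G : Z → ℂ}
    (hG : TestOn K G) {c : D → ℂ} (hc : c.HasTemperateGrowth) (w₀ : D) :
    osc B μ ν (fun z => (B z w₀ : ℝ) * G z) c = -Complex.I * osc B μ ν G (pd w₀ c) := by
  have hL : TestOn K fun z => (B z w₀ : ℝ) * G z :=
    hG.mul_left (Complex.ofRealCLM.contDiff.comp (contDiff_pairing B w₀))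
  have e : ∀ w, fhat B μ (fun z => (B z w₀ : ℝ) * G z) w = Complex.I * pd w₀ (fhat B μ G) w := by
    intro w
    rw [pd_fhat_testOn B μ hK hG, ← fhat_const_mul]
    congr 1
    ext z
    linear_combination ((B z w₀ : ℂ) * G z) * Complex.I_mul_I
  have i1 := osc_integrable B μ ν hB hK hG (temperate_pd hc w₀)
  have i2 := osc_integrable B μ ν hB hK hG hc
  have i3 := osc_integrable B μ ν hB hK hL hc
  have i4 : Integrable (fun w => c w * pd w₀ (fhat B μ G) w) ν := by
    refine (i3.const_mul (-Complex.I)).congr (Filter.Eventually.of_forall fun w => ?_)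
    simp only [e]
    linear_combination (-(c w) * pd w₀ (fhat B μ G) w) * Complex.I_mul_I
  have key := integral_mul_fderiv_eq_neg_fderiv_mul_of_integrable (μ := ν) (v := w₀) i1 i4 i2
    (fun w _ => differentiable_of_smooth hc.1 w)
    (fun w _ => differentiable_of_smooth (hG.smooth_fhat B μ hK) w)
  unfold osc
  simp only [e]
  have : ∀ w, c w * (Complex.I * pd w₀ (fhat B μ G) w)
      = Complex.I * (c w * fderiv ℝ (fhat B μ G) w w₀) := fun w => by simp only [pd]; ring
  simp only [this]
  rw [integral_const_mul, key]
  simp only [pd]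
  ring

theorem fhat_pd {K : Set Z} (hK : IsCompact K) {G : Z → ℂ} (hG : TestOn K G) (v : Z) (w : D) :
    fhat B μ (pd v G) w = Complex.I * (B v w : ℝ) * fhat B μ G w := by
  have h := integral_pd_mul μ hG.smooth (smooth_char B w) (hG.hasCompactSupport hK) v
  rw [pd_cexp (contDiff_pairing B w).neg] at h
  have e : ∀ z, pd v (fun z => -(B z w)) z = -(B v w) := by
    intro z
    have := ((B.flip w).hasFDerivAt (x := z)).neg.fderiv
    simp only [pd]
    erw [this]
    rfl
  simp only [e] at h
  unfold fhat
  rw [← integral_const_mul, ← neg_eq_iff_eq_neg.2 h, ← integral_neg]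
  congr 1
  ext z
  push_cast
  ring

/-- Multiplication of the symbol by a linear form corresponds to a derivative. -/
theorem osc_mul_linear {K : Set Z} (hK : IsCompact K) {G : Z → ℂ} (hG : TestOn K G) (c : D → ℂ)
    (v : Z) :
    osc B μ ν G (fun w => (B v w : ℝ) * c w) = -Complex.I * osc B μ ν (pd v G) c := by
  unfold osc
  rw [← integral_const_mul]
  congr 1
  ext w
  rw [fhat_pd B μ hK hG]
  linear_combination ((B v w : ℂ) * c w * fhat B μ G w) * Complex.I_mul_I

theorem one_add_norm_prod_le {q p : P} {r : ℝ} (hr : 0 ≤ r) (hq : q ∈ Metric.closedBall p r) (w : D) :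
    1 + ‖(q, w)‖ ≤ (1 + ‖p‖ + r) * (1 + ‖w‖) := by
  have h1 : ‖q‖ ≤ ‖p‖ + r := by
    have : ‖q - p‖ ≤ r := by simpa [dist_eq_norm] using hq
    calc ‖q‖ = ‖p + (q - p)‖ := by congr 1; abel
      _ ≤ _ := (norm_add_le _ _).trans (by linarith)
  have h2 : ‖(q, w)‖ ≤ ‖q‖ + ‖w‖ := by
    rw [Prod.norm_def]
    exact max_le (by linarith [norm_nonneg w]) (by linarith [norm_nonneg q])
  nlinarith [norm_nonneg p, norm_nonneg w, mul_nonneg (norm_nonneg p) (norm_nonneg w),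
    mul_nonneg hr (norm_nonneg w)]

/-- Differentiation of the pairing with respect to parameters. -/
theorem hasFDerivAt_osc (hB : Function.Injective B.flip) {K : Set Z} (hK : IsCompact K)
    {c : P × D → ℂ} (hc : c.HasTemperateGrowth) {H : P × Z → ℂ} (hH : TestFamilyOn K H) (p : P) :
    DifferentiableAt ℝ (fun p => osc B μ ν (fun z => H (p, z)) (fun w => c (p, w))) p ∧
    ∀ v, pd v (fun p => osc B μ ν (fun z => H (p, z)) (fun w => c (p, w))) p
      = osc B μ ν (fun z => H (p, z)) (fun w => pd (v, 0) c (p, w))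
        + osc B μ ν (fun z => pd (v, 0) H (p, z)) (fun w => c (p, w)) := by
  let Fh : P × D → ℂ := fun q => fhat B μ (fun z => H (q.1, z)) q.2
  have hFh : ContDiff ℝ ∞ Fh := smooth_fhat B μ hK hH
  let F : P × D → ℂ := fun q => c q * Fh q
  have hF : ContDiff ℝ ∞ F := hc.1.mul hFh
  obtain ⟨M, hM⟩ := exists_integrable_weight ν
  obtain ⟨k, C, hC, hc1, hc2⟩ := temperate_bound hc
  obtain ⟨C₁, hC₁, hd1⟩ := fhat_family_decay B μ hB hK hH p 1 (M + k)
  obtain ⟨C₂, hC₂, hd2⟩ := fderiv_fhat_decay B μ hB hK hH p 1 (M + k)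
  set A : ℝ := (1 + ‖p‖ + 1) ^ k
  have hb : ∀ q ∈ Metric.closedBall p 1, ∀ w : D,
      ‖fderiv ℝ F (q, w)‖ ≤ (C * A * (C₁ + C₂)) * ((1 + ‖w‖) ^ M)⁻¹ := by
    intro q hq w
    refine le_mul_inv_of_mul_le (by positivity) ?_
    have hw : (1 + ‖(q, w)‖) ^ k ≤ A * (1 + ‖w‖) ^ k := by
      rw [← mul_pow]
      gcongr
      exact one_add_norm_prod_le zero_le_one hq w
    have h1 : ‖fderiv ℝ F (q, w)‖ ≤ ‖c (q, w)‖ * ‖fderiv ℝ Fh (q, w)‖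
        + ‖Fh (q, w)‖ * ‖fderiv ℝ c (q, w)‖ := by
      simp only [F]
      rw [fderiv_fun_mul (differentiable_of_smooth hc.1 _) (differentiable_of_smooth hFh _)]
      refine (norm_add_le _ _).trans ?_
      rw [norm_smul, norm_smul]
    calc ‖fderiv ℝ F (q, w)‖ * (1 + ‖w‖) ^ M
        ≤ (C * (A * (1 + ‖w‖) ^ k) * ‖fderiv ℝ Fh (q, w)‖
          + ‖Fh (q, w)‖ * (C * (A * (1 + ‖w‖) ^ k))) * (1 + ‖w‖) ^ M := by
          gcongr
          refine h1.trans ?_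
          gcongr
          · exact (hc1 _).trans (by gcongr)
          · exact (hc2 _).trans (by gcongr)
      _ = C * A * (‖Fh (q, w)‖ * (1 + ‖w‖) ^ (M + k)
          + ‖fderiv ℝ Fh (q, w)‖ * (1 + ‖w‖) ^ (M + k)) := by ring
      _ ≤ C * A * (C₁ + C₂) := by
          have := hd1 q hq w
          have := hd2 q hq w
          gcongr
  obtain ⟨h1, h2⟩ := hasFDerivAt_integral_of_smooth ν hF p one_pos
    (osc_integrable B μ ν hB hK (hH.testOn p) (temperate_section hc p)) (hM.const_mul _)
    (Filter.Eventually.of_forall fun w q hq => hb q (Metric.ball_subset_closedBall hq) w)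
  refine ⟨h1.differentiableAt, fun v => ?_⟩
  have h3 : pd v (fun p => osc B μ ν (fun z => H (p, z)) (fun w => c (p, w))) p
      = ∫ w, pd (v, 0) F (p, w) ∂ν := by
    rw [← h2 v, ← h1.fderiv]
    rfl
  rw [h3]
  have h4 : ∀ w, pd (v, 0) F (p, w) = pd (v, 0) c (p, w) * fhat B μ (fun z => H (p, z)) w
      + c (p, w) * fhat B μ (fun z => pd (v, 0) H (p, z)) w := by
    intro w
    simp only [F]
    rw [pd_mul hc.1 hFh]
    simp only [Fh]
    rw [pd_fhat B μ hK hH v 0]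
    have e : dualDeriv B H v (0 : D) = pd (v, 0) H := by
      ext q
      simp [dualDeriv]
    rw [e]
  simp only [h4]
  rw [integral_add]
  · rfl
  · exact osc_integrable B μ ν hB hK (hH.testOn p)
      (temperate_section (temperate_pd hc (v, 0)) p)
  · exact osc_integrable B μ ν hB hK ((hH.pd hK (v, 0)).testOn p) (temperate_section hc p)

/-- A parameter derivative splits into two pairings of the same type, one with the symbol and one
with the test family differentiated; hence the induction generalizes over both. -/
theorem smooth_osc (hB : Function.Injective B.flip) {K : Set Z} (hK : IsCompact K)
    {c : P × D → ℂ} (hc : c.HasTemperateGrowth) {H : P × Z → ℂ} (hH : TestFamilyOn K H) :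
    ContDiff ℝ ∞ (fun p => osc B μ ν (fun z => H (p, z)) (fun w => c (p, w))) := by
  rw [contDiff_infty]
  intro n
  induction n generalizing c H with
  | zero =>
    exact contDiff_zero.2 (continuous_iff_continuousAt.2 fun p =>
      (hasFDerivAt_osc B μ ν hB hK hc hH p).1.continuousAt)
  | succ n ih =>
    push_cast
    rw [contDiff_succ_iff_fderiv_apply]
    refine ⟨fun p => (hasFDerivAt_osc B μ ν hB hK hc hH p).1, by simp, fun v => ?_⟩
    change ContDiff ℝ n (pd v fun p => osc B μ ν (fun z => H (p, z)) (fun w => c (p, w)))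
    have : pd v (fun p => osc B μ ν (fun z => H (p, z)) (fun w => c (p, w)))
        = fun p => osc B μ ν (fun z => H (p, z)) (fun w => pd (v, 0) c (p, w))
        + osc B μ ν (fun z => pd (v, 0) H (p, z)) (fun w => c (p, w)) := by
      ext p
      exact (hasFDerivAt_osc B μ ν hB hK hc hH p).2 v
    rw [this]
    exact (ih (temperate_pd hc (v, 0)) hH).add (ih hc (hH.pd hK (v, 0)))

end Pairing

end StarProduct

namespace StarProduct

open MeasureTheory

set_option linter.unusedSectionVars false

/-! ### The pairing for a product of two spaces, and Taylor expansions of the symbols -/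

section ProductPairing

variable (X Y : Type*) [NormedAddCommGroup X] [NormedSpace ℝ X] [FiniteDimensional ℝ X]
  [NormedAddCommGroup Y] [NormedSpace ℝ Y] [FiniteDimensional ℝ Y]

/-- The pairing of `X × Y` with the product of the dual spaces. -/
def pairing : (X × Y) →L[ℝ] (StrongDual ℝ X × StrongDual ℝ Y) →L[ℝ] ℝ :=
  (((ContinuousLinearMap.compL ℝ (StrongDual ℝ X × StrongDual ℝ Y) (StrongDual ℝ X) ℝ).flip
      (ContinuousLinearMap.fst ℝ _ _)).comp (ContinuousLinearMap.apply ℝ ℝ)).coprod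
  (((ContinuousLinearMap.compL ℝ (StrongDual ℝ X × StrongDual ℝ Y) (StrongDual ℝ Y) ℝ).flip
      (ContinuousLinearMap.snd ℝ _ _)).comp (ContinuousLinearMap.apply ℝ ℝ))

variable {X Y}

@[simp] theorem pairing_apply (z : X × Y) (w : StrongDual ℝ X × StrongDual ℝ Y) :
    pairing X Y z w = w.1 z.1 + w.2 z.2 := by
  simp [pairing]

theorem pairing_injective : Function.Injective (pairing X Y).flip := by
  rw [injective_iff_map_eq_zero]
  intro w hw
  have h : ∀ z : X × Y, w.1 z.1 + w.2 z.2 = 0 := fun z => by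
    have := congrArg (fun T => T z) hw
    simpa using this
  refine Prod.ext ?_ ?_
  · ext x
    simpa using h (x, 0)
  · ext y
    simpa using h (0, y)

theorem dualFinBasis_apply (i j : Fin (Module.finrank ℝ X)) :
    dualFinBasis X i (Module.finBasis ℝ X j) = if j = i then 1 else 0 := by
  simp [dualFinBasis, Finsupp.single_apply]

theorem dual_expand (w : StrongDual ℝ X) :
    w = ∑ i, w (Module.finBasis ℝ X i) • dualFinBasis X i := by
  have : (w : X →ₗ[ℝ] ℝ) = (∑ i, w (Module.finBasis ℝ X i) • dualFinBasis X i : StrongDual ℝ X) := by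
    refine (Module.finBasis ℝ X).ext fun j => ?_
    simp [dualFinBasis_apply]
  ext x
  exact LinearMap.congr_fun this x

theorem expand_dualFinBasis (x : X) :
    x = ∑ i, dualFinBasis X i x • Module.finBasis ℝ X i := by
  conv_lhs => rw [← (Module.finBasis ℝ X).sum_repr x]
  simp [dualFinBasis]

section Generic

variable {D₁ D₂ : Type*} [NormedAddCommGroup D₁] [NormedSpace ℝ D₁] [NormedAddCommGroup D₂]
  [NormedSpace ℝ D₂]

/-- The function `a(ζ₁ + sξ) b(ζ₂ + tη)` of `(ξ, η)`. -/
def cpair (a : D₁ → ℂ) (b : D₂ → ℂ) (s t : ℝ) (ζ w : D₁ × D₂) : ℂ :=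
  a (ζ.1 + s • w.1) * b (ζ.2 + t • w.2)

theorem temperate_of_affine {E F Q : Type*} [NormedAddCommGroup E] [NormedSpace ℝ E]
    [NormedAddCommGroup F] [NormedSpace ℝ F] [NormedAddCommGroup Q] [NormedSpace ℝ Q]
    {a : E → F} (ha : a.HasTemperateGrowth) (ζ : E) (A : Q →L[ℝ] E) :
    Function.HasTemperateGrowth fun q => a (ζ + A q) :=
  ha.comp ((Function.HasTemperateGrowth.const ζ).fun_add A.hasTemperateGrowth)

theorem temperate_comp_fst_smul {E F D : Type*} [NormedAddCommGroup E] [NormedSpace ℝ E]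
    [NormedAddCommGroup F] [NormedSpace ℝ F] [NormedAddCommGroup D] [NormedSpace ℝ D]
    {a : E → F} (ha : a.HasTemperateGrowth) (ζ : E) (A : D →L[ℝ] E) :
    Function.HasTemperateGrowth fun q : ℝ × D => a (ζ + q.1 • A q.2) := by
  have h1 : Function.HasTemperateGrowth fun q : ℝ × D => q.1 :=
    (ContinuousLinearMap.fst ℝ ℝ D).hasTemperateGrowth
  have h2 : Function.HasTemperateGrowth fun q : ℝ × D => A q.2 :=
    (A.comp (ContinuousLinearMap.snd ℝ ℝ D)).hasTemperateGrowth
  exact ha.comp ((Function.HasTemperateGrowth.const ζ).fun_add (h1.fun_smul h2))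

variable {a : D₁ → ℂ} {b : D₂ → ℂ}

theorem temperate_cpair_fst (ha : a.HasTemperateGrowth) (s : ℝ) (ζ : D₁) :
    Function.HasTemperateGrowth fun w : D₁ × D₂ => a (ζ + s • w.1) :=
  temperate_of_affine ha ζ (s • ContinuousLinearMap.fst ℝ D₁ D₂)

theorem temperate_cpair_snd (hb : b.HasTemperateGrowth) (t : ℝ) (ζ : D₂) :
    Function.HasTemperateGrowth fun w : D₁ × D₂ => b (ζ + t • w.2) :=
  temperate_of_affine hb ζ (t • ContinuousLinearMap.snd ℝ D₁ D₂)

theorem cpair_temperate (ha : a.HasTemperateGrowth) (hb : b.HasTemperateGrowth) (s t : ℝ)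
    (ζ : D₁ × D₂) : (cpair a b s t ζ).HasTemperateGrowth :=
  (temperate_cpair_fst ha s ζ.1).fun_mul (temperate_cpair_snd hb t ζ.2)

theorem cpair_temperate_left (ha : a.HasTemperateGrowth) (hb : b.HasTemperateGrowth) (t : ℝ)
    (ζ : D₁ × D₂) :
    Function.HasTemperateGrowth fun q : ℝ × (D₁ × D₂) => cpair a b q.1 t ζ q.2 :=
  (temperate_comp_fst_smul ha ζ.1 (ContinuousLinearMap.fst ℝ D₁ D₂)).fun_mul
    (temperate_of_affine hb ζ.2 (t • (ContinuousLinearMap.snd ℝ D₁ D₂).comp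
      (ContinuousLinearMap.snd ℝ ℝ (D₁ × D₂))))

theorem cpair_temperate_right (ha : a.HasTemperateGrowth) (hb : b.HasTemperateGrowth) (s : ℝ)
    (ζ : D₁ × D₂) :
    Function.HasTemperateGrowth fun q : ℝ × (D₁ × D₂) => cpair a b s q.1 ζ q.2 :=
  (temperate_of_affine ha ζ.1 (s • (ContinuousLinearMap.fst ℝ D₁ D₂).comp
      (ContinuousLinearMap.snd ℝ ℝ (D₁ × D₂)))).fun_mul
    (temperate_comp_fst_smul hb ζ.2 (ContinuousLinearMap.snd ℝ D₁ D₂))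

theorem pd_cpair (ha : a.HasTemperateGrowth) (hb : b.HasTemperateGrowth) (s t : ℝ)
    (ζ v : D₁ × D₂) :
    pd v (cpair a b s t ζ) = fun w => (s : ℂ) * cpair (pd v.1 a) b s t ζ w
      + (t : ℂ) * cpair a (pd v.2 b) s t ζ w := by
  have h1 := pd_comp_affine ha.1 (s • ContinuousLinearMap.fst ℝ D₁ D₂) ζ.1 v
  have h2 := pd_comp_affine hb.1 (t • ContinuousLinearMap.snd ℝ D₁ D₂) ζ.2 v
  simp only [smul_apply, ContinuousLinearMap.coe_fst', ContinuousLinearMap.coe_snd',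
    add_comm _ ζ.1, add_comm _ ζ.2] at h1 h2
  have := pd_mul (temperate_cpair_fst (D₂ := D₂) ha s ζ.1).1
    (temperate_cpair_snd (D₁ := D₁) hb t ζ.2).1 v
  rw [h1, h2] at this
  refine Eq.trans this ?_
  ext w
  simp only [pd, map_smul, cpair, Complex.real_smul]
  ring

theorem pd_cpair_left (ha : a.HasTemperateGrowth) (hb : b.HasTemperateGrowth) (s t : ℝ)
    (ζ : D₁ × D₂) (v : D₁) :
    pd (v, 0) (cpair a b s t ζ) = fun w => (s : ℂ) * cpair (pd v a) b s t ζ w := by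
  rw [pd_cpair ha hb]
  ext w
  simp [cpair, pd]

theorem pd_cpair_right (ha : a.HasTemperateGrowth) (hb : b.HasTemperateGrowth) (s t : ℝ)
    (ζ : D₁ × D₂) (v : D₂) :
    pd (0, v) (cpair a b s t ζ) = fun w => (t : ℂ) * cpair a (pd v b) s t ζ w := by
  rw [pd_cpair ha hb]
  ext w
  simp [cpair, pd]

theorem pd_comp_snd {Q Z F : Type*} [NormedAddCommGroup Q] [NormedSpace ℝ Q]
    [NormedAddCommGroup Z] [NormedSpace ℝ Z] [NormedAddCommGroup F] [NormedSpace ℝ F] {G : Z → F}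
    (hG : ContDiff ℝ ∞ G) (u : Q) (q : Q × Z) : pd (u, 0) (fun q : Q × Z => G q.2) q = 0 := by
  have := congrFun (pd_comp_clm hG (ContinuousLinearMap.snd ℝ Q Z) (u, 0)) q
  refine Eq.trans this ?_
  simp [pd]

theorem pd_cpair_param_left (ha : a.HasTemperateGrowth) (hb : b.HasTemperateGrowth) (s t : ℝ)
    (ζ w : D₁ × D₂) :
    pd (1, 0) (fun q : ℝ × (D₁ × D₂) => cpair a b q.1 t ζ q.2) (s, w)
      = fderiv ℝ a (ζ.1 + s • w.1) w.1 * b (ζ.2 + t • w.2) := by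
  have hw : HasDerivAt (fun r : ℝ => ζ.1 + r • w.1) w.1 s := by
    simpa using ((hasDerivAt_id s).smul_const w.1).const_add ζ.1
  have hd : HasDerivAt (fun r : ℝ => cpair a b r t ζ w)
      (fderiv ℝ a (ζ.1 + s • w.1) w.1 * b (ζ.2 + t • w.2)) s :=
    ((differentiable_of_smooth ha.1 (ζ.1 + s • w.1)).hasFDerivAt.comp_hasDerivAt s hw).mul_const _
  have hc' := (differentiable_of_smooth (cpair_temperate_left ha hb t ζ).1
    (s, w)).hasFDerivAt.comp_hasDerivAt s ((hasDerivAt_id s).prodMk (hasDerivAt_const s w))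
  exact hc'.unique hd

theorem pd_cpair_param_right (ha : a.HasTemperateGrowth) (hb : b.HasTemperateGrowth) (s t : ℝ)
    (ζ w : D₁ × D₂) :
    pd (1, 0) (fun q : ℝ × (D₁ × D₂) => cpair a b s q.1 ζ q.2) (t, w)
      = a (ζ.1 + s • w.1) * fderiv ℝ b (ζ.2 + t • w.2) w.2 := by
  have hw : HasDerivAt (fun r : ℝ => ζ.2 + r • w.2) w.2 t := by
    simpa using ((hasDerivAt_id t).smul_const w.2).const_add ζ.2
  have hd : HasDerivAt (fun r : ℝ => cpair a b s r ζ w)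
      (a (ζ.1 + s • w.1) * fderiv ℝ b (ζ.2 + t • w.2) w.2) t :=
    ((differentiable_of_smooth hb.1 (ζ.2 + t • w.2)).hasFDerivAt.comp_hasDerivAt t hw).const_mul _
  have hc' := (differentiable_of_smooth (cpair_temperate_right ha hb s ζ).1
    (t, w)).hasFDerivAt.comp_hasDerivAt t ((hasDerivAt_id t).prodMk (hasDerivAt_const t w))
  exact hc'.unique hd

end Generic

variable {a : StrongDual ℝ X → ℂ} {b : StrongDual ℝ Y → ℂ}

theorem fderiv_dual_expand {f : StrongDual ℝ X → ℂ} (ξ w : StrongDual ℝ X) :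
    fderiv ℝ f ξ w = ∑ i, (w (Module.finBasis ℝ X i) : ℂ) * pd (dualFinBasis X i) f ξ := by
  conv_lhs => rw [dual_expand w, map_sum]
  simp [pd]

variable [MeasurableSpace X] [BorelSpace X] [MeasurableSpace Y] [BorelSpace Y]
  (μ : Measure (X × Y)) [μ.IsAddHaarMeasure]
  (ν : Measure (StrongDual ℝ X × StrongDual ℝ Y)) [ν.IsAddHaarMeasure]

/-- The derivative in `s` of the pairing with `a(ζ₁ + sξ) b(ζ₂ + tη)`. -/
theorem hasDerivAt_osc_left {K : Set (X × Y)} (hK : IsCompact K) {G : X × Y → ℂ}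
    (hG : TestOn K G) (ha : a.HasTemperateGrowth) (hb : b.HasTemperateGrowth) (s t : ℝ)
    (ζ : StrongDual ℝ X × StrongDual ℝ Y) :
    HasDerivAt (fun s => osc (pairing X Y) μ ν G (cpair a b s t ζ))
      (-Complex.I * ∑ i, osc (pairing X Y) μ ν (pd (Module.finBasis ℝ X i, 0) G)
        (cpair (pd (dualFinBasis X i) a) b s t ζ)) s := by
  obtain ⟨h1, h2⟩ := hasFDerivAt_osc (pairing X Y) μ ν pairing_injective hK
    (cpair_temperate_left ha hb t ζ) (testOn_toFamily (P := ℝ) hG) s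
  have h3 := h1.hasFDerivAt.hasDerivAt
  have h4 := h2 1
  have e1 : ∀ z : X × Y, pd (1, 0) (fun q : ℝ × (X × Y) => G q.2) (s, z) = 0 := by
    intro z
    exact pd_comp_snd hG.smooth 1 _
  -- The derivative of a(ζ₁ + sξ) in s is the derivative of a along ξ, a sum of linear forms ξ(eᵢ)
  -- times partial derivatives. The Fourier transform turns each linear form into an x-derivative of
  -- `G`, so a derivative of a is paired with one of `G`.
  have e2 : ∀ w, pd (1, 0) (fun q : ℝ × (StrongDual ℝ X × StrongDual ℝ Y) => cpair a b q.1 t ζ q.2)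
      (s, w) = ∑ i, (pairing X Y (Module.finBasis ℝ X i, 0) w : ℝ) *
        cpair (pd (dualFinBasis X i) a) b s t ζ w := by
    intro w
    rw [pd_cpair_param_left ha hb, fderiv_dual_expand, Finset.sum_mul]
    refine Finset.sum_congr rfl fun i _ => ?_
    simp [cpair, mul_assoc]
  have e3 : osc (pairing X Y) μ ν (fun _ => 0) (cpair a b s t ζ) = 0 := by
    simp [osc, fhat]
  have e4 : ∀ i, Function.HasTemperateGrowth fun w : StrongDual ℝ X × StrongDual ℝ Y =>
      ((pairing X Y (Module.finBasis ℝ X i, 0) w : ℝ) : ℂ) *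
        cpair (pd (dualFinBasis X i) a) b s t ζ w := fun i =>
    (Complex.ofRealCLM.comp
      (pairing X Y (Module.finBasis ℝ X i, 0))).hasTemperateGrowth.fun_mul
      (cpair_temperate (temperate_pd ha _) hb s t ζ)
  simp only [e1, e2] at h4
  rw [e3, add_zero, osc_sum_right _ μ ν pairing_injective hK hG _ e4] at h4
  convert h3 using 1
  refine Eq.trans ?_ h4.symm
  rw [Finset.mul_sum]
  refine Finset.sum_congr rfl fun i _ => ?_
  exact (osc_mul_linear _ μ ν hK hG _ _).symm

/-- The derivative in `t` of the pairing with `a(ζ₁ + sξ) b(ζ₂ + tη)`. -/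
theorem hasDerivAt_osc_right {K : Set (X × Y)} (hK : IsCompact K) {G : X × Y → ℂ}
    (hG : TestOn K G) (ha : a.HasTemperateGrowth) (hb : b.HasTemperateGrowth) (s t : ℝ)
    (ζ : StrongDual ℝ X × StrongDual ℝ Y) :
    HasDerivAt (fun t => osc (pairing X Y) μ ν G (cpair a b s t ζ))
      (-Complex.I * ∑ i, osc (pairing X Y) μ ν (pd (0, Module.finBasis ℝ Y i) G)
        (cpair a (pd (dualFinBasis Y i) b) s t ζ)) t := by
  obtain ⟨h1, h2⟩ := hasFDerivAt_osc (pairing X Y) μ ν pairing_injective hK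
    (cpair_temperate_right ha hb s ζ) (testOn_toFamily (P := ℝ) hG) t
  have h3 := h1.hasFDerivAt.hasDerivAt
  have h4 := h2 1
  have e1 : ∀ z : X × Y, pd (1, 0) (fun q : ℝ × (X × Y) => G q.2) (t, z) = 0 := by
    intro z
    exact pd_comp_snd hG.smooth 1 _
  have e2 : ∀ w, pd (1, 0) (fun q : ℝ × (StrongDual ℝ X × StrongDual ℝ Y) => cpair a b s q.1 ζ q.2)
      (t, w) = ∑ i, (pairing X Y (0, Module.finBasis ℝ Y i) w : ℝ) *
        cpair a (pd (dualFinBasis Y i) b) s t ζ w := by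
    intro w
    rw [pd_cpair_param_right ha hb, fderiv_dual_expand, Finset.mul_sum]
    refine Finset.sum_congr rfl fun i _ => ?_
    simp [cpair, mul_left_comm]
  have e3 : osc (pairing X Y) μ ν (fun _ => 0) (cpair a b s t ζ) = 0 := by
    simp [osc, fhat]
  have e4 : ∀ i, Function.HasTemperateGrowth fun w : StrongDual ℝ X × StrongDual ℝ Y =>
      ((pairing X Y (0, Module.finBasis ℝ Y i) w : ℝ) : ℂ) *
        cpair a (pd (dualFinBasis Y i) b) s t ζ w := fun i =>
    (Complex.ofRealCLM.comp
      (pairing X Y (0, Module.finBasis ℝ Y i))).hasTemperateGrowth.fun_mul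
      (cpair_temperate ha (temperate_pd hb _) s t ζ)
  simp only [e1, e2] at h4
  rw [e3, add_zero, osc_sum_right _ μ ν pairing_injective hK hG _ e4] at h4
  convert h3 using 1
  refine Eq.trans ?_ h4.symm
  rw [Finset.mul_sum]
  refine Finset.sum_congr rfl fun i _ => ?_
  exact (osc_mul_linear _ μ ν hK hG _ _).symm

theorem sum_fin_cons {ι M : Type*} [Fintype ι] [AddCommMonoid M] (p : ℕ)
    (F : (Fin (p + 1) → ι) → M) :
    ∑ i : Fin (p + 1) → ι, F i = ∑ i : Fin p → ι, ∑ k, F (Fin.cons k i) := by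
  rw [Finset.sum_comm, ← Fintype.sum_prod_type']
  exact (Fintype.sum_equiv (Fin.consEquiv fun _ => ι) _ _ fun x => rfl).symm

/-- Taylor's formula for a function given along with its successive derivatives. -/
theorem taylor_remainder_bound (P : ℕ) {Φ : ℕ → ℝ → ℂ}
    {h C : ℝ} (hΦ : ∀ p < P, ∀ s ∈ Set.Icc 0 h, HasDerivAt (Φ p) (Φ (p + 1) s) s)
    (hC : ∀ s ∈ Set.Icc 0 h, ‖Φ P s‖ ≤ C) :
    ∀ s ∈ Set.Icc 0 h, ‖Φ 0 s - ∑ p ∈ Finset.range P, (s : ℂ) ^ p / (p.factorial : ℂ) * Φ p 0‖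
      ≤ C * s ^ P := by
  -- The derivative of the remainder of order P + 1 is the remainder of order P of the shifted
  -- family, and the mean value inequality gains a factor s. The factorial of the sharp bound is
  -- given away.
  induction P generalizing Φ with
  | zero => intro s hs; simpa using hC s hs
  | succ P ih =>
    intro s hs
    have ih' := ih (Φ := fun p => Φ (p + 1)) (fun p hp => hΦ (p + 1) (by omega)) hC
    let R : ℝ → ℂ := fun s => Φ 0 s - ∑ p ∈ Finset.range (P + 1), (s : ℂ) ^ p / (p.factorial : ℂ) * Φ p 0
    have hR : ∀ r ∈ Set.Icc 0 s, HasDerivAt R (Φ 1 r -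
        ∑ p ∈ Finset.range P, (r : ℂ) ^ p / (p.factorial : ℂ) * Φ (p + 1) 0) r := by
      intro r hr
      refine (hΦ 0 (by omega) r ⟨hr.1, hr.2.trans hs.2⟩).sub ?_
      have h1 : ∀ p ∈ Finset.range (P + 1), HasDerivAt
          (fun s : ℝ => (s : ℂ) ^ p / (p.factorial : ℂ) * Φ p 0)
          ((p : ℂ) * (r : ℂ) ^ (p - 1) / (p.factorial : ℂ) * Φ p 0) r := by
        intro p _
        have := (((hasDerivAt_id r).ofReal_comp.pow p).div_const (p.factorial : ℂ)).mul_const (Φ p 0)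
        simpa using this
      have h2 := HasDerivAt.fun_sum h1
      convert h2 using 1
      rw [Finset.sum_range_succ']
      simp only [Nat.cast_zero, zero_mul, zero_div, add_zero]
      refine Finset.sum_congr rfl fun p _ => ?_
      rw [Nat.factorial_succ]
      push_cast
      have : ((p.factorial : ℕ) : ℂ) ≠ 0 := by exact_mod_cast p.factorial_ne_zero
      have h3 : (p : ℂ) + 1 ≠ 0 := by exact_mod_cast p.succ_ne_zero
      field_simp
    have hR0 : R 0 = 0 := by
      simp [R, Finset.sum_range_succ']
    have h3 := (convex_Icc (0 : ℝ) s).norm_image_sub_le_of_norm_hasDerivWithin_le (f := R)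
      (C := C * s ^ P) (fun r hr => (hR r hr).hasDerivWithinAt) (fun r hr => by
        refine (ih' r ⟨hr.1, hr.2.trans hs.2⟩).trans ?_
        have hC0 : 0 ≤ C := (norm_nonneg _).trans (hC s hs)
        have := hr.1
        have := hr.2
        gcongr)
      (Set.left_mem_Icc.2 hs.1) (Set.right_mem_Icc.2 hs.1)
    rw [hR0, sub_zero, sub_zero, Real.norm_of_nonneg hs.1] at h3
    refine h3.trans (le_of_eq ?_)
    ring

/-- The directions in `X × Y` corresponding to a multi-index. -/
def dirX {p : ℕ} (i : Fin p → Fin (Module.finrank ℝ X)) : List (X × Y) :=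
  List.ofFn fun k => ((Module.finBasis ℝ X (i k), 0) : X × Y)

/-- The directions in `X × Y` corresponding to a multi-index. -/
def dirY {q : ℕ} (j : Fin q → Fin (Module.finrank ℝ Y)) : List (X × Y) :=
  List.ofFn fun k => ((0, Module.finBasis ℝ Y (j k)) : X × Y)

/-- The directions in the dual space corresponding to a multi-index. -/
def dirD {p : ℕ} (i : Fin p → Fin (Module.finrank ℝ X)) : List (StrongDual ℝ X) :=
  List.ofFn fun k => dualFinBasis X (i k)

theorem dirX_cons {p : ℕ} (k : Fin (Module.finrank ℝ X)) (i : Fin p → Fin (Module.finrank ℝ X)) :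
    dirX (X := X) (Y := Y) (Fin.cons k i : Fin (p + 1) → _)
      = (Module.finBasis ℝ X k, 0) :: dirX i := by
  simp [dirX, List.ofFn_succ]

theorem dirY_cons {p : ℕ} (k : Fin (Module.finrank ℝ Y)) (i : Fin p → Fin (Module.finrank ℝ Y)) :
    dirY (X := X) (Y := Y) (Fin.cons k i : Fin (p + 1) → _)
      = (0, Module.finBasis ℝ Y k) :: dirY i := by
  simp [dirY, List.ofFn_succ]

theorem dirD_cons {p : ℕ} (k : Fin (Module.finrank ℝ X)) (i : Fin p → Fin (Module.finrank ℝ X)) :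
    dirD (X := X) (Fin.cons k i : Fin (p + 1) → _) = dualFinBasis X k :: dirD i := by
  simp [dirD, List.ofFn_succ]

theorem temperate_pds {E F : Type*} [NormedAddCommGroup E] [NormedSpace ℝ E]
    [NormedAddCommGroup F] [NormedSpace ℝ F] {c : E → F} (hc : c.HasTemperateGrowth) (l : List E) :
    (pds l c).HasTemperateGrowth := by
  induction l with
  | nil => exact hc
  | cons v l ih => exact temperate_pd ih v

theorem hasDerivAt_osc_iter_left {K : Set (X × Y)} (hK : IsCompact K) {G : X × Y → ℂ}
    (hG : TestOn K G) (ha : a.HasTemperateGrowth) (hb : b.HasTemperateGrowth) (p : ℕ) (s t : ℝ)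
    (ζ : StrongDual ℝ X × StrongDual ℝ Y) :
    HasDerivAt (fun s => (-Complex.I) ^ p * ∑ i : Fin p → Fin (Module.finrank ℝ X),
        osc (pairing X Y) μ ν (pds (dirX i) G) (cpair (pds (dirD i) a) b s t ζ))
      ((-Complex.I) ^ (p + 1) * ∑ i : Fin (p + 1) → Fin (Module.finrank ℝ X),
        osc (pairing X Y) μ ν (pds (dirX i) G) (cpair (pds (dirD i) a) b s t ζ)) s := by
  rw [sum_fin_cons, pow_succ, mul_assoc, Finset.mul_sum]
  refine HasDerivAt.const_mul _ (HasDerivAt.fun_sum fun i _ => ?_)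
  simp only [dirX_cons, dirD_cons, pds_cons]
  exact hasDerivAt_osc_left μ ν hK (hG.pds hK _) (temperate_pds ha _) hb s t ζ

theorem hasDerivAt_osc_iter_right {K : Set (X × Y)} (hK : IsCompact K) {G : X × Y → ℂ}
    (hG : TestOn K G) (ha : a.HasTemperateGrowth) (hb : b.HasTemperateGrowth) (q : ℕ) (s t : ℝ)
    (ζ : StrongDual ℝ X × StrongDual ℝ Y) :
    HasDerivAt (fun t => (-Complex.I) ^ q * ∑ j : Fin q → Fin (Module.finrank ℝ Y),
        osc (pairing X Y) μ ν (pds (dirY j) G) (cpair a (pds (dirD j) b) s t ζ))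
      ((-Complex.I) ^ (q + 1) * ∑ j : Fin (q + 1) → Fin (Module.finrank ℝ Y),
        osc (pairing X Y) μ ν (pds (dirY j) G) (cpair a (pds (dirD j) b) s t ζ)) t := by
  rw [sum_fin_cons, pow_succ, mul_assoc, Finset.mul_sum]
  refine HasDerivAt.const_mul _ (HasDerivAt.fun_sum fun i _ => ?_)
  simp only [dirY_cons, dirD_cons, pds_cons]
  exact hasDerivAt_osc_right μ ν hK (hG.pds hK _) ha (temperate_pds hb _) s t ζ

/-- The terms of order at most `P` in each variable of the expansion of the pairing. -/
def expansion (G : X × Y → ℂ) (P : ℕ) (h : ℝ) (a : StrongDual ℝ X → ℂ) (b : StrongDual ℝ Y → ℂ)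
    (ζ : StrongDual ℝ X × StrongDual ℝ Y) : ℂ :=
  ∑ p ∈ Finset.range P, ∑ q ∈ Finset.range P,
    (-Complex.I) ^ (p + q) * (h : ℂ) ^ (p + q) / ((p.factorial : ℂ) * (q.factorial : ℂ)) *
      ∑ i : Fin p → Fin (Module.finrank ℝ X), ∑ j : Fin q → Fin (Module.finrank ℝ Y),
        pds (dirY j) (pds (dirX i) G) 0 * pds (dirD i) a ζ.1 * pds (dirD j) b ζ.2

/-- The remainder of the expansion is controlled by derivatives of order `P` in one of the
variables. -/
theorem osc_sub_expansion_bound {K : Set (X × Y)} (hK : IsCompact K)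
    (hinv : ∀ G : X × Y → ℂ, TestOn K G → ∫ w, fhat (pairing X Y) μ G w ∂ν = G 0)
    {G : X × Y → ℂ} (hG : TestOn K G) (ha : a.HasTemperateGrowth) (hb : b.HasTemperateGrowth)
    (P : ℕ) {h : ℝ} (hh : 0 < h) (ζ : StrongDual ℝ X × StrongDual ℝ Y) {C : ℝ}
    (hC : ∀ p q : ℕ, max p q = P → ∀ (i : Fin p → Fin (Module.finrank ℝ X))
      (j : Fin q → Fin (Module.finrank ℝ Y)), ∀ s ∈ Set.Icc 0 h, ∀ t ∈ Set.Icc 0 h,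
      h ^ (p + q) * ‖osc (pairing X Y) μ ν (pds (dirY j) (pds (dirX i) G))
        (cpair (pds (dirD i) a) (pds (dirD j) b) s t ζ)‖ ≤ C) :
    ‖osc (pairing X Y) μ ν G (cpair a b h h ζ) - expansion G P h a b ζ‖ ≤
      (Fintype.card (Fin P → Fin (Module.finrank ℝ X)) * C) +
        ∑ p ∈ Finset.range P, ∑ _i : Fin p → Fin (Module.finrank ℝ X),
          (Fintype.card (Fin P → Fin (Module.finrank ℝ Y)) * C) := by
  have hh' : h ∈ Set.Icc 0 h := ⟨hh.le, le_rfl⟩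
  have h0' : (0 : ℝ) ∈ Set.Icc 0 h := ⟨le_rfl, hh.le⟩
  have hnI : ∀ p : ℕ, ‖(-Complex.I) ^ p‖ = 1 := fun p => by simp
  -- The expansion is first in s with t = h fixed, and then in t for each coefficient, at s = 0. The
  -- two kinds of remainder have orders (P, 0) and (p, P) with p < P, which is why the hypothesis
  -- concerns max p q = P.
  let Φ : ℕ → ℝ → ℂ := fun p s => (-Complex.I) ^ p * ∑ i : Fin p → Fin (Module.finrank ℝ X),
    osc (pairing X Y) μ ν (pds (dirX i) G) (cpair (pds (dirD i) a) b s h ζ)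
  let Ψ : ∀ p : ℕ, (Fin p → Fin (Module.finrank ℝ X)) → ℕ → ℝ → ℂ := fun p i q t =>
    (-Complex.I) ^ q * ∑ j : Fin q → Fin (Module.finrank ℝ Y),
      osc (pairing X Y) μ ν (pds (dirY j) (pds (dirX i) G))
        (cpair (pds (dirD i) a) (pds (dirD j) b) 0 t ζ)
  have hΦ := taylor_remainder_bound P (Φ := Φ) (h := h)
    (C := Fintype.card (Fin P → Fin (Module.finrank ℝ X)) * C / h ^ P)
    (fun p _ s _ => hasDerivAt_osc_iter_left μ ν hK hG ha hb p s h ζ) (fun s hs => by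
      simp only [Φ]
      rw [norm_mul, hnI, one_mul, le_div_iff₀ (by positivity)]
      calc _ ≤ (∑ i : Fin P → Fin (Module.finrank ℝ X), C / h ^ P) * h ^ P := by
            gcongr
            refine norm_sum_le_of_le _ fun i _ => ?_
            rw [le_div_iff₀ (by positivity), mul_comm]
            simpa [dirY, dirD] using hC P 0 (by simp) i Fin.elim0 s hs h hh'
        _ = _ := by
            rw [Finset.sum_const, nsmul_eq_mul, Finset.card_univ]
            field_simp) h hh'
  have hΨ : ∀ p < P, ∀ i : Fin p → Fin (Module.finrank ℝ X),
      h ^ p * ‖Ψ p i 0 h - ∑ q ∈ Finset.range P, (h : ℂ) ^ q / (q.factorial : ℂ) * Ψ p i q 0‖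
        ≤ Fintype.card (Fin P → Fin (Module.finrank ℝ Y)) * C := by
    intro p hp i
    have := taylor_remainder_bound P (Φ := Ψ p i) (h := h)
      (C := Fintype.card (Fin P → Fin (Module.finrank ℝ Y)) * C / h ^ (p + P))
      (fun q _ t _ => hasDerivAt_osc_iter_right μ ν hK (hG.pds hK _) (temperate_pds ha _) hb q 0 t ζ)
      (fun t ht => by
        simp only [Ψ]
        rw [norm_mul, hnI, one_mul, le_div_iff₀ (by positivity)]
        calc _ ≤ (∑ j : Fin P → Fin (Module.finrank ℝ Y), C / h ^ (p + P)) * h ^ (p + P) := by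
              gcongr
              refine norm_sum_le_of_le _ fun j _ => ?_
              rw [le_div_iff₀ (by positivity), mul_comm]
              exact hC p P (max_eq_right hp.le) i j 0 h0' t ht
          _ = _ := by
              rw [Finset.sum_const, nsmul_eq_mul, Finset.card_univ]
              field_simp) h hh'
    calc _ ≤ h ^ p * (Fintype.card (Fin P → Fin (Module.finrank ℝ Y)) * C / h ^ (p + P) * h ^ P) := by
          gcongr
      _ = _ := by
          rw [pow_add]
          field_simp
  have hΦ0 : Φ 0 h = osc (pairing X Y) μ ν G (cpair a b h h ζ) := by
    simp [Φ, dirX, dirD]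
  have hΦp : ∀ p, Φ p 0 = (-Complex.I) ^ p * ∑ i, Ψ p i 0 h := by
    intro p
    simp [Φ, Ψ, dirY, dirD]
  -- At s = t = 0 the symbol does not depend on the frequency, so Fourier inversion evaluates the
  -- pairing as a value at the origin.
  have hΨq : ∀ p i q, Ψ p i q 0 = (-Complex.I) ^ q * ∑ j : Fin q → Fin (Module.finrank ℝ Y),
      pds (dirY j) (pds (dirX i) G) 0 * pds (dirD i) a ζ.1 * pds (dirD j) b ζ.2 := by
    intro p i q
    simp only [Ψ]
    congr 1
    refine Finset.sum_congr rfl fun j _ => ?_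
    simp only [osc, cpair, zero_smul, add_zero]
    rw [integral_const_mul, hinv _ ((hG.pds hK _).pds hK _)]
    ring
  have hexp : expansion G P h a b ζ = ∑ p ∈ Finset.range P, (h : ℂ) ^ p / (p.factorial : ℂ) *
      ((-Complex.I) ^ p * ∑ i, ∑ q ∈ Finset.range P, (h : ℂ) ^ q / (q.factorial : ℂ) * Ψ p i q 0) := by
    unfold expansion
    refine Finset.sum_congr rfl fun p _ => ?_
    rw [Finset.sum_comm, Finset.mul_sum, Finset.mul_sum]
    refine Finset.sum_congr rfl fun q _ => ?_
    simp only [hΨq]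
    rw [← Finset.mul_sum, ← Finset.mul_sum, pow_add, pow_add]
    have h1 : ((p.factorial : ℕ) : ℂ) ≠ 0 := by exact_mod_cast p.factorial_ne_zero
    have h2 : ((q.factorial : ℕ) : ℂ) ≠ 0 := by exact_mod_cast q.factorial_ne_zero
    field_simp
  rw [← hΦ0, hexp]
  have split : Φ 0 h - ∑ p ∈ Finset.range P, (h : ℂ) ^ p / (p.factorial : ℂ) *
      ((-Complex.I) ^ p * ∑ i, ∑ q ∈ Finset.range P, (h : ℂ) ^ q / (q.factorial : ℂ) * Ψ p i q 0)
      = (Φ 0 h - ∑ p ∈ Finset.range P, (h : ℂ) ^ p / (p.factorial : ℂ) * Φ p 0)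
      + ∑ p ∈ Finset.range P, (h : ℂ) ^ p / (p.factorial : ℂ) * ((-Complex.I) ^ p *
        ∑ i, (Ψ p i 0 h - ∑ q ∈ Finset.range P, (h : ℂ) ^ q / (q.factorial : ℂ) * Ψ p i q 0)) := by
    simp only [hΦp, Finset.sum_sub_distrib, mul_sub]
    ring
  rw [split]
  refine (norm_add_le _ _).trans (add_le_add (hΦ.trans (le_of_eq ?_)) ?_)
  · field_simp
  · refine norm_sum_le_of_le _ fun p hp => ?_
    rw [norm_mul, norm_mul, hnI, one_mul, norm_div, norm_pow, Complex.norm_real,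
      Real.norm_of_nonneg hh.le, Complex.norm_natCast]
    have hf : (1 : ℝ) ≤ p.factorial := by exact_mod_cast p.factorial_pos
    calc _ ≤ h ^ p * ‖∑ i, (Ψ p i 0 h
          - ∑ q ∈ Finset.range P, (h : ℂ) ^ q / (q.factorial : ℂ) * Ψ p i q 0)‖ := by
          gcongr
          exact div_le_self (by positivity) hf
      _ ≤ h ^ p * ∑ i, ‖Ψ p i 0 h
          - ∑ q ∈ Finset.range P, (h : ℂ) ^ q / (q.factorial : ℂ) * Ψ p i q 0‖ := by
          gcongr
          exact norm_sum_le _ _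
      _ ≤ _ := by
          rw [Finset.mul_sum]
          exact Finset.sum_le_sum fun i _ => hΨ p (Finset.mem_range.1 hp) i

end ProductPairing

end StarProduct

namespace StarProduct

open MeasureTheory

set_option linter.unusedSectionVars false

/-! ### Amplitudes and their derivatives -/

section Amplitudes

variable {X Y V : Type*} [NormedAddCommGroup X] [NormedSpace ℝ X] [FiniteDimensional ℝ X]
  [NormedAddCommGroup Y] [NormedSpace ℝ Y] [FiniteDimensional ℝ Y]
  [NormedAddCommGroup V] [NormedSpace ℝ V] [FiniteDimensional ℝ V]

/-- Hadamard's lemma: integrate the derivative of t ↦ F(x, ty) over [0, 1]; the factors gⱼ are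
smooth as integrals with parameters. -/
theorem hadamard_right {F : X × Y → V} (hF : ContDiff ℝ ∞ F) (h0 : ∀ x, F (x, 0) = 0) :
    ∃ g : Fin (Module.finrank ℝ Y) → X × Y → V, (∀ j, ContDiff ℝ ∞ (g j)) ∧
      ∀ z, F z = ∑ j, dualFinBasis Y j z.2 • g j z := by
  let e : (X × Y) × ℝ → X × Y := fun q => (q.1.1, q.2 • q.1.2)
  have he : ContDiff ℝ ∞ e := by fun_prop
  refine ⟨fun j z => ∫ t in Set.Icc (0 : ℝ) 1, pd ((0 : X), Module.finBasis ℝ Y j) F (e (z, t)),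
    fun j => contDiff_setIntegral volume isCompact_Icc ((ContDiff.pd hF _).comp he), fun z => ?_⟩
  have hc : ∀ j, Continuous fun t : ℝ => pd ((0 : X), Module.finBasis ℝ Y j) F (e (z, t)) :=
    fun j => ((ContDiff.pd hF _).comp he).continuous.comp (by fun_prop)
  have hd : ∀ t : ℝ, HasDerivAt (fun t : ℝ => F (e (z, t)))
      (∑ j, dualFinBasis Y j z.2 • pd ((0 : X), Module.finBasis ℝ Y j) F (e (z, t))) t := by
    intro t
    have h1 : HasDerivAt (fun t : ℝ => e (z, t)) ((0 : X), z.2) t := by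
      simpa using (hasDerivAt_const t z.1).prodMk ((hasDerivAt_id t).smul_const z.2)
    have h2 := (differentiable_of_smooth hF (e (z, t))).hasFDerivAt.comp_hasDerivAt t h1
    refine h2.congr_deriv ?_
    have h3 : ((0 : X), z.2) = ∑ j, dualFinBasis Y j z.2 • ((0 : X), Module.finBasis ℝ Y j) := by
      conv_lhs => rw [expand_dualFinBasis z.2]
      ext
      · simp [Prod.fst_sum]
      · simp [Prod.snd_sum]
    rw [h3, map_sum]
    exact Finset.sum_congr rfl fun j _ => by rw [map_smul]; rfl
  have h4 := intervalIntegral.integral_eq_sub_of_hasDerivAt (a := 0) (b := 1) (fun t _ => hd t)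
    (Continuous.intervalIntegrable (by fun_prop) _ _)
  have h5 : F z = F (e (z, 1)) - F (e (z, 0)) := by simp [e, h0]
  rw [h5, ← h4, intervalIntegral.integral_of_le zero_le_one, ← integral_Icc_eq_integral_Ioc,
    integral_finsetSum]
  · exact Finset.sum_congr rfl fun j _ => integral_smul _ _
  · intro j _
    exact ((hc j).const_smul _).integrableOn_Icc

theorem hadamard_left {F : X × Y → V} (hF : ContDiff ℝ ∞ F) (h0 : ∀ y, F (0, y) = 0) :
    ∃ g : Fin (Module.finrank ℝ X) → X × Y → V, (∀ j, ContDiff ℝ ∞ (g j)) ∧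
      ∀ z, F z = ∑ j, dualFinBasis X j z.1 • g j z := by
  have hs : ContDiff ℝ ∞ (Prod.swap : Y × X → X × Y) := contDiff_snd.prodMk contDiff_fst
  have hs' : ContDiff ℝ ∞ (Prod.swap : X × Y → Y × X) := contDiff_snd.prodMk contDiff_fst
  obtain ⟨g, hg, h⟩ := hadamard_right (hF.comp hs) h0
  exact ⟨fun j => g j ∘ Prod.swap, fun j => (hg j).comp hs', fun z => h z.swap⟩

/-- The amplitude `f(z) e^{i l(β(z))}`. -/
def amp (f : X × Y → ℂ) (β : X × Y → V) (l : StrongDual ℝ V) (z : X × Y) : ℂ :=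
  f z * Complex.exp (Complex.I * (l (β z) : ℝ))

/-- Amplitudes obtained from `f e^{i l(β)}` by differentiations.  The indices count the admissible
number of derivatives in `x` and in `y`. -/
inductive Good (K : Set (X × Y)) (β : X × Y → V) :
    ℕ → ℕ → (StrongDual ℝ V → X × Y → ℂ) → Prop
  | base (p q : ℕ) {f : X × Y → ℂ} (hf : TestOn K f) : Good K β p q (amp f β)
  | mulX (p q : ℕ) (i : Fin (Module.finrank ℝ X)) {G : StrongDual ℝ V → X × Y → ℂ}
      (hG : Good K β (p + 1) q G) : Good K β p q fun l z => (dualFinBasis X i z.1 : ℂ) * G l z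
  | mulY (p q : ℕ) (j : Fin (Module.finrank ℝ Y)) {G : StrongDual ℝ V → X × Y → ℂ}
      (hG : Good K β p (q + 1) G) : Good K β p q fun l z => (dualFinBasis Y j z.2 : ℂ) * G l z
  -- A component of l is charged one derivative in each variable, while a coordinate refunds one in
  -- its own variable. An x-derivative of the phase produces a component of l times a y-coordinate,
  -- so its net charge is one x-derivative.
  | lam (p q : ℕ) (v : V) {G : StrongDual ℝ V → X × Y → ℂ} (hG : Good K β p q G) :
      Good K β (p + 1) (q + 1) fun l z => (l v : ℂ) * G l z
  | add {p q : ℕ} {G G' : StrongDual ℝ V → X × Y → ℂ} (hG : Good K β p q G)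
      (hG' : Good K β p q G') : Good K β p q fun l z => G l z + G' l z

variable {K : Set (X × Y)} {β : X × Y → V}

theorem smooth_exp_phase (hβ : ContDiff ℝ ∞ β) (l : StrongDual ℝ V) :
    ContDiff ℝ ∞ fun z => Complex.exp (Complex.I * (l (β z) : ℝ)) :=
  contDiff_cexp_I (l.contDiff.comp hβ)

theorem TestOn.mul_right' {f g : X × Y → ℂ} (hf : TestOn K f) (hg : ContDiff ℝ ∞ g) :
    TestOn K fun z => f z * g z :=
  ⟨hf.smooth.mul hg, fun z hz => by rw [hf.zero z hz, zero_mul]⟩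

theorem TestOn.mul_left' {f g : X × Y → ℂ} (hf : TestOn K f) (hg : ContDiff ℝ ∞ g) :
    TestOn K fun z => g z * f z :=
  ⟨hg.mul hf.smooth, fun z hz => by rw [hf.zero z hz, mul_zero]⟩

theorem smooth_coordX (i : Fin (Module.finrank ℝ X)) :
    ContDiff ℝ ∞ fun z : X × Y => (dualFinBasis X i z.1 : ℂ) :=
  (Complex.ofRealCLM.comp ((dualFinBasis X i).comp (ContinuousLinearMap.fst ℝ X Y))).contDiff

theorem smooth_coordY (i : Fin (Module.finrank ℝ Y)) :
    ContDiff ℝ ∞ fun z : X × Y => (dualFinBasis Y i z.2 : ℂ) :=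
  (Complex.ofRealCLM.comp ((dualFinBasis Y i).comp (ContinuousLinearMap.snd ℝ X Y))).contDiff

theorem testOn_amp (hβ : ContDiff ℝ ∞ β) {f : X × Y → ℂ} (hf : TestOn K f) (l : StrongDual ℝ V) :
    TestOn K (amp f β l) :=
  hf.mul_right' (smooth_exp_phase hβ l)

theorem Good.testOn (hβ : ContDiff ℝ ∞ β) {p q : ℕ} {G : StrongDual ℝ V → X × Y → ℂ}
    (hG : Good K β p q G) (l : StrongDual ℝ V) : TestOn K (G l) := by
  induction hG with
  | base p q hf => exact testOn_amp hβ hf l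
  | mulX p q i _ ih => exact ih.mul_left' (smooth_coordX i)
  | mulY p q i _ ih => exact ih.mul_left' (smooth_coordY i)
  | lam p q v _ ih => exact ih.mul_left' contDiff_const
  | add _ _ ih ih' => exact ⟨ih.smooth.add ih'.smooth, fun z hz => by
      simp [ih.zero z hz, ih'.zero z hz]⟩

theorem Good.const_mul {p q : ℕ} {G : StrongDual ℝ V → X × Y → ℂ} (hG : Good K β p q G) (c : ℂ) :
    Good K β p q fun l z => c * G l z := by
  induction hG with
  | base p q hf =>
    rename_i f
    have := Good.base (β := β) p q (hf.mul_left' (contDiff_const (c := c)))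
    convert this using 3
    simp [amp, mul_assoc]
  | mulX p q i _ ih => simpa only [mul_left_comm] using ih.mulX p q i
  | mulY p q i _ ih => simpa only [mul_left_comm] using ih.mulY p q i
  | lam p q v _ ih => simpa only [mul_left_comm] using ih.lam p q v
  | add _ _ ih ih' => simpa only [mul_add] using ih.add ih'

theorem testOn_zero : TestOn K (fun _ : X × Y => (0 : ℂ)) := ⟨contDiff_const, fun _ _ => rfl⟩

theorem Good.sum {p q : ℕ} {ι : Type*} (s : Finset ι) {G : ι → StrongDual ℝ V → X × Y → ℂ}
    (hG : ∀ i ∈ s, Good K β p q (G i)) : Good K β p q fun l z => ∑ i ∈ s, G i l z := by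
  classical
  induction s using Finset.induction_on with
  | empty =>
    have h : (fun (_ : StrongDual ℝ V) (_ : X × Y) => (0 : ℂ)) = amp (fun _ => 0) β := by
      funext l z
      simp [amp]
    have h' := Good.base (β := β) p q (testOn_zero (K := K))
    rw [← h] at h'
    simpa only [Finset.sum_empty] using h'
  | insert i s hi ih =>
    simp only [Finset.sum_insert hi]
    exact (hG i (Finset.mem_insert_self i s)).add
      (ih fun j hj => hG j (Finset.mem_insert_of_mem hj))

theorem pd_amp (hβ : ContDiff ℝ ∞ β) {f : X × Y → ℂ} (hf : ContDiff ℝ ∞ f) (v : X × Y)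
    (l : StrongDual ℝ V) :
    pd v (amp f β l) = fun z => amp (pd v f) β l z
      + Complex.I * (l (pd v β z) : ℝ) * amp f β l z := by
  have h1 := pd_mul hf (smooth_exp_phase hβ l) v
  have h2 := pd_cexp (l.contDiff.comp hβ) v
  simp only [Function.comp_def] at h2
  have h3 : pd v (fun z => l (β z)) = fun z => l (pd v β z) := by
    funext z
    have := (l.hasFDerivAt.comp z (differentiable_of_smooth hβ z).hasFDerivAt).fderiv
    exact congrArg (fun T => T v) this
  rw [h2, h3] at h1
  refine h1.trans ?_
  funext z
  simp only [amp]
  ring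

theorem dual_expand_apply (l : StrongDual ℝ V) (v : V) :
    l v = ∑ k, dualFinBasis V k v * l (Module.finBasis ℝ V k) := by
  conv_lhs => rw [expand_dualFinBasis v]
  simp

/-- Since β vanishes for y = 0, so does its x-derivative, and Hadamard's lemma extracts a coordinate
of y. The factor l thus never comes alone, and the count rises in x only. -/
theorem good_phase_derivX (hβ : ContDiff ℝ ∞ β) (hβ0 : ∀ x, β (x, 0) = 0) (v : X) {f : X × Y → ℂ}
    (hf : TestOn K f) (p q : ℕ) :
    Good K β (p + 1) q fun l z => Complex.I * (l (pd (v, 0) β z) : ℝ) * amp f β l z := by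
  have h0 : ∀ x, pd (v, 0) β (x, 0) = 0 := by
    intro x
    have h1 : HasDerivAt (fun t : ℝ => (x + t • v, (0 : Y))) (v, 0) 0 := by
      simpa using ((((hasDerivAt_id (0 : ℝ)).smul_const v).const_add x).prodMk
        (hasDerivAt_const (0 : ℝ) (0 : Y)))
    have h2 := (differentiable_of_smooth hβ (x + (0 : ℝ) • v, (0 : Y))).hasFDerivAt.comp_hasDerivAt
      (0 : ℝ) h1
    have h3 : HasDerivAt (β ∘ fun t : ℝ => (x + t • v, (0 : Y))) 0 0 := by
      have : (β ∘ fun t : ℝ => (x + t • v, (0 : Y))) = fun _ => 0 := funext fun t => hβ0 _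
      rw [this]
      exact hasDerivAt_const _ _
    simpa [pd] using h2.unique h3
  obtain ⟨g, hg, hgz⟩ := hadamard_right (ContDiff.pd hβ (v, 0)) h0
  have hk : ∀ k j, ContDiff ℝ ∞ fun z => Complex.I * (dualFinBasis V k (g j z) : ℂ) := fun k j =>
    contDiff_const.mul (Complex.ofRealCLM.contDiff.comp ((dualFinBasis V k).contDiff.comp (hg j)))
  have := Good.sum Finset.univ fun (j : Fin (Module.finrank ℝ Y)) _ =>
    Good.sum Finset.univ fun (k : Fin (Module.finrank ℝ V)) _ =>
      ((Good.base (β := β) p q (hf.mul_left' (hk k j))).lam p q (Module.finBasis ℝ V k)).mulY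
        (p + 1) q j
  convert this using 3 with l z
  rw [hgz, map_sum]
  simp only [map_smul, smul_eq_mul, amp]
  push_cast
  rw [Finset.mul_sum, Finset.sum_mul]
  refine Finset.sum_congr rfl fun j _ => ?_
  rw [dual_expand_apply l (g j z)]
  push_cast
  rw [Finset.mul_sum, Finset.mul_sum, Finset.sum_mul]
  exact Finset.sum_congr rfl fun k _ => by ring

theorem good_phase_derivY (hβ : ContDiff ℝ ∞ β) (hβ0 : ∀ y, β (0, y) = 0) (v : Y) {f : X × Y → ℂ}
    (hf : TestOn K f) (p q : ℕ) :
    Good K β p (q + 1) fun l z => Complex.I * (l (pd (0, v) β z) : ℝ) * amp f β l z := by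
  have h0 : ∀ y, pd (0, v) β (0, y) = 0 := by
    intro y
    have h1 : HasDerivAt (fun t : ℝ => ((0 : X), y + t • v)) (0, v) 0 := by
      simpa using (hasDerivAt_const (0 : ℝ) (0 : X)).prodMk
        (((hasDerivAt_id (0 : ℝ)).smul_const v).const_add y)
    have h2 := (differentiable_of_smooth hβ ((0 : X), y + (0 : ℝ) • v)).hasFDerivAt.comp_hasDerivAt
      (0 : ℝ) h1
    have h3 : HasDerivAt (β ∘ fun t : ℝ => ((0 : X), y + t • v)) 0 0 := by
      have : (β ∘ fun t : ℝ => ((0 : X), y + t • v)) = fun _ => 0 := funext fun t => hβ0 _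
      rw [this]
      exact hasDerivAt_const _ _
    simpa [pd] using h2.unique h3
  obtain ⟨g, hg, hgz⟩ := hadamard_left (ContDiff.pd hβ (0, v)) h0
  have hk : ∀ k j, ContDiff ℝ ∞ fun z => Complex.I * (dualFinBasis V k (g j z) : ℂ) := fun k j =>
    contDiff_const.mul (Complex.ofRealCLM.contDiff.comp ((dualFinBasis V k).contDiff.comp (hg j)))
  have := Good.sum Finset.univ fun (j : Fin (Module.finrank ℝ X)) _ =>
    Good.sum Finset.univ fun (k : Fin (Module.finrank ℝ V)) _ =>
      ((Good.base (β := β) p q (hf.mul_left' (hk k j))).lam p q (Module.finBasis ℝ V k)).mulX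
        p (q + 1) j
  convert this using 3 with l z
  rw [hgz, map_sum]
  simp only [map_smul, smul_eq_mul, amp]
  push_cast
  rw [Finset.mul_sum, Finset.sum_mul]
  refine Finset.sum_congr rfl fun j _ => ?_
  rw [dual_expand_apply l (g j z)]
  push_cast
  rw [Finset.mul_sum, Finset.mul_sum, Finset.sum_mul]
  exact Finset.sum_congr rfl fun k _ => by ring

theorem pd_mul_clm {E : Type*} [NormedAddCommGroup E] [NormedSpace ℝ E] (T : StrongDual ℝ E)
    {G : E → ℂ} (hG : ContDiff ℝ ∞ G) (v : E) :
    pd v (fun z => (T z : ℂ) * G z) = fun z => (T v : ℂ) * G z + (T z : ℂ) * pd v G z := by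
  have hT : ContDiff ℝ ∞ fun z => (T z : ℂ) := (Complex.ofRealCLM.comp T).contDiff
  rw [pd_mul hT hG v]
  funext z
  congr 2
  have := (Complex.ofRealCLM.comp T).fderiv (x := z)
  exact congrArg (fun S => S v) this

/-- The geometry enters in the base case only. For the other constructors the product rule applies;
differentiating an explicit coordinate of x removes it, and this lands on the amplitude with x-count
p + 1. -/
theorem Good.pdX (hβ : ContDiff ℝ ∞ β) (hβ0 : ∀ x, β (x, 0) = 0) (v : X) {p q : ℕ}
    {G : StrongDual ℝ V → X × Y → ℂ} (hG : Good K β p q G) (hK : IsCompact K) :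
    Good K β (p + 1) q fun l => StarProduct.pd (v, 0) (G l) := by
  borelize X
  borelize Y
  induction hG with
  | base p q hf =>
    simp only [pd_amp hβ hf.smooth]
    exact (Good.base _ _ (hf.pd hK _)).add (good_phase_derivX hβ hβ0 v hf p q)
  | mulX p q i hG ih =>
    have h : ∀ l, _ := fun l => pd_mul_clm
      ((dualFinBasis X i).comp (ContinuousLinearMap.fst ℝ X Y)) (hG.testOn hβ l).smooth (v, 0)
    simp only [ContinuousLinearMap.comp_apply, ContinuousLinearMap.coe_fst'] at h
    simp only [h]
    exact (hG.const_mul _).add (ih.mulX _ _ i)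
  | mulY p q i hG ih =>
    have h : ∀ l, _ := fun l => pd_mul_clm
      ((dualFinBasis Y i).comp (ContinuousLinearMap.snd ℝ X Y)) (hG.testOn hβ l).smooth (v, 0)
    simp only [ContinuousLinearMap.comp_apply, ContinuousLinearMap.coe_snd', map_zero,
      Complex.ofReal_zero, zero_mul, zero_add] at h
    simp only [h]
    exact ih.mulY _ _ i
  | lam p q w hG ih =>
    have h : ∀ l : StrongDual ℝ V, _ := fun l => pd_const_mul (hG.testOn hβ l).smooth (l w : ℂ) (v, (0 : Y))
    simp only [h]
    exact ih.lam _ _ w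
  | add hG hG' ih ih' =>
    have h : ∀ l : StrongDual ℝ V, _ := fun l => pd_add (hG.testOn hβ l).smooth
      (hG'.testOn hβ l).smooth (v, (0 : Y))
    simp only [h]
    exact ih.add ih'

theorem Good.pdY (hβ : ContDiff ℝ ∞ β) (hβ0 : ∀ y, β (0, y) = 0) (v : Y) {p q : ℕ}
    {G : StrongDual ℝ V → X × Y → ℂ} (hG : Good K β p q G) (hK : IsCompact K) :
    Good K β p (q + 1) fun l => StarProduct.pd (0, v) (G l) := by
  borelize X
  borelize Y
  induction hG with
  | base p q hf =>
    simp only [pd_amp hβ hf.smooth]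
    exact (Good.base _ _ (hf.pd hK _)).add (good_phase_derivY hβ hβ0 v hf p q)
  | mulY p q i hG ih =>
    have h : ∀ l, _ := fun l => pd_mul_clm
      ((dualFinBasis Y i).comp (ContinuousLinearMap.snd ℝ X Y)) (hG.testOn hβ l).smooth (0, v)
    simp only [ContinuousLinearMap.comp_apply, ContinuousLinearMap.coe_snd'] at h
    simp only [h]
    exact (hG.const_mul _).add (ih.mulY _ _ i)
  | mulX p q i hG ih =>
    have h : ∀ l, _ := fun l => pd_mul_clm
      ((dualFinBasis X i).comp (ContinuousLinearMap.fst ℝ X Y)) (hG.testOn hβ l).smooth (0, v)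
    simp only [ContinuousLinearMap.comp_apply, ContinuousLinearMap.coe_fst', map_zero,
      Complex.ofReal_zero, zero_mul, zero_add] at h
    simp only [h]
    exact ih.mulX _ _ i
  | lam p q w hG ih =>
    have h : ∀ l : StrongDual ℝ V, _ := fun l => pd_const_mul (hG.testOn hβ l).smooth (l w : ℂ) ((0 : X), v)
    simp only [h]
    exact ih.lam _ _ w
  | add hG hG' ih ih' =>
    have h : ∀ l : StrongDual ℝ V, _ := fun l => pd_add (hG.testOn hβ l).smooth
      (hG'.testOn hβ l).smooth ((0 : X), v)
    simp only [h]
    exact ih.add ih'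

theorem Good.pds_dir (hβ : ContDiff ℝ ∞ β) (hβ1 : ∀ x, β (x, 0) = 0) (hβ2 : ∀ y, β (0, y) = 0)
    (hK : IsCompact K) {f : X × Y → ℂ} (hf : TestOn K f) {p q : ℕ}
    (i : Fin p → Fin (Module.finrank ℝ X)) (j : Fin q → Fin (Module.finrank ℝ Y)) :
    Good K β p q fun l => pds (dirY j) (pds (dirX i) (amp f β l)) := by
  borelize X
  borelize Y
  have h1 : Good K β p 0 fun l => pds (dirX i) (amp f β l) := by
    induction p with
    | zero => simpa [dirX] using Good.base (β := β) 0 0 hf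
    | succ p ih =>
      obtain ⟨k, i', rfl⟩ : ∃ (k : Fin (Module.finrank ℝ X)) (i' : Fin p → Fin (Module.finrank ℝ X)),
          i = (Fin.cons k i' : Fin (p + 1) → Fin (Module.finrank ℝ X)) :=
        ⟨_, _, (Fin.cons_self_tail i).symm⟩
      rw [dirX_cons]
      exact (ih i').pdX hβ hβ1 _ hK
  induction q with
  | zero => simpa [dirY] using h1
  | succ q ih =>
    obtain ⟨k, j', rfl⟩ : ∃ (k : Fin (Module.finrank ℝ Y)) (j' : Fin q → Fin (Module.finrank ℝ Y)),
        j = (Fin.cons k j' : Fin (q + 1) → Fin (Module.finrank ℝ Y)) :=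
      ⟨_, _, (Fin.cons_self_tail j).symm⟩
    rw [dirY_cons]
    exact (ih j').pdY hβ hβ2 _ hK

end Amplitudes

end StarProduct

namespace StarProduct

open MeasureTheory

set_option linter.unusedSectionVars false

/-! ### Bounds for oscillatory integrals with symbols -/

section Bounds

/-! ### Japanese brackets, symbol bounds and the comparison of weights. -/

section Brackets

variable {D : Type*} [NormedAddCommGroup D] [NormedSpace ℝ D]

theorem norm_le_japaneseBracket (ξ : D) : ‖ξ‖ ≤ japaneseBracket ξ :=
  Real.le_sqrt_of_sq_le (by linarith)

theorem japaneseBracket_le_one_add (ξ : D) : japaneseBracket ξ ≤ 1 + ‖ξ‖ :=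
  Real.sqrt_le_iff.2 ⟨by positivity, by nlinarith [norm_nonneg ξ]⟩

theorem japaneseBracket_zpow_le_pow {ξ : D} {T : ℝ} (h : japaneseBracket ξ ≤ T) (n : ℤ) :
    japaneseBracket ξ ^ n ≤ T ^ n.natAbs := by
  have h1 := one_le_japaneseBracket ξ
  calc japaneseBracket ξ ^ n ≤ japaneseBracket ξ ^ (n.natAbs : ℤ) :=
        zpow_le_zpow_right₀ h1 Int.le_natAbs
    _ = japaneseBracket ξ ^ n.natAbs := zpow_natCast _ _
    _ ≤ T ^ n.natAbs := by gcongr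

theorem one_le_pow_mul_japaneseBracket_zpow {ξ : D} {T : ℝ} (h : japaneseBracket ξ ≤ T) (n : ℤ) :
    1 ≤ T ^ n.natAbs * japaneseBracket ξ ^ n := by
  have h1 := japaneseBracket_zpow_le_pow h (-n)
  have h2 := zpow_pos (japaneseBracket_pos ξ) n
  rw [zpow_neg, Int.natAbs_neg] at h1
  calc (1 : ℝ) = (japaneseBracket ξ ^ n)⁻¹ * japaneseBracket ξ ^ n := by field_simp
    _ ≤ _ := by gcongr

/-- Symbol bounds on finitely many derivatives, each derivative costing a factor `θ`. -/
structure SymBound (θ A : ℝ) (n : ℤ) (κ : ℕ) (a : D → ℂ) : Prop where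
  temperate : a.HasTemperateGrowth
  nonneg : 0 ≤ A
  bound : ∀ k ≤ κ, ∀ ξ, ‖iteratedFDeriv ℝ k a ξ‖ ≤ A * θ ^ k * japaneseBracket ξ ^ (n - k)

theorem SymBound.mono {θ A : ℝ} {n : ℤ} {κ κ' : ℕ} {a : D → ℂ} (h : SymBound θ A n κ a)
    (hκ : κ' ≤ κ) : SymBound θ A n κ' a :=
  ⟨h.temperate, h.nonneg, fun k hk => h.bound k (hk.trans hκ)⟩

theorem norm_iteratedFDeriv_pd_le {F : Type*} [NormedAddCommGroup F] [NormedSpace ℝ F] {a : D → F}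
    (ha : ContDiff ℝ ∞ a) (v : D) (k : ℕ) (ξ : D) :
    ‖iteratedFDeriv ℝ k (pd v a) ξ‖ ≤ ‖v‖ * ‖iteratedFDeriv ℝ (k + 1) a ξ‖ := by
  have h1 : pd v a = (ContinuousLinearMap.apply ℝ F v) ∘ fderiv ℝ a := rfl
  have h2 : ContDiff ℝ ∞ (fderiv ℝ a) := ha.fderiv_right (by simp)
  rw [h1, ← norm_iteratedFDeriv_fderiv]
  refine ((ContinuousLinearMap.apply ℝ F v).norm_iteratedFDeriv_comp_left
    (h2.contDiffAt (x := ξ)) (n := k) (by exact_mod_cast le_top)).trans ?_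
  gcongr
  refine ContinuousLinearMap.opNorm_le_bound _ (norm_nonneg v) fun f => ?_
  rw [mul_comm]
  exact f.le_opNorm v

theorem SymBound.pd {θ A : ℝ} {n : ℤ} {κ : ℕ} {a : D → ℂ} (h : SymBound θ A n (κ + 1) a)
    (hθ : 0 ≤ θ) (v : D) : SymBound θ (A * θ * ‖v‖) (n - 1) κ (pd v a) := by
  refine ⟨temperate_pd h.temperate v, by have := h.nonneg; positivity, fun k hk ξ => ?_⟩
  refine (norm_iteratedFDeriv_pd_le h.temperate.1 v k ξ).trans ?_
  have h1 := h.bound (k + 1) (by omega) ξ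
  calc ‖v‖ * ‖iteratedFDeriv ℝ (k + 1) a ξ‖
      ≤ ‖v‖ * (A * θ ^ (k + 1) * japaneseBracket ξ ^ (n - (k + 1 : ℕ))) := by gcongr
    _ = _ := by
      rw [show n - 1 - (k : ℤ) = n - (k + 1 : ℕ) by push_cast; ring]
      ring

theorem SymBound.norm_le {θ A : ℝ} {n : ℤ} {κ : ℕ} {a : D → ℂ} (h : SymBound θ A n κ a) (ξ : D) :
    ‖a ξ‖ ≤ A * japaneseBracket ξ ^ n := by
  simpa using h.bound 0 (Nat.zero_le _) ξ

/-- The product of the weights `⟨ζ₁ + ξ⟩^{n₁}` and `⟨ζ₂ + η⟩^{n₂}`, along with those obtained by up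
to `κ` differentiations, is controlled for small `ξ`, `η` by that of order `n`. -/
def WeightOK {D₁ D₂ : Type*} [NormedAddCommGroup D₁] [NormedSpace ℝ D₁] [NormedAddCommGroup D₂]
    [NormedSpace ℝ D₂] (r₁ : D →L[ℝ] D₁) (r₂ : D →L[ℝ] D₂) (ε : ℝ) (κ : ℕ) (n₁ n₂ n : ℤ) : Prop :=
  ∃ C : ℝ, 0 ≤ C ∧ ∀ p ≤ κ, ∀ q ≤ κ, ∀ (ζ : D) (ξ : D₁) (η : D₂), ‖ξ‖ ≤ ε * ‖ζ‖ →
    ‖η‖ ≤ ε * ‖ζ‖ → japaneseBracket (r₁ ζ + ξ) ^ (n₁ - p) * japaneseBracket (r₂ ζ + η) ^ (n₂ - q) ≤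
      C * japaneseBracket ζ ^ (n - p - q)

section

variable {D₁ D₂ : Type*} [NormedAddCommGroup D₁] [NormedSpace ℝ D₁] [NormedAddCommGroup D₂]
    [NormedSpace ℝ D₂] {r₁ : D →L[ℝ] D₁} {r₂ : D →L[ℝ] D₂} {ε : ℝ} {κ κ' : ℕ} {n₁ n₂ n : ℤ}

theorem WeightOK.mono (h : WeightOK r₁ r₂ ε κ n₁ n₂ n) (hκ : κ' ≤ κ) :
    WeightOK r₁ r₂ ε κ' n₁ n₂ n := by
  obtain ⟨C, h0, hC⟩ := h
  exact ⟨C, h0, fun p hp q hq => hC p (hp.trans hκ) q (hq.trans hκ)⟩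

/-- Differentiating the symbols s and t times lowers their orders accordingly. The weight condition
survives because it was required with enough derivatives in reserve. -/
theorem WeightOK.shift (s t : ℕ) (h : WeightOK r₁ r₂ ε (κ + s + t) n₁ n₂ n) :
    WeightOK r₁ r₂ ε κ (n₁ - s) (n₂ - t) (n - s - t) := by
  obtain ⟨C, h0, hC⟩ := h
  refine ⟨C, h0, fun p hp q hq ζ ξ η hξ hη => ?_⟩
  convert hC (p + s) (by omega) (q + t) (by omega) ζ ξ η hξ hη using 3 <;> push_cast <;> ring_nf

end

end Brackets

/-! ### The crude bound, by splitting the frequencies at ε‖l‖. -/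

section Base

variable {D₁ D₂ Λ : Type*} [NormedAddCommGroup D₁] [NormedSpace ℝ D₁] [FiniteDimensional ℝ D₁]
  [NormedAddCommGroup D₂] [NormedSpace ℝ D₂] [FiniteDimensional ℝ D₂]
  [NormedAddCommGroup Λ] [NormedSpace ℝ Λ]
  [MeasurableSpace D₁] [BorelSpace D₁] [MeasurableSpace D₂] [BorelSpace D₂]
  {r₁ : Λ →L[ℝ] D₁} {r₂ : Λ →L[ℝ] D₂}

/-- The frequencies are split at ‖w‖ = ε‖l‖, where l = h⁻¹ζ. Below, the displacements are at most
ε‖ζ‖, as s, t ≤ h, and the weights compare; only boundedness of `F` is available there, and forcing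
integrability costs the factor ⟨l⟩^M. Above, ζ and both displaced arguments are bounded by multiples
of 1 + ‖w‖, so all weights, including the inverse of ⟨ζ⟩^n, are powers of 1 + ‖w‖ that the decay of
`F` absorbs. -/
theorem symbol_pair_integral_bound (ν : Measure (D₁ × D₂)) {M : ℕ}
    (hM : Integrable (fun w : D₁ × D₂ => ((1 + ‖w‖) ^ M)⁻¹) ν) {ε : ℝ} (hε : 0 < ε)
    {F : Λ → D₁ × D₂ → ℂ}
    (hF : ∀ N : ℕ, ∃ C : ℝ, 0 ≤ C ∧ ∀ l w, ‖F l w‖ ≤ C ∧ (ε * ‖l‖ ≤ ‖w‖ → ‖F l w‖ * (1 + ‖w‖) ^ N ≤ C))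
    {n₁ n₂ n : ℤ} (hW : WeightOK r₁ r₂ ε 0 n₁ n₂ n) :
    ∃ C : ℝ, 0 ≤ C ∧ ∀ {h θ₁ θ₂ A B : ℝ} {a : D₁ → ℂ} {b : D₂ → ℂ}, 0 < h → h ≤ 1 →
      SymBound θ₁ A n₁ 0 a → SymBound θ₂ B n₂ 0 b →
      ∀ (ζ : Λ), ∀ s ∈ Set.Icc 0 h, ∀ t ∈ Set.Icc 0 h,
        ‖∫ w, cpair a b s t (r₁ ζ, r₂ ζ) w * F (h⁻¹ • ζ) w ∂ν‖ ≤
          C * A * B * japaneseBracket (h⁻¹ • ζ) ^ M * japaneseBracket ζ ^ n := by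
  obtain ⟨W, hW0, hW⟩ := hW
  -- The exponent pays for the three weights at high frequency and leaves M powers for
  -- integrability.
  obtain ⟨C, hC0, hC⟩ := hF (n₁.natAbs + n₂.natAbs + n.natAbs + M)
  set R := ‖r₁‖ + ‖r₂‖
  set c := R / ε + 1 + 1 / ε
  have hR : 0 ≤ R := by positivity
  have hc : 1 ≤ c := by
    have : 0 ≤ R / ε + 1 / ε := by positivity
    linarith
  set S := ∫ w : D₁ × D₂, ((1 + ‖w‖) ^ M)⁻¹ ∂ν
  have hS : 0 ≤ S := integral_nonneg fun w => by positivity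
  set C₁ := W * C * (1 + ε) ^ M + C * c ^ (n₁.natAbs + n₂.natAbs + n.natAbs)
  have hC₁ : 0 ≤ C₁ := by positivity
  refine ⟨C₁ * S, by positivity, ?_⟩
  intro h θ₁ θ₂ A B a b h0 h1 ha hb ζ s hs t ht
  have hA := ha.nonneg
  have hB := hb.nonneg
  set l := h⁻¹ • ζ
  have hl : ‖ζ‖ = h * ‖l‖ := by
    rw [norm_smul, norm_inv, Real.norm_of_nonneg h0.le]
    field_simp
  set Q := japaneseBracket l ^ M * japaneseBracket ζ ^ n
  have jl := one_le_japaneseBracket l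
  have jz := zpow_pos (japaneseBracket_pos ζ) n
  have key : ∀ w, ‖cpair a b s t (r₁ ζ, r₂ ζ) w * F l w‖ ≤
      C₁ * A * B * Q * ((1 + ‖w‖) ^ M)⁻¹ := by
    intro w
    have hw1 : ‖w.1‖ ≤ ‖w‖ := norm_fst_le w
    have hw2 : ‖w.2‖ ≤ ‖w‖ := norm_snd_le w
    have nab : ‖cpair a b s t (r₁ ζ, r₂ ζ) w‖ ≤ A * B *
        (japaneseBracket (r₁ ζ + s • w.1) ^ n₁ * japaneseBracket (r₂ ζ + t • w.2) ^ n₂) := by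
      rw [cpair, norm_mul]
      calc _ ≤ (A * japaneseBracket (r₁ ζ + s • w.1) ^ n₁) *
            (B * japaneseBracket (r₂ ζ + t • w.2) ^ n₂) := by
            gcongr
            · exact mul_nonneg hA (zpow_pos (japaneseBracket_pos _) _).le
            · exact ha.norm_le _
            · exact hb.norm_le _
        _ = _ := by ring
    rw [norm_mul]
    have hpos : 0 < (1 + ‖w‖) ^ M := by positivity
    have ns1 : ‖s • w.1‖ ≤ h * ‖w‖ := by
      rw [norm_smul, Real.norm_of_nonneg hs.1]
      exact mul_le_mul hs.2 hw1 (norm_nonneg _) h0.le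
    have ns2 : ‖t • w.2‖ ≤ h * ‖w‖ := by
      rw [norm_smul, Real.norm_of_nonneg ht.1]
      exact mul_le_mul ht.2 hw2 (norm_nonneg _) h0.le
    rw [← div_eq_mul_inv, le_div_iff₀ hpos]
    rcases le_total ‖w‖ (ε * ‖l‖) with hw | hw
    · have hz : h * ‖w‖ ≤ ε * ‖ζ‖ := by
        rw [hl]
        calc h * ‖w‖ ≤ h * (ε * ‖l‖) := by gcongr
          _ = _ := by ring
      have h2 := hW 0 le_rfl 0 le_rfl ζ (s • w.1) (t • w.2) (ns1.trans hz) (ns2.trans hz)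
      simp only [Nat.cast_zero, sub_zero] at h2
      have h3 : (1 + ‖w‖) ^ M ≤ (1 + ε) ^ M * japaneseBracket l ^ M := by
        rw [← mul_pow]
        gcongr
        have := norm_le_japaneseBracket l
        nlinarith
      calc _ ≤ A * B * (W * japaneseBracket ζ ^ n) * C *
            ((1 + ε) ^ M * japaneseBracket l ^ M) := by
            gcongr
            · exact nab.trans (by gcongr)
            · exact (hC l w).1
        _ = (W * C * (1 + ε) ^ M) * A * B * Q := by ring
        _ ≤ _ := by
          gcongr
          exact le_add_of_nonneg_right (by positivity)
    · set T := c * (1 + ‖w‖)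
      have hlw : ‖l‖ ≤ ‖w‖ / ε := by rw [le_div_iff₀ hε]; linarith
      have hzw : ‖ζ‖ ≤ ‖w‖ / ε := by
        rw [hl]
        exact (mul_le_of_le_one_left (norm_nonneg l) h1).trans hlw
      have hT : 1 + (R * (‖w‖ / ε) + ‖w‖ + ‖w‖ / ε) ≤ T := by
        have : T = c + (R * (‖w‖ / ε) + ‖w‖ + ‖w‖ / ε) := by
          simp only [T, c]
          field_simp
        linarith
      have hwε : 0 ≤ ‖w‖ / ε := by positivity
      have hsw : h * ‖w‖ ≤ ‖w‖ := mul_le_of_le_one_left (norm_nonneg w) h1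
      have t1 : japaneseBracket (r₁ ζ + s • w.1) ≤ T := by
        refine (japaneseBracket_le_one_add _).trans (le_trans ?_ hT)
        have e1 : ‖r₁ ζ‖ ≤ R * (‖w‖ / ε) := (r₁.le_opNorm ζ).trans (by
          gcongr
          exact le_add_of_nonneg_right (norm_nonneg _))
        have := norm_add_le (r₁ ζ) (s • w.1)
        linarith
      have t2 : japaneseBracket (r₂ ζ + t • w.2) ≤ T := by
        refine (japaneseBracket_le_one_add _).trans (le_trans ?_ hT)
        have e1 : ‖r₂ ζ‖ ≤ R * (‖w‖ / ε) := (r₂.le_opNorm ζ).trans (by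
          gcongr
          exact le_add_of_nonneg_left (norm_nonneg _))
        have := norm_add_le (r₂ ζ) (t • w.2)
        linarith
      have t3 : japaneseBracket ζ ≤ T := by
        refine (japaneseBracket_le_one_add _).trans (le_trans ?_ hT)
        have : 0 ≤ R * (‖w‖ / ε) := by positivity
        have := norm_nonneg w
        linarith
      have b1 := japaneseBracket_zpow_le_pow t1 n₁
      have b2 := japaneseBracket_zpow_le_pow t2 n₂
      have b3 := one_le_pow_mul_japaneseBracket_zpow t3 n
      have b4 := (hC l w).2 hw
      have hTpos : 0 < T := by positivity
      have p1 := zpow_pos (japaneseBracket_pos (r₁ ζ + s • w.1)) n₁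
      have p2 := zpow_pos (japaneseBracket_pos (r₂ ζ + t • w.2)) n₂
      calc _ ≤ A * B * (T ^ n₁.natAbs * T ^ n₂.natAbs) * ‖F l w‖ * (1 + ‖w‖) ^ M := by
            gcongr
            exact nab.trans (by gcongr)
        _ ≤ A * B * (T ^ n₁.natAbs * T ^ n₂.natAbs) * ‖F l w‖ * (1 + ‖w‖) ^ M *
              (T ^ n.natAbs * japaneseBracket ζ ^ n) := le_mul_of_one_le_right (by positivity) b3
        _ = c ^ (n₁.natAbs + n₂.natAbs + n.natAbs) * A * B * japaneseBracket ζ ^ n *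
            (‖F l w‖ * (1 + ‖w‖) ^ (n₁.natAbs + n₂.natAbs + n.natAbs + M)) := by
            simp only [T, mul_pow, pow_add]
            ring
        _ ≤ c ^ (n₁.natAbs + n₂.natAbs + n.natAbs) * A * B * japaneseBracket ζ ^ n * C := by
            gcongr
        _ ≤ c ^ (n₁.natAbs + n₂.natAbs + n.natAbs) * A * B * japaneseBracket ζ ^ n * C *
            japaneseBracket l ^ M := le_mul_of_one_le_right (by positivity) (one_le_pow₀ jl)
        _ = (C * c ^ (n₁.natAbs + n₂.natAbs + n.natAbs)) * A * B * Q := by ring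
        _ ≤ _ := by
          gcongr
          exact le_add_of_nonneg_left (by positivity)
  refine (norm_integral_le_of_norm_le (hM.const_mul _) (Filter.Eventually.of_forall key)).trans
    (le_of_eq ?_)
  rw [integral_const_mul]
  ring

end Base

end Bounds

end StarProduct

namespace StarProduct

open MeasureTheory

set_option linter.unusedSectionVars false

/-! ### Bounds for the remainder of the expansion -/

section GoodBounds

/-- The admissible semiclassical parameters: `h` and the costs `θ₁`, `θ₂` of the derivatives. -/
structure Regime (h θ₁ θ₂ : ℝ) : Prop where
  pos : 0 < h
  le_one : h ≤ 1
  one_le_left : 1 ≤ θ₁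
  one_le_right : 1 ≤ θ₂
  mul_le_one : h * θ₁ * θ₂ ≤ 1

variable {X Y V : Type*} [NormedAddCommGroup X] [NormedSpace ℝ X] [FiniteDimensional ℝ X]
  [NormedAddCommGroup Y] [NormedSpace ℝ Y] [FiniteDimensional ℝ Y]
  [NormedAddCommGroup V] [NormedSpace ℝ V] [FiniteDimensional ℝ V]
  [MeasurableSpace X] [BorelSpace X] [MeasurableSpace Y] [BorelSpace Y]
  (μ : Measure (X × Y)) [μ.IsAddHaarMeasure]
  (ν : Measure (StrongDual ℝ X × StrongDual ℝ Y)) [ν.IsAddHaarMeasure]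
  (r₁ : StrongDual ℝ V →L[ℝ] StrongDual ℝ X) (r₂ : StrongDual ℝ V →L[ℝ] StrongDual ℝ Y)

/-- A bound for the pairings of an amplitude with symbols which is uniform in all parameters. -/
def UnifBound (M : ℕ) (n₁ n₂ n : ℤ) (p q κ : ℕ) (G : StrongDual ℝ V → X × Y → ℂ) (C : ℝ) : Prop :=
  ∀ {h θ₁ θ₂ A B : ℝ} {a : StrongDual ℝ X → ℂ} {b : StrongDual ℝ Y → ℂ}, Regime h θ₁ θ₂ →
    SymBound θ₁ A n₁ κ a → SymBound θ₂ B n₂ κ b → ∀ (ζ : StrongDual ℝ V), ∀ s ∈ Set.Icc 0 h,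
    ∀ t ∈ Set.Icc 0 h, ‖osc (pairing X Y) μ ν (G (h⁻¹ • ζ)) (cpair a b s t (r₁ ζ, r₂ ζ))‖ *
        (h * θ₁ / japaneseBracket ζ) ^ p * (h * θ₂ / japaneseBracket ζ) ^ q ≤
      C * A * B * japaneseBracket (h⁻¹ • ζ) ^ M * japaneseBracket ζ ^ n *
        (h * θ₁ * θ₂ / japaneseBracket ζ) ^ (max p q)

variable {K : Set (X × Y)} {β : X × Y → V} {ε : ℝ} {M : ℕ}

/-- No gain is needed here. The factors hθ₁/⟨ζ⟩ and hθ₂/⟨ζ⟩ are at most τ = hθ₁θ₂/⟨ζ⟩ ≤ 1, and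
τ^(p+q) ≤ τ^max(p,q), so the crude bound suffices for all p and q. -/
theorem unifBound_base (hε : 0 < ε)
    (hM : Integrable (fun w : StrongDual ℝ X × StrongDual ℝ Y => ((1 + ‖w‖) ^ M)⁻¹) ν)
    {f : X × Y → ℂ} (hdec : ∀ N : ℕ, ∃ C : ℝ, 0 ≤ C ∧ ∀ (l : StrongDual ℝ V) w,
      ‖fhat (pairing X Y) μ (amp f β l) w‖ ≤ C ∧
      (ε * ‖l‖ ≤ ‖w‖ → ‖fhat (pairing X Y) μ (amp f β l) w‖ * (1 + ‖w‖) ^ N ≤ C))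
    (p q : ℕ) {n₁ n₂ n : ℤ} (hW : WeightOK r₁ r₂ ε 0 n₁ n₂ n) :
    ∃ C : ℝ, 0 ≤ C ∧ UnifBound μ ν r₁ r₂ M n₁ n₂ n p q 0 (amp f β) C := by
  obtain ⟨C, hC0, hC⟩ := symbol_pair_integral_bound ν hM hε hdec hW
  refine ⟨C, hC0, fun {h θ₁ θ₂ A B a b} hr ha hb ζ s hs t ht => ?_⟩
  have hA := ha.nonneg
  have hB := hb.nonneg
  have hz := one_le_japaneseBracket ζ
  have jz := zpow_pos (japaneseBracket_pos ζ) n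
  have jl := (one_pos.trans_le (one_le_japaneseBracket (h⁻¹ • ζ)))
  have hh := hr.pos
  have h1 := hr.one_le_left
  have h2 := hr.one_le_right
  have hu : h * θ₁ / japaneseBracket ζ ≤ h * θ₁ * θ₂ / japaneseBracket ζ := by
    exact div_le_div_of_nonneg_right (le_mul_of_one_le_right (by positivity) h2) (by positivity)
  have hv : h * θ₂ / japaneseBracket ζ ≤ h * θ₁ * θ₂ / japaneseBracket ζ := by
    refine div_le_div_of_nonneg_right ?_ (by positivity)
    calc h * θ₂ = h * 1 * θ₂ := by ring
      _ ≤ _ := by gcongr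
  have hg : h * θ₁ * θ₂ / japaneseBracket ζ ≤ 1 :=
    div_le_one_of_le₀ (hr.mul_le_one.trans hz) (by positivity)
  have hg0 : 0 ≤ h * θ₁ * θ₂ / japaneseBracket ζ := by positivity
  rw [mul_assoc]
  gcongr
  · exact hC hr.pos hr.le_one ha hb ζ s hs t ht
  · calc _ ≤ (h * θ₁ * θ₂ / japaneseBracket ζ) ^ p * (h * θ₁ * θ₂ / japaneseBracket ζ) ^ q := by
          gcongr
      _ = (h * θ₁ * θ₂ / japaneseBracket ζ) ^ (p + q) := (pow_add _ _ _).symm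
      _ ≤ _ := pow_le_pow_of_le_one hg0 hg (by omega)

/-- A coordinate of x is a derivative on the frequency side. The chain rule for a(ζ₁ + sξ) supplies
the factor s, which makes the exchange profitable when s ≤ h. -/
theorem osc_coordX_mul (hK : IsCompact K) {G : X × Y → ℂ} (hG : TestOn K G)
    {a : StrongDual ℝ X → ℂ} {b : StrongDual ℝ Y → ℂ} (ha : a.HasTemperateGrowth)
    (hb : b.HasTemperateGrowth) (i : Fin (Module.finrank ℝ X)) (s t : ℝ)
    (ζ : StrongDual ℝ X × StrongDual ℝ Y) :
    osc (pairing X Y) μ ν (fun z => (dualFinBasis X i z.1 : ℂ) * G z) (cpair a b s t ζ) =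
      -Complex.I * (s * osc (pairing X Y) μ ν G (cpair (pd (dualFinBasis X i) a) b s t ζ)) := by
  have h := osc_linear_mul (pairing X Y) μ ν pairing_injective hK hG (cpair_temperate ha hb s t ζ)
    (dualFinBasis X i, 0)
  rw [pd_cpair_left ha hb, osc_const_mul_right] at h
  simpa using h

theorem osc_coordY_mul (hK : IsCompact K) {G : X × Y → ℂ} (hG : TestOn K G)
    {a : StrongDual ℝ X → ℂ} {b : StrongDual ℝ Y → ℂ} (ha : a.HasTemperateGrowth)
    (hb : b.HasTemperateGrowth) (i : Fin (Module.finrank ℝ Y)) (s t : ℝ)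
    (ζ : StrongDual ℝ X × StrongDual ℝ Y) :
    osc (pairing X Y) μ ν (fun z => (dualFinBasis Y i z.2 : ℂ) * G z) (cpair a b s t ζ) =
      -Complex.I * (t * osc (pairing X Y) μ ν G (cpair a (pd (dualFinBasis Y i) b) s t ζ)) := by
  have h := osc_linear_mul (pairing X Y) μ ν pairing_injective hK hG (cpair_temperate ha hb s t ζ)
    (0, dualFinBasis Y i)
  rw [pd_cpair_right ha hb, osc_const_mul_right] at h
  simpa using h

/-- Write u = hθ₁/⟨ζ⟩, v = hθ₂/⟨ζ⟩ and τ = hθ₁θ₂/⟨ζ⟩. A coordinate of x is exchanged for a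
derivative of a at the price s ≤ h and θ₁, with the order lowered by one: this is exactly the factor
u by which the two bounds differ, and likewise for y with v. A component of h⁻¹ζ is at most a
multiple of ⟨ζ⟩/h, and uv⟨ζ⟩/h = τ, which matches max(p + 1, q + 1) = max(p, q) + 1. All
inequalities between powers of τ use τ ≤ 1. -/
theorem Good.unifBound (hβ : ContDiff ℝ ∞ β) (hK : IsCompact K) (hε : 0 < ε)
    (hM : Integrable (fun w : StrongDual ℝ X × StrongDual ℝ Y => ((1 + ‖w‖) ^ M)⁻¹) ν)
    (hdec : ∀ f, TestOn K f → ∀ N : ℕ, ∃ C : ℝ, 0 ≤ C ∧ ∀ (l : StrongDual ℝ V) w,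
      ‖fhat (pairing X Y) μ (amp f β l) w‖ ≤ C ∧
      (ε * ‖l‖ ≤ ‖w‖ → ‖fhat (pairing X Y) μ (amp f β l) w‖ * (1 + ‖w‖) ^ N ≤ C))
    {p q : ℕ} {G : StrongDual ℝ V → X × Y → ℂ} (hG : Good K β p q G) :
    ∃ κ, ∀ n₁ n₂ n : ℤ, WeightOK r₁ r₂ ε κ n₁ n₂ n →
      ∃ C : ℝ, 0 ≤ C ∧ UnifBound μ ν r₁ r₂ M n₁ n₂ n p q κ G C := by
  induction hG with
  | base p q hf => exact ⟨0, fun n₁ n₂ n hW => unifBound_base μ ν r₁ r₂ hε hM (hdec _ hf) p q hW⟩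
  | mulX p q i hG ih =>
    rename_i G
    obtain ⟨κ, hκ⟩ := ih
    refine ⟨κ + 1, fun n₁ n₂ n hW => ?_⟩
    obtain ⟨C, hC0, hC⟩ := hκ _ _ _ (hW.shift 1 0)
    refine ⟨C * ‖dualFinBasis X i‖, by positivity, fun {h θ₁ θ₂ A B a b} hr ha hb ζ s hs t ht => ?_⟩
    have hA := ha.nonneg
    have hB := hb.nonneg
    have hh := hr.pos
    have h1 := hr.one_le_left
    have h2 := hr.one_le_right
    have hz := one_le_japaneseBracket ζ
    have jl := (one_pos.trans_le (one_le_japaneseBracket (h⁻¹ • ζ)))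
    have hz0 : 0 < japaneseBracket ζ := by positivity
    have jz := zpow_pos hz0 n
    have b1 := hC hr (by simpa using ha.pd (by positivity) (dualFinBasis X i))
      (by simpa using hb.mono (Nat.le_succ κ)) ζ s hs t ht
    have hg : h * θ₁ * θ₂ / japaneseBracket ζ ≤ 1 :=
      div_le_one_of_le₀ (hr.mul_le_one.trans hz) (by positivity)
    have hg0 : 0 ≤ h * θ₁ * θ₂ / japaneseBracket ζ := by positivity
    have hmax : (h * θ₁ * θ₂ / japaneseBracket ζ) ^ (max (p + 1) q) ≤
        (h * θ₁ * θ₂ / japaneseBracket ζ) ^ (max p q) := pow_le_pow_of_le_one hg0 hg (by omega)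
    rw [osc_coordX_mul μ ν hK (hG.testOn hβ _) ha.temperate hb.temperate, norm_mul, norm_neg,
      Complex.norm_I, one_mul, norm_mul, Complex.norm_real, Real.norm_of_nonneg hs.1]
    set O := ‖osc (pairing X Y) μ ν (G (h⁻¹ • ζ)) (cpair (pd (dualFinBasis X i) a) b s t (r₁ ζ, r₂ ζ))‖
    have hO : 0 ≤ O := norm_nonneg _
    calc s * O * (h * θ₁ / japaneseBracket ζ) ^ p * (h * θ₂ / japaneseBracket ζ) ^ q
        ≤ h * O * (h * θ₁ / japaneseBracket ζ) ^ p * (h * θ₂ / japaneseBracket ζ) ^ q := by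
          have := hs.2
          gcongr
      _ = (japaneseBracket ζ / θ₁) * (O * (h * θ₁ / japaneseBracket ζ) ^ (p + 1) *
          (h * θ₂ / japaneseBracket ζ) ^ q) := by
          rw [pow_succ]
          field_simp
      _ ≤ (japaneseBracket ζ / θ₁) * (C * (A * θ₁ * ‖dualFinBasis X i‖) * B *
          japaneseBracket (h⁻¹ • ζ) ^ M * japaneseBracket ζ ^ (n - (1 : ℕ) - (0 : ℕ)) *
          (h * θ₁ * θ₂ / japaneseBracket ζ) ^ (max (p + 1) q)) := by gcongr
      _ = C * ‖dualFinBasis X i‖ * A * B * japaneseBracket (h⁻¹ • ζ) ^ M * japaneseBracket ζ ^ n *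
          (h * θ₁ * θ₂ / japaneseBracket ζ) ^ (max (p + 1) q) := by
          rw [Nat.cast_one, Nat.cast_zero, sub_zero, zpow_sub_one₀ hz0.ne']
          field_simp
      _ ≤ _ := by gcongr
  | mulY p q i hG ih =>
    rename_i G
    obtain ⟨κ, hκ⟩ := ih
    refine ⟨κ + 1, fun n₁ n₂ n hW => ?_⟩
    obtain ⟨C, hC0, hC⟩ := hκ _ _ _ (hW.shift 0 1)
    refine ⟨C * ‖dualFinBasis Y i‖, by positivity, fun {h θ₁ θ₂ A B a b} hr ha hb ζ s hs t ht => ?_⟩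
    have hA := ha.nonneg
    have hB := hb.nonneg
    have hh := hr.pos
    have h1 := hr.one_le_left
    have h2 := hr.one_le_right
    have hz := one_le_japaneseBracket ζ
    have jl := (one_pos.trans_le (one_le_japaneseBracket (h⁻¹ • ζ)))
    have hz0 : 0 < japaneseBracket ζ := by positivity
    have jz := zpow_pos hz0 n
    have b1 := hC hr (by simpa using ha.mono (Nat.le_succ κ))
      (by simpa using hb.pd (by positivity) (dualFinBasis Y i)) ζ s hs t ht
    have hg : h * θ₁ * θ₂ / japaneseBracket ζ ≤ 1 :=
      div_le_one_of_le₀ (hr.mul_le_one.trans hz) (by positivity)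
    have hg0 : 0 ≤ h * θ₁ * θ₂ / japaneseBracket ζ := by positivity
    have hmax : (h * θ₁ * θ₂ / japaneseBracket ζ) ^ (max p (q + 1)) ≤
        (h * θ₁ * θ₂ / japaneseBracket ζ) ^ (max p q) := pow_le_pow_of_le_one hg0 hg (by omega)
    rw [osc_coordY_mul μ ν hK (hG.testOn hβ _) ha.temperate hb.temperate, norm_mul, norm_neg,
      Complex.norm_I, one_mul, norm_mul, Complex.norm_real, Real.norm_of_nonneg ht.1]
    set O := ‖osc (pairing X Y) μ ν (G (h⁻¹ • ζ)) (cpair a (pd (dualFinBasis Y i) b) s t (r₁ ζ, r₂ ζ))‖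
    have hO : 0 ≤ O := norm_nonneg _
    calc t * O * (h * θ₁ / japaneseBracket ζ) ^ p * (h * θ₂ / japaneseBracket ζ) ^ q
        ≤ h * O * (h * θ₁ / japaneseBracket ζ) ^ p * (h * θ₂ / japaneseBracket ζ) ^ q := by
          have := ht.2
          gcongr
      _ = (japaneseBracket ζ / θ₂) * (O * (h * θ₁ / japaneseBracket ζ) ^ p *
          (h * θ₂ / japaneseBracket ζ) ^ (q + 1)) := by
          rw [pow_succ]
          field_simp
      _ ≤ (japaneseBracket ζ / θ₂) * (C * A * (B * θ₂ * ‖dualFinBasis Y i‖) *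
          japaneseBracket (h⁻¹ • ζ) ^ M * japaneseBracket ζ ^ (n - (0 : ℕ) - (1 : ℕ)) *
          (h * θ₁ * θ₂ / japaneseBracket ζ) ^ (max p (q + 1))) := by gcongr
      _ = C * ‖dualFinBasis Y i‖ * A * B * japaneseBracket (h⁻¹ • ζ) ^ M * japaneseBracket ζ ^ n *
          (h * θ₁ * θ₂ / japaneseBracket ζ) ^ (max p (q + 1)) := by
          rw [Nat.cast_one, Nat.cast_zero, sub_zero, zpow_sub_one₀ hz0.ne']
          field_simp
      _ ≤ _ := by gcongr
  | lam p q v hG ih =>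
    rename_i G
    obtain ⟨κ, hκ⟩ := ih
    refine ⟨κ, fun n₁ n₂ n hW => ?_⟩
    obtain ⟨C, hC0, hC⟩ := hκ _ _ _ hW
    refine ⟨C * ‖v‖, by positivity, fun {h θ₁ θ₂ A B a b} hr ha hb ζ s hs t ht => ?_⟩
    have hA := ha.nonneg
    have hB := hb.nonneg
    have hh := hr.pos
    have h1 := hr.one_le_left
    have h2 := hr.one_le_right
    have hz0 := japaneseBracket_pos ζ
    have b1 := hC hr ha hb ζ s hs t ht
    have hv : ‖(((h⁻¹ • ζ) v : ℝ) : ℂ)‖ ≤ japaneseBracket ζ / h * ‖v‖ := by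
      rw [Complex.norm_real]
      refine ((h⁻¹ • ζ).le_opNorm v).trans ?_
      gcongr
      rw [norm_smul, norm_inv, Real.norm_of_nonneg hh.le, inv_mul_eq_div]
      gcongr
      exact norm_le_japaneseBracket ζ
    rw [osc_const_mul_left, norm_mul, Nat.add_max_add_right]
    set O := ‖osc (pairing X Y) μ ν (G (h⁻¹ • ζ)) (cpair a b s t (r₁ ζ, r₂ ζ))‖
    have hO : 0 ≤ O := norm_nonneg _
    calc _ ≤ japaneseBracket ζ / h * ‖v‖ * O * (h * θ₁ / japaneseBracket ζ) ^ (p + 1) *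
          (h * θ₂ / japaneseBracket ζ) ^ (q + 1) := by gcongr
      _ = ‖v‖ * (O * (h * θ₁ / japaneseBracket ζ) ^ p * (h * θ₂ / japaneseBracket ζ) ^ q) *
          (h * θ₁ * θ₂ / japaneseBracket ζ) := by
          rw [pow_succ, pow_succ]
          field_simp
      _ ≤ ‖v‖ * (C * A * B * japaneseBracket (h⁻¹ • ζ) ^ M * japaneseBracket ζ ^ n *
          (h * θ₁ * θ₂ / japaneseBracket ζ) ^ (max p q)) *
          (h * θ₁ * θ₂ / japaneseBracket ζ) := by gcongr
      _ = _ := by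
          rw [pow_succ]
          ring
  | add hG hG' ih ih' =>
    obtain ⟨κ, hκ⟩ := ih
    obtain ⟨κ', hκ'⟩ := ih'
    refine ⟨max κ κ', fun n₁ n₂ n hW => ?_⟩
    obtain ⟨C, hC0, hC⟩ := hκ _ _ _ (hW.mono (le_max_left _ _))
    obtain ⟨C', hC0', hC'⟩ := hκ' _ _ _ (hW.mono (le_max_right _ _))
    refine ⟨C + C', by positivity, fun {h θ₁ θ₂ A B a b} hr ha hb ζ s hs t ht => ?_⟩
    have hh := hr.pos
    have h1 := hr.one_le_left
    have h2 := hr.one_le_right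
    have hz0 := japaneseBracket_pos ζ
    rw [osc_add_left _ μ ν pairing_injective hK (hG.testOn hβ _) (hG'.testOn hβ _)
      (cpair_temperate ha.temperate hb.temperate s t _)]
    have b1 := hC hr (ha.mono (le_max_left _ _)) (hb.mono (le_max_left _ _)) ζ s hs t ht
    have b2 := hC' hr (ha.mono (le_max_right _ _)) (hb.mono (le_max_right _ _)) ζ s hs t ht
    refine le_trans ?_ ((add_le_add b1 b2).trans (le_of_eq (by ring)))
    rw [← add_mul, ← add_mul]
    gcongr
    exact norm_add_le _ _

theorem SymBound.pds {D : Type*} [NormedAddCommGroup D] [NormedSpace ℝ D] {θ A : ℝ} {n : ℤ}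
    {κ : ℕ} {a : D → ℂ} (hθ : 0 ≤ θ) (l : List D) (h : SymBound θ A n (κ + l.length) a) :
    SymBound θ (A * θ ^ l.length * (l.map norm).prod) (n - l.length) κ (StarProduct.pds l a) := by
  induction l generalizing κ with
  | nil => simpa using h
  | cons v l ih =>
    have h1 := (ih (κ := κ + 1) (by simpa [add_assoc, add_comm 1] using h)).pd hθ v
    simp only [List.length_cons, List.map_cons, List.prod_cons, pds_cons]
    convert h1 using 1
    · rw [pow_succ]
      ring
    · push_cast
      ring

/-- The remainder of the expansion, as a function of `ζ`. -/
def remainder (β : X × Y → V) (f : X × Y → ℂ) (P : ℕ) (h : ℝ) (a : StrongDual ℝ X → ℂ)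
    (b : StrongDual ℝ Y → ℂ) (ζ : StrongDual ℝ V) : ℂ :=
  osc (pairing X Y) μ ν (amp f β (h⁻¹ • ζ)) (cpair a b h h (r₁ ζ, r₂ ζ)) -
    expansion (amp f β (h⁻¹ • ζ)) P h a b (r₁ ζ, r₂ ζ)

theorem prod_map_norm_nonneg {D : Type*} [NormedAddCommGroup D] (l : List D) :
    0 ≤ (l.map norm).prod := by
  induction l with
  | nil => simp
  | cons v l ih => simpa using mul_nonneg (norm_nonneg v) ih

/-- The pairings left by the two Taylor expansions have p derivatives on a and q on b with max p q =
P, against an amplitude of type `Good` for the same p and q. Differentiating the symbols supplies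
θ₁^p θ₂^q and ⟨ζ⟩^(-p-q), which together with h^(p+q) are the factors in `UnifBound`; the gain τ^P
remains. The loss ⟨h⁻¹ζ⟩^M does not depend on P. -/
theorem remainder_bound (hβ : ContDiff ℝ ∞ β) (hβ1 : ∀ x, β (x, 0) = 0)
    (hβ2 : ∀ y, β (0, y) = 0) (hK : IsCompact K) (hε : 0 < ε)
    (hM : Integrable (fun w : StrongDual ℝ X × StrongDual ℝ Y => ((1 + ‖w‖) ^ M)⁻¹) ν)
    (hdec : ∀ f, TestOn K f → ∀ N : ℕ, ∃ C : ℝ, 0 ≤ C ∧ ∀ (l : StrongDual ℝ V) w,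
      ‖fhat (pairing X Y) μ (amp f β l) w‖ ≤ C ∧
      (ε * ‖l‖ ≤ ‖w‖ → ‖fhat (pairing X Y) μ (amp f β l) w‖ * (1 + ‖w‖) ^ N ≤ C))
    (hinv : ∀ G : X × Y → ℂ, TestOn K G → ∫ w, fhat (pairing X Y) μ G w ∂ν = G 0)
    {f : X × Y → ℂ} (hf : TestOn K f) (P : ℕ) :
    ∃ κ, ∀ n₁ n₂ n : ℤ, WeightOK r₁ r₂ ε κ n₁ n₂ n → ∃ C : ℝ, 0 ≤ C ∧
      ∀ {h θ₁ θ₂ A B : ℝ} {a : StrongDual ℝ X → ℂ} {b : StrongDual ℝ Y → ℂ}, Regime h θ₁ θ₂ →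
        SymBound θ₁ A n₁ κ a → SymBound θ₂ B n₂ κ b → ∀ ζ : StrongDual ℝ V,
        ‖remainder μ ν r₁ r₂ β f P h a b ζ‖ ≤ C * A * B * japaneseBracket (h⁻¹ • ζ) ^ M *
          japaneseBracket ζ ^ n * (h * θ₁ * θ₂ / japaneseBracket ζ) ^ P := by
  have hgood : ∀ (p q : ℕ) (i : Fin p → Fin (Module.finrank ℝ X))
      (j : Fin q → Fin (Module.finrank ℝ Y)), ∃ κ, ∀ n₁ n₂ n : ℤ, WeightOK r₁ r₂ ε κ n₁ n₂ n →
      ∃ C : ℝ, 0 ≤ C ∧ UnifBound μ ν r₁ r₂ M n₁ n₂ n p q κ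
        (fun l => pds (dirY j) (pds (dirX i) (amp f β l))) C := fun p q i j =>
    (Good.pds_dir hβ hβ1 hβ2 hK hf i j).unifBound μ ν r₁ r₂ hβ hK hε hM hdec
  choose κ₀ hκ₀ using hgood
  -- One number of derivatives that serves all of the finitely many multi-indices. The extra P + P
  -- below accounts for the derivatives that the expansion itself puts on a and b.
  let κ₁ : ℕ := ∑ p ∈ Finset.range (P + 1), ∑ q ∈ Finset.range (P + 1),
    ∑ i : Fin p → Fin (Module.finrank ℝ X), ∑ j : Fin q → Fin (Module.finrank ℝ Y), κ₀ p q i j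
  have hκ₁ : ∀ p ≤ P, ∀ q ≤ P, ∀ i j, κ₀ p q i j ≤ κ₁ := by
    intro p hp q hq i j
    refine le_trans ?_ (Finset.single_le_sum (f := fun p => ∑ q ∈ Finset.range (P + 1),
      ∑ i : Fin p → Fin (Module.finrank ℝ X), ∑ j : Fin q → Fin (Module.finrank ℝ Y), κ₀ p q i j)
      (fun _ _ => Nat.zero_le _) (Finset.mem_range.2 (Nat.lt_succ_of_le hp)))
    refine le_trans ?_ (Finset.single_le_sum (f := fun q =>
      ∑ i : Fin p → Fin (Module.finrank ℝ X), ∑ j : Fin q → Fin (Module.finrank ℝ Y), κ₀ p q i j)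
      (fun _ _ => Nat.zero_le _) (Finset.mem_range.2 (Nat.lt_succ_of_le hq)))
    refine le_trans ?_ (Finset.single_le_sum (f := fun i =>
      ∑ j : Fin q → Fin (Module.finrank ℝ Y), κ₀ p q i j)
      (fun _ _ => Nat.zero_le _) (Finset.mem_univ i))
    exact Finset.single_le_sum (f := fun j => κ₀ p q i j)
      (fun _ _ => Nat.zero_le _) (Finset.mem_univ j)
  refine ⟨κ₁ + P + P, fun n₁ n₂ n hW => ?_⟩
  have hC₀ : ∀ (p q : ℕ) (i : Fin p → Fin (Module.finrank ℝ X))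
      (j : Fin q → Fin (Module.finrank ℝ Y)), ∃ C : ℝ, 0 ≤ C ∧ (p ≤ P → q ≤ P →
      UnifBound μ ν r₁ r₂ M (n₁ - p) (n₂ - q) (n - p - q) p q (κ₀ p q i j)
        (fun l => pds (dirY j) (pds (dirX i) (amp f β l))) C) := by
    intro p q i j
    by_cases hpq : p ≤ P ∧ q ≤ P
    · obtain ⟨C, h0, hC⟩ := hκ₀ p q i j _ _ _
        ((hW.mono (by have := hκ₁ p hpq.1 q hpq.2 i j; omega)).shift p q)
      exact ⟨C, h0, fun _ _ => hC⟩
    · exact ⟨0, le_rfl, fun h1 h2 => absurd ⟨h1, h2⟩ hpq⟩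
  choose C₀ hC₀0 hC₀ using hC₀
  let nd : ∀ (p q : ℕ) (i : Fin p → Fin (Module.finrank ℝ X)) (j : Fin q → Fin (Module.finrank ℝ Y)),
    ℝ := fun p q i j => C₀ p q i j * ((dirD i).map norm).prod * ((dirD j).map norm).prod
  have hnd : ∀ p q i j, 0 ≤ nd p q i j := fun p q i j =>
    mul_nonneg (mul_nonneg (hC₀0 p q i j) (prod_map_norm_nonneg _)) (prod_map_norm_nonneg _)
  let C₁ : ℝ := ∑ p ∈ Finset.range (P + 1), ∑ q ∈ Finset.range (P + 1),
    ∑ i : Fin p → Fin (Module.finrank ℝ X), ∑ j : Fin q → Fin (Module.finrank ℝ Y), nd p q i j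
  have hC₁ : ∀ p ≤ P, ∀ q ≤ P, ∀ i j, nd p q i j ≤ C₁ := by
    intro p hp q hq i j
    refine le_trans ?_ (Finset.single_le_sum (f := fun p => ∑ q ∈ Finset.range (P + 1),
      ∑ i : Fin p → Fin (Module.finrank ℝ X), ∑ j : Fin q → Fin (Module.finrank ℝ Y), nd p q i j)
      (fun _ _ => Finset.sum_nonneg fun _ _ => Finset.sum_nonneg fun _ _ =>
        Finset.sum_nonneg fun _ _ => hnd _ _ _ _) (Finset.mem_range.2 (Nat.lt_succ_of_le hp)))
    refine le_trans ?_ (Finset.single_le_sum (f := fun q =>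
      ∑ i : Fin p → Fin (Module.finrank ℝ X), ∑ j : Fin q → Fin (Module.finrank ℝ Y), nd p q i j)
      (fun _ _ => Finset.sum_nonneg fun _ _ =>
        Finset.sum_nonneg fun _ _ => hnd _ _ _ _) (Finset.mem_range.2 (Nat.lt_succ_of_le hq)))
    refine le_trans ?_ (Finset.single_le_sum (f := fun i =>
      ∑ j : Fin q → Fin (Module.finrank ℝ Y), nd p q i j)
      (fun _ _ => Finset.sum_nonneg fun _ _ => hnd _ _ _ _) (Finset.mem_univ i))
    exact Finset.single_le_sum (f := fun j => nd p q i j)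
      (fun _ _ => hnd _ _ _ _) (Finset.mem_univ j)
  have hC₁0 : 0 ≤ C₁ := Finset.sum_nonneg fun _ _ => Finset.sum_nonneg fun _ _ =>
    Finset.sum_nonneg fun _ _ => Finset.sum_nonneg fun _ _ => hnd _ _ _ _
  let c₂ : ℝ := (Fintype.card (Fin P → Fin (Module.finrank ℝ X))) +
        ∑ p ∈ Finset.range P, ∑ _i : Fin p → Fin (Module.finrank ℝ X),
          (Fintype.card (Fin P → Fin (Module.finrank ℝ Y)) : ℝ)
  have hc₂ : 0 ≤ c₂ := by positivity
  refine ⟨c₂ * C₁, by positivity, fun {h θ₁ θ₂ A B a b} hr ha hb ζ => ?_⟩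
  have hA := ha.nonneg
  have hB := hb.nonneg
  have hh := hr.pos
  have h1 := hr.one_le_left
  have h2 := hr.one_le_right
  have hz0 := japaneseBracket_pos ζ
  have jz := zpow_pos hz0 n
  have jl := (one_pos.trans_le (one_le_japaneseBracket (h⁻¹ • ζ)))
  have main := osc_sub_expansion_bound μ ν hK hinv (testOn_amp hβ hf (h⁻¹ • ζ)) ha.temperate
    hb.temperate P hr.pos (r₁ ζ, r₂ ζ) (C := C₁ * (A * B * japaneseBracket (h⁻¹ • ζ) ^ M *
      japaneseBracket ζ ^ n * (h * θ₁ * θ₂ / japaneseBracket ζ) ^ P)) (by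
    intro p q hpq i j s hs t ht
    have hp : p ≤ P := hpq ▸ le_max_left p q
    have hq : q ≤ P := hpq ▸ le_max_right p q
    have hk := hκ₁ p hp q hq i j
    have l1 : (dirD i).length = p := List.length_ofFn
    have l2 : (dirD j).length = q := List.length_ofFn
    have sa := SymBound.pds (κ := κ₀ p q i j) (by positivity) (dirD i)
      (ha.mono (by rw [l1]; omega))
    have sb := SymBound.pds (κ := κ₀ p q i j) (by positivity) (dirD j)
      (hb.mono (by rw [l2]; omega))
    rw [l1] at sa
    rw [l2] at sb
    have hb' := hC₀ p q i j hp hq hr sa sb ζ s hs t ht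
    set O := ‖osc (pairing X Y) μ ν (pds (dirY j) (pds (dirX i) (amp f β (h⁻¹ • ζ))))
      (cpair (pds (dirD i) a) (pds (dirD j) b) s t (r₁ ζ, r₂ ζ))‖
    rw [hpq] at hb'
    have e : h ^ (p + q) * O = (japaneseBracket ζ ^ (p + q) / (θ₁ ^ p * θ₂ ^ q)) *
        (O * (h * θ₁ / japaneseBracket ζ) ^ p * (h * θ₂ / japaneseBracket ζ) ^ q) := by
      rw [div_pow, div_pow, mul_pow, mul_pow, pow_add, pow_add]
      field_simp
    rw [e]
    calc _ ≤ _ := mul_le_mul_of_nonneg_left hb' (by positivity)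
      _ = nd p q i j * (A * B * japaneseBracket (h⁻¹ • ζ) ^ M *
          japaneseBracket ζ ^ n * (h * θ₁ * θ₂ / japaneseBracket ζ) ^ P) := by
          rw [zpow_sub₀ hz0.ne', zpow_sub₀ hz0.ne', zpow_natCast, zpow_natCast, pow_add]
          simp only [nd]
          field_simp
      _ ≤ _ := by
          gcongr
          exact hC₁ p hp q hq i j)
  refine main.trans (le_of_eq ?_)
  simp only [c₂, ← Finset.sum_mul]
  ring

end GoodBounds

end StarProduct

namespace StarProduct

open MeasureTheory

set_option linter.unusedSectionVars false

/-! ### Derivatives of the remainder of the expansion -/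

section RemainderDerivatives

variable {X Y V : Type*} [NormedAddCommGroup X] [NormedSpace ℝ X] [FiniteDimensional ℝ X]
  [NormedAddCommGroup Y] [NormedSpace ℝ Y] [FiniteDimensional ℝ Y]
  [NormedAddCommGroup V] [NormedSpace ℝ V] [FiniteDimensional ℝ V]

section

variable {K : Set (X × Y)} {β : X × Y → V}

theorem ampFamily_testOn (hβ : ContDiff ℝ ∞ β) {f : X × Y → ℂ} (hf : TestOn K f) (h : ℝ) :
    TestFamilyOn K fun q : StrongDual ℝ V × (X × Y) => amp f β (h⁻¹ • q.1) q.2 := by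
  refine ⟨(hf.smooth.comp contDiff_snd).mul (contDiff_cexp_I ?_), fun l z hz => ?_⟩
  · exact (contDiff_fst.const_smul h⁻¹).clm_apply (hβ.comp contDiff_snd)
  · simp [amp, hf.zero z hz]

/-- The amplitude `i v(β) f`, which arises from differentiating `f e^{i l(β)}` in `l`. -/
def phaseMul (β : X × Y → V) (v : StrongDual ℝ V) (f : X × Y → ℂ) (z : X × Y) : ℂ :=
  Complex.I * (v (β z) : ℝ) * f z

theorem phaseMul_testOn (hβ : ContDiff ℝ ∞ β) {f : X × Y → ℂ} (hf : TestOn K f)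
    (v : StrongDual ℝ V) : TestOn K (phaseMul β v f) :=
  hf.mul_left' (contDiff_const.mul (Complex.ofRealCLM.contDiff.comp (v.contDiff.comp hβ)))

theorem pd_ampFamily (hβ : ContDiff ℝ ∞ β) {f : X × Y → ℂ} (hf : TestOn K f) (h : ℝ)
    (v : StrongDual ℝ V) :
    pd (v, 0) (fun q : StrongDual ℝ V × (X × Y) => amp f β (h⁻¹ • q.1) q.2) =
      fun q => (h : ℂ)⁻¹ * amp (phaseMul β v f) β (h⁻¹ • q.1) q.2 := by
  funext q
  obtain ⟨l, z⟩ := q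
  have h1 : HasDerivAt (fun t : ℝ => (l + t • v, z)) (v, (0 : X × Y)) 0 := by
    simpa using (((hasDerivAt_id (0 : ℝ)).smul_const v).const_add l).prodMk
      (hasDerivAt_const (0 : ℝ) z)
  have h2 := (differentiable_of_smooth (ampFamily_testOn hβ hf h).smooth
    (l + (0 : ℝ) • v, z)).hasFDerivAt.comp_hasDerivAt (0 : ℝ) h1
  have h3 : HasDerivAt (fun t : ℝ => amp f β (h⁻¹ • (l + t • v)) z)
      ((h : ℂ)⁻¹ * amp (phaseMul β v f) β (h⁻¹ • l) z) 0 := by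
    have e : HasDerivAt (fun t : ℝ => (h⁻¹ • (l + t • v)) (β z)) (h⁻¹ * v (β z)) 0 := by
      have : HasDerivAt (fun t : ℝ => h⁻¹ * (l (β z) + t * v (β z))) (h⁻¹ * (1 * v (β z))) 0 :=
        (((hasDerivAt_id (0 : ℝ)).mul_const (v (β z))).const_add (l (β z))).const_mul h⁻¹
      exact this.congr_deriv (by ring)
    have e2 := ((e.ofReal_comp.const_mul Complex.I).cexp).const_mul (f z)
    refine e2.congr_deriv ?_
    simp only [amp, phaseMul, zero_smul, add_zero]
    push_cast
    ring
  have h4 := h2.unique h3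
  simpa [pd] using h4

theorem pds_section {Λ Z : Type*} [NormedAddCommGroup Λ] [NormedSpace ℝ Λ] [NormedAddCommGroup Z]
    [NormedSpace ℝ Z] {H : Λ × Z → ℂ} (hH : ContDiff ℝ ∞ H) (l : List Z) (x : Λ) (z : Z) :
    pds l (fun z => H (x, z)) z = pds (l.map fun z => ((0 : Λ), z)) H (x, z) := by
  have := congrFun (pds_comp_affine hH (ContinuousLinearMap.inr ℝ Λ Z) (x, 0) l) z
  simp only [ContinuousLinearMap.inr_apply, Prod.mk_add_mk, zero_add, add_zero] at this
  exact this

/-- The derivatives at the origin of the amplitude, as functions of the phase parameter. -/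
def ampJet (β : X × Y → V) (f : X × Y → ℂ) (h : ℝ) (l : List (X × Y)) (ζ : StrongDual ℝ V) : ℂ :=
  pds l (amp f β (h⁻¹ • ζ)) 0

theorem ampJet_eq (hβ : ContDiff ℝ ∞ β) {f : X × Y → ℂ} (hf : TestOn K f) (h : ℝ)
    (l : List (X × Y)) : ampJet β f h l = fun ζ =>
      pds (l.map fun z => ((0 : StrongDual ℝ V), z)) (fun q => amp f β (h⁻¹ • q.1) q.2) (ζ, 0) := by
  funext ζ
  exact pds_section (ampFamily_testOn hβ hf h).smooth l ζ 0

theorem ampJet_smooth (hβ : ContDiff ℝ ∞ β) {f : X × Y → ℂ} (hf : TestOn K f) (h : ℝ)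
    (l : List (X × Y)) : ContDiff ℝ ∞ (ampJet β f h l) := by
  rw [ampJet_eq hβ hf]
  exact (ContDiff.pds (ampFamily_testOn hβ hf h).smooth _).comp (contDiff_id.prodMk contDiff_const)

theorem pd_ampJet (hβ : ContDiff ℝ ∞ β) {f : X × Y → ℂ} (hf : TestOn K f) (h : ℝ)
    (l : List (X × Y)) (v : StrongDual ℝ V) :
    pd v (ampJet β f h l) = fun ζ => (h : ℂ)⁻¹ * ampJet β (phaseMul β v f) h l ζ := by
  have hs := (ampFamily_testOn hβ hf h).smooth
  have hs' := (ampFamily_testOn hβ (phaseMul_testOn hβ hf v) h).smooth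
  have e := pd_comp_clm (ContDiff.pds hs (l.map fun z => ((0 : StrongDual ℝ V), z)))
    (ContinuousLinearMap.inl ℝ (StrongDual ℝ V) (X × Y)) v
  rw [ampJet_eq hβ hf, ampJet_eq hβ (phaseMul_testOn hβ hf v)]
  refine e.trans ?_
  funext ζ
  rw [ContinuousLinearMap.inl_apply, ← pds_pd hs, pd_ampFamily hβ hf,
    pds_const_mul hs']
  rfl

end

theorem expansion_eq (β : X × Y → V) (f : X × Y → ℂ) (P : ℕ) (h : ℝ) (a : StrongDual ℝ X → ℂ)
    (b : StrongDual ℝ Y → ℂ) (ζ : StrongDual ℝ V) (ζ' : StrongDual ℝ X × StrongDual ℝ Y) :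
    expansion (amp f β (h⁻¹ • ζ)) P h a b ζ' = ∑ p ∈ Finset.range P, ∑ q ∈ Finset.range P,
      ∑ i : Fin p → Fin (Module.finrank ℝ X), ∑ j : Fin q → Fin (Module.finrank ℝ Y),
      (-Complex.I) ^ (p + q) * (h : ℂ) ^ (p + q) / ((p.factorial : ℂ) * (q.factorial : ℂ)) *
      (ampJet β f h (dirY j ++ dirX i) ζ * (pds (dirD i) a ζ'.1 * pds (dirD j) b ζ'.2)) := by
  unfold expansion ampJet
  simp only [pds_append, Finset.mul_sum, mul_assoc]

section Generic

variable {D₁ D₂ Λ : Type*} [NormedAddCommGroup D₁] [NormedSpace ℝ D₁]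
  [NormedAddCommGroup D₂] [NormedSpace ℝ D₂] [NormedAddCommGroup Λ] [NormedSpace ℝ Λ]
  (r₁ : Λ →L[ℝ] D₁) (r₂ : Λ →L[ℝ] D₂) {a : D₁ → ℂ} {b : D₂ → ℂ}

theorem cpair_family_temperate (ha : a.HasTemperateGrowth) (hb : b.HasTemperateGrowth) (h : ℝ) :
    Function.HasTemperateGrowth fun q : Λ × (D₁ × D₂) => cpair a b h h (r₁ q.1, r₂ q.1) q.2 := by
  have h1 := ha.comp (r₁.comp (ContinuousLinearMap.fst ℝ Λ (D₁ × D₂)) +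
    h • (ContinuousLinearMap.fst ℝ D₁ D₂).comp (ContinuousLinearMap.snd ℝ Λ _)).hasTemperateGrowth
  have h2 := hb.comp (r₂.comp (ContinuousLinearMap.fst ℝ Λ (D₁ × D₂)) +
    h • (ContinuousLinearMap.snd ℝ D₁ D₂).comp (ContinuousLinearMap.snd ℝ Λ _)).hasTemperateGrowth
  exact h1.fun_mul h2

theorem pd_cpair_family (ha : ContDiff ℝ ∞ a) (hb : ContDiff ℝ ∞ b) (h : ℝ) (v : Λ) :
    pd (v, 0) (fun q : Λ × (D₁ × D₂) => cpair a b h h (r₁ q.1, r₂ q.1) q.2) =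
      fun q => cpair (pd (r₁ v) a) b h h (r₁ q.1, r₂ q.1) q.2 +
        cpair a (pd (r₂ v) b) h h (r₁ q.1, r₂ q.1) q.2 := by
  let A₁ := r₁.comp (ContinuousLinearMap.fst ℝ Λ (D₁ × D₂)) +
    h • (ContinuousLinearMap.fst ℝ D₁ D₂).comp (ContinuousLinearMap.snd ℝ Λ _)
  let A₂ := r₂.comp (ContinuousLinearMap.fst ℝ Λ (D₁ × D₂)) +
    h • (ContinuousLinearMap.snd ℝ D₁ D₂).comp (ContinuousLinearMap.snd ℝ Λ _)
  have h1 := pd_comp_clm ha A₁ (v, 0)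
  have h2 := pd_comp_clm hb A₂ (v, 0)
  have h3 := pd_mul (ha.comp A₁.contDiff) (hb.comp A₂.contDiff) (v, 0)
  simp only [Function.comp_def] at h3
  rw [h1, h2] at h3
  refine h3.trans ?_
  funext q
  simp [A₁, A₂, cpair]

theorem pd_mul_comp (ha : ContDiff ℝ ∞ a) (hb : ContDiff ℝ ∞ b) {J : Λ → ℂ} (hJ : ContDiff ℝ ∞ J)
    (v : Λ) : pd v (fun ζ => J ζ * (a (r₁ ζ) * b (r₂ ζ))) = fun ζ =>
      J ζ * (pd (r₁ v) a (r₁ ζ) * b (r₂ ζ)) + J ζ * (a (r₁ ζ) * pd (r₂ v) b (r₂ ζ)) +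
        pd v J ζ * (a (r₁ ζ) * b (r₂ ζ)) := by
  have ha' : ContDiff ℝ ∞ fun ζ => a (r₁ ζ) := ha.comp r₁.contDiff
  have hb' : ContDiff ℝ ∞ fun ζ => b (r₂ ζ) := hb.comp r₂.contDiff
  rw [pd_mul hJ (ha'.mul hb'), pd_mul ha' hb', pd_comp_clm ha r₁, pd_comp_clm hb r₂]
  funext ζ
  ring

end Generic

variable [MeasurableSpace X] [BorelSpace X] [MeasurableSpace Y] [BorelSpace Y]
  (μ : Measure (X × Y)) [μ.IsAddHaarMeasure]
  (ν : Measure (StrongDual ℝ X × StrongDual ℝ Y)) [ν.IsAddHaarMeasure]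
  (r₁ : StrongDual ℝ V →L[ℝ] StrongDual ℝ X) (r₂ : StrongDual ℝ V →L[ℝ] StrongDual ℝ Y)
  {K : Set (X × Y)} {β : X × Y → V} {a : StrongDual ℝ X → ℂ} {b : StrongDual ℝ Y → ℂ}

theorem osc_family_smooth (hβ : ContDiff ℝ ∞ β) (hK : IsCompact K) {f : X × Y → ℂ}
    (hf : TestOn K f) (ha : a.HasTemperateGrowth) (hb : b.HasTemperateGrowth) (h : ℝ) :
    ContDiff ℝ ∞ fun ζ => osc (pairing X Y) μ ν (amp f β (h⁻¹ • ζ)) (cpair a b h h (r₁ ζ, r₂ ζ)) :=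
  smooth_osc (pairing X Y) μ ν pairing_injective hK (cpair_family_temperate r₁ r₂ ha hb h)
    (ampFamily_testOn hβ hf h)

theorem pd_osc_family (hβ : ContDiff ℝ ∞ β) (hK : IsCompact K) {f : X × Y → ℂ}
    (hf : TestOn K f) (ha : a.HasTemperateGrowth) (hb : b.HasTemperateGrowth) (h : ℝ)
    (v : StrongDual ℝ V) :
    pd v (fun ζ => osc (pairing X Y) μ ν (amp f β (h⁻¹ • ζ)) (cpair a b h h (r₁ ζ, r₂ ζ))) =
      fun ζ =>
      osc (pairing X Y) μ ν (amp f β (h⁻¹ • ζ)) (cpair (pd (r₁ v) a) b h h (r₁ ζ, r₂ ζ)) +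
      osc (pairing X Y) μ ν (amp f β (h⁻¹ • ζ)) (cpair a (pd (r₂ v) b) h h (r₁ ζ, r₂ ζ)) +
      (h : ℂ)⁻¹ * osc (pairing X Y) μ ν (amp (phaseMul β v f) β (h⁻¹ • ζ))
        (cpair a b h h (r₁ ζ, r₂ ζ)) := by
  funext ζ
  have h1 := (hasFDerivAt_osc (pairing X Y) μ ν pairing_injective hK
    (cpair_family_temperate r₁ r₂ ha hb h) (ampFamily_testOn hβ hf h) ζ).2 v
  rw [pd_ampFamily hβ hf, pd_cpair_family r₁ r₂ ha.1 hb.1] at h1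
  have h2 : ∀ l, TestOn K (amp f β l) := fun l => testOn_amp hβ hf l
  have h3 := osc_add_right (pairing X Y) μ ν pairing_injective hK (h2 (h⁻¹ • ζ))
    (cpair_temperate (temperate_pd ha (r₁ v)) hb h h (r₁ ζ, r₂ ζ))
    (cpair_temperate ha (temperate_pd hb (r₂ v)) h h (r₁ ζ, r₂ ζ))
  have h4 := osc_const_mul_left (pairing X Y) μ ν (h : ℂ)⁻¹ (amp (phaseMul β v f) β (h⁻¹ • ζ))
    (cpair a b h h (r₁ ζ, r₂ ζ))
  exact h1.trans (congrArg₂ (· + ·) h3 h4)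

theorem expansion_smooth (hβ : ContDiff ℝ ∞ β) {f : X × Y → ℂ}
    (hf : TestOn K f) (ha : ContDiff ℝ ∞ a) (hb : ContDiff ℝ ∞ b) (P : ℕ) (h : ℝ) :
    ContDiff ℝ ∞ fun ζ => expansion (amp f β (h⁻¹ • ζ)) P h a b (r₁ ζ, r₂ ζ) := by
  simp only [expansion_eq]
  refine ContDiff.sum fun p _ => ContDiff.sum fun q _ => ContDiff.sum fun i _ =>
    ContDiff.sum fun j _ => contDiff_const.mul ((ampJet_smooth hβ hf h _).mul
      (((ContDiff.pds ha _).comp r₁.contDiff).mul ((ContDiff.pds hb _).comp r₂.contDiff)))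

theorem pd_expansion (hβ : ContDiff ℝ ∞ β) {f : X × Y → ℂ}
    (hf : TestOn K f) (ha : ContDiff ℝ ∞ a) (hb : ContDiff ℝ ∞ b) (P : ℕ) (h : ℝ)
    (v : StrongDual ℝ V) :
    pd v (fun ζ => expansion (amp f β (h⁻¹ • ζ)) P h a b (r₁ ζ, r₂ ζ)) = fun ζ =>
      expansion (amp f β (h⁻¹ • ζ)) P h (pd (r₁ v) a) b (r₁ ζ, r₂ ζ) +
      expansion (amp f β (h⁻¹ • ζ)) P h a (pd (r₂ v) b) (r₁ ζ, r₂ ζ) +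
      (h : ℂ)⁻¹ * expansion (amp (phaseMul β v f) β (h⁻¹ • ζ)) P h a b (r₁ ζ, r₂ ζ) := by
  simp only [expansion_eq]
  have hsm : ∀ (p q : ℕ) (i : Fin p → Fin (Module.finrank ℝ X))
      (j : Fin q → Fin (Module.finrank ℝ Y)), ContDiff ℝ ∞ fun ζ => ampJet β f h (dirY j ++ dirX i) ζ *
      (pds (dirD i) a (r₁ ζ) * pds (dirD j) b (r₂ ζ)) := fun p q i j =>
    (ampJet_smooth hβ hf h _).mul
      (((ContDiff.pds ha _).comp r₁.contDiff).mul ((ContDiff.pds hb _).comp r₂.contDiff))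
  rw [pd_sum _ fun p => ContDiff.sum fun q _ => ContDiff.sum fun i _ =>
    ContDiff.sum fun j _ => contDiff_const.mul (hsm p q i j)]
  funext ζ
  rw [Finset.mul_sum, ← Finset.sum_add_distrib, ← Finset.sum_add_distrib]
  refine Finset.sum_congr rfl fun p _ => ?_
  rw [pd_sum _ fun q => ContDiff.sum fun i _ =>
    ContDiff.sum fun j _ => contDiff_const.mul (hsm p q i j)]
  rw [Finset.mul_sum, ← Finset.sum_add_distrib, ← Finset.sum_add_distrib]
  refine Finset.sum_congr rfl fun q _ => ?_
  rw [pd_sum _ fun i => ContDiff.sum fun j _ => contDiff_const.mul (hsm p q i j)]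
  rw [Finset.mul_sum, ← Finset.sum_add_distrib, ← Finset.sum_add_distrib]
  refine Finset.sum_congr rfl fun i _ => ?_
  rw [pd_sum _ fun j => contDiff_const.mul (hsm p q i j)]
  rw [Finset.mul_sum, ← Finset.sum_add_distrib, ← Finset.sum_add_distrib]
  refine Finset.sum_congr rfl fun j _ => ?_
  rw [pd_const_mul (hsm p q i j), pd_mul_comp r₁ r₂ (ContDiff.pds ha _) (ContDiff.pds hb _)
    (ampJet_smooth hβ hf h _), pd_ampJet hβ hf, pds_pd ha, pds_pd hb]
  ring

theorem remainder_smooth (hβ : ContDiff ℝ ∞ β) (hK : IsCompact K) {f : X × Y → ℂ}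
    (hf : TestOn K f) (ha : a.HasTemperateGrowth) (hb : b.HasTemperateGrowth) (P : ℕ) (h : ℝ) :
    ContDiff ℝ ∞ (remainder μ ν r₁ r₂ β f P h a b) :=
  (osc_family_smooth μ ν r₁ r₂ hβ hK hf ha hb h).sub (expansion_smooth r₁ r₂ hβ hf ha.1 hb.1 P h)

/-- The derivative falls on a, on b or on the phase. Each time the pairing and its expansion change
in the same way, so the result is the remainder of the same order P for new data, and estimates that
are uniform in the data pass to derivatives. -/
theorem pd_remainder (hβ : ContDiff ℝ ∞ β) (hK : IsCompact K) {f : X × Y → ℂ}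
    (hf : TestOn K f) (ha : a.HasTemperateGrowth) (hb : b.HasTemperateGrowth) (P : ℕ) (h : ℝ)
    (v : StrongDual ℝ V) :
    pd v (remainder μ ν r₁ r₂ β f P h a b) = fun ζ =>
      remainder μ ν r₁ r₂ β f P h (pd (r₁ v) a) b ζ +
      remainder μ ν r₁ r₂ β f P h a (pd (r₂ v) b) ζ +
      (h : ℂ)⁻¹ * remainder μ ν r₁ r₂ β (phaseMul β v f) P h a b ζ := by
  have e1 := osc_family_smooth μ ν r₁ r₂ hβ hK hf ha hb h
  have e2 := expansion_smooth r₁ r₂ hβ hf ha.1 hb.1 P h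
  have e3 : pd v (remainder μ ν r₁ r₂ β f P h a b) = fun ζ =>
      pd v (fun ζ => osc (pairing X Y) μ ν (amp f β (h⁻¹ • ζ)) (cpair a b h h (r₁ ζ, r₂ ζ))) ζ -
      pd v (fun ζ => expansion (amp f β (h⁻¹ • ζ)) P h a b (r₁ ζ, r₂ ζ)) ζ := by
    funext ζ
    have := fderiv_fun_sub (differentiable_of_smooth e1 ζ) (differentiable_of_smooth e2 ζ)
    exact congrArg (fun T => T v) this
  rw [e3, pd_osc_family μ ν r₁ r₂ hβ hK hf ha hb, pd_expansion r₁ r₂ hβ hf ha.1 hb.1]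
  funext ζ
  simp only [remainder]
  ring

variable {ε : ℝ} {M : ℕ}

/-- By induction through `pd_remainder`. A derivative of a symbol costs θ₁ or θ₂, which are at most
h⁻¹ in the regime considered, and one of the phase costs h⁻¹. The improvement in the order from
differentiating a symbol is discarded: the decay in ζ is recovered later from large P. -/
theorem pds_remainder_bound (hβ : ContDiff ℝ ∞ β) (hβ1 : ∀ x, β (x, 0) = 0)
    (hβ2 : ∀ y, β (0, y) = 0) (hK : IsCompact K) (hε : 0 < ε)
    (hM : Integrable (fun w : StrongDual ℝ X × StrongDual ℝ Y => ((1 + ‖w‖) ^ M)⁻¹) ν)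
    (hdec : ∀ f, TestOn K f → ∀ N : ℕ, ∃ C : ℝ, 0 ≤ C ∧ ∀ (l : StrongDual ℝ V) w,
      ‖fhat (pairing X Y) μ (amp f β l) w‖ ≤ C ∧
      (ε * ‖l‖ ≤ ‖w‖ → ‖fhat (pairing X Y) μ (amp f β l) w‖ * (1 + ‖w‖) ^ N ≤ C))
    (hinv : ∀ G : X × Y → ℂ, TestOn K G → ∫ w, fhat (pairing X Y) μ G w ∂ν = G 0)
    (P : ℕ) (l : List (StrongDual ℝ V)) {f : X × Y → ℂ} (hf : TestOn K f) :
    ∃ κ, ∀ n₁ n₂ n : ℤ, WeightOK r₁ r₂ ε κ n₁ n₂ n → ∃ C : ℝ, 0 ≤ C ∧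
      ∀ {h θ₁ θ₂ A B : ℝ} {a : StrongDual ℝ X → ℂ} {b : StrongDual ℝ Y → ℂ}, Regime h θ₁ θ₂ →
        SymBound θ₁ A n₁ κ a → SymBound θ₂ B n₂ κ b → ∀ ζ : StrongDual ℝ V,
        ‖pds l (remainder μ ν r₁ r₂ β f P h a b) ζ‖ ≤ C * A * B * h⁻¹ ^ l.length *
          (japaneseBracket (h⁻¹ • ζ) ^ M * japaneseBracket ζ ^ n *
          (h * θ₁ * θ₂ / japaneseBracket ζ) ^ P) := by
  induction l generalizing f with
  | nil =>
    obtain ⟨κ, hκ⟩ := remainder_bound μ ν r₁ r₂ hβ hβ1 hβ2 hK hε hM hdec hinv hf P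
    refine ⟨κ, fun n₁ n₂ n hW => ?_⟩
    obtain ⟨C, h0, hC⟩ := hκ n₁ n₂ n hW
    refine ⟨C, h0, fun {h θ₁ θ₂ A B a b} hr ha hb ζ => (hC hr ha hb ζ).trans (le_of_eq ?_)⟩
    simp only [List.length_nil, pow_zero]
    ring
  | cons v l ih =>
    obtain ⟨κ₁, hκ₁⟩ := ih hf
    obtain ⟨κ₂, hκ₂⟩ := ih (phaseMul_testOn hβ hf v)
    refine ⟨κ₁ + 1 + κ₂, fun n₁ n₂ n hW => ?_⟩
    obtain ⟨C₁, h1, hC₁⟩ := hκ₁ _ _ _ ((hW.mono (by omega)).shift 1 0)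
    obtain ⟨C₂, h2, hC₂⟩ := hκ₁ _ _ _ ((hW.mono (by omega)).shift 0 1)
    obtain ⟨C₃, h3, hC₃⟩ := hκ₂ _ _ _ (hW.mono (by omega))
    refine ⟨C₁ * ‖r₁ v‖ + C₂ * ‖r₂ v‖ + C₃, by positivity, fun {h θ₁ θ₂ A B a b} hr ha hb ζ => ?_⟩
    have hA := ha.nonneg
    have hB := hb.nonneg
    have hh := hr.pos
    have t1 := hr.one_le_left
    have t2 := hr.one_le_right
    have hz0 := japaneseBracket_pos ζ
    have hz := one_le_japaneseBracket ζ
    have jl := (one_pos.trans_le (one_le_japaneseBracket (h⁻¹ • ζ)))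
    have jz := zpow_pos hz0 n
    have jn : japaneseBracket ζ ^ (n - 1) ≤ japaneseBracket ζ ^ n :=
      zpow_le_zpow_right₀ hz (by omega)
    have jn0 := zpow_pos hz0 (n - 1)
    have hθ₁ : θ₁ ≤ h⁻¹ := by
      rw [← one_div, le_div_iff₀ hh]
      refine le_trans ?_ hr.mul_le_one
      calc θ₁ * h = h * θ₁ * 1 := by ring
        _ ≤ _ := by gcongr
    have hθ₂ : θ₂ ≤ h⁻¹ := by
      rw [← one_div, le_div_iff₀ hh]
      refine le_trans ?_ hr.mul_le_one
      calc θ₂ * h = h * 1 * θ₂ := by ring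
        _ ≤ _ := by gcongr
    have sa : SymBound θ₁ (A * θ₁ * ‖r₁ v‖) (n₁ - (1 : ℕ)) κ₁ (StarProduct.pd (r₁ v) a) := by
      simpa using (ha.mono (show κ₁ + 1 ≤ κ₁ + 1 + κ₂ by omega)).pd (by positivity) (r₁ v)
    have sb : SymBound θ₂ (B * θ₂ * ‖r₂ v‖) (n₂ - (1 : ℕ)) κ₁ (StarProduct.pd (r₂ v) b) := by
      simpa using (hb.mono (show κ₁ + 1 ≤ κ₁ + 1 + κ₂ by omega)).pd (by positivity) (r₂ v)
    have b1 := hC₁ hr sa (by simpa using hb.mono (show κ₁ ≤ _ by omega)) ζ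
    have b2 := hC₂ hr (by simpa using ha.mono (show κ₁ ≤ _ by omega)) sb ζ
    have b3 := hC₃ hr (ha.mono (by omega)) (hb.mono (by omega)) ζ
    have sm := remainder_smooth μ ν r₁ r₂ hβ hK hf ha.temperate hb.temperate P h
    have sm1 := remainder_smooth μ ν r₁ r₂ hβ hK hf sa.temperate hb.temperate P h
    have sm2 := remainder_smooth μ ν r₁ r₂ hβ hK hf ha.temperate sb.temperate P h
    have sm3 := remainder_smooth μ ν r₁ r₂ hβ hK (phaseMul_testOn hβ hf v) ha.temperate
      hb.temperate P h
    rw [pds_cons, ← pds_pd sm, pd_remainder μ ν r₁ r₂ hβ hK hf ha.temperate hb.temperate,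
      pds_add (sm1.add sm2) (contDiff_const.mul sm3), pds_add sm1 sm2, pds_const_mul sm3]
    set Q := japaneseBracket (h⁻¹ • ζ) ^ M * japaneseBracket ζ ^ n *
          (h * θ₁ * θ₂ / japaneseBracket ζ) ^ P
    have hQ : 0 ≤ Q := by positivity
    have hQ' : japaneseBracket (h⁻¹ • ζ) ^ M * japaneseBracket ζ ^ (n - 1) *
          (h * θ₁ * θ₂ / japaneseBracket ζ) ^ P ≤ Q := by
      simp only [Q]
      gcongr
    simp only [Nat.cast_one, Nat.cast_zero, sub_zero] at b1 b2
    refine (norm_add_le _ _).trans (le_trans (add_le_add (norm_add_le _ _) le_rfl) ?_)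
    have c1 : C₁ * (A * θ₁ * ‖r₁ v‖) * B * h⁻¹ ^ l.length * (japaneseBracket (h⁻¹ • ζ) ^ M *
        japaneseBracket ζ ^ (n - 1) * (h * θ₁ * θ₂ / japaneseBracket ζ) ^ P) ≤
        C₁ * (A * h⁻¹ * ‖r₁ v‖) * B * h⁻¹ ^ l.length * Q := by gcongr
    have c2 : C₂ * A * (B * θ₂ * ‖r₂ v‖) * h⁻¹ ^ l.length * (japaneseBracket (h⁻¹ • ζ) ^ M *
        japaneseBracket ζ ^ (n - 1) * (h * θ₁ * θ₂ / japaneseBracket ζ) ^ P) ≤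
        C₂ * A * (B * h⁻¹ * ‖r₂ v‖) * h⁻¹ ^ l.length * Q := by gcongr
    have c3 : ‖(h : ℂ)⁻¹ * pds l (remainder μ ν r₁ r₂ β (phaseMul β v f) P h a b) ζ‖ ≤
        h⁻¹ * (C₃ * A * B * h⁻¹ ^ l.length * Q) := by
      rw [norm_mul, norm_inv, Complex.norm_real, Real.norm_of_nonneg hh.le]
      gcongr
    refine (add_le_add (add_le_add (b1.trans c1) (b2.trans c2)) c3).trans (le_of_eq ?_)
    rw [List.length_cons, pow_succ]
    ring

end RemainderDerivatives

theorem exists_norm_multilinear_le {D ι : Type*} [NormedAddCommGroup D] [NormedSpace ℝ D]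
    [FiniteDimensional ℝ D] [Fintype ι] (bs : Module.Basis ι ℝ D) (k : ℕ) :
    ∃ C : ℝ, 0 ≤ C ∧ ∀ (T : D [×k]→L[ℝ] ℂ) (S : ℝ), (∀ i : Fin k → ι, ‖T fun j => bs (i j)‖ ≤ S) →
      ‖T‖ ≤ C * S := by
  classical
  let c : ℝ := ∑ i, ‖LinearMap.toContinuousLinearMap (bs.coord i)‖
  have hc : ∀ i x, |bs.repr x i| ≤ c * ‖x‖ := by
    intro i x
    refine ((LinearMap.toContinuousLinearMap (bs.coord i)).le_opNorm x).trans ?_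
    gcongr
    exact Finset.single_le_sum (f := fun i => ‖LinearMap.toContinuousLinearMap (bs.coord i)‖)
      (fun _ _ => norm_nonneg _) (Finset.mem_univ i)
  have hc0 : 0 ≤ c := Finset.sum_nonneg fun _ _ => norm_nonneg _
  refine ⟨Fintype.card (Fin k → ι) * c ^ k, by positivity, fun T S hS => ?_⟩
  by_cases hne : Nonempty (Fin k → ι)
  · have hS0 : 0 ≤ S := (norm_nonneg _).trans (hS hne.some)
    refine ContinuousMultilinearMap.opNorm_le_bound (by positivity) fun m => ?_
    have e : T m = ∑ i : Fin k → ι, T fun j => bs.repr (m j) (i j) • bs (i j) := by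
      conv_lhs => rw [show m = fun j => ∑ i, bs.repr (m j) i • bs i from
        funext fun j => (bs.sum_repr (m j)).symm]
      exact T.toMultilinearMap.map_sum _
    rw [e]
    calc _ ≤ ∑ _i : Fin k → ι, c ^ k * S * ∏ j, ‖m j‖ := by
          refine norm_sum_le_of_le _ fun i _ => ?_
          rw [T.map_smul_univ, norm_smul, norm_prod]
          calc _ ≤ (∏ j, (c * ‖m j‖)) * S := by
                gcongr
                · exact hc _ _
                · exact hS i
            _ = _ := by
              rw [Finset.prod_mul_distrib, Finset.prod_const, Finset.card_univ, Fintype.card_fin]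
              ring
      _ = _ := by
        rw [Finset.sum_const, nsmul_eq_mul, Finset.card_univ]
        ring
  -- The basis is empty and k is positive: T is then an empty sum.
  · have : IsEmpty (Fin k → ι) := not_nonempty_iff.1 hne
    have hT : T = 0 := by
      ext m
      have e : T m = ∑ i : Fin k → ι, T fun j => bs.repr (m j) (i j) • bs (i j) := by
        conv_lhs => rw [show m = fun j => ∑ i, bs.repr (m j) i • bs i from
          funext fun j => (bs.sum_repr (m j)).symm]
        exact T.toMultilinearMap.map_sum _
      simpa using e
    simp [hT]

end StarProduct

namespace StarProduct

open MeasureTheory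

set_option linter.unusedSectionVars false

/-! ### The terms of the expansion -/

section Vanishing

variable {Z A : Type*} [NormedAddCommGroup Z] [NormedSpace ℝ Z] [NormedAddCommGroup A]
  [NormedSpace ℝ A]

/-- The function `F` vanishes to order `r` along the kernel of `T`. -/
def VanishesAlong (T : Z →L[ℝ] A) (r : ℕ) (F : Z → ℂ) : Prop :=
  ∀ l : List Z, l.length < r → ∀ z, T z = 0 → pds l F z = 0

variable {T : Z →L[ℝ] A}

theorem VanishesAlong.pd {r : ℕ} {F : Z → ℂ} (hF : ContDiff ℝ ∞ F) (h : VanishesAlong T r F)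
    (v : Z) : VanishesAlong T (r - 1) (pd v F) := by
  intro l hl z hz
  rw [pds_pd hF, ← pds_cons]
  exact h (v :: l) (by simp; omega) z hz

theorem VanishesAlong.mul {r s : ℕ} {F G : Z → ℂ} (hF : ContDiff ℝ ∞ F) (hG : ContDiff ℝ ∞ G)
    (h : VanishesAlong T r F) (h' : VanishesAlong T s G) :
    VanishesAlong T (r + s) fun z => F z * G z := by
  intro l
  induction l generalizing r s F G with
  | nil =>
    intro hl z hz
    rcases Nat.eq_zero_or_pos r with h0 | h0
    · have := h' [] (by simp at hl ⊢; omega) z hz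
      simp only [pds_nil] at this ⊢
      rw [this, mul_zero]
    · have := h [] (by simpa using h0) z hz
      simp only [pds_nil] at this ⊢
      rw [this, zero_mul]
  | cons v l ih =>
    intro hl z hz
    simp only [List.length_cons] at hl
    rw [pds_cons, ← pds_pd (hF.mul hG), pd_mul hF hG,
      pds_add ((ContDiff.pd hF v).mul hG) (hF.mul (ContDiff.pd hG v))]
    dsimp only
    rw [ih (ContDiff.pd hF v) hG (h.pd hF v) h' (by omega) z hz,
      ih hF (ContDiff.pd hG v) h (h'.pd hG v) (by omega) z hz, add_zero]

theorem pd_eq_zero_of_tangent {F : Z → ℂ} (hF : ContDiff ℝ ∞ F) (h : ∀ z, T z = 0 → F z = 0) {v : Z}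
    (hv : T v = 0) (z : Z) (hz : T z = 0) : pd v F z = 0 := by
  have h1 : HasDerivAt (fun t : ℝ => z + t • v) v 0 := by
    simpa using ((hasDerivAt_id (0 : ℝ)).smul_const v).const_add z
  have h2 := (differentiable_of_smooth hF (z + (0 : ℝ) • v)).hasFDerivAt.comp_hasDerivAt (0 : ℝ) h1
  have h3 : HasDerivAt (F ∘ fun t : ℝ => z + t • v) 0 0 := by
    have : (F ∘ fun t : ℝ => z + t • v) = fun _ => 0 :=
      funext fun t => h _ (by simp [hz, hv])
    rw [this]
    exact hasDerivAt_const _ _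
  simpa [pd] using h2.unique h3

/-- Only derivatives transverse to the kernel count against the order of vanishing. After those in
l' the function still vanishes on the kernel, and tangential derivatives preserve this. -/
theorem VanishesAlong.pds_append_eq_zero {r : ℕ} {F : Z → ℂ} (hF : ContDiff ℝ ∞ F)
    (h : VanishesAlong T r F) {l l' : List Z} (hl : ∀ v ∈ l, T v = 0) (hl' : l'.length < r) (z : Z)
    (hz : T z = 0) : pds (l ++ l') F z = 0 := by
  rw [pds_append]
  induction l generalizing z with
  | nil => exact h l' hl' z hz
  | cons v l ih =>
    rw [pds_cons]
    exact pd_eq_zero_of_tangent (ContDiff.pds (ContDiff.pds hF _) _)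
      (fun z hz => ih (fun v hv => hl v (List.mem_cons_of_mem _ hv)) z hz)
      (hl v List.mem_cons_self) z hz

end Vanishing

/-! ### Jets of the amplitude at the origin as polynomials in the phase parameter. -/

section Jets

variable {X Y V : Type*} [NormedAddCommGroup X] [NormedSpace ℝ X] [FiniteDimensional ℝ X]
  [NormedAddCommGroup Y] [NormedSpace ℝ Y] [FiniteDimensional ℝ Y]
  [NormedAddCommGroup V] [NormedSpace ℝ V] [FiniteDimensional ℝ V]
  {K : Set (X × Y)} {β : X × Y → V} {f : X × Y → ℂ}

theorem phaseMul_iterate_testOn (hβ : ContDiff ℝ ∞ β) (hf : TestOn K f) (v : StrongDual ℝ V)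
    (r : ℕ) : TestOn K ((phaseMul β v)^[r] f) := by
  induction r with
  | zero => exact hf
  | succ r ih =>
    rw [Function.iterate_succ_apply']
    exact phaseMul_testOn hβ ih v

theorem vanishesAlong_phaseMul_iterate {A : Type*} [NormedAddCommGroup A] [NormedSpace ℝ A]
    {T : X × Y →L[ℝ] A} (hβ : ContDiff ℝ ∞ β) (hβT : ∀ z, T z = 0 → β z = 0) (hf : TestOn K f)
    (v : StrongDual ℝ V) (r : ℕ) : VanishesAlong T r ((phaseMul β v)^[r] f) := by
  induction r with
  | zero => exact fun l hl => absurd hl (Nat.not_lt_zero _)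
  | succ r ih =>
    rw [Function.iterate_succ_apply', add_comm]
    refine VanishesAlong.mul (contDiff_const.mul (Complex.ofRealCLM.contDiff.comp
      (v.contDiff.comp hβ))) (phaseMul_iterate_testOn hβ hf v r).smooth ?_ ih
    intro l hl z hz
    obtain rfl : l = [] := List.length_eq_zero_iff.1 (by omega)
    simp [hβT z hz]

/-- The part of degree `r` in the phase parameter `ζ` of the derivatives at the origin of the
amplitude. -/
def jetPoly (β : X × Y → V) (f : X × Y → ℂ) (r : ℕ) (l : List (X × Y)) (ζ : StrongDual ℝ V) : ℂ :=
  pds l ((phaseMul β ζ)^[r] f) 0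

theorem ampJet_zero (β : X × Y → V) (f : X × Y → ℂ) (h : ℝ) (l : List (X × Y)) :
    ampJet β f h l 0 = pds l f 0 := by
  have : amp f β (h⁻¹ • (0 : StrongDual ℝ V)) = f := by
    funext z
    simp [amp]
  rw [ampJet, this]

theorem phaseMul_iterate_smul (v : StrongDual ℝ V) (c : ℝ) (r : ℕ) :
    (phaseMul β (c • v))^[r] f = fun z => (c : ℂ) ^ r * (phaseMul β v)^[r] f z := by
  induction r with
  | zero => simp
  | succ r ih =>
    rw [Function.iterate_succ_apply', Function.iterate_succ_apply', ih]
    funext z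
    simp only [phaseMul, smul_apply, smul_eq_mul]
    push_cast
    ring

theorem jetPoly_smul (hβ : ContDiff ℝ ∞ β) (hf : TestOn K f) (r : ℕ) (l : List (X × Y))
    (ζ : StrongDual ℝ V) (c : ℝ) : jetPoly β f r l (c • ζ) = (c : ℂ) ^ r * jetPoly β f r l ζ := by
  rw [jetPoly, phaseMul_iterate_smul, pds_const_mul (phaseMul_iterate_testOn hβ hf ζ r).smooth]
  rfl

theorem amp_phaseMul_iterate (v l : StrongDual ℝ V) (r : ℕ) :
    amp ((phaseMul β v)^[r] f) β l = (phaseMul β v)^[r] (amp f β l) := by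
  induction r with
  | zero => rfl
  | succ r ih =>
    rw [Function.iterate_succ_apply', Function.iterate_succ_apply', ← ih]
    funext z
    simp only [amp, phaseMul]
    ring

/-- The Taylor expansion in the phase parameter is finite. -/
theorem ampJet_eq_sum (hβ : ContDiff ℝ ∞ β) (hβ1 : ∀ x, β (x, 0) = 0) (hβ2 : ∀ y, β (0, y) = 0)
    (hf : TestOn K f) (h : ℝ) {lX lY : List (X × Y)} (hX : ∀ v ∈ lX, v.2 = 0)
    (hY : ∀ v ∈ lY, v.1 = 0) (ζ : StrongDual ℝ V) :
    ampJet β f h (lY ++ lX) ζ = ∑ r ∈ Finset.range (min lX.length lY.length + 1),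
      (h : ℂ)⁻¹ ^ r / (r.factorial : ℂ) * jetPoly β f r (lY ++ lX) ζ := by
  set v := h⁻¹ • ζ
  have hone : ∀ g, ampJet β g h (lY ++ lX) ζ = ampJet β g 1 (lY ++ lX) v := by
    intro g
    simp [ampJet, v]
  -- Taylor's formula along the segment from 0 to h⁻¹ζ, with remainder constant 0. The derivative of
  -- order min + 1 contains min + 1 factors v(β), each vanishing on both axes. The axis along which
  -- the shorter of the two lists is transverse leaves too few transverse derivatives for a nonzero
  -- value at the origin.
  have hR := taylor_remainder_bound (min lX.length lY.length + 1) (h := 1) (C := 0)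
    (Φ := fun r t => ampJet β ((phaseMul β v)^[r] f) 1 (lY ++ lX) (t • v)) (by
      intro r _ t _
      have h1 : HasDerivAt (fun t : ℝ => t • v) v t := by
        simpa using (hasDerivAt_id t).smul_const v
      have hfr := phaseMul_iterate_testOn hβ hf v r
      have h2 := (differentiable_of_smooth (ampJet_smooth hβ hfr 1 (lY ++ lX))
        (t • v)).hasFDerivAt.comp_hasDerivAt t h1
      refine h2.congr_deriv ?_
      have h3 := congrFun (pd_ampJet hβ hfr 1 (lY ++ lX) v) (t • v)
      rw [Function.iterate_succ_apply']
      exact h3.trans (by simp)) (by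
      intro t _
      refine le_of_eq (norm_eq_zero.2 ?_)
      rw [ampJet, amp_phaseMul_iterate]
      have ht := testOn_amp hβ hf ((1 : ℝ)⁻¹ • t • v)
      have hs := (phaseMul_iterate_testOn hβ ht v (min lX.length lY.length + 1)).smooth
      rcases le_total lX.length lY.length with hle | hle
      · refine (vanishesAlong_phaseMul_iterate (T := ContinuousLinearMap.fst ℝ X Y) hβ ?_ ht v
          _).pds_append_eq_zero hs (fun w hw => hY w hw) (by omega) 0 rfl
        rintro ⟨x, y⟩ hx
        obtain rfl : x = 0 := hx
        exact hβ2 y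
      · rw [pds_perm hs List.perm_append_comm]
        refine (vanishesAlong_phaseMul_iterate (T := ContinuousLinearMap.snd ℝ X Y) hβ ?_ ht v
          _).pds_append_eq_zero hs (fun w hw => hX w hw) (by omega) 0 rfl
        rintro ⟨x, y⟩ hy
        obtain rfl : y = 0 := hy
        exact hβ1 x) 1 ⟨zero_le_one, le_rfl⟩
  rw [zero_mul] at hR
  have hR' := sub_eq_zero.1 (norm_le_zero_iff.1 hR)
  rw [hone]
  simp only [Function.iterate_zero, id_eq, one_smul, zero_smul] at hR'
  rw [hR']
  refine Finset.sum_congr rfl fun r _ => ?_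
  rw [ampJet_zero]
  have := jetPoly_smul hβ hf r (lY ++ lX) ζ h⁻¹
  rw [jetPoly] at this
  rw [this]
  push_cast
  ring

/-- The derivatives of the joint function `Ω` at the origin. -/
theorem iteratedFDeriv_joint_eq (hβ : ContDiff ℝ ∞ β) (hf : TestOn K f)
    {Om : X × Y × StrongDual ℝ V → ℂ}
    (hOm : Om =ᶠ[𝓝 0] fun p => amp f β p.2.2 (p.1, p.2.1)) {p q : ℕ} (r : ℕ)
    (i : Fin p → Fin (Module.finrank ℝ X)) (j : Fin q → Fin (Module.finrank ℝ Y))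
    (ζ : StrongDual ℝ V) :
    iteratedFDeriv ℝ (p + q + r) Om 0
        (Fin.append
          (Fin.append
            (fun k => ((Module.finBasis ℝ X (i k), 0, 0) : X × Y × StrongDual ℝ V))
            (fun k => ((0, Module.finBasis ℝ Y (j k), 0) : X × Y × StrongDual ℝ V)))
          (fun _ : Fin r => ((0, 0, ζ) : X × Y × StrongDual ℝ V))) =
      jetPoly β f r (dirY j ++ dirX i) ζ := by
  borelize X
  borelize Y
  have hs := (ampFamily_testOn hβ hf 1).smooth
  let H : StrongDual ℝ V × (X × Y) → ℂ := fun q => amp f β ((1 : ℝ)⁻¹ • q.1) q.2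
  let e : (X × Y × StrongDual ℝ V) →L[ℝ] StrongDual ℝ V × (X × Y) :=
    ((ContinuousLinearMap.snd ℝ _ _).comp (ContinuousLinearMap.snd ℝ _ _)).prod
      ((ContinuousLinearMap.fst ℝ _ _).prod
        ((ContinuousLinearMap.fst ℝ _ _).comp (ContinuousLinearMap.snd ℝ _ _)))
  have hOm' : Om =ᶠ[𝓝 0] fun p => H (e p) := by
    refine hOm.trans (Filter.Eventually.of_forall fun p => ?_)
    simp [H, e]
  have hs' : ContDiff ℝ ∞ fun p => H (e p) := hs.comp e.contDiff
  -- Each derivative in the direction ζ of the phase parameter multiplies the amplitude by iζ(β).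
  -- The remaining derivatives can then be taken at phase parameter 0, where the exponential is 1.
  have hpow : ∀ r : ℕ, pds (List.replicate r ((ζ, 0) : StrongDual ℝ V × (X × Y))) H =
      fun q => amp ((phaseMul β ζ)^[r] f) β ((1 : ℝ)⁻¹ • q.1) q.2 := by
    intro r
    induction r with
    | zero => rfl
    | succ r ih =>
      rw [List.replicate_succ, pds_cons, ih, pd_ampFamily hβ (phaseMul_iterate_testOn hβ hf ζ r),
        Function.iterate_succ_apply']
      simp
  rw [(Filter.EventuallyEq.iteratedFDeriv ℝ hOm' (p + q + r)).eq_of_nhds, iteratedFDeriv_eq_pds hs', List.ofFn_fin_append,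
    List.ofFn_fin_append]
  have h1 := congrFun (pds_comp_affine hs e 0 (List.ofFn (fun k =>
      ((Module.finBasis ℝ X (i k), 0, 0) : X × Y × StrongDual ℝ V)) ++
    List.ofFn (fun k => ((0, Module.finBasis ℝ Y (j k), 0) : X × Y × StrongDual ℝ V)) ++
    List.ofFn (fun _ : Fin r => ((0, 0, ζ) : X × Y × StrongDual ℝ V)))) 0
  simp only [add_zero, map_zero] at h1
  refine h1.trans ?_
  have h2 : List.map e (List.ofFn (fun k =>
      ((Module.finBasis ℝ X (i k), 0, 0) : X × Y × StrongDual ℝ V)) ++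
    List.ofFn (fun k => ((0, Module.finBasis ℝ Y (j k), 0) : X × Y × StrongDual ℝ V)) ++
    List.ofFn (fun _ : Fin r => ((0, 0, ζ) : X × Y × StrongDual ℝ V))) =
      ((dirX i).map fun z => ((0 : StrongDual ℝ V), z)) ++
      ((dirY j).map fun z => ((0 : StrongDual ℝ V), z)) ++
      List.replicate r ((ζ, 0) : StrongDual ℝ V × (X × Y)) := by
    simp only [List.map_append, List.map_ofFn, dirX, dirY, List.ofFn_const, List.map_replicate]
    rfl
  rw [h2, pds_append, hpow, pds_perm (ampFamily_testOn hβ (phaseMul_iterate_testOn hβ hf ζ r)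
    1).smooth List.perm_append_comm, ← List.map_append]
  have h3 := pds_section (ampFamily_testOn hβ (phaseMul_iterate_testOn hβ hf ζ r) 1).smooth
    (dirY j ++ dirX i) 0 0
  refine h3.symm.trans ?_
  simp [jetPoly, amp]

/-- The contribution of the terms of given degrees. -/
def termOf (r₁ : StrongDual ℝ V →L[ℝ] StrongDual ℝ X) (r₂ : StrongDual ℝ V →L[ℝ] StrongDual ℝ Y)
    (β : X × Y → V) (f : X × Y → ℂ) (p q r : ℕ) (a : StrongDual ℝ X → ℂ) (b : StrongDual ℝ Y → ℂ)
    (ζ : StrongDual ℝ V) : ℂ :=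
  ((-Complex.I) ^ (p + q) / ((p.factorial * q.factorial * r.factorial : ℕ) : ℂ)) *
    ∑ i : Fin p → Fin (Module.finrank ℝ X), ∑ j : Fin q → Fin (Module.finrank ℝ Y),
      jetPoly β f r (dirY j ++ dirX i) ζ * (pds (dirD i) a (r₁ ζ) * pds (dirD j) b (r₂ ζ))

/-- A jet of order (p, q) is a polynomial in h⁻¹ζ of degree at most min p q. Its part of degree r
contributes h^(-r) next to h^(p+q) from the expansion, and the truncated subtraction p + q − r is
genuine because r ≤ min p q. -/
theorem expansion_eq_sum_termOf (r₁ : StrongDual ℝ V →L[ℝ] StrongDual ℝ X)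
    (r₂ : StrongDual ℝ V →L[ℝ] StrongDual ℝ Y) (hβ : ContDiff ℝ ∞ β) (hβ1 : ∀ x, β (x, 0) = 0)
    (hβ2 : ∀ y, β (0, y) = 0) (hf : TestOn K f) (P : ℕ) {h : ℝ} (hh : h ≠ 0)
    (a : StrongDual ℝ X → ℂ) (b : StrongDual ℝ Y → ℂ) (ζ : StrongDual ℝ V) :
    expansion (amp f β (h⁻¹ • ζ)) P h a b (r₁ ζ, r₂ ζ) =
      ∑ p ∈ Finset.range P, ∑ q ∈ Finset.range P, ∑ r ∈ Finset.range (min p q + 1),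
        (h : ℂ) ^ (p + q - r) * termOf r₁ r₂ β f p q r a b ζ := by
  borelize X
  borelize Y
  rw [expansion_eq]
  refine Finset.sum_congr rfl fun p _ => Finset.sum_congr rfl fun q _ => ?_
  simp only [termOf, Finset.mul_sum]
  rw [Finset.sum_comm' (s := Finset.range (min p q + 1)) (t' := Finset.univ)
    (s' := fun _ => Finset.range (min p q + 1)) (by simp)]
  refine Finset.sum_congr rfl fun i _ => ?_
  rw [Finset.sum_comm' (s := Finset.range (min p q + 1)) (t' := Finset.univ)
    (s' := fun _ => Finset.range (min p q + 1)) (by simp)]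
  refine Finset.sum_congr rfl fun j _ => ?_
  rw [ampJet_eq_sum hβ hβ1 hβ2 hf h (by simp [dirX]) (by simp [dirY])]
  simp only [dirX, dirY, List.length_ofFn]
  rw [Finset.sum_mul, Finset.mul_sum]
  refine Finset.sum_congr rfl fun r hr => ?_
  have hr' : r ≤ p + q := by
    have := Finset.mem_range.1 hr
    omega
  have hh' : (h : ℂ) ≠ 0 := by exact_mod_cast hh
  rw [pow_sub₀ _ hh' hr', inv_pow]
  push_cast
  have e1 : (p.factorial : ℂ) ≠ 0 := by exact_mod_cast p.factorial_ne_zero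
  have e2 : (q.factorial : ℂ) ≠ 0 := by exact_mod_cast q.factorial_ne_zero
  have e3 : (r.factorial : ℂ) ≠ 0 := by exact_mod_cast r.factorial_ne_zero
  field_simp

end Jets

end StarProduct

namespace StarProduct

open MeasureTheory

set_option linter.unusedSectionVars false

/-! ### Symbol bounds for the remainder -/

theorem pds_zero {E : Type*} [NormedAddCommGroup E] [NormedSpace ℝ E] (l : List E) :
    pds l (fun _ : E => (0 : ℂ)) = fun _ => 0 := by
  induction l with
  | nil => rfl
  | cons v l ih => rw [pds_cons, ih, pd_const]

theorem pds_sum {E ι : Type*} [NormedAddCommGroup E] [NormedSpace ℝ E] (s : Finset ι)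
    {f : ι → E → ℂ} (hf : ∀ i, ContDiff ℝ ∞ (f i)) (l : List E) :
    pds l (fun x => ∑ i ∈ s, f i x) = fun x => ∑ i ∈ s, pds l (f i) x := by
  induction l with
  | nil => rfl
  | cons v l ih => rw [pds_cons, ih, pd_sum _ fun i => ContDiff.pds (hf i) l]; rfl

/-! ### Symbols through directional derivatives; polynomials in ζ. -/

section PdsSym

variable {D : Type*} [NormedAddCommGroup D] [NormedSpace ℝ D]

/-- Symbols of order `m`, in terms of directional derivatives. -/
def PdsSym (m : ℤ) (J : D → ℂ) : Prop :=
  ContDiff ℝ ∞ J ∧ ∀ l : List D, ∃ C : ℝ, 0 ≤ C ∧ ∀ ζ, ‖pds l J ζ‖ ≤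
    C * japaneseBracket ζ ^ (m - l.length)

theorem PdsSym.pd {m : ℤ} {J : D → ℂ} (hJ : PdsSym m J) (v : D) :
    PdsSym (m - 1) (StarProduct.pd v J) := by
  refine ⟨ContDiff.pd hJ.1 v, fun l => ?_⟩
  obtain ⟨C, h0, hC⟩ := hJ.2 (v :: l)
  refine ⟨C, h0, fun ζ => ?_⟩
  rw [pds_pd hJ.1, ← pds_cons]
  convert hC ζ using 3
  rw [List.length_cons]
  push_cast
  ring

theorem PdsSym.const (c : ℂ) : PdsSym 0 fun _ : D => c := by
  refine ⟨contDiff_const, fun l => ⟨‖c‖, norm_nonneg c, fun ζ => ?_⟩⟩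
  cases l with
  | nil => simp
  | cons v l =>
    rw [pds_cons, ← pds_pd contDiff_const, pd_const, pds_zero]
    have := zpow_pos (japaneseBracket_pos ζ) ((0 : ℤ) - (v :: l).length)
    simpa using mul_nonneg (norm_nonneg c) this.le

theorem PdsSym.add {m : ℤ} {J J' : D → ℂ} (hJ : PdsSym m J) (hJ' : PdsSym m J') :
    PdsSym m fun ζ => J ζ + J' ζ := by
  refine ⟨hJ.1.add hJ'.1, fun l => ?_⟩
  obtain ⟨C, h0, hC⟩ := hJ.2 l
  obtain ⟨C', h0', hC'⟩ := hJ'.2 l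
  refine ⟨C + C', by positivity, fun ζ => ?_⟩
  rw [pds_add hJ.1 hJ'.1, add_mul]
  exact (norm_add_le _ _).trans (add_le_add (hC ζ) (hC' ζ))

theorem PdsSym.zero (m : ℤ) : PdsSym m fun _ : D => (0 : ℂ) :=
  ⟨contDiff_const, fun l => ⟨0, le_rfl, fun ζ => by simp [pds_zero]⟩⟩

theorem PdsSym.sum {ι : Type*} (s : Finset ι) {m : ℤ} {J : ι → D → ℂ} (hJ : ∀ i, PdsSym m (J i)) :
    PdsSym m fun ζ => ∑ i ∈ s, J i ζ := by
  classical
  induction s using Finset.induction_on with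
  | empty => simpa using PdsSym.zero m
  | insert i s hi ih =>
    simp only [Finset.sum_insert hi]
    exact (hJ i).add ih

/-- By the Leibniz rule a derivative either removes the linear factor, and with it one order of
growth, or falls on the symbol and lowers its order. -/
theorem PdsSym.linear_mul {m : ℤ} {J : D → ℂ} (T : StrongDual ℝ D) (hJ : PdsSym m J) :
    PdsSym (m + 1) fun ζ => (T ζ : ℂ) * J ζ := by
  have hT : ContDiff ℝ ∞ fun ζ => (T ζ : ℂ) := (Complex.ofRealCLM.comp T).contDiff
  refine ⟨hT.mul hJ.1, fun l => ?_⟩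
  induction l generalizing m J with
  | nil =>
    obtain ⟨C, h0, hC⟩ := hJ.2 []
    refine ⟨‖T‖ * C, by positivity, fun ζ => ?_⟩
    have h1 : ‖(T ζ : ℂ)‖ ≤ ‖T‖ * japaneseBracket ζ := by
      rw [Complex.norm_real]
      exact (T.le_opNorm ζ).trans (by gcongr; exact norm_le_japaneseBracket ζ)
    have h2 := hC ζ
    simp only [pds_nil, List.length_nil, Nat.cast_zero, sub_zero] at h2 ⊢
    rw [norm_mul, zpow_add_one₀ (japaneseBracket_pos ζ).ne']
    have := japaneseBracket_pos ζ
    calc _ ≤ (‖T‖ * japaneseBracket ζ) * (C * japaneseBracket ζ ^ m) := by gcongr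
      _ = _ := by ring
  | cons v l ih =>
    obtain ⟨C, h0, hC⟩ := hJ.2 l
    obtain ⟨C', h0', hC'⟩ := ih (hJ.pd v)
    refine ⟨|T v| * C + C', by positivity, fun ζ => ?_⟩
    rw [pds_cons, ← pds_pd (hT.mul hJ.1), pd_mul_clm T hJ.1 v,
      pds_add (contDiff_const.mul hJ.1) (hT.mul (ContDiff.pd hJ.1 v)), pds_const_mul hJ.1, add_mul]
    refine (norm_add_le _ _).trans (add_le_add ?_ ?_)
    · rw [norm_mul, Complex.norm_real, Real.norm_eq_abs, mul_assoc]
      have e : m + 1 - ((v :: l).length : ℤ) = m - l.length := by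
        rw [List.length_cons]
        push_cast
        ring
      rw [e]
      gcongr
      exact hC ζ
    · have e : m + 1 - ((v :: l).length : ℤ) = m - 1 + 1 - l.length := by
        rw [List.length_cons]
        push_cast
        ring
      rw [e]
      exact hC' ζ

end PdsSym

section

variable {X Y V : Type*} [NormedAddCommGroup X] [NormedSpace ℝ X] [FiniteDimensional ℝ X]
  [NormedAddCommGroup Y] [NormedSpace ℝ Y] [FiniteDimensional ℝ Y]
  [NormedAddCommGroup V] [NormedSpace ℝ V] [FiniteDimensional ℝ V]
  {K : Set (X × Y)} {β : X × Y → V} {f : X × Y → ℂ}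

theorem phaseMul_iterate_sum (β : X × Y → V) (ζ : StrongDual ℝ V) (r : ℕ) {ι : Type*} (s : Finset ι) (c : ι → ℂ)
    (g : ι → X × Y → ℂ) : (phaseMul β ζ)^[r] (fun z => ∑ k ∈ s, c k * g k z) =
      fun z => ∑ k ∈ s, c k * (phaseMul β ζ)^[r] (g k) z := by
  induction r with
  | zero => rfl
  | succ r ih =>
    simp only [Function.iterate_succ_apply', ih]
    funext z
    simp only [phaseMul, Finset.mul_sum]
    exact Finset.sum_congr rfl fun k _ => by ring

/-- Expanding one factor ζ(β) in a basis writes the jet of degree r + 1 as a sum of linear forms in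
ζ times jets of degree r of other amplitudes; hence the induction generalizes over the amplitude. -/
theorem jetPoly_pdsSym (hβ : ContDiff ℝ ∞ β) (hf : TestOn K f) (r : ℕ) (l : List (X × Y)) :
    PdsSym (r : ℤ) (jetPoly β f r l) := by
  induction r generalizing f with
  | zero =>
    rw [Nat.cast_zero]
    exact PdsSym.const (pds l f 0)
  | succ r ih =>
    have hk : ∀ k, TestOn K fun z => Complex.I * (dualFinBasis V k (β z) : ℂ) * f z := fun k =>
      hf.mul_left' (contDiff_const.mul (Complex.ofRealCLM.contDiff.comp
        ((dualFinBasis V k).contDiff.comp hβ)))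
    have e : jetPoly β f (r + 1) l = fun ζ => ∑ k, (ContinuousLinearMap.apply ℝ ℝ
        (Module.finBasis ℝ V k) ζ : ℂ) *
        jetPoly β (fun z => Complex.I * (dualFinBasis V k (β z) : ℂ) * f z) r l ζ := by
      funext ζ
      have e1 : phaseMul β ζ f = fun z => ∑ k, (ζ (Module.finBasis ℝ V k) : ℂ) *
          (Complex.I * (dualFinBasis V k (β z) : ℂ) * f z) := by
        funext z
        rw [phaseMul, dual_expand_apply ζ (β z)]
        push_cast
        rw [Finset.mul_sum, Finset.sum_mul]
        exact Finset.sum_congr rfl fun k _ => by ring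
      simp only [jetPoly]
      rw [Function.iterate_succ_apply, e1, phaseMul_iterate_sum, pds_sum _ fun k =>
        contDiff_const.mul (phaseMul_iterate_testOn hβ (hk k) ζ r).smooth]
      refine Finset.sum_congr rfl fun k _ => ?_
      rw [pds_const_mul (phaseMul_iterate_testOn hβ (hk k) ζ r).smooth]
      rfl
    rw [e]
    push_cast
    exact PdsSym.sum _ fun k => (ih (hk k)).linear_mul _

end

/-! ### Semiclassical bounds for products of symbols. -/

section Product

variable {D₁ D₂ Λ : Type*} [NormedAddCommGroup D₁] [NormedSpace ℝ D₁]
  [NormedAddCommGroup D₂] [NormedSpace ℝ D₂] [NormedAddCommGroup Λ] [NormedSpace ℝ Λ]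
  {r₁ : Λ →L[ℝ] D₁} {r₂ : Λ →L[ℝ] D₂} {ε : ℝ}

/-- The Leibniz rule: wherever a derivative falls, the total order drops by one, and the cost is at
most Θ, which dominates θ₁, θ₂ and 1. -/
theorem pds_product_bound (hε : 0 < ε) (l : List Λ) {m : ℤ} {J : Λ → ℂ} (hJ : PdsSym m J)
    {n₁ n₂ n : ℤ} (hW : WeightOK r₁ r₂ ε l.length n₁ n₂ n) : ∃ C : ℝ, 0 ≤ C ∧
    ∀ {θ₁ θ₂ Θ A B : ℝ} {a : D₁ → ℂ} {b : D₂ → ℂ}, 1 ≤ θ₁ → 1 ≤ θ₂ → θ₁ ≤ Θ → θ₂ ≤ Θ →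
      SymBound θ₁ A n₁ l.length a → SymBound θ₂ B n₂ l.length b → ∀ ζ,
      ‖pds l (fun ζ => J ζ * (a (r₁ ζ) * b (r₂ ζ))) ζ‖ ≤
        C * A * B * Θ ^ l.length * japaneseBracket ζ ^ (n + m - l.length) := by
  induction l generalizing J m n₁ n₂ n with
  | nil =>
    obtain ⟨C, h0, hC⟩ := hJ.2 []
    obtain ⟨W, w0, hW⟩ := hW
    refine ⟨C * W, by positivity, fun {θ₁ θ₂ Θ A B a b} t1 t2 t1' t2' ha hb ζ => ?_⟩
    have hA := ha.nonneg
    have hB := hb.nonneg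
    have h1 := hC ζ
    -- No displacement is present here: the weight condition is used at the restrictions of ζ
    -- themselves.
    have h2 := hW 0 le_rfl 0 le_rfl ζ 0 0 (by simpa using by positivity)
      (by simpa using by positivity)
    simp only [pds_nil, List.length_nil, Nat.cast_zero, sub_zero, add_zero, pow_zero,
      mul_one] at h1 h2 ⊢
    have p1 := zpow_pos (japaneseBracket_pos (r₁ ζ)) n₁
    have p2 := zpow_pos (japaneseBracket_pos (r₂ ζ)) n₂
    have p3 := zpow_pos (japaneseBracket_pos ζ) m
    rw [norm_mul, norm_mul]
    calc _ ≤ (C * japaneseBracket ζ ^ m) * ((A * japaneseBracket (r₁ ζ) ^ n₁) *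
          (B * japaneseBracket (r₂ ζ) ^ n₂)) := by
          gcongr
          · exact ha.norm_le _
          · exact hb.norm_le _
      _ = C * japaneseBracket ζ ^ m * A * B * (japaneseBracket (r₁ ζ) ^ n₁ *
          japaneseBracket (r₂ ζ) ^ n₂) := by ring
      _ ≤ C * japaneseBracket ζ ^ m * A * B * (W * japaneseBracket ζ ^ n) := by gcongr
      _ = _ := by
        rw [zpow_add₀ (japaneseBracket_pos ζ).ne']
        ring
  | cons v l ih =>
    rw [List.length_cons] at hW
    obtain ⟨C₁, h1, hC₁⟩ := ih hJ (hW.shift 1 0)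
    obtain ⟨C₂, h2, hC₂⟩ := ih hJ (hW.shift 0 1)
    obtain ⟨C₃, h3, hC₃⟩ := ih (hJ.pd v) (hW.mono (Nat.le_succ _))
    refine ⟨C₁ * ‖r₁ v‖ + C₂ * ‖r₂ v‖ + C₃, by positivity,
      fun {θ₁ θ₂ Θ A B a b} t1 t2 t1' t2' ha hb ζ => ?_⟩
    have hA := ha.nonneg
    have hB := hb.nonneg
    rw [List.length_cons] at ha hb
    have hΘ : 1 ≤ Θ := t1.trans t1'
    have sa : SymBound θ₁ (A * θ₁ * ‖r₁ v‖) (n₁ - (1 : ℕ)) l.length (StarProduct.pd (r₁ v) a) := by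
      simpa using ha.pd (by positivity) (r₁ v)
    have sb : SymBound θ₂ (B * θ₂ * ‖r₂ v‖) (n₂ - (1 : ℕ)) l.length (StarProduct.pd (r₂ v) b) := by
      simpa using hb.pd (by positivity) (r₂ v)
    have b1 := hC₁ t1 t2 t1' t2' sa (by simpa using hb.mono (Nat.le_succ _)) ζ
    have b2 := hC₂ t1 t2 t1' t2' (by simpa using ha.mono (Nat.le_succ _)) sb ζ
    have b3 := hC₃ t1 t2 t1' t2' (ha.mono (Nat.le_succ _)) (hb.mono (Nat.le_succ _)) ζ
    have ca := ha.temperate.1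
    have cb := hb.temperate.1
    have s1 : ContDiff ℝ ∞ fun ζ => J ζ * (a (r₁ ζ) * b (r₂ ζ)) :=
      hJ.1.mul ((ca.comp r₁.contDiff).mul (cb.comp r₂.contDiff))
    have s2 : ContDiff ℝ ∞ fun ζ => J ζ * (StarProduct.pd (r₁ v) a (r₁ ζ) * b (r₂ ζ)) :=
      hJ.1.mul (((ContDiff.pd ca _).comp r₁.contDiff).mul (cb.comp r₂.contDiff))
    have s3 : ContDiff ℝ ∞ fun ζ => J ζ * (a (r₁ ζ) * StarProduct.pd (r₂ v) b (r₂ ζ)) :=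
      hJ.1.mul ((ca.comp r₁.contDiff).mul ((ContDiff.pd cb _).comp r₂.contDiff))
    have s4 : ContDiff ℝ ∞ fun ζ => StarProduct.pd v J ζ * (a (r₁ ζ) * b (r₂ ζ)) :=
      (ContDiff.pd hJ.1 v).mul ((ca.comp r₁.contDiff).mul (cb.comp r₂.contDiff))
    rw [pds_cons, ← pds_pd s1, pd_mul_comp r₁ r₂ ca cb hJ.1 v, pds_add (s2.add s3) s4,
      pds_add s2 s3]
    have e1 : n - (1 : ℕ) - (0 : ℕ) + m - (l.length : ℤ) = n + m - (v :: l).length := by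
      rw [List.length_cons]; push_cast; ring
    have e2 : n - (0 : ℕ) - (1 : ℕ) + m - (l.length : ℤ) = n + m - (v :: l).length := by
      rw [List.length_cons]; push_cast; ring
    have e3 : n + (m - 1) - (l.length : ℤ) = n + m - (v :: l).length := by
      rw [List.length_cons]; push_cast; ring
    rw [e1] at b1
    rw [e2] at b2
    rw [e3] at b3
    set Q := japaneseBracket ζ ^ (n + m - (v :: l).length)
    have hQ : 0 < Q := zpow_pos (japaneseBracket_pos ζ) _
    refine (norm_add_le _ _).trans ((add_le_add (norm_add_le _ _) le_rfl).trans ?_)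
    have c1 : C₁ * (A * θ₁ * ‖r₁ v‖) * B * Θ ^ l.length * Q ≤
        C₁ * (A * Θ * ‖r₁ v‖) * B * Θ ^ l.length * Q := by gcongr
    have c2 : C₂ * A * (B * θ₂ * ‖r₂ v‖) * Θ ^ l.length * Q ≤
        C₂ * A * (B * Θ * ‖r₂ v‖) * Θ ^ l.length * Q := by gcongr
    have c3 : C₃ * A * B * Θ ^ l.length * Q ≤ C₃ * A * B * (Θ ^ l.length * Θ) * Q := by
      gcongr
      exact le_mul_of_one_le_right (by positivity) hΘ
    refine (add_le_add (add_le_add (b1.trans c1) (b2.trans c2)) (b3.trans c3)).trans (le_of_eq ?_)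
    rw [List.length_cons, pow_succ]
    ring

/-- A bound for a quantity depending on `h`, two symbols and `ζ` which is appropriate for the
derivatives of order `k` of the remainder of order `J`. -/
def SemiBound (r₁ : Λ →L[ℝ] D₁) (r₂ : Λ →L[ℝ] D₂) (ε : ℝ) (J L k : ℕ)
    (F : ℝ → (D₁ → ℂ) → (D₂ → ℂ) → Λ → ℝ) : Prop :=
  ∃ κ, ∀ n₁ n₂ n : ℤ, WeightOK r₁ r₂ ε κ n₁ n₂ n → ∃ C : ℝ, 0 ≤ C ∧
    ∀ {h θ₁ θ₂ Θ A B : ℝ} {a : D₁ → ℂ} {b : D₂ → ℂ}, Regime h θ₁ θ₂ →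
      (h * θ₁ * θ₂) ^ L ≤ h → θ₁ ≤ Θ → θ₂ ≤ Θ → SymBound θ₁ A n₁ κ a → SymBound θ₂ B n₂ κ b →
      ∀ ζ, F h a b ζ ≤ C * A * B * (h * θ₁ * θ₂) ^ J * Θ ^ k * japaneseBracket ζ ^ (n - J - k)

variable {J L k : ℕ} {F F' : ℝ → (D₁ → ℂ) → (D₂ → ℂ) → Λ → ℝ}

theorem SemiBound.of_le (hF : SemiBound r₁ r₂ ε J L k F) {c : ℝ} (hc : 0 ≤ c)
    (hle : ∀ (h : ℝ) (a : D₁ → ℂ) (b : D₂ → ℂ) (ζ : Λ), 0 < h → a.HasTemperateGrowth →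
      b.HasTemperateGrowth → F' h a b ζ ≤ c * F h a b ζ) : SemiBound r₁ r₂ ε J L k F' := by
  obtain ⟨κ, hκ⟩ := hF
  refine ⟨κ, fun n₁ n₂ n hW => ?_⟩
  obtain ⟨C, h0, hC⟩ := hκ n₁ n₂ n hW
  refine ⟨c * C, by positivity, fun {h θ₁ θ₂ Θ A B a b} hr hL t1 t2 ha hb ζ => ?_⟩
  refine (hle h a b ζ hr.pos ha.temperate hb.temperate).trans ?_
  refine (mul_le_mul_of_nonneg_left (hC hr hL t1 t2 ha hb ζ) hc).trans (le_of_eq ?_)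
  ring

theorem SemiBound.add (hF : SemiBound r₁ r₂ ε J L k F) (hF' : SemiBound r₁ r₂ ε J L k F') :
    SemiBound r₁ r₂ ε J L k fun h a b ζ => F h a b ζ + F' h a b ζ := by
  obtain ⟨κ, hκ⟩ := hF
  obtain ⟨κ', hκ'⟩ := hF'
  refine ⟨max κ κ', fun n₁ n₂ n hW => ?_⟩
  obtain ⟨C, h0, hC⟩ := hκ n₁ n₂ n (hW.mono (le_max_left _ _))
  obtain ⟨C', h0', hC'⟩ := hκ' n₁ n₂ n (hW.mono (le_max_right _ _))
  refine ⟨C + C', by positivity, fun {h θ₁ θ₂ Θ A B a b} hr hL t1 t2 ha hb ζ => ?_⟩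
  refine (add_le_add (hC hr hL t1 t2 (ha.mono (le_max_left _ _)) (hb.mono (le_max_left _ _)) ζ)
    (hC' hr hL t1 t2 (ha.mono (le_max_right _ _)) (hb.mono (le_max_right _ _)) ζ)).trans
    (le_of_eq ?_)
  ring

theorem SemiBound.zero : SemiBound r₁ r₂ ε J L k fun _ _ _ _ => 0 :=
  ⟨0, fun _ _ _ _ => ⟨0, le_rfl, fun _ _ _ _ _ _ _ => by simp⟩⟩

theorem SemiBound.sum {ι : Type*} (s : Finset ι) {F : ι → ℝ → (D₁ → ℂ) → (D₂ → ℂ) → Λ → ℝ}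
    (hF : ∀ i ∈ s, SemiBound r₁ r₂ ε J L k (F i)) :
    SemiBound r₁ r₂ ε J L k fun h a b ζ => ∑ i ∈ s, F i h a b ζ := by
  classical
  induction s using Finset.induction_on with
  | empty => simpa using SemiBound.zero
  | insert i s hi ih =>
    simp only [Finset.sum_insert hi]
    exact (hF i (Finset.mem_insert_self i s)).add
      (ih fun j hj => hF j (Finset.mem_insert_of_mem hj))

/-- Put s = p + q − r. Since r ≤ min p q, both p and q are at most s, so θ₁^p θ₂^q ≤ (θ₁θ₂)^s, and
h^s turns this into (hθ₁θ₂)^s ≤ (hθ₁θ₂)^J. The order in ζ drops by s as well, because the jet gives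
back r of the p + q orders lost by differentiation. -/
theorem semiBound_term (hε : 0 < ε) (l : List Λ) {r p q : ℕ} {Jf : Λ → ℂ} (hJ : PdsSym (r : ℤ) Jf)
    (hr : r ≤ min p q) (hJs : J + r ≤ p + q) (l₁ : List D₁) (l₂ : List D₂) (h1 : l₁.length = p)
    (h2 : l₂.length = q) :
    SemiBound r₁ r₂ ε J L l.length fun h a b ζ => h ^ (p + q - r) *
      ‖pds l (fun ζ => Jf ζ * (pds l₁ a (r₁ ζ) * pds l₂ b (r₂ ζ))) ζ‖ := by
  subst h1 h2
  refine ⟨l.length + l₁.length + l₂.length, fun n₁ n₂ n hW => ?_⟩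
  obtain ⟨C, h0, hC⟩ := pds_product_bound hε l hJ (hW.shift l₁.length l₂.length)
  set c₁ := (l₁.map norm).prod
  set c₂ := (l₂.map norm).prod
  have hc₁ : 0 ≤ c₁ := prod_map_norm_nonneg l₁
  have hc₂ : 0 ≤ c₂ := prod_map_norm_nonneg l₂
  refine ⟨C * c₁ * c₂, by positivity, fun {h θ₁ θ₂ Θ A B a b} hreg hL t1 t2 ha hb ζ => ?_⟩
  have hA := ha.nonneg
  have hB := hb.nonneg
  have hh := hreg.pos
  have e1 := hreg.one_le_left
  have e2 := hreg.one_le_right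
  have hΘ : 0 < Θ := by linarith
  have b1 := hC e1 e2 t1 t2 (SymBound.pds (by positivity) l₁ (ha.mono (by omega)))
    (SymBound.pds (by positivity) l₂ (hb.mono (by omega))) ζ
  set τ := h * θ₁ * θ₂
  have hτ0 : 0 ≤ τ := by positivity
  set s := l₁.length + l₂.length - r
  have hs1 : l₁.length ≤ s := by omega
  have hs2 : l₂.length ≤ s := by omega
  have hsJ : J ≤ s := by omega
  have hcast : (s : ℤ) = l₁.length + l₂.length - r := by omega
  have k1 : h ^ s * (θ₁ ^ l₁.length * θ₂ ^ l₂.length) ≤ τ ^ J := by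
    calc _ ≤ h ^ s * (θ₁ ^ s * θ₂ ^ s) := by gcongr
      _ = τ ^ s := by simp only [τ, mul_pow]; ring
      _ ≤ τ ^ J := pow_le_pow_of_le_one hτ0 hreg.mul_le_one hsJ
  have k2 : japaneseBracket ζ ^ (n - l₁.length - l₂.length + r - l.length) ≤
      japaneseBracket ζ ^ (n - J - l.length) :=
    zpow_le_zpow_right₀ (one_le_japaneseBracket ζ) (by omega)
  have k3 := zpow_pos (japaneseBracket_pos ζ) (n - l₁.length - l₂.length + r - l.length)
  refine (mul_le_mul_of_nonneg_left b1 (by positivity)).trans ?_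
  calc _ = C * c₁ * c₂ * A * B * (h ^ s * (θ₁ ^ l₁.length * θ₂ ^ l₂.length)) * Θ ^ l.length *
        japaneseBracket ζ ^ (n - l₁.length - l₂.length + r - l.length) := by ring
    _ ≤ _ := by gcongr

end Product

end StarProduct

namespace StarProduct

open MeasureTheory

set_option linter.unusedSectionVars false

/-! ### The remainder after the homogeneous components of degree less than J. -/

section FullRemainder

variable {X Y V : Type*} [NormedAddCommGroup X] [NormedSpace ℝ X] [FiniteDimensional ℝ X]
  [NormedAddCommGroup Y] [NormedSpace ℝ Y] [FiniteDimensional ℝ Y]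
  [NormedAddCommGroup V] [NormedSpace ℝ V] [FiniteDimensional ℝ V]

section Sums

variable (T : ℕ → ℕ → ℕ → ℂ)

/-- Terms of a triple expansion grouped by the total degree. -/
def gradedPart (j : ℕ) : ℂ :=
  ∑ p ∈ Finset.range (j + 1), ∑ q ∈ Finset.range (j + 1), ∑ r ∈ Finset.range (min p q + 1),
    if p + q = r + j then T p q r else 0

/-- The relations p + q = r + j and r ≤ min p q force p, q ≤ j, so enlarging the box of summation
adds only zeros. -/
theorem gradedPart_eq {j P : ℕ} (hj : j < P) : gradedPart T j =
    ∑ p ∈ Finset.range P, ∑ q ∈ Finset.range P, ∑ r ∈ Finset.range (min p q + 1),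
      if p + q = r + j then T p q r else 0 := by
  have hsub : Finset.range (j + 1) ⊆ Finset.range P := Finset.range_mono hj
  unfold gradedPart
  rw [← Finset.sum_subset hsub]
  · refine Finset.sum_congr rfl fun p _ => Finset.sum_subset hsub fun q _ hq => ?_
    refine Finset.sum_eq_zero fun r hr => if_neg ?_
    have := Finset.mem_range.1 hr
    have : ¬ q < j + 1 := fun h => hq (Finset.mem_range.2 h)
    omega
  · intro p _ hp
    refine Finset.sum_eq_zero fun q _ => Finset.sum_eq_zero fun r hr => if_neg ?_
    have := Finset.mem_range.1 hr
    have : ¬ p < j + 1 := fun h => hp (Finset.mem_range.2 h)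
    omega

/-- Each triple has exactly one degree p + q − r, and J ≤ P guarantees that the box contains all
triples of degree below J; subtracting these components therefore leaves the triples of degree at
least J. -/
theorem sum_sub_gradedPart (h : ℂ) {J P : ℕ} (hJP : J ≤ P) :
    ∑ p ∈ Finset.range P, ∑ q ∈ Finset.range P, ∑ r ∈ Finset.range (min p q + 1),
      h ^ (p + q - r) * T p q r - ∑ j ∈ Finset.range J, h ^ j * gradedPart T j =
    ∑ p ∈ Finset.range P, ∑ q ∈ Finset.range P, ∑ r ∈ Finset.range (min p q + 1),
      if J + r ≤ p + q then h ^ (p + q - r) * T p q r else 0 := by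
  have e : ∑ j ∈ Finset.range J, h ^ j * gradedPart T j =
      ∑ p ∈ Finset.range P, ∑ q ∈ Finset.range P, ∑ r ∈ Finset.range (min p q + 1),
        ∑ j ∈ Finset.range J, if p + q = r + j then h ^ (p + q - r) * T p q r else 0 := by
    have e1 : ∀ j ∈ Finset.range J, h ^ j * gradedPart T j =
        ∑ p ∈ Finset.range P, ∑ q ∈ Finset.range P, ∑ r ∈ Finset.range (min p q + 1),
          if p + q = r + j then h ^ (p + q - r) * T p q r else 0 := by
      intro j hj
      rw [gradedPart_eq T ((Finset.mem_range.1 hj).trans_le hJP)]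
      simp only [Finset.mul_sum]
      refine Finset.sum_congr rfl fun p _ => Finset.sum_congr rfl fun q _ =>
        Finset.sum_congr rfl fun r _ => ?_
      split_ifs with hc
      · rw [show p + q - r = j by omega]
      · rw [mul_zero]
    rw [Finset.sum_congr rfl e1, Finset.sum_comm]
    refine Finset.sum_congr rfl fun p _ => ?_
    rw [Finset.sum_comm]
    refine Finset.sum_congr rfl fun q _ => ?_
    rw [Finset.sum_comm]
  rw [e, ← Finset.sum_sub_distrib]
  refine Finset.sum_congr rfl fun p _ => ?_
  rw [← Finset.sum_sub_distrib]
  refine Finset.sum_congr rfl fun q _ => ?_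
  rw [← Finset.sum_sub_distrib]
  refine Finset.sum_congr rfl fun r hr => ?_
  have hr' := Finset.mem_range.1 hr
  split_ifs with hc
  · rw [Finset.sum_eq_zero, sub_zero]
    intro j hj
    have := Finset.mem_range.1 hj
    exact if_neg (by omega)
  · rw [Finset.sum_eq_single (p + q - r), if_pos (by omega), sub_self]
    · intro j _ hj
      exact if_neg (by omega)
    · intro hj
      exact absurd (Finset.mem_range.2 (by omega)) hj

end Sums

variable [MeasurableSpace X] [BorelSpace X] [MeasurableSpace Y] [BorelSpace Y]
  (μ : Measure (X × Y)) [μ.IsAddHaarMeasure]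
  (ν : Measure (StrongDual ℝ X × StrongDual ℝ Y)) [ν.IsAddHaarMeasure]
  (r₁ : StrongDual ℝ V →L[ℝ] StrongDual ℝ X) (r₂ : StrongDual ℝ V →L[ℝ] StrongDual ℝ Y)
  {K : Set (X × Y)} {β : X × Y → V} {f : X × Y → ℂ}

/-- The star product minus the first `J` homogeneous components of its expansion. -/
def fullRemainder (β : X × Y → V) (f : X × Y → ℂ) (J : ℕ) (h : ℝ) (a : StrongDual ℝ X → ℂ)
    (b : StrongDual ℝ Y → ℂ) (ζ : StrongDual ℝ V) : ℂ :=
  osc (pairing X Y) μ ν (amp f β (h⁻¹ • ζ)) (cpair a b h h (r₁ ζ, r₂ ζ)) -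
    ∑ j ∈ Finset.range J, (h : ℂ) ^ j *
      gradedPart (fun p q r => termOf r₁ r₂ β f p q r a b ζ) j

/-- The order P of the Taylor expansion is a free auxiliary parameter: the left side does not
involve it. It can therefore be chosen in terms of the number of derivatives to be estimated, at the
expense of finitely many explicit terms of degree at least J. -/
theorem fullRemainder_eq (hβ : ContDiff ℝ ∞ β) (hβ1 : ∀ x, β (x, 0) = 0)
    (hβ2 : ∀ y, β (0, y) = 0) (hf : TestOn K f) {J P : ℕ} (hJP : J ≤ P) {h : ℝ} (hh : h ≠ 0)
    (a : StrongDual ℝ X → ℂ) (b : StrongDual ℝ Y → ℂ) :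
    fullRemainder μ ν r₁ r₂ β f J h a b = fun ζ => remainder μ ν r₁ r₂ β f P h a b ζ +
      ∑ p ∈ Finset.range P, ∑ q ∈ Finset.range P, ∑ r ∈ Finset.range (min p q + 1),
        if J + r ≤ p + q then (h : ℂ) ^ (p + q - r) * termOf r₁ r₂ β f p q r a b ζ else 0 := by
  funext ζ
  rw [← sum_sub_gradedPart _ (h : ℂ) hJP, remainder,
    expansion_eq_sum_termOf r₁ r₂ hβ hβ1 hβ2 hf P hh, fullRemainder]
  ring

variable {a : StrongDual ℝ X → ℂ} {b : StrongDual ℝ Y → ℂ}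

theorem termOf_smooth (hβ : ContDiff ℝ ∞ β) (hf : TestOn K f) (ha : ContDiff ℝ ∞ a)
    (hb : ContDiff ℝ ∞ b) (p q r : ℕ) : ContDiff ℝ ∞ (termOf r₁ r₂ β f p q r a b) :=
  contDiff_const.mul (ContDiff.sum fun _ _ => ContDiff.sum fun _ _ =>
    (jetPoly_pdsSym hβ hf r _).1.mul
      (((ContDiff.pds ha _).comp r₁.contDiff).mul ((ContDiff.pds hb _).comp r₂.contDiff)))

theorem fullRemainder_smooth (hβ : ContDiff ℝ ∞ β) (hK : IsCompact K) (hf : TestOn K f)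
    (ha : a.HasTemperateGrowth) (hb : b.HasTemperateGrowth) (J : ℕ) (h : ℝ) :
    ContDiff ℝ ∞ (fullRemainder μ ν r₁ r₂ β f J h a b) := by
  refine (osc_family_smooth μ ν r₁ r₂ hβ hK hf ha hb h).sub (ContDiff.sum fun j _ =>
    contDiff_const.mul (ContDiff.sum fun p _ => ContDiff.sum fun q _ => ContDiff.sum fun r _ => ?_))
  split_ifs
  · exact termOf_smooth r₁ r₂ hβ hf ha.1 hb.1 p q r
  · exact contDiff_const

theorem semiBound_termOf (hβ : ContDiff ℝ ∞ β) (hf : TestOn K f) {ε : ℝ} (hε : 0 < ε)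
    (l : List (StrongDual ℝ V)) {J L p q r : ℕ} (hr : r ≤ min p q) (hJs : J + r ≤ p + q) :
    SemiBound r₁ r₂ ε J L l.length fun h a b ζ => h ^ (p + q - r) *
      ‖pds l (termOf r₁ r₂ β f p q r a b) ζ‖ := by
  have h1 := SemiBound.sum Finset.univ fun (i : Fin p → Fin (Module.finrank ℝ X)) _ =>
    SemiBound.sum Finset.univ fun (j : Fin q → Fin (Module.finrank ℝ Y)) _ =>
      semiBound_term (r₁ := r₁) (r₂ := r₂) (J := J) (L := L) hε l
        (jetPoly_pdsSym hβ hf r (dirY j ++ dirX i)) hr hJs (dirD i) (dirD j)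
        List.length_ofFn List.length_ofFn
  refine h1.of_le (c := ‖(-Complex.I) ^ (p + q) /
    ((p.factorial * q.factorial * r.factorial : ℕ) : ℂ)‖) (norm_nonneg _) ?_
  intro h a b ζ hh ha hb
  have hs : ∀ (i : Fin p → Fin (Module.finrank ℝ X)) (j : Fin q → Fin (Module.finrank ℝ Y)),
      ContDiff ℝ ∞ fun ζ => jetPoly β f r (dirY j ++ dirX i) ζ *
        (pds (dirD i) a (r₁ ζ) * pds (dirD j) b (r₂ ζ)) := fun i j =>
    (jetPoly_pdsSym hβ hf r _).1.mul
      (((ContDiff.pds ha.1 _).comp r₁.contDiff).mul ((ContDiff.pds hb.1 _).comp r₂.contDiff))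
  have e : pds l (termOf r₁ r₂ β f p q r a b) = fun ζ =>
      (-Complex.I) ^ (p + q) / ((p.factorial * q.factorial * r.factorial : ℕ) : ℂ) *
      ∑ i : Fin p → Fin (Module.finrank ℝ X), ∑ j : Fin q → Fin (Module.finrank ℝ Y),
        pds l (fun ζ => jetPoly β f r (dirY j ++ dirX i) ζ *
          (pds (dirD i) a (r₁ ζ) * pds (dirD j) b (r₂ ζ))) ζ := by
    unfold termOf
    rw [pds_const_mul (ContDiff.sum fun i _ => ContDiff.sum fun j _ => hs i j),
      pds_sum _ fun i => ContDiff.sum fun j _ => hs i j]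
    funext ζ
    congr 1
    exact Finset.sum_congr rfl fun i _ => congrFun (pds_sum _ (fun j => hs i j) l) ζ
  rw [e, norm_mul, mul_left_comm]
  gcongr
  simp only [← Finset.mul_sum]
  gcongr
  exact (norm_sum_le _ _).trans (Finset.sum_le_sum fun i _ => norm_sum_le _ _)

variable {ε : ℝ} {M : ℕ}

/-- The choice of P. The losses are h^(-k), for k derivatives, and ⟨h⁻¹ζ⟩^M ≤ h^(-M)⟨ζ⟩^M. Among the
P factors τ = hθ₁θ₂, J are kept, and L(k + M) compensate h^(-(k+M)) because τ^L ≤ h. The powers of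
⟨ζ⟩⁻¹ number at least J + k + M, which cancels ⟨ζ⟩^M and leaves the decay of order J + k required of
a k-th derivative. -/
theorem semiBound_remainder (hβ : ContDiff ℝ ∞ β) (hβ1 : ∀ x, β (x, 0) = 0)
    (hβ2 : ∀ y, β (0, y) = 0) (hK : IsCompact K) (hε : 0 < ε)
    (hM : Integrable (fun w : StrongDual ℝ X × StrongDual ℝ Y => ((1 + ‖w‖) ^ M)⁻¹) ν)
    (hdec : ∀ f, TestOn K f → ∀ N : ℕ, ∃ C : ℝ, 0 ≤ C ∧ ∀ (l : StrongDual ℝ V) w,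
      ‖fhat (pairing X Y) μ (amp f β l) w‖ ≤ C ∧
      (ε * ‖l‖ ≤ ‖w‖ → ‖fhat (pairing X Y) μ (amp f β l) w‖ * (1 + ‖w‖) ^ N ≤ C))
    (hinv : ∀ G : X × Y → ℂ, TestOn K G → ∫ w, fhat (pairing X Y) μ G w ∂ν = G 0)
    (hf : TestOn K f) (J L : ℕ) (l : List (StrongDual ℝ V)) {P : ℕ}
    (hP : P = J + (l.length + M) + L * (l.length + M)) :
    SemiBound r₁ r₂ ε J L l.length fun h a b ζ =>
      ‖pds l (remainder μ ν r₁ r₂ β f P h a b) ζ‖ := by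
  obtain ⟨κ, hκ⟩ := pds_remainder_bound μ ν r₁ r₂ hβ hβ1 hβ2 hK hε hM hdec hinv P l hf
  refine ⟨κ, fun n₁ n₂ n hW => ?_⟩
  obtain ⟨C, h0, hC⟩ := hκ n₁ n₂ n hW
  refine ⟨C, h0, fun {h θ₁ θ₂ Θ A B a b} hr hL t1 t2 ha hb ζ => (hC hr ha hb ζ).trans ?_⟩
  have hA := ha.nonneg
  have hB := hb.nonneg
  have hh := hr.pos
  have e1 := hr.one_le_left
  have e2 := hr.one_le_right
  have hΘ : 1 ≤ Θ := e1.trans t1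
  have jz := japaneseBracket_pos ζ
  have jl := japaneseBracket_pos (h⁻¹ • ζ)
  set τ := h * θ₁ * θ₂
  have hτ0 : 0 < τ := by positivity
  have k1 : japaneseBracket (h⁻¹ • ζ) ≤ h⁻¹ * japaneseBracket ζ := by
    have := mul_japaneseBracket_le hh hr.le_one (h⁻¹ • ζ)
    rw [smul_inv_smul₀ hh.ne'] at this
    rw [inv_mul_eq_div, le_div_iff₀ hh]
    linarith
  have k2 : τ ^ P * h⁻¹ ^ (l.length + M) ≤ τ ^ J := by
    have h1 : τ ^ P ≤ τ ^ (J + L * (l.length + M)) :=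
      pow_le_pow_of_le_one hτ0.le hr.mul_le_one (by omega)
    have h2 : τ ^ (L * (l.length + M)) ≤ h ^ (l.length + M) := by
      rw [pow_mul]
      gcongr
    calc _ ≤ (τ ^ J * h ^ (l.length + M)) * h⁻¹ ^ (l.length + M) := by
          gcongr
          refine h1.trans ?_
          rw [pow_add]
          gcongr
      _ = τ ^ J := by
        rw [inv_pow]
        field_simp
  have k3 : japaneseBracket ζ ^ (n + M - P) ≤ japaneseBracket ζ ^ (n - J - l.length) :=
    zpow_le_zpow_right₀ (one_le_japaneseBracket ζ) (by subst hP; push_cast; nlinarith)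
  have k4 := zpow_pos jz (n + M - P)
  have k5 := zpow_pos jz n
  calc _ ≤ C * A * B * h⁻¹ ^ l.length * ((h⁻¹ * japaneseBracket ζ) ^ M * japaneseBracket ζ ^ n *
        (τ / japaneseBracket ζ) ^ P) := by gcongr
    _ = C * A * B * (τ ^ P * h⁻¹ ^ (l.length + M)) * japaneseBracket ζ ^ (n + M - P) := by
        rw [zpow_sub₀ jz.ne', zpow_add₀ jz.ne', zpow_natCast, zpow_natCast, mul_pow, div_pow,
          pow_add]
        field_simp
    _ ≤ C * A * B * τ ^ J * japaneseBracket ζ ^ (n - J - l.length) := by gcongr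
    _ ≤ C * A * B * τ ^ J * Θ ^ l.length * japaneseBracket ζ ^ (n - J - l.length) := by
        exact mul_le_mul_of_nonneg_right (le_mul_of_one_le_right (by positivity)
          (one_le_pow₀ hΘ)) (by positivity)

theorem semiBound_pds_fullRemainder (hβ : ContDiff ℝ ∞ β) (hβ1 : ∀ x, β (x, 0) = 0)
    (hβ2 : ∀ y, β (0, y) = 0) (hK : IsCompact K) (hε : 0 < ε)
    (hM : Integrable (fun w : StrongDual ℝ X × StrongDual ℝ Y => ((1 + ‖w‖) ^ M)⁻¹) ν)
    (hdec : ∀ f, TestOn K f → ∀ N : ℕ, ∃ C : ℝ, 0 ≤ C ∧ ∀ (l : StrongDual ℝ V) w,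
      ‖fhat (pairing X Y) μ (amp f β l) w‖ ≤ C ∧
      (ε * ‖l‖ ≤ ‖w‖ → ‖fhat (pairing X Y) μ (amp f β l) w‖ * (1 + ‖w‖) ^ N ≤ C))
    (hinv : ∀ G : X × Y → ℂ, TestOn K G → ∫ w, fhat (pairing X Y) μ G w ∂ν = G 0)
    (hf : TestOn K f) (J L : ℕ) (l : List (StrongDual ℝ V)) :
    SemiBound r₁ r₂ ε J L l.length fun h a b ζ =>
      ‖pds l (fullRemainder μ ν r₁ r₂ β f J h a b) ζ‖ := by
  obtain ⟨P, hP⟩ : ∃ P, P = J + (l.length + M) + L * (l.length + M) := ⟨_, rfl⟩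
  have hJP : J ≤ P := by omega
  have h1 := semiBound_remainder μ ν r₁ r₂ hβ hβ1 hβ2 hK hε hM hdec hinv hf J L l hP
  have h2 := SemiBound.sum (Finset.range P) fun p _ => SemiBound.sum (Finset.range P) fun q _ =>
    SemiBound.sum (Finset.range (min p q + 1)) fun r hr =>
      (show SemiBound r₁ r₂ ε J L l.length fun h a b ζ => if J + r ≤ p + q then h ^ (p + q - r) *
        ‖pds l (termOf r₁ r₂ β f p q r a b) ζ‖ else 0 by
        split_ifs with hc
        · exact semiBound_termOf r₁ r₂ hβ hf hε l
            (Nat.lt_succ_iff.1 (Finset.mem_range.1 hr)) hc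
        · exact SemiBound.zero)
  refine (h1.add h2).of_le (c := 1) zero_le_one fun h a b ζ hh ha hb => ?_
  have st : ∀ p q r, ContDiff ℝ ∞ fun ζ => if J + r ≤ p + q then
      (h : ℂ) ^ (p + q - r) * termOf r₁ r₂ β f p q r a b ζ else 0 := by
    intro p q r
    split_ifs
    · exact contDiff_const.mul (termOf_smooth r₁ r₂ hβ hf ha.1 hb.1 p q r)
    · exact contDiff_const
  rw [one_mul, fullRemainder_eq μ ν r₁ r₂ hβ hβ1 hβ2 hf hJP hh.ne', pds_add
    (remainder_smooth μ ν r₁ r₂ hβ hK hf ha hb P h)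
    (ContDiff.sum fun p _ => ContDiff.sum fun q _ => ContDiff.sum fun r _ => st p q r),
    pds_sum _ fun p => ContDiff.sum fun q _ => ContDiff.sum fun r _ => st p q r]
  refine (norm_add_le _ _).trans (add_le_add le_rfl ?_)
  refine norm_sum_le_of_le _ fun p _ => ?_
  rw [pds_sum _ fun q => ContDiff.sum fun r _ => st p q r]
  refine norm_sum_le_of_le _ fun q _ => ?_
  rw [pds_sum _ fun r => st p q r]
  refine norm_sum_le_of_le _ fun r _ => ?_
  split_ifs
  · rw [pds_const_mul (termOf_smooth r₁ r₂ hβ hf ha.1 hb.1 p q r), norm_mul, norm_pow,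
      Complex.norm_real, Real.norm_of_nonneg hh.le]
  · rw [pds_zero, norm_zero]

/-- The symbol bounds for the remainder. -/
theorem semiBound_fullRemainder (hβ : ContDiff ℝ ∞ β) (hβ1 : ∀ x, β (x, 0) = 0)
    (hβ2 : ∀ y, β (0, y) = 0) (hK : IsCompact K) (hε : 0 < ε)
    (hM : Integrable (fun w : StrongDual ℝ X × StrongDual ℝ Y => ((1 + ‖w‖) ^ M)⁻¹) ν)
    (hdec : ∀ f, TestOn K f → ∀ N : ℕ, ∃ C : ℝ, 0 ≤ C ∧ ∀ (l : StrongDual ℝ V) w,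
      ‖fhat (pairing X Y) μ (amp f β l) w‖ ≤ C ∧
      (ε * ‖l‖ ≤ ‖w‖ → ‖fhat (pairing X Y) μ (amp f β l) w‖ * (1 + ‖w‖) ^ N ≤ C))
    (hinv : ∀ G : X × Y → ℂ, TestOn K G → ∫ w, fhat (pairing X Y) μ G w ∂ν = G 0)
    (hf : TestOn K f) (J L k : ℕ) :
    SemiBound r₁ r₂ ε J L k fun h a b ζ =>
      ‖iteratedFDeriv ℝ k (fullRemainder μ ν r₁ r₂ β f J h a b) ζ‖ := by
  obtain ⟨C, h0, hC⟩ := exists_norm_multilinear_le (dualFinBasis V) k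
  have h1 : ∀ i : Fin k → Fin (Module.finrank ℝ V), SemiBound r₁ r₂ ε J L k fun h a b ζ =>
      ‖pds (dirD i) (fullRemainder μ ν r₁ r₂ β f J h a b) ζ‖ := fun i => by
    have := semiBound_pds_fullRemainder μ ν r₁ r₂ hβ hβ1 hβ2 hK hε hM hdec hinv hf J L (dirD i)
    rwa [show (dirD i).length = k from List.length_ofFn] at this
  have h2 := SemiBound.sum Finset.univ fun i _ => h1 i
  refine h2.of_le h0 fun h a b ζ hh ha hb => hC _ _ fun i => ?_
  rw [iteratedFDeriv_eq_pds (fullRemainder_smooth μ ν r₁ r₂ hβ hK hf ha hb J h)]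
  exact Finset.single_le_sum (f := fun i : Fin k → Fin (Module.finrank ℝ V) =>
    ‖pds (dirD i)
      (fullRemainder μ ν r₁ r₂ β f J h a b) ζ‖) (fun _ _ => norm_nonneg _) (Finset.mem_univ i)

end FullRemainder

end StarProduct

namespace StarProduct

open MeasureTheory

set_option linter.unusedSectionVars false

/-! ### Fourier inversion for the dual measures -/

section Inversion

/-- The coordinates with respect to a basis, as a continuous linear map from Euclidean space. -/
def euclideanEquiv {ι Z : Type*} [Fintype ι] [NormedAddCommGroup Z] [NormedSpace ℝ Z]
    (b : Module.Basis ι ℝ Z) : EuclideanSpace ℝ ι ≃L[ℝ] Z :=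
  haveI := b.finiteDimensional_of_finite
  ((EuclideanSpace.basisFun ι ℝ).toBasis.equiv b (Equiv.refl ι)).toContinuousLinearEquiv

variable {ι Z D : Type*} [Fintype ι] [DecidableEq ι] [NormedAddCommGroup Z] [NormedSpace ℝ Z]
  [MeasurableSpace Z] [BorelSpace Z]
  [NormedAddCommGroup D] [NormedSpace ℝ D] [MeasurableSpace D] [BorelSpace D]

theorem euclideanEquiv_apply (b : Module.Basis ι ℝ Z) (x : EuclideanSpace ℝ ι) :
    euclideanEquiv b x = ∑ i, x i • b i := by
  have h : x = ∑ i, x i • (EuclideanSpace.basisFun ι ℝ).toBasis i := by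
    conv_lhs => rw [← (EuclideanSpace.basisFun ι ℝ).toBasis.sum_repr x]
    simp
  conv_lhs => rw [h]
  rw [map_sum]
  refine Finset.sum_congr rfl fun i _ => ?_
  rw [map_smul]
  congr 1
  simp [euclideanEquiv, - OrthonormalBasis.coe_toBasis]

theorem integral_euclideanEquiv (b : Module.Basis ι ℝ Z) (g : Z → ℂ) :
    ∫ x, g (euclideanEquiv b x) = ∫ z, g z ∂b.addHaar := by
  have := b.finiteDimensional_of_finite
  have hm : MeasurePreserving (euclideanEquiv b) volume b.addHaar := by
    refine ⟨(euclideanEquiv b).continuous.measurable, ?_⟩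
    rw [← OrthonormalBasis.addHaar_eq_volume (EuclideanSpace.basisFun ι ℝ),
      Module.Basis.map_addHaar]
    congr 1
    ext i
    simp [euclideanEquiv, - OrthonormalBasis.coe_toBasis]
  exact hm.integral_comp (euclideanEquiv b).toHomeomorph.measurableEmbedding g

theorem pairing_euclideanEquiv (B : Z →L[ℝ] D →L[ℝ] ℝ) {b : Module.Basis ι ℝ Z}
    {d : Module.Basis ι ℝ D} (hB : ∀ i j, B (b i) (d j) = if i = j then 1 else 0)
    (x y : EuclideanSpace ℝ ι) :
    B (euclideanEquiv b x) (euclideanEquiv d y) = inner ℝ x y := by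
  rw [euclideanEquiv_apply, euclideanEquiv_apply]
  simp [hB, PiLp.inner_apply, mul_comm]

/-- Fourier inversion at the origin, for the measures attached to dual bases. -/
theorem integral_fhat_basis (B : Z →L[ℝ] D →L[ℝ] ℝ) {b : Module.Basis ι ℝ Z}
    {d : Module.Basis ι ℝ D} (hB : ∀ i j, B (b i) (d j) = if i = j then 1 else 0) {K : Set Z}
    (hK : IsCompact K) {G : Z → ℂ} (hG : TestOn K G) :
    ∫ w, fhat B b.addHaar G w ∂d.addHaar = ((2 * Real.pi) ^ Fintype.card ι : ℝ) * G 0 := by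
  have := b.finiteDimensional_of_finite
  set g : EuclideanSpace ℝ ι → ℂ := fun x => G (euclideanEquiv b x) with hg
  have hsm : ContDiff ℝ ∞ g := hG.smooth.comp (euclideanEquiv b).contDiff
  have hcs : HasCompactSupport g :=
    (hG.hasCompactSupport hK).comp_homeomorph (euclideanEquiv b).toHomeomorph
  -- The Euclidean Fourier transform has kernel e^{-2πi⟨x,y⟩}, hence the dilation by (2π)⁻¹. Its
  -- Jacobian is the constant in the statement, and the integral that remains is the inverse
  -- transform at the origin.
  have hft : ∀ y, fhat B b.addHaar G (euclideanEquiv d y) =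
      FourierTransform.fourier g ((2 * Real.pi)⁻¹ • y) := by
    intro y
    rw [fhat, ← integral_euclideanEquiv, Real.fourier_eq']
    refine integral_congr_ae (.of_forall fun x => ?_)
    dsimp only
    rw [pairing_euclideanEquiv B hB, smul_eq_mul, mul_comm]
    congr 2
    rw [inner_smul_right, mul_comm]
    congr 2
    have := Real.pi_ne_zero
    field_simp
  rw [← integral_euclideanEquiv, integral_congr_ae (.of_forall hft),
    Measure.integral_comp_inv_smul]
  have hint : Integrable (FourierTransform.fourier g) := by
    have := (FourierTransform.fourier (hcs.toSchwartzMap hsm)).integrable (μ := volume)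
    rwa [SchwartzMap.fourier_coe] at this
  have hinv := congrFun (Continuous.fourierInv_fourier_eq hsm.continuous
    (hsm.continuous.integrable_of_hasCompactSupport hcs) hint) 0
  rw [Real.fourierInv_eq'] at hinv
  simp only [inner_zero_right, mul_zero, Complex.ofReal_zero, zero_mul, Complex.exp_zero,
    one_smul] at hinv
  rw [hinv, finrank_euclideanSpace, abs_of_pos (by positivity), hg]
  simp

theorem fhat_smul_measure (B : Z →L[ℝ] D →L[ℝ] ℝ) (c : ℝ≥0∞) (μ : Measure Z) (G : Z → ℂ) (w : D) :
    fhat B (c • μ) G w = (c.toReal : ℂ) * fhat B μ G w := by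
  rw [fhat, integral_smul_measure, Complex.real_smul, fhat]

end Inversion

/-! ### Haar measures and their duals as multiples of the measures attached to dual bases. -/

section DualHaar

variable {W : Type*} [NormedAddCommGroup W] [NormedSpace ℝ W] [FiniteDimensional ℝ W]
  [MeasurableSpace W] [BorelSpace W] (μ : Measure W) [μ.IsAddHaarMeasure]

/-- The volume of the parallelepiped spanned by the standard basis. -/
def basisVolume : ℝ≥0∞ := μ (parallelepiped (Module.finBasis ℝ W))

theorem eq_basisVolume_smul : μ = basisVolume μ • (Module.finBasis ℝ W).addHaar := by
  rw [Module.Basis.addHaar_def, basisVolume]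
  exact Measure.addHaarMeasure_unique μ (Module.finBasis ℝ W).parallelepiped

theorem basisVolume_ne_zero : basisVolume μ ≠ 0 :=
  ((IsOpen.measure_pos μ isOpen_interior
    (Module.finBasis ℝ W).parallelepiped.interior_nonempty').trans_le
      (measure_mono interior_subset)).ne'

theorem basisVolume_ne_top : basisVolume μ ≠ ⊤ :=
  (Module.finBasis ℝ W).parallelepiped.isCompact.measure_lt_top.ne

/-- The constant relating the dual measure to the one attached to the dual basis. -/
def dualVolume : ℝ≥0∞ := (ENNReal.ofReal ((2 * Real.pi) ^ Module.finrank ℝ W) * basisVolume μ)⁻¹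

theorem dualHaar_eq : dualHaar μ = dualVolume μ • (dualFinBasis W).addHaar := rfl

theorem two_pi_pow_pos (n : ℕ) : 0 < (2 * Real.pi) ^ n := by positivity

theorem dualVolume_ne_zero : dualVolume μ ≠ 0 :=
  ENNReal.inv_ne_zero.2 (ENNReal.mul_ne_top ENNReal.ofReal_ne_top (basisVolume_ne_top μ))

theorem dualVolume_ne_top : dualVolume μ ≠ ⊤ :=
  ENNReal.inv_ne_top.2 (mul_ne_zero
    (by simpa using two_pi_pow_pos (Module.finrank ℝ W)) (basisVolume_ne_zero μ))

theorem basisVolume_mul_dualVolume :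
    (basisVolume μ).toReal * (dualVolume μ).toReal * (2 * Real.pi) ^ Module.finrank ℝ W = 1 := by
  have h1 : (basisVolume μ).toReal ≠ 0 :=
    ENNReal.toReal_ne_zero.2 ⟨basisVolume_ne_zero μ, basisVolume_ne_top μ⟩
  have h2 := two_pi_pow_pos (Module.finrank ℝ W)
  rw [dualVolume, ENNReal.toReal_inv, ENNReal.toReal_mul, ENNReal.toReal_ofReal h2.le]
  field_simp

instance isAddHaarMeasure_dualHaar : (dualHaar μ).IsAddHaarMeasure := by
  rw [dualHaar_eq]
  exact Measure.IsAddHaarMeasure.smul _ (dualVolume_ne_zero μ) (dualVolume_ne_top μ)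

end DualHaar

/-! ### Fourier inversion at the origin on a product. -/

section ProductInversion

variable {X Y : Type*} [NormedAddCommGroup X] [NormedSpace ℝ X] [FiniteDimensional ℝ X]
  [NormedAddCommGroup Y] [NormedSpace ℝ Y] [FiniteDimensional ℝ Y]
  [MeasurableSpace X] [BorelSpace X] [MeasurableSpace Y] [BorelSpace Y]
  (μ₁ : Measure X) [μ₁.IsAddHaarMeasure] (μ₂ : Measure Y) [μ₂.IsAddHaarMeasure]

instance isAddHaarMeasure_prod_dualHaar : ((dualHaar μ₁).prod (dualHaar μ₂)).IsAddHaarMeasure :=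
  inferInstance

/-- By uniqueness of Haar measure everything reduces to dual bases. The normalization of the dual
measures is what cancels the powers of 2π and the volumes of the basic parallelepipeds. -/
theorem integral_fhat_pairing {K : Set (X × Y)} (hK : IsCompact K) {G : X × Y → ℂ}
    (hG : TestOn K G) :
    ∫ w, fhat (pairing X Y) (μ₁.prod μ₂) G w ∂((dualHaar μ₁).prod (dualHaar μ₂)) = G 0 := by
  have e1 : μ₁.prod μ₂ = (basisVolume μ₁ * basisVolume μ₂) •
      ((Module.finBasis ℝ X).prod (Module.finBasis ℝ Y)).addHaar := by
    conv_lhs => rw [eq_basisVolume_smul μ₁, eq_basisVolume_smul μ₂]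
    rw [Module.Basis.prod_addHaar, Measure.prod_smul_left, mul_smul]
    congr 1
    exact Measure.prod_smul_right _
  have e2 : (dualHaar μ₁).prod (dualHaar μ₂) = (dualVolume μ₁ * dualVolume μ₂) •
      ((dualFinBasis X).prod (dualFinBasis Y)).addHaar := by
    rw [dualHaar_eq, dualHaar_eq, Module.Basis.prod_addHaar, Measure.prod_smul_left, mul_smul]
    congr 1
    exact Measure.prod_smul_right _
  have hB : ∀ i j, pairing X Y ((Module.finBasis ℝ X).prod (Module.finBasis ℝ Y) i)
      ((dualFinBasis X).prod (dualFinBasis Y) j) = if i = j then 1 else 0 := by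
    rintro (i | i) (j | j) <;> simp [dualFinBasis_apply]
  rw [e1, e2, integral_smul_measure]
  simp only [fhat_smul_measure]
  rw [integral_const_mul, integral_fhat_basis _ hB hK hG, Complex.real_smul]
  have h1 := basisVolume_mul_dualVolume μ₁
  have h2 := basisVolume_mul_dualVolume μ₂
  have h3 : (((dualVolume μ₁ * dualVolume μ₂).toReal * ((basisVolume μ₁ * basisVolume μ₂).toReal *
      (2 * Real.pi) ^ Fintype.card (Fin (Module.finrank ℝ X) ⊕ Fin (Module.finrank ℝ Y))) : ℝ) : ℂ)
      = 1 := by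
    rw [Complex.ofReal_eq_one, Fintype.card_sum, Fintype.card_fin, Fintype.card_fin,
      ENNReal.toReal_mul, ENNReal.toReal_mul, pow_add]
    linear_combination ((basisVolume μ₂).toReal * (dualVolume μ₂).toReal *
      (2 * Real.pi) ^ Module.finrank ℝ Y) * h1 + h2
  rw [Complex.ofReal_mul, Complex.ofReal_mul] at h3
  linear_combination G 0 * h3

end ProductInversion

end StarProduct

namespace StarProduct

open MeasureTheory

set_option linter.unusedSectionVars false

/-! ### The star product of integrable symbols as a pairing with a Fourier transform -/

section Translation

variable {X Y : Type*} [NormedAddCommGroup X] [NormedSpace ℝ X] [FiniteDimensional ℝ X]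
  [NormedAddCommGroup Y] [NormedSpace ℝ Y] [FiniteDimensional ℝ Y]
  [MeasurableSpace X] [BorelSpace X] [MeasurableSpace Y] [BorelSpace Y]
  (μ₁ : Measure X) [μ₁.IsAddHaarMeasure] (μ₂ : Measure Y) [μ₂.IsAddHaarMeasure]

/-- Insert the definitions of the inverse Fourier transforms, integrate over x and y first, and
translate the frequencies by ζ. Integrability of a and b is needed for Fubini only; the right side
makes sense for arbitrary symbols, which is how the star product is extended. -/
theorem integral_invFourier_mul {a : StrongDual ℝ X → ℂ} {b : StrongDual ℝ Y → ℂ}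
    (ha : Integrable a (dualHaar μ₁)) (hb : Integrable b (dualHaar μ₂)) {K : Set (X × Y)}
    (hK : IsCompact K) {F : X × Y → ℂ} (hF : TestOn K F) (ζ : StrongDual ℝ X × StrongDual ℝ Y) :
    ∫ p : X × Y, invFourier μ₁ a p.1 * invFourier μ₂ b p.2 *
      Complex.exp (Complex.I * (ζ.1 p.1 : ℝ)) * Complex.exp (Complex.I * (ζ.2 p.2 : ℝ)) * F p
      ∂(μ₁.prod μ₂) =
    osc (pairing X Y) (μ₁.prod μ₂) ((dualHaar μ₁).prod (dualHaar μ₂)) F (cpair a b 1 1 ζ) := by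
  set μ := μ₁.prod μ₂
  set ν := (dualHaar μ₁).prod (dualHaar μ₂) with hν
  have hab : Integrable (fun w : StrongDual ℝ X × StrongDual ℝ Y => a w.1 * b w.2) ν :=
    ha.mul_prod hb
  have hFi : Integrable F μ := hF.integrable hK μ
  set ph : (StrongDual ℝ X × StrongDual ℝ Y) → X × Y → ℂ := fun w z =>
    Complex.exp (Complex.I * ((pairing X Y z ζ - pairing X Y z w : ℝ) : ℂ)) with hph
  have hphn : ∀ w z, ‖ph w z‖ = 1 := fun w z => by
    change ‖Complex.exp (Complex.I * _)‖ = 1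
    rw [mul_comm]
    exact Complex.norm_exp_ofReal_mul_I _
  have hphc : Continuous fun q : (StrongDual ℝ X × StrongDual ℝ Y) × (X × Y) => ph q.1 q.2 := by
    have h1 : Continuous fun q : (StrongDual ℝ X × StrongDual ℝ Y) × (X × Y) =>
        pairing X Y q.2 ζ - pairing X Y q.2 q.1 := by
      refine Continuous.sub ?_ ?_
      · exact ((pairing X Y).continuous.comp continuous_snd).clm_apply continuous_const
      · exact ((pairing X Y).continuous.comp continuous_snd).clm_apply continuous_fst
    exact Complex.continuous_exp.comp
      (continuous_const.mul (Complex.continuous_ofReal.comp h1))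
  have hint : Integrable (Function.uncurry fun w z => (a w.1 * b w.2) * (F z * ph w z))
      (ν.prod μ) := by
    have h1 := (hab.mul_prod hFi).bdd_mul (c := 1) hphc.aestronglyMeasurable
      (.of_forall fun q => (hphn q.1 q.2).le)
    refine h1.congr (.of_forall fun q => ?_)
    simp only [Function.uncurry]
    ring
  have hR : osc (pairing X Y) μ ν F (cpair a b 1 1 ζ) =
      ∫ w, ∫ z, (a w.1 * b w.2) * (F z * ph w z) ∂μ ∂ν := by
    rw [osc, ← integral_sub_right_eq_self _ ζ]
    refine integral_congr_ae (.of_forall fun w => ?_)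
    dsimp only
    rw [integral_const_mul, fhat, cpair]
    congr 1
    · simp
    · refine integral_congr_ae (.of_forall fun z => ?_)
      dsimp only [hph]
      rw [map_sub]
      congr 4
      ring
  rw [hR, integral_integral_swap hint]
  refine integral_congr_ae (.of_forall fun z => ?_)
  dsimp only
  have e : ∀ w : StrongDual ℝ X × StrongDual ℝ Y, (a w.1 * b w.2) * (F z * ph w z) =
      (F z * (Complex.exp (Complex.I * (ζ.1 z.1 : ℝ)) * Complex.exp (Complex.I * (ζ.2 z.2 : ℝ)))) *
      ((a w.1 * Complex.exp (-(Complex.I * (w.1 z.1 : ℝ)))) *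
        (b w.2 * Complex.exp (-(Complex.I * (w.2 z.2 : ℝ))))) := by
    intro w
    have : ph w z = Complex.exp (Complex.I * (ζ.1 z.1 : ℝ)) *
        Complex.exp (Complex.I * (ζ.2 z.2 : ℝ)) * (Complex.exp (-(Complex.I * (w.1 z.1 : ℝ))) *
        Complex.exp (-(Complex.I * (w.2 z.2 : ℝ)))) := by
      simp only [hph, pairing_apply, ← Complex.exp_add]
      congr 1
      push_cast
      ring
    rw [this]
    ring
  rw [integral_congr_ae (.of_forall e), integral_const_mul, hν]
  have h3 := integral_prod_mul (μ := dualHaar μ₁) (ν := dualHaar μ₂)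
    (fun ξ : StrongDual ℝ X => a ξ * Complex.exp (-(Complex.I * (ξ z.1 : ℝ))))
    (fun η : StrongDual ℝ Y => b η * Complex.exp (-(Complex.I * (η z.2 : ℝ))))
  rw [h3, invFourier, invFourier]
  ring

end Translation

end StarProduct

namespace StarProduct

open MeasureTheory

set_option linter.unusedSectionVars false

/-! ### The Baker–Campbell–Hausdorff remainder near the origin -/

section Lie

variable {E : Type*} [NormedAddCommGroup E] [NormedSpace ℝ E] [FiniteDimensional ℝ E]
  {G : Type*} [TopologicalSpace G] [T2Space G] [ChartedSpace E G] [Group G]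
  [LieGroup 𝓘(ℝ, E) ω G]
  {V : Type*} [NormedAddCommGroup V] [NormedSpace ℝ V] [FiniteDimensional ℝ V]

/-- The constant curve is an integral curve of the zero field. As `lieExp` selects some endpoint,
uniqueness of integral curves is needed to conclude that the selected one is the identity. -/
theorem lieExp_zero : lieExp (0 : GroupLieAlgebra 𝓘(ℝ, E) G) = 1 := by
  have hc := FiniteDimensional.complete ℝ E
  have : LieGroup 𝓘(ℝ, E) (minSmoothness ℝ 3) G := LieGroup.of_le le_top
  have hz : ∀ g : G, mulInvariantVectorField (0 : GroupLieAlgebra 𝓘(ℝ, E) G) g = 0 := fun g => by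
    exact map_zero (mfderiv 𝓘(ℝ, E) 𝓘(ℝ, E) (g * ·) (1 : G))
  have hconst : IsMIntegralCurve (I := 𝓘(ℝ, E)) (fun _ : ℝ => (1 : G))
      (mulInvariantVectorField (0 : GroupLieAlgebra 𝓘(ℝ, E) G)) := isMIntegralCurve_const (hz 1)
  obtain ⟨γ, h0, hγ, h1⟩ := Classical.epsilon_spec
    (p := fun g : G => ∃ γ : ℝ → G, γ 0 = 1 ∧ IsMIntegralCurve (I := 𝓘(ℝ, E)) γ
      (mulInvariantVectorField (0 : GroupLieAlgebra 𝓘(ℝ, E) G)) ∧ γ 1 = g) ⟨1, _, rfl, hconst, rfl⟩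
  have hM : IsManifold 𝓘(ℝ, E) 1 G := by
    have : IsManifold 𝓘(ℝ, E) ω G := inferInstance
    exact IsManifold.of_le (n := ω) le_top
  have e : γ = fun _ => (1 : G) :=
    isMIntegralCurve_Ioo_eq_of_contMDiff_boundaryless (t₀ := 0)
      ((contMDiff_mulInvariantVectorField (0 : GroupLieAlgebra 𝓘(ℝ, E) G)).of_le (by simp)) hγ hconst h0
  exact h1.symm.trans (congrFun e 1)

variable {L : V ≃L[ℝ] GroupLieAlgebra 𝓘(ℝ, E) G} {𝒢 : Set V}

theorem expMap_zero : expMap L 0 = 1 := by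
  rw [expMap, map_zero, lieExp_zero]

theorem logMap_expMap (h𝒢 : IsExpNeighborhood L 𝒢) {x : V} (hx : x ∈ 𝒢) :
    logMap L 𝒢 (expMap L x) = x :=
  h𝒢.injOn (Function.invFunOn_mem ⟨x, hx, rfl⟩) hx (Function.invFunOn_eq ⟨x, hx, rfl⟩)

theorem bchRemainder_zero_right (h𝒢 : IsExpNeighborhood L 𝒢) {x : V} (hx : x ∈ 𝒢) :
    bchRemainder L 𝒢 x 0 = 0 := by
  rw [bchRemainder, expMap_zero, mul_one, logMap_expMap h𝒢 hx]
  simp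

theorem bchRemainder_zero_left (h𝒢 : IsExpNeighborhood L 𝒢) {y : V} (hy : y ∈ 𝒢) :
    bchRemainder L 𝒢 0 y = 0 := by
  rw [bchRemainder, expMap_zero, one_mul, logMap_expMap h𝒢 hy]
  simp

/-- The logarithm is analytic only on the image of 𝒢, so x and y are restricted to the open set of
pairs in 𝒢 for which exp(x) exp(y) lies in this image. By continuity of the product it is a
neighborhood of the origin. -/
theorem contDiffAt_bchRemainder (h𝒢 : IsExpNeighborhood L 𝒢) :
    ∀ᶠ p : V × V in 𝓝 0, ContDiffAt ℝ ∞ (fun p : V × V => bchRemainder L 𝒢 p.1 p.2) p := by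
  have hmul : ContMDiffOn 𝓘(ℝ, V × V) 𝓘(ℝ, E) ω
      (fun p : V × V => expMap L p.1 * expMap L p.2) (𝒢 ×ˢ 𝒢) :=
    (h𝒢.analytic_exp.comp contDiff_fst.contMDiff.contMDiffOn fun p hp => hp.1).mul
      (h𝒢.analytic_exp.comp contDiff_snd.contMDiff.contMDiffOn fun p hp => hp.2)
  have ho : IsOpen (𝒢 ×ˢ 𝒢) := h𝒢.isOpen.prod h𝒢.isOpen
  set O := (𝒢 ×ˢ 𝒢) ∩ (fun p : V × V => expMap L p.1 * expMap L p.2) ⁻¹' (expMap L '' 𝒢) with hO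
  have hOo : IsOpen O := hmul.continuousOn.isOpen_inter_preimage ho h𝒢.isOpen_image
  have h0 : (0 : V × V) ∈ O :=
    ⟨⟨h𝒢.zero_mem, h𝒢.zero_mem⟩, 0, h𝒢.zero_mem, by simp [expMap_zero]⟩
  have hlog : ContMDiffOn 𝓘(ℝ, V × V) 𝓘(ℝ, V) ω
      (fun p : V × V => logMap L 𝒢 (expMap L p.1 * expMap L p.2)) O :=
    h𝒢.analytic_log.comp (hmul.mono Set.inter_subset_left) fun p hp => hp.2
  rw [contMDiffOn_iff_contDiffOn] at hlog
  filter_upwards [hOo.mem_nhds h0] with p hp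
  exact (((hlog.contDiffAt (hOo.mem_nhds hp)).of_le le_top).sub contDiffAt_fst).sub contDiffAt_snd

/-- Near the origin the remainder agrees with a globally defined smooth map. -/
theorem exists_smooth_phase (h𝒢 : IsExpNeighborhood L 𝒢) (W₁ W₂ : Submodule ℝ V) :
    ∃ β : W₁ × W₂ → V, ContDiff ℝ ∞ β ∧ (∀ x, β (x, 0) = 0) ∧ (∀ y, β (0, y) = 0) ∧
      ∀ᶠ z : W₁ × W₂ in 𝓝 0, bchRemainder L 𝒢 z.1 z.2 = β z := by
  set ι : W₁ × W₂ →L[ℝ] V × V := W₁.subtypeL.prodMap W₂.subtypeL with hι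
  have hc : Filter.Tendsto ι (𝓝 0) (𝓝 0) := by
    have := ι.continuous.tendsto 0
    rwa [map_zero] at this
  have hev : ∀ᶠ z : W₁ × W₂ in 𝓝 0,
      ContDiffAt ℝ ∞ (fun z : W₁ × W₂ => bchRemainder L 𝒢 z.1 z.2) z ∧ (z.1 : V) ∈ 𝒢 ∧
        (z.2 : V) ∈ 𝒢 := by
    have h1 := hc.eventually (contDiffAt_bchRemainder h𝒢)
    have h2 : ∀ᶠ p : V × V in 𝓝 0, p ∈ 𝒢 ×ˢ 𝒢 :=
      (h𝒢.isOpen.prod h𝒢.isOpen).mem_nhds ⟨h𝒢.zero_mem, h𝒢.zero_mem⟩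
    filter_upwards [h1, hc.eventually h2] with z hz hz'
    exact ⟨hz.comp z ι.contDiff.contDiffAt, hz'.1, hz'.2⟩
  obtain ⟨ρ, hρ, hsub⟩ := Metric.mem_nhds_iff.1 hev
  -- Far from the origin the remainder {x, y} has no good properties, so it is cut off. The product
  -- still vanishes on both axes: where η is nonzero, x and y lie in 𝒢, and there {x, 0} = {0, y} =
  -- 0.
  let η : ContDiffBump (0 : W₁ × W₂) := ⟨ρ / 4, ρ / 2, by positivity, by linarith⟩
  have hη : ∀ z, η z ≠ 0 → z ∈ Metric.ball (0 : W₁ × W₂) ρ := fun z hz => by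
    have : z ∈ Function.support η := hz
    rw [η.support_eq] at this
    exact Metric.ball_subset_ball (by change ρ / 2 ≤ ρ; linarith) this
  refine ⟨fun z => η z • bchRemainder L 𝒢 z.1 z.2, ?_, fun x => ?_, fun y => ?_, ?_⟩
  · rw [contDiff_iff_contDiffAt]
    intro z
    by_cases hz : z ∈ tsupport η
    · rw [η.tsupport_eq] at hz
      have hz' : z ∈ Metric.ball (0 : W₁ × W₂) ρ :=
        Metric.closedBall_subset_ball (by change ρ / 2 < ρ; linarith) hz
      exact η.contDiffAt.smul (hsub hz').1
    · have h1 := notMem_tsupport_iff_eventuallyEq.1 hz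
      refine (contDiffAt_const (c := (0 : V))).congr_of_eventuallyEq ?_
      filter_upwards [h1] with w hw
      rw [hw]
      simp
  · by_cases h : η (x, 0) = 0
    · simp [h]
    · have := (hsub (hη _ h)).2.1
      simp [bchRemainder_zero_right h𝒢 this]
  · by_cases h : η (0, y) = 0
    · simp [h]
    · have := (hsub (hη _ h)).2.2
      simp [bchRemainder_zero_left h𝒢 this]
  · filter_upwards [Metric.closedBall_mem_nhds (0 : W₁ × W₂) η.rIn_pos] with z hz
    rw [η.one_of_mem_closedBall hz, one_smul]

end Lie

end StarProduct

namespace StarProduct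

open MeasureTheory

set_option linter.unusedSectionVars false

/-! ### Comparison of weights on the dual of a space and of its subspaces -/

section Weights

theorem eq_bot_or_eq_ofInt {m : Order} (h : m ≠ ⊤) : m = ⊥ ∨ ∃ k : ℤ, m = ofInt k :=
  match m, h with
  | none, _ => .inl rfl
  | some none, h => absurd rfl h
  | some (some k), _ => .inr ⟨k, rfl⟩

theorem ofInt_le_ofInt {k n : ℤ} : ofInt k ≤ ofInt n ↔ k ≤ n :=
  WithBot.coe_le_coe.trans WithTop.coe_le_coe

theorem ofInt_ne_top (k : ℤ) : ofInt k ≠ ⊤ := fun h =>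
  WithTop.coe_ne_top (WithBot.coe_injective h)

theorem japaneseBracket_le_mul {D D' : Type*} [NormedAddCommGroup D] [NormedSpace ℝ D]
    [NormedAddCommGroup D'] [NormedSpace ℝ D'] {T : ℝ} (hT : 1 ≤ T) {x : D} {y : D'}
    (h : ‖x‖ ≤ T * ‖y‖) : japaneseBracket x ≤ T * japaneseBracket y := by
  have hT0 : 0 ≤ T := zero_le_one.trans hT
  unfold japaneseBracket
  rw [← Real.sqrt_sq hT0, ← Real.sqrt_mul (sq_nonneg T)]
  refine Real.sqrt_le_sqrt ?_
  have h1 : ‖x‖ ^ 2 ≤ (T * ‖y‖) ^ 2 := by gcongr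
  nlinarith

variable {V : Type*} [NormedAddCommGroup V] [NormedSpace ℝ V] [FiniteDimensional ℝ V]

/-- Restriction of functionals to a subspace, as a continuous linear map. -/
def restrictL (W : Submodule ℝ V) : StrongDual ℝ V →L[ℝ] StrongDual ℝ W :=
  (ContinuousLinearMap.compL ℝ W V ℝ).flip W.subtypeL

@[simp] theorem restrictL_apply (W : Submodule ℝ V) (ζ : StrongDual ℝ V) :
    restrictL W ζ = restrict W ζ := rfl

theorem norm_restrict_le (W : Submodule ℝ V) (ζ : StrongDual ℝ V) : ‖restrict W ζ‖ ≤ ‖ζ‖ :=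
  (ContinuousLinearMap.opNorm_comp_le _ _).trans
    (mul_le_of_le_one_right (norm_nonneg _) W.norm_subtypeL_le)

theorem exists_norm_le_mul_of_injective {D D' : Type*} [NormedAddCommGroup D] [NormedSpace ℝ D]
    [FiniteDimensional ℝ D] [NormedAddCommGroup D'] [NormedSpace ℝ D'] (A : D →L[ℝ] D')
    (hA : ∀ x, A x = 0 → x = 0) : ∃ K : ℝ, 1 ≤ K ∧ ∀ x, ‖x‖ ≤ K * ‖A x‖ := by
  obtain ⟨K, -, hK⟩ := LinearMap.exists_antilipschitzWith (A : D →ₗ[ℝ] D')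
    (LinearMap.ker_eq_bot'.2 hA)
  refine ⟨max 1 K, le_max_left _ _, fun x => ?_⟩
  have h1 := hK.le_mul_dist x 0
  simp only [dist_zero_right, map_zero] at h1
  exact h1.trans (mul_le_mul_of_nonneg_right (le_max_right _ _) (norm_nonneg _))

variable {W₁ W₂ : Submodule ℝ V}

theorem eq_zero_of_restrict_eq_zero (hW : W₁ ⊔ W₂ = ⊤) {ζ : StrongDual ℝ V}
    (h₁ : restrict W₁ ζ = 0) (h₂ : restrict W₂ ζ = 0) : ζ = 0 := by
  have k : (⊤ : Submodule ℝ V) ≤ LinearMap.ker (ζ : V →ₗ[ℝ] ℝ) := by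
    rw [← hW, sup_le_iff]
    refine ⟨fun x hx => ?_, fun x hx => ?_⟩
    · have := congrArg (fun T : StrongDual ℝ W₁ => T ⟨x, hx⟩) h₁
      simpa [restrict] using this
    · have := congrArg (fun T : StrongDual ℝ W₂ => T ⟨x, hx⟩) h₂
      simpa [restrict] using this
  ext x
  exact LinearMap.mem_ker.1 (k Submodule.mem_top)

theorem eq_zero_of_restrict_top {W : Submodule ℝ V} (hW : W = ⊤) {ζ : StrongDual ℝ V}
    (h : restrict W ζ = 0) : ζ = 0 :=
  eq_zero_of_restrict_eq_zero (W₁ := W) (W₂ := W) (by simpa using hW) h h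

/-- The comparison of the weights at a functional and at small perturbations of its restrictions. -/
structure BracketComparison (W₁ W₂ : Submodule ℝ V) (T : ℝ) (ζ : StrongDual ℝ V)
    (u : StrongDual ℝ W₁) (v : StrongDual ℝ W₂) : Prop where
  left_le : japaneseBracket u ≤ T * japaneseBracket ζ
  right_le : japaneseBracket v ≤ T * japaneseBracket ζ
  le_left : W₁ = ⊤ → japaneseBracket ζ ≤ T * japaneseBracket u
  le_right : W₂ = ⊤ → japaneseBracket ζ ≤ T * japaneseBracket v
  le_or_le : japaneseBracket ζ ≤ T * japaneseBracket u ∨ japaneseBracket ζ ≤ T * japaneseBracket v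

/-- A value of the small parameter for which the weights can be compared. -/
def SmallParameter (W₁ W₂ : Submodule ℝ V) (ε : ℝ) : Prop :=
  ∃ T : ℝ, 1 ≤ T ∧ ∀ (ζ : StrongDual ℝ V) (ξ : StrongDual ℝ W₁) (η : StrongDual ℝ W₂),
    ‖ξ‖ ≤ ε * ‖ζ‖ → ‖η‖ ≤ ε * ‖ζ‖ →
      BracketComparison W₁ W₂ T ζ (restrictL W₁ ζ + ξ) (restrictL W₂ ζ + η)

/-- As W₁ + W₂ = V, the map ζ ↦ (ζ₁, ζ₂) is injective and hence bounded below, and so is restriction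
to a single Wᵢ if that is all of V. Let K dominate the constants: with ε = 1/(2K), a perturbation of
size ε‖ζ‖ destroys at most half of the lower bound, which gives comparability with constant 2K. -/
theorem exists_smallParameter (hW : W₁ ⊔ W₂ = ⊤) : ∃ ε : ℝ, 0 < ε ∧
    SmallParameter W₁ W₂ ε := by
  obtain ⟨K₀, k0, hK₀⟩ := exists_norm_le_mul_of_injective (D := StrongDual ℝ V)
    (D' := StrongDual ℝ W₁ × StrongDual ℝ W₂) ((restrictL W₁).prod (restrictL W₂))
    fun ζ h => by
      have h' : ((restrictL W₁ ζ, restrictL W₂ ζ) : StrongDual ℝ W₁ × StrongDual ℝ W₂) = 0 := h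
      exact eq_zero_of_restrict_eq_zero hW (congrArg Prod.fst h') (congrArg Prod.snd h')
  have hK' : ∀ W : Submodule ℝ V, ∃ K : ℝ, 1 ≤ K ∧
      (W = ⊤ → ∀ ζ : StrongDual ℝ V, ‖ζ‖ ≤ K * ‖restrictL W ζ‖) := fun W => by
    by_cases h : W = ⊤
    · obtain ⟨K, k1, hK⟩ := exists_norm_le_mul_of_injective (D := StrongDual ℝ V)
        (D' := StrongDual ℝ W) (restrictL W)
        fun ζ hζ => eq_zero_of_restrict_top h hζ
      exact ⟨K, k1, fun _ => hK⟩
    · exact ⟨1, le_rfl, fun h' => absurd h' h⟩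
  obtain ⟨K₁, k1, hK₁⟩ := hK' W₁
  obtain ⟨K₂, k2, hK₂⟩ := hK' W₂
  set K := K₀ + K₁ + K₂
  have hK1 : 1 ≤ K := by linarith
  set ε := (2 * K)⁻¹ with hε
  have hε0 : 0 < ε := by positivity
  have hε1 : ε ≤ 1 := inv_le_one_of_one_le₀ (by linarith)
  have hεK : ε * (2 * K) = 1 := inv_mul_cancel₀ (by positivity)
  refine ⟨ε, hε0, 2 * K, by linarith, ?_⟩
  intro ζ ξ η hξ hη
  set T := 2 * K
  have hT1 : 1 ≤ T := by linarith
  have nζ := norm_nonneg ζ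
  have low : ∀ {W : Submodule ℝ V} (κ : StrongDual ℝ W), ‖κ‖ ≤ ε * ‖ζ‖ →
      ‖ζ‖ ≤ K * ‖restrictL W ζ‖ →
      japaneseBracket ζ ≤ T * japaneseBracket (restrictL W ζ + κ) := by
    intro W κ hκ h
    refine japaneseBracket_le_mul hT1 ?_
    have h1 : ‖restrictL W ζ‖ ≤ ‖restrictL W ζ + κ‖ + ‖κ‖ := by
      simpa using norm_sub_le (restrictL W ζ + κ) κ
    have h2 : ‖ζ‖ ≤ K * (‖restrictL W ζ + κ‖ + ε * ‖ζ‖) := h.trans (by gcongr; linarith)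
    have h3 : ‖ζ‖ ≤ 2 * K * ‖restrictL W ζ + κ‖ := by nlinarith
    exact h3
  have up : ∀ {W : Submodule ℝ V} (κ : StrongDual ℝ W), ‖κ‖ ≤ ε * ‖ζ‖ →
      japaneseBracket (restrictL W ζ + κ) ≤ T * japaneseBracket ζ := by
    intro W κ hκ
    refine japaneseBracket_le_mul hT1 ?_
    have h1 := norm_restrict_le W ζ
    rw [← restrictL_apply] at h1
    have h2 := norm_add_le (restrictL W ζ) κ
    nlinarith
  refine ⟨up ξ hξ, up η hη, fun h => low ξ hξ ?_,
    fun h => low η hη ?_, ?_⟩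
  · exact (hK₁ h ζ).trans (by gcongr; linarith)
  · exact (hK₂ h ζ).trans (by gcongr; linarith)
  · have h0 := hK₀ ζ
    rw [ContinuousLinearMap.prod_apply, Prod.norm_def] at h0
    rcases max_choice ‖restrictL W₁ ζ‖ ‖restrictL W₂ ζ‖ with h | h
    · exact .inl (low ξ hξ (by rw [h] at h0; exact h0.trans (by gcongr; linarith)))
    · exact .inr (low η hη (by rw [h] at h0; exact h0.trans (by gcongr; linarith)))

theorem zpow_le_of_comparable {x y T : ℝ} (hx : 1 ≤ x) (hy : 1 ≤ y) (hT : 1 ≤ T)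
    (h1 : x ≤ T * y) (h2 : y ≤ T * x) {m : ℤ} {N : ℕ} (hm : m.natAbs ≤ N) :
    x ^ m ≤ T ^ N * y ^ m := by
  have hx0 : 0 < x := by linarith
  have hy0 : 0 < y := by linarith
  have hT0 : 0 < T := by linarith
  refine le_trans ?_ (mul_le_mul_of_nonneg_right (pow_le_pow_right₀ hT hm) (zpow_pos hy0 m).le)
  rcases le_total 0 m with hs | hs
  · obtain ⟨t, rfl⟩ := Int.eq_ofNat_of_zero_le hs
    simp only [Int.natAbs_natCast, zpow_natCast]
    rw [← mul_pow]
    gcongr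
  · obtain ⟨t, ht⟩ := Int.eq_ofNat_of_zero_le (neg_nonneg.2 hs)
    obtain rfl : m = -(t : ℤ) := by rw [← neg_neg m, ht]
    simp only [Int.natAbs_neg, Int.natAbs_natCast, zpow_neg, zpow_natCast]
    rw [← div_eq_mul_inv, inv_le_comm₀ (by positivity) (by positivity), inv_div,
      div_le_iff₀ (by positivity), ← mul_pow, mul_comm]
    gcongr

theorem zpow_le_of_le_mul {x y T : ℝ} (hx : 1 ≤ x)
    (h1 : x ≤ T * y) {m : ℤ} {N : ℕ} (hm : m.natAbs ≤ N) : x ^ m ≤ T ^ N * y ^ (N : ℤ) := by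
  calc x ^ m ≤ x ^ (N : ℤ) := zpow_le_zpow_right₀ hx (by omega)
    _ = x ^ N := zpow_natCast _ _
    _ ≤ (T * y) ^ N := by gcongr
    _ = _ := by rw [mul_pow, zpow_natCast]

/-- The condition `WeightOK` for the restriction maps. -/
abbrev RestrictWeightOK (W₁ W₂ : Submodule ℝ V) (ε : ℝ) (κ : ℕ) (n₁ n₂ n : ℤ) : Prop :=
  WeightOK (D := StrongDual ℝ V) (D₁ := StrongDual ℝ W₁) (D₂ := StrongDual ℝ W₂) (restrictL W₁)
    (restrictL W₂) ε κ n₁ n₂ n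

variable {ε : ℝ}

theorem weightOK_full (h : SmallParameter W₁ W₂ ε) (h₁ : W₁ = ⊤) (h₂ : W₂ = ⊤) (κ : ℕ)
    (n₁ n₂ : ℤ) : RestrictWeightOK W₁ W₂ ε κ n₁ n₂ (n₁ + n₂) := by
  obtain ⟨T, hT, hc⟩ := h
  refine ⟨T ^ (n₁.natAbs + κ) * T ^ (n₂.natAbs + κ), by positivity,
    fun p hp q hq ζ ξ η hξ hη => ?_⟩
  have c := hc ζ ξ η hξ hη
  have j0 := one_le_japaneseBracket ζ
  have e1 := zpow_le_of_comparable (one_le_japaneseBracket _) j0 hT c.left_le (c.le_left h₁)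
    (m := n₁ - p) (N := n₁.natAbs + κ) (by omega)
  have e2 := zpow_le_of_comparable (one_le_japaneseBracket _) j0 hT c.right_le (c.le_right h₂)
    (m := n₂ - q) (N := n₂.natAbs + κ) (by omega)
  have p2 := zpow_pos (japaneseBracket_pos (restrictL W₂ ζ + η)) (n₂ - q)
  have p0 := zpow_pos (japaneseBracket_pos ζ) (n₁ - p)
  refine (mul_le_mul e1 e2 p2.le (by positivity)).trans (le_of_eq ?_)
  rw [show n₁ + n₂ - p - q = (n₁ - p) + (n₂ - q) by ring, zpow_add₀ (by positivity)]
  ring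

/-- Here ⟨ζ₂ + η⟩ is comparable to ⟨ζ⟩, but ⟨ζ₁ + ξ⟩ is only bounded above by it. In the worst case
the first factor grows like ⟨ζ⟩^(|n₁|+κ), and the order of the second symbol is chosen low enough to
pay for this and for the κ orders that differentiating the first symbol should have gained. -/
theorem weightOK_right (h : SmallParameter W₁ W₂ ε) (h₂ : W₂ = ⊤) (κ : ℕ) (n₁ n : ℤ) :
    RestrictWeightOK W₁ W₂ ε κ n₁ (n - κ - (n₁.natAbs + κ : ℕ)) n := by
  obtain ⟨T, hT, hc⟩ := h
  set n₂ : ℤ := n - κ - (n₁.natAbs + κ : ℕ) with hn₂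
  refine ⟨T ^ (n₁.natAbs + κ) * T ^ (n₂.natAbs + κ), by positivity,
    fun p hp q hq ζ ξ η hξ hη => ?_⟩
  have c := hc ζ ξ η hξ hη
  have j0 := one_le_japaneseBracket ζ
  have e1 := zpow_le_of_le_mul (one_le_japaneseBracket _) c.left_le
    (m := n₁ - p) (N := n₁.natAbs + κ) (by omega)
  have e2 := zpow_le_of_comparable (one_le_japaneseBracket _) j0 hT c.right_le (c.le_right h₂)
    (m := n₂ - q) (N := n₂.natAbs + κ) (by omega)
  have p2 := zpow_pos (japaneseBracket_pos (restrictL W₂ ζ + η)) (n₂ - q)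
  refine (mul_le_mul e1 e2 p2.le (by positivity)).trans ?_
  rw [mul_mul_mul_comm, ← zpow_add₀ (by positivity)]
  gcongr
  omega

theorem weightOK_left (h : SmallParameter W₁ W₂ ε) (h₁ : W₁ = ⊤) (κ : ℕ) (n₂ n : ℤ) :
    RestrictWeightOK W₁ W₂ ε κ (n - κ - (n₂.natAbs + κ : ℕ)) n₂ n := by
  obtain ⟨T, hT, hc⟩ := h
  set n₁ : ℤ := n - κ - (n₂.natAbs + κ : ℕ) with hn₁
  refine ⟨T ^ (n₁.natAbs + κ) * T ^ (n₂.natAbs + κ), by positivity,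
    fun p hp q hq ζ ξ η hξ hη => ?_⟩
  have c := hc ζ ξ η hξ hη
  have j0 := one_le_japaneseBracket ζ
  have e1 := zpow_le_of_comparable (one_le_japaneseBracket _) j0 hT c.left_le (c.le_left h₁)
    (m := n₁ - p) (N := n₁.natAbs + κ) (by omega)
  have e2 := zpow_le_of_le_mul (one_le_japaneseBracket _) c.right_le
    (m := n₂ - q) (N := n₂.natAbs + κ) (by omega)
  have p2 := zpow_pos (japaneseBracket_pos (restrictL W₂ ζ + η)) (n₂ - q)
  have p0 := zpow_pos (japaneseBracket_pos ζ) (n₁ - p)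
  refine (mul_le_mul e1 e2 p2.le (by positivity)).trans ?_
  rw [mul_mul_mul_comm, ← zpow_add₀ (by positivity)]
  gcongr
  omega

/-- One of the two brackets is always comparable to ⟨ζ⟩, but which one depends on ζ. So both orders
are made very negative: the comparable factor supplies all the decay, and the other is at most 1. -/
theorem weightOK_rapid (h : SmallParameter W₁ W₂ ε) (κ : ℕ) (n : ℤ) :
    RestrictWeightOK W₁ W₂ ε κ (-(n.natAbs + 2 * κ : ℕ)) (-(n.natAbs + 2 * κ : ℕ))
      n := by
  obtain ⟨T, hT, hc⟩ := h
  set N := n.natAbs + 2 * κ with hN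
  refine ⟨T ^ N, by positivity, fun p hp q hq ζ ξ η hξ hη => ?_⟩
  have c := hc ζ ξ η hξ hη
  have j0 := one_le_japaneseBracket ζ
  have key : ∀ x y : ℝ, 1 ≤ x → 1 ≤ y → japaneseBracket ζ ≤ T * x → ∀ p q : ℕ, p ≤ κ → q ≤ κ →
      x ^ (-(N : ℤ) - p) * y ^ (-(N : ℤ) - q) ≤ T ^ N * japaneseBracket ζ ^ (n - p - q) := by
    intro x y hx hy hxζ p q hp hq
    have hx0 : 0 < x := by linarith
    have e1 : y ^ (-(N : ℤ) - q) ≤ 1 := zpow_le_one_of_nonpos₀ hy (by omega)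
    have e2 : x ^ (-(N : ℤ) - p) ≤ x ^ (-(N : ℤ)) := zpow_le_zpow_right₀ hx (by omega)
    have e3 : x ^ (-(N : ℤ)) ≤ T ^ N * japaneseBracket ζ ^ (-(N : ℤ)) := by
      rw [zpow_neg, zpow_neg, zpow_natCast, zpow_natCast, ← div_eq_mul_inv,
        inv_le_comm₀ (by positivity) (by positivity), inv_div, div_le_iff₀ (by positivity),
        ← mul_pow, mul_comm]
      gcongr
    have e4 : japaneseBracket ζ ^ (-(N : ℤ)) ≤ japaneseBracket ζ ^ (n - p - q) :=
      zpow_le_zpow_right₀ j0 (by omega)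
    calc _ ≤ x ^ (-(N : ℤ) - p) * 1 := by gcongr
      _ ≤ T ^ N * japaneseBracket ζ ^ (-(N : ℤ)) := by rw [mul_one]; exact e2.trans e3
      _ ≤ _ := by gcongr
  rcases c.le_or_le with h | h
  · exact key _ _ (one_le_japaneseBracket _) (one_le_japaneseBracket _) h p q hp hq
  · rw [mul_comm, sub_right_comm]
    exact key _ _ (one_le_japaneseBracket _) (one_le_japaneseBracket _) h q p hq hp

/-- A symbol of order −∞ has every integer order, so its order may be taken as low as the weight
condition demands. Admissibility provides such a symbol exactly where one of the restrictions of ζ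
fails to control ζ. If both subspaces are everything, the orders simply add up, and any slack is
given to a symbol that has room for it. -/
theorem exists_weights (h : SmallParameter W₁ W₂ ε) {m₁ m₂ : Order}
    (hm : Admissible W₁ W₂ m₁ m₂) (h₁ : m₁ ≠ ⊤) (h₂ : m₂ ≠ ⊤) {n : ℤ}
    (hn : m₁ + m₂ ≤ ofInt n) (κ : ℕ) : ∃ n₁ n₂ : ℤ, m₁ ≤ ofInt n₁ ∧ m₂ ≤ ofInt n₂ ∧
      RestrictWeightOK W₁ W₂ ε κ n₁ n₂ n := by
  by_cases hW₁ : W₁ = ⊤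
  · by_cases hW₂ : W₂ = ⊤
    · have hfull : ∀ n₁, RestrictWeightOK W₁ W₂ ε κ n₁ (n - n₁) n := fun n₁ => by
        have := weightOK_full h hW₁ hW₂ κ n₁ (n - n₁)
        rwa [add_sub_cancel] at this
      rcases eq_bot_or_eq_ofInt h₁ with rfl | ⟨k₁, rfl⟩
      · rcases eq_bot_or_eq_ofInt h₂ with rfl | ⟨k₂, rfl⟩
        · exact ⟨n, 0, bot_le, bot_le, by simpa using hfull n⟩
        · exact ⟨n - k₂, k₂, bot_le, le_rfl, by simpa using hfull (n - k₂)⟩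
      · refine ⟨k₁, n - k₁, le_rfl, ?_, hfull k₁⟩
        rcases eq_bot_or_eq_ofInt h₂ with rfl | ⟨k₂, rfl⟩
        · exact bot_le
        · have h3 : ofInt (k₁ + k₂) ≤ ofInt n := hn
          have h4 : k₁ + k₂ ≤ n := WithTop.coe_le_coe.1 (WithBot.coe_le_coe.1 h3)
          exact WithBot.coe_le_coe.2 (WithTop.coe_le_coe.2 (by omega))
    · obtain rfl := hm.2 hW₂
      rcases eq_bot_or_eq_ofInt h₂ with rfl | ⟨k₂, rfl⟩
      · exact ⟨_, 0, bot_le, bot_le, weightOK_left h hW₁ κ 0 n⟩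
      · exact ⟨_, k₂, bot_le, le_rfl, weightOK_left h hW₁ κ k₂ n⟩
  · obtain rfl := hm.1 hW₁
    by_cases hW₂ : W₂ = ⊤
    · rcases eq_bot_or_eq_ofInt h₁ with rfl | ⟨k₁, rfl⟩
      · exact ⟨0, _, bot_le, bot_le, weightOK_right h hW₂ κ 0 n⟩
      · exact ⟨k₁, _, le_rfl, bot_le, weightOK_right h hW₂ κ k₁ n⟩
    · obtain rfl := hm.2 hW₂
      exact ⟨_, _, bot_le, bot_le, weightOK_rapid h κ n⟩

end Weights

end StarProduct

namespace StarProduct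

set_option linter.unusedSectionVars false

/-! ### Continuity of bilinear maps between scales -/

section Scales

open Filter

/-! ### A single scale: steps, convergence and inclusions. -/

section One

variable {X : Type*} [AddCommGroup X] [Module ℂ X]

/-- A scale of spaces defined by seminorms, decreasing in the order, on a space `S`. -/
structure SeminormScale (S : Submodule ℂ X) (F : ℤ → Submodule ℂ X) (N : ℤ × ℕ → X → ℝ≥0∞) :
    Prop where
  add_le : ∀ i {a b}, a ∈ S → b ∈ S → N i (a + b) ≤ N i a + N i b
  smul_le : ∀ i (c : ℂ) {a}, a ∈ S → N i (c • a) ≤ ENNReal.ofReal ‖c‖ * N i a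
  anti : ∀ {n n' : ℤ}, n ≤ n' → ∀ k a, N (n', k) a ≤ N (n, k) a
  mem_iff : ∀ n a, a ∈ F n ↔ a ∈ S ∧ ∀ k, N (n, k) a < ⊤

variable {S : Submodule ℂ X} {F : ℤ → Submodule ℂ X} {N : ℤ × ℕ → X → ℝ≥0∞}

namespace SeminormScale

theorem mono (s : SeminormScale S F N) : Monotone F := fun n n' h a ha =>
  (s.mem_iff n' a).2 ⟨((s.mem_iff n a).1 ha).1, fun k =>
    (s.anti h k a).trans_lt (((s.mem_iff n a).1 ha).2 k)⟩

theorem map_zero (s : SeminormScale S F N) (i : ℤ × ℕ) : N i 0 = 0 := by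
  have := s.smul_le i 0 S.zero_mem
  simpa using this

theorem mem_step (s : SeminormScale S F N) {m : Order} {l : ℤ} (hl : m ≤ ofInt l) {a : X}
    (ha : a ∈ scaleSpace F m) : a ∈ F l := scaleSpace_mono s.mono hl ha

theorem exists_le_ofInt {m : Order} (h : m ≠ ⊤) : ∃ l : ℤ, m ≤ ofInt l := by
  rcases eq_bot_or_eq_ofInt h with rfl | ⟨k, rfl⟩
  exacts [⟨0, bot_le⟩, ⟨k, le_rfl⟩]

theorem exists_step (s : SeminormScale S F N) {m : Order} {a : X} (ha : a ∈ scaleSpace F m) :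
    ∃ n ≤ m, n ≠ ⊤ ∧ a ∈ scaleSpace F n := by
  by_cases h : m = ⊤
  · subst h
    obtain ⟨k, hk⟩ := (Submodule.mem_iSup_of_directed F s.mono.directed_le).1
      (show a ∈ ⨆ n, F n from ha)
    exact ⟨ofInt k, le_top, ofInt_ne_top k, hk⟩
  · exact ⟨m, le_rfl, h, ha⟩

theorem mem_of_ne_top {m : Order} (h : m ≠ ⊤) {a : X}
    (ha : ∀ n : ℤ, m ≤ ofInt n → a ∈ F n) : a ∈ scaleSpace F m := by
  rcases eq_bot_or_eq_ofInt h with rfl | ⟨k, rfl⟩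
  · rw [scaleSpace_bot, Submodule.mem_iInf]
    exact fun n => ha n bot_le
  · exact ha k le_rfl

theorem exists_common_step (s : SeminormScale S F N) {m : Order} {a a' : X}
    (ha : a ∈ scaleSpace F m) (ha' : a' ∈ scaleSpace F m) : ∃ l : ℤ, a ∈ F l ∧ a' ∈ F l := by
  obtain ⟨n, -, hn, h⟩ := s.exists_step ha
  obtain ⟨n', -, hn', h'⟩ := s.exists_step ha'
  obtain ⟨l, hl⟩ := exists_le_ofInt hn
  obtain ⟨l', hl'⟩ := exists_le_ofInt hn'
  exact ⟨max l l', s.mono (le_max_left _ _) (s.mem_step hl h),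
    s.mono (le_max_right _ _) (s.mem_step hl' h')⟩

theorem mem_base (s : SeminormScale S F N) {m : Order} {a : X} (ha : a ∈ scaleSpace F m) :
    a ∈ S := by
  obtain ⟨n, -, hn, ha'⟩ := s.exists_step ha
  obtain ⟨l, hl⟩ := exists_le_ofInt hn
  exact ((s.mem_iff l a).1 (s.mem_step hl ha')).1

/-- One criterion for integer order and for order −∞: the seminorms that define the topology have
order at least m and dominate, by monotonicity, all others of order at least m. Subbasic balls with
another center are handled by the triangle inequality. -/
theorem tendsto_nhds_iff (s : SeminormScale S F N) {m : Order} (h : m ≠ ⊤) {Y : Type*}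
    {f : Y → scaleSpace F m} {l : Filter Y} {v : scaleSpace F m} :
    Tendsto f l (@nhds _ (scaleTopology F N m) v) ↔ ∀ (n : ℤ) (k : ℕ), m ≤ ofInt n →
      Tendsto (fun y => N (n, k) ((f y : X) - v)) l (𝓝 0) := by
  have main : ∀ I : Set (ℤ × ℕ), (∀ i ∈ I, m ≤ ofInt i.1) →
      (∀ (n : ℤ) (k : ℕ), m ≤ ofInt n → ∃ n' ≤ n, (n', k) ∈ I) →
      (Tendsto f l (@nhds _ (seminormTopology (scaleSpace F m) I N) v) ↔
        ∀ (n : ℤ) (k : ℕ), m ≤ ofInt n →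
          Tendsto (fun y => N (n, k) ((f y : X) - v)) l (𝓝 0)) := by
    intro I hI hI'
    rw [TopologicalSpace.tendsto_nhds_generateFrom_iff]
    constructor
    · intro H n k hn
      obtain ⟨n', hn', hmem⟩ := hI' n k hn
      rw [ENNReal.tendsto_nhds_zero]
      intro ε hε
      have h1 := H _ ⟨v, (n', k), hmem, ε, hε, rfl⟩ (by
        simp only [Set.mem_ofPred_eq, sub_self, s.map_zero]
        exact hε)
      filter_upwards [h1] with y hy
      exact (s.anti hn' k _).trans (le_of_lt hy)
    · rintro H _ ⟨v₀, i, hi, ε, hε, rfl⟩ hv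
      have hv' : N i ((v : X) - v₀) < ε := hv
      have h1 := (H i.1 i.2 (hI i hi)).add_const (N i ((v : X) - v₀))
      rw [zero_add] at h1
      filter_upwards [h1.eventually_lt_const hv'] with y hy
      refine lt_of_le_of_lt ?_ hy
      have h2 := s.add_le i (s.mem_base (m := m) (f y - v).2) (s.mem_base (m := m) (v - v₀).2)
      simpa using h2
  rcases eq_bot_or_eq_ofInt h with rfl | ⟨n₀, rfl⟩
  · exact main Set.univ (fun _ _ => bot_le) fun n k _ => ⟨n, le_rfl, trivial⟩
  · exact main {i | i.1 = n₀} (fun i hi => by rw [show i.1 = n₀ from hi])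
      fun n k hn => ⟨n₀, ofInt_le_ofInt.1 hn, rfl⟩

theorem tendsto_seminorm (s : SeminormScale S F N) {m : Order} (h : m ≠ ⊤) (v : scaleSpace F m)
    {n : ℤ} (hn : m ≤ ofInt n) (k : ℕ) :
    Tendsto (fun y : scaleSpace F m => N (n, k) ((y : X) - v))
      (@nhds _ (scaleTopology F N m) v) (𝓝 0) :=
  (s.tendsto_nhds_iff h).1 tendsto_id n k hn

theorem continuous_inclusion (s : SeminormScale S F N) {n m : Order} (hn : n ≠ ⊤) (hnm : n ≤ m) :
    @Continuous _ _ (scaleTopology F N n) (scaleTopology F N m)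
      (Submodule.inclusion (scaleSpace_mono s.mono hnm)) := by
  have h1 : ∀ {m : Order} (hnm : n ≤ m), m ≠ ⊤ →
      @Continuous _ _ (scaleTopology F N n) (scaleTopology F N m)
        (Submodule.inclusion (scaleSpace_mono s.mono hnm)) := by
    intro m hnm hm
    let := scaleTopology F N n
    let := scaleTopology F N m
    refine continuous_iff_continuousAt.2 fun v => ?_
    exact (s.tendsto_nhds_iff hm).2 fun l k hl => s.tendsto_seminorm hn v (hnm.trans hl) k
  -- Continuity into the infimum of topologies that defines the inductive limit is tested in each of
  -- them, and there continuity on integer steps is part of the definition.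
  by_cases hm : m = ⊤
  · subst hm
    obtain ⟨l, hl⟩ := exists_le_ofInt hn
    have h2 := h1 hl (ofInt_ne_top l)
    have h3 : @Continuous _ _ (scaleTopology F N (ofInt l)) (scaleTopology F N ⊤)
        (Submodule.inclusion (scaleSpace_mono s.mono le_top)) :=
      continuous_sInf_rng.2 fun t ht => ht.2.2.2 l
    exact @Continuous.comp _ _ _ (scaleTopology F N n) (scaleTopology F N (ofInt l))
      (scaleTopology F N ⊤) _ _ h3 h2
  · exact h1 hnm hm

end SeminormScale

end One

/-! ### Bilinear maps between scales. -/

section Two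

variable {X₁ X₂ X : Type*} [AddCommGroup X₁] [Module ℂ X₁] [AddCommGroup X₂] [Module ℂ X₂]
  [AddCommGroup X] [Module ℂ X]
  {S₁ : Submodule ℂ X₁} {F₁ : ℤ → Submodule ℂ X₁} {N₁ : ℤ × ℕ → X₁ → ℝ≥0∞}
  {S₂ : Submodule ℂ X₂} {F₂ : ℤ → Submodule ℂ X₂} {N₂ : ℤ × ℕ → X₂ → ℝ≥0∞}
  {S : Submodule ℂ X} {F : ℤ → Submodule ℂ X} {N : ℤ × ℕ → X → ℝ≥0∞}
  {adm : Order → Order → Prop} {σ : Order → Order → Order} {Φ : X₁ → X₂ → X}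

/-- A bilinear map defined on pairs of elements of two scales, which for the pairs of orders in a
lower set maps the spaces of orders `m₁`, `m₂` to those of order `σ m₁ m₂`, with estimates. -/
structure ScaleBilinear (F₁ : ℤ → Submodule ℂ X₁) (N₁ : ℤ × ℕ → X₁ → ℝ≥0∞)
    (F₂ : ℤ → Submodule ℂ X₂) (N₂ : ℤ × ℕ → X₂ → ℝ≥0∞) (S : Submodule ℂ X)
    (N : ℤ × ℕ → X → ℝ≥0∞) (adm : Order → Order → Prop) (σ : Order → Order → Order)
    (Φ : X₁ → X₂ → X) : Prop where
  lower : ∀ {m₁ m₂ n₁ n₂}, adm m₁ m₂ → n₁ ≤ m₁ → n₂ ≤ m₂ → adm n₁ n₂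
  monotone : ∀ {m₁ m₂ n₁ n₂}, n₁ ≤ m₁ → n₂ ≤ m₂ → σ n₁ n₂ ≤ σ m₁ m₂
  ne_top : ∀ {m₁ m₂}, m₁ ≠ ⊤ → m₂ ≠ ⊤ → σ m₁ m₂ ≠ ⊤
  mem : ∀ {n₁ n₂ : ℤ} {a b}, a ∈ F₁ n₁ → b ∈ F₂ n₂ → Φ a b ∈ S
  left : ∀ {n₁ n₂ : ℤ} {a a' b} (c : ℂ), a ∈ F₁ n₁ → a' ∈ F₁ n₁ → b ∈ F₂ n₂ →
    Φ (c • a + a') b = c • Φ a b + Φ a' b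
  right : ∀ {n₁ n₂ : ℤ} {a b b'} (c : ℂ), a ∈ F₁ n₁ → b ∈ F₂ n₂ → b' ∈ F₂ n₂ →
    Φ a (c • b + b') = c • Φ a b + Φ a b'
  estimate : ∀ {m₁ m₂ : Order} {n : ℤ} (k : ℕ), adm m₁ m₂ → m₁ ≠ ⊤ → m₂ ≠ ⊤ →
    σ m₁ m₂ ≤ ofInt n → ∃ (l₁ l₂ : ℤ) (κ : ℕ) (C : ℝ≥0∞), C ≠ ⊤ ∧ m₁ ≤ ofInt l₁ ∧
      m₂ ≤ ofInt l₂ ∧ ∀ {a b}, a ∈ F₁ l₁ → b ∈ F₂ l₂ →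
        N (n, k) (Φ a b) ≤ C * (∑ j ∈ Finset.range (κ + 1), N₁ (l₁, j) a) *
          ∑ j ∈ Finset.range (κ + 1), N₂ (l₂, j) b

namespace ScaleBilinear

variable (s₁ : SeminormScale S₁ F₁ N₁) (s₂ : SeminormScale S₂ F₂ N₂) (s : SeminormScale S F N)
  (hΦ : ScaleBilinear F₁ N₁ F₂ N₂ S N adm σ Φ)

include hΦ

theorem add_left {n₁ n₂ : ℤ} {a a' : X₁} {b : X₂} (ha : a ∈ F₁ n₁) (ha' : a' ∈ F₁ n₁)
    (hb : b ∈ F₂ n₂) : Φ (a + a') b = Φ a b + Φ a' b := by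
  simpa using hΦ.left 1 ha ha' hb

theorem add_right {n₁ n₂ : ℤ} {a : X₁} {b b' : X₂} (ha : a ∈ F₁ n₁) (hb : b ∈ F₂ n₂)
    (hb' : b' ∈ F₂ n₂) : Φ a (b + b') = Φ a b + Φ a b' := by
  simpa using hΦ.right 1 ha hb hb'

theorem smul_left {n₁ n₂ : ℤ} {a : X₁} {b : X₂} (c : ℂ) (ha : a ∈ F₁ n₁) (hb : b ∈ F₂ n₂) :
    Φ (c • a) b = c • Φ a b := by
  have h0 : Φ 0 b = 0 := by simpa using hΦ.add_left (F₁ n₁).zero_mem (F₁ n₁).zero_mem hb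
  simpa [h0] using hΦ.left c ha (F₁ n₁).zero_mem hb

theorem smul_right {n₁ n₂ : ℤ} {a : X₁} {b : X₂} (c : ℂ) (ha : a ∈ F₁ n₁) (hb : b ∈ F₂ n₂) :
    Φ a (c • b) = c • Φ a b := by
  have h0 : Φ a 0 = 0 := by simpa using hΦ.add_right ha (F₂ n₂).zero_mem (F₂ n₂).zero_mem
  simpa [h0] using hΦ.right c ha hb (F₂ n₂).zero_mem

include s₁ s₂ s

/-- An element of order +∞ already has some integer order, and lowering orders preserves
admissibility, so the estimates are only needed below +∞. -/
theorem mem_scaleSpace {m₁ m₂ : Order} (hm : adm m₁ m₂) {a : X₁} {b : X₂}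
    (ha : a ∈ scaleSpace F₁ m₁) (hb : b ∈ scaleSpace F₂ m₂) :
    Φ a b ∈ scaleSpace F (σ m₁ m₂) := by
  obtain ⟨n₁, h₁, t₁, ha'⟩ := s₁.exists_step ha
  obtain ⟨n₂, h₂, t₂, hb'⟩ := s₂.exists_step hb
  refine scaleSpace_mono s.mono (hΦ.monotone h₁ h₂) ?_
  refine SeminormScale.mem_of_ne_top (hΦ.ne_top t₁ t₂) fun n hn => ?_
  refine (s.mem_iff n _).2 ⟨?_, fun k => ?_⟩
  · obtain ⟨l₁, q₁⟩ := SeminormScale.exists_le_ofInt t₁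
    obtain ⟨l₂, q₂⟩ := SeminormScale.exists_le_ofInt t₂
    exact hΦ.mem (s₁.mem_step q₁ ha') (s₂.mem_step q₂ hb')
  · obtain ⟨l₁, l₂, κ, C, hC, q₁, q₂, hle⟩ := hΦ.estimate k (hΦ.lower hm h₁ h₂) t₁ t₂ hn
    have a1 := s₁.mem_step q₁ ha'
    have b1 := s₂.mem_step q₂ hb'
    refine (hle a1 b1).trans_lt (ENNReal.mul_lt_top (ENNReal.mul_lt_top hC.lt_top ?_) ?_)
    · exact ENNReal.sum_lt_top.2 fun j _ => ((s₁.mem_iff l₁ a).1 a1).2 j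
    · exact ENNReal.sum_lt_top.2 fun j _ => ((s₂.mem_iff l₂ b).1 b1).2 j

theorem exists_bilinear {m₁ m₂ : Order} (hm : adm m₁ m₂) :
    ∃ B : scaleSpace F₁ m₁ →ₗ[ℂ] scaleSpace F₂ m₂ →ₗ[ℂ] scaleSpace F (σ m₁ m₂),
      ∀ a b, (B a b : X) = Φ a b := by
  refine ⟨LinearMap.mk₂ ℂ (fun a b => ⟨Φ a b, hΦ.mem_scaleSpace s₁ s₂ s hm a.2 b.2⟩)
    (fun a a' b => Subtype.ext ?_) (fun c a b => Subtype.ext ?_)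
    (fun a b b' => Subtype.ext ?_) (fun c a b => Subtype.ext ?_), fun _ _ => rfl⟩
  · obtain ⟨l, h, h'⟩ := s₁.exists_common_step a.2 a'.2
    obtain ⟨k, hb, -⟩ := s₂.exists_common_step b.2 b.2
    exact hΦ.add_left h h' hb
  · obtain ⟨l, h, -⟩ := s₁.exists_common_step a.2 a.2
    obtain ⟨k, hb, -⟩ := s₂.exists_common_step b.2 b.2
    exact hΦ.smul_left c h hb
  · obtain ⟨l, h, -⟩ := s₁.exists_common_step a.2 a.2
    obtain ⟨k, hb, hb'⟩ := s₂.exists_common_step b.2 b'.2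
    exact hΦ.add_right h hb hb'
  · obtain ⟨l, h, -⟩ := s₁.exists_common_step a.2 a.2
    obtain ⟨k, hb, -⟩ := s₂.exists_common_step b.2 b.2
    exact hΦ.smul_right c h hb

/-- Write Φ(a, b) − Φ(a₀, b₀) as Φ(a − a₀, b − b₀) + Φ(a − a₀, b₀) + Φ(a₀, b − b₀) and estimate each
term. Since the seminorms take values in [0, ∞], their finiteness at a₀ and b₀ is needed in the
limit. -/
theorem continuous_of_ne_top {m₁ m₂ : Order} (hm : adm m₁ m₂) (t₁ : m₁ ≠ ⊤) (t₂ : m₂ ≠ ⊤) :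
    @Continuous _ _
      (@instTopologicalSpaceProd _ _ (scaleTopology F₁ N₁ m₁) (scaleTopology F₂ N₂ m₂))
      (scaleTopology F N (σ m₁ m₂))
      (fun p : scaleSpace F₁ m₁ × scaleSpace F₂ m₂ =>
        (⟨Φ p.1 p.2, hΦ.mem_scaleSpace s₁ s₂ s hm p.1.2 p.2.2⟩ : scaleSpace F (σ m₁ m₂))) := by
  let := scaleTopology F₁ N₁ m₁
  let := scaleTopology F₂ N₂ m₂
  let := scaleTopology F N (σ m₁ m₂)
  refine continuous_iff_continuousAt.2 fun p₀ => ?_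
  obtain ⟨a₀, b₀⟩ := p₀
  refine (s.tendsto_nhds_iff (hΦ.ne_top t₁ t₂)).2 fun n k hn => ?_
  obtain ⟨l₁, l₂, κ, C, hC, q₁, q₂, hle⟩ := hΦ.estimate k hm t₁ t₂ hn
  set A : X₁ → ℝ≥0∞ := fun a => ∑ j ∈ Finset.range (κ + 1), N₁ (l₁, j) a with hA
  set B : X₂ → ℝ≥0∞ := fun b => ∑ j ∈ Finset.range (κ + 1), N₂ (l₂, j) b with hB
  have memA : ∀ a : scaleSpace F₁ m₁, (a : X₁) ∈ F₁ l₁ := fun a => s₁.mem_step q₁ a.2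
  have memB : ∀ b : scaleSpace F₂ m₂, (b : X₂) ∈ F₂ l₂ := fun b => s₂.mem_step q₂ b.2
  have fA : A a₀ ≠ ⊤ :=
    (ENNReal.sum_lt_top.2 fun j _ => ((s₁.mem_iff l₁ a₀).1 (memA a₀)).2 j).ne
  have fB : B b₀ ≠ ⊤ :=
    (ENNReal.sum_lt_top.2 fun j _ => ((s₂.mem_iff l₂ b₀).1 (memB b₀)).2 j).ne
  have tA : Tendsto (fun p : scaleSpace F₁ m₁ × scaleSpace F₂ m₂ => A ((p.1 : X₁) - a₀))
      (𝓝 (a₀, b₀)) (𝓝 0) := by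
    have h1 : Tendsto (fun a : scaleSpace F₁ m₁ => A ((a : X₁) - a₀)) (𝓝 a₀) (𝓝 0) := by
      have := tendsto_finsetSum (Finset.range (κ + 1)) fun j _ => s₁.tendsto_seminorm t₁ a₀ q₁ j
      simpa using this
    exact h1.comp (continuous_fst.tendsto (a₀, b₀))
  have tB : Tendsto (fun p : scaleSpace F₁ m₁ × scaleSpace F₂ m₂ => B ((p.2 : X₂) - b₀))
      (𝓝 (a₀, b₀)) (𝓝 0) := by
    have h1 : Tendsto (fun b : scaleSpace F₂ m₂ => B ((b : X₂) - b₀)) (𝓝 b₀) (𝓝 0) := by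
      have := tendsto_finsetSum (Finset.range (κ + 1)) fun j _ => s₂.tendsto_seminorm t₂ b₀ q₂ j
      simpa using this
    exact h1.comp (continuous_snd.tendsto (a₀, b₀))
  have hbound : ∀ p : scaleSpace F₁ m₁ × scaleSpace F₂ m₂,
      N (n, k) (Φ p.1 p.2 - Φ a₀ b₀) ≤ C * A ((p.1 : X₁) - a₀) * B ((p.2 : X₂) - b₀) +
        (C * A ((p.1 : X₁) - a₀) * B b₀ + C * A a₀ * B ((p.2 : X₂) - b₀)) := by
    intro p
    have m1 : (p.1 : X₁) - a₀ ∈ F₁ l₁ := (F₁ l₁).sub_mem (memA _) (memA _)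
    have m2 : (p.2 : X₂) - b₀ ∈ F₂ l₂ := (F₂ l₂).sub_mem (memB _) (memB _)
    have e : Φ p.1 p.2 - Φ a₀ b₀ = Φ ((p.1 : X₁) - a₀) ((p.2 : X₂) - b₀) +
        (Φ ((p.1 : X₁) - a₀) b₀ + Φ a₀ ((p.2 : X₂) - b₀)) := by
      have e1 : Φ p.1 p.2 = Φ ((p.1 : X₁) - a₀) p.2 + Φ a₀ p.2 := by
        rw [← hΦ.add_left m1 (memA a₀) (memB p.2), sub_add_cancel]
      have e2 : Φ ((p.1 : X₁) - a₀) p.2 = Φ ((p.1 : X₁) - a₀) ((p.2 : X₂) - b₀) +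
          Φ ((p.1 : X₁) - a₀) b₀ := by
        rw [← hΦ.add_right m1 m2 (memB b₀), sub_add_cancel]
      have e3 : Φ a₀ p.2 = Φ a₀ ((p.2 : X₂) - b₀) + Φ a₀ b₀ := by
        rw [← hΦ.add_right (memA a₀) m2 (memB b₀), sub_add_cancel]
      rw [e1, e2, e3]
      abel
    rw [e]
    refine (s.add_le _ (hΦ.mem m1 m2) (S.add_mem (hΦ.mem m1 (memB b₀))
      (hΦ.mem (memA a₀) m2))).trans (add_le_add (hle m1 m2) ?_)
    exact (s.add_le _ (hΦ.mem m1 (memB b₀)) (hΦ.mem (memA a₀) m2)).trans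
      (add_le_add (hle m1 (memB b₀)) (hle (memA a₀) m2))
  refine tendsto_of_tendsto_of_tendsto_of_le_of_le tendsto_const_nhds ?_ (fun _ => zero_le)
    hbound
  have u1 := ENNReal.Tendsto.const_mul tA (.inr hC)
  have u2 := ENNReal.Tendsto.mul u1 (.inr ENNReal.zero_ne_top) tB
    (.inr (by rw [mul_zero]; exact ENNReal.zero_ne_top))
  have u3 := ENNReal.Tendsto.mul_const u1 (.inr fB)
  have u4 := ENNReal.Tendsto.const_mul tB (.inr (ENNReal.mul_ne_top hC fA))
  have := u2.add (u3.add u4)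
  simpa using this

/-- A bilinear map with estimates is continuous. -/
theorem continuousOnSteps {m₁ m₂ : Order} (hm : adm m₁ m₂)
    (T : scaleSpace F₁ m₁ → scaleSpace F₂ m₂ → scaleSpace F (σ m₁ m₂))
    (hT : ∀ a b, (T a b : X) = Φ a b) (h₁ : Monotone F₁) (h₂ : Monotone F₂) :
    ContinuousOnSteps h₁ N₁ h₂ N₂ F N T := by
  intro n₁ n₂ q₁ q₂ t₁ t₂
  have c1 := hΦ.continuous_of_ne_top s₁ s₂ s (hΦ.lower hm q₁ q₂) t₁ t₂
  have c2 := s.continuous_inclusion (hΦ.ne_top t₁ t₂) (hΦ.monotone q₁ q₂)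
  have c3 := @Continuous.comp _ _ _
    (@instTopologicalSpaceProd _ _ (scaleTopology F₁ N₁ n₁) (scaleTopology F₂ N₂ n₂))
    (scaleTopology F N (σ n₁ n₂)) (scaleTopology F N (σ m₁ m₂)) _ _ c2 c1
  convert c3 using 1
  funext p
  exact Subtype.ext (hT _ _)

end ScaleBilinear

end Two

end Scales

end StarProduct

namespace StarProduct

open MeasureTheory

set_option linter.unusedSectionVars false

/-! ### Symbol classes as scales -/

section SymbolScales

open Filter

variable {D : Type*} [NormedAddCommGroup D] [NormedSpace ℝ D]

/-- The space of smooth functions. -/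
def smoothFunctions (D : Type*) [NormedAddCommGroup D] [NormedSpace ℝ D] :
    Submodule ℂ (D → ℂ) where
  carrier := {a | ContDiff ℝ ∞ a}
  add_mem' {a b} (ha : ContDiff ℝ ∞ a) (hb : ContDiff ℝ ∞ b) := ha.add hb
  zero_mem' := (contDiff_const : ContDiff ℝ ∞ fun _ : D => (0 : ℂ))
  smul_mem' c a (ha : ContDiff ℝ ∞ a) := ha.const_smul c

theorem symbolScale : SeminormScale (smoothFunctions D) (symbolsOfInt D) symbolSeminorm where
  add_le i _ _ ha hb := symbolSeminorm_add i ha hb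
  smul_le i c _ ha := symbolSeminorm_smul i c ha
  anti h k a := symbolSeminorm_mono h k a
  mem_iff _ _ := Iff.rfl

/-- The space of parameter-dependent smooth functions. -/
def hSmoothFunctions (D : Type*) [NormedAddCommGroup D] [NormedSpace ℝ D] (H : Set ℝ) :
    Submodule ℂ (H → D → ℂ) where
  carrier := {a | ∀ h, ContDiff ℝ ∞ (a h)}
  add_mem' ha hb h := (ha h).add (hb h)
  zero_mem' _ := contDiff_const
  smul_mem' c _ ha h := (ha h).const_smul c

theorem le_hSymbolSeminorm (H : Set ℝ) (c δ : ℝ) (i : ℤ × ℕ) (a : H → D → ℂ) (h : H) :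
    ENNReal.ofReal ((h : ℝ) ^ (δ * i.2 - c)) * symbolSeminorm i (a h) ≤
      hSymbolSeminorm H c δ i a :=
  le_iSup (fun h : H => ENNReal.ofReal ((h : ℝ) ^ (δ * i.2 - c)) * symbolSeminorm i (a h)) h

theorem hSymbolScale (H : Set ℝ) (c δ : ℝ) : SeminormScale (hSmoothFunctions D H)
    (hSymbolsOfInt D H c δ) (hSymbolSeminorm H c δ) where
  add_le i a b ha hb := by
    refine iSup_le fun h => ?_
    refine le_trans (mul_le_mul_right (symbolSeminorm_add i (ha h) (hb h)) _) ?_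
    rw [mul_add]
    exact add_le_add (le_hSymbolSeminorm H c δ i a h) (le_hSymbolSeminorm H c δ i b h)
  smul_le i z a ha := by
    refine iSup_le fun h => ?_
    refine le_trans (mul_le_mul_right (symbolSeminorm_smul i z (ha h)) _) ?_
    rw [mul_left_comm]
    gcongr
    exact le_hSymbolSeminorm H c δ i a h
  anti hn k a := iSup_mono fun h => mul_le_mul_right (symbolSeminorm_mono hn k (a h)) _
  mem_iff _ _ := Iff.rfl

theorem symbolSeminorm_le {n : ℤ} {k : ℕ} {a : D → ℂ} {M : ℝ}
    (h : ∀ ξ, ‖iteratedFDeriv ℝ k a ξ‖ ≤ M * japaneseBracket ξ ^ (n - k)) :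
    symbolSeminorm (n, k) a ≤ ENNReal.ofReal M := by
  refine iSup_le fun ξ => ENNReal.ofReal_le_ofReal ?_
  have p := zpow_pos (japaneseBracket_pos ξ) ((k : ℤ) - n)
  refine (mul_le_mul_of_nonneg_left (h ξ) p.le).trans (le_of_eq ?_)
  rw [mul_left_comm, ← zpow_add₀ (japaneseBracket_pos ξ).ne']
  simp

theorem le_mul_of_symbolSeminorm_le {n : ℤ} {k : ℕ} {a : D → ℂ} {M : ℝ} (hM : 0 ≤ M)
    (h : symbolSeminorm (n, k) a ≤ ENNReal.ofReal M) (ξ : D) :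
    ‖iteratedFDeriv ℝ k a ξ‖ ≤ M * japaneseBracket ξ ^ (n - k) := by
  have h1 := (ENNReal.ofReal_le_ofReal_iff hM).1 ((le_symbolSeminorm (n, k) a ξ).trans h)
  dsimp only at h1
  have p := zpow_pos (japaneseBracket_pos ξ) ((k : ℤ) - n)
  rw [← neg_sub, zpow_neg, ← div_eq_mul_inv, le_div_iff₀ p, mul_comm]
  exact h1

theorem symbol_bound {n : ℤ} {a : D → ℂ} (ha : a ∈ symbolsOfInt D n) (k : ℕ) :
    ∃ C : ℝ, 0 ≤ C ∧ ∀ ξ, ‖iteratedFDeriv ℝ k a ξ‖ ≤ C * japaneseBracket ξ ^ (n - k) :=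
  ⟨(symbolSeminorm (n, k) a).toReal, ENNReal.toReal_nonneg,
    le_mul_of_symbolSeminorm_le ENNReal.toReal_nonneg (ENNReal.ofReal_toReal (ha.2 k).ne).ge⟩

theorem symbol_temperate {n : ℤ} {a : D → ℂ} (ha : a ∈ symbolsOfInt D n) :
    a.HasTemperateGrowth := by
  refine ⟨ha.1, fun k => ?_⟩
  obtain ⟨C, h0, hC⟩ := symbol_bound ha k
  refine ⟨(n - k).natAbs, C, fun ξ => (hC ξ).trans ?_⟩
  gcongr
  exact japaneseBracket_zpow_le_pow (japaneseBracket_le_one_add ξ) _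

theorem symBound_of_mem {n : ℤ} {a : D → ℂ} (ha : a ∈ symbolsOfInt D n) (κ : ℕ) :
    SymBound 1 (∑ j ∈ Finset.range (κ + 1), symbolSeminorm (n, j) a).toReal n κ a := by
  refine ⟨symbol_temperate ha, ENNReal.toReal_nonneg, fun k hk ξ => ?_⟩
  rw [one_pow, mul_one]
  refine le_mul_of_symbolSeminorm_le ENNReal.toReal_nonneg ?_ ξ
  rw [ENNReal.ofReal_toReal (ENNReal.sum_lt_top.2 fun j _ => ha.2 j).ne]
  exact Finset.single_le_sum (f := fun j => symbolSeminorm (n, j) a) (fun _ _ => zero_le)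
    (Finset.mem_range.2 (by omega))

/-! ### Symbols depending on the semiclassical parameter. -/

section Semiclassical

variable {H : Set ℝ} {c δ : ℝ} {n : ℤ}

theorem hSymbolSeminorm_le {k : ℕ} {a : H → D → ℂ} {M : ℝ} (hH : ∀ h ∈ H, 0 < h)
    (h : ∀ (h : H) ξ, ‖iteratedFDeriv ℝ k (a h) ξ‖ ≤
      M * (h : ℝ) ^ (c - δ * k) * japaneseBracket ξ ^ (n - k)) :
    hSymbolSeminorm H c δ (n, k) a ≤ ENNReal.ofReal M := by
  refine iSup_le fun h' => ?_
  have h0 := hH h' h'.2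
  have p := Real.rpow_pos_of_pos h0 (δ * k - c)
  refine (mul_le_mul_right (symbolSeminorm_le (h h')) _).trans ?_
  rw [← ENNReal.ofReal_mul p.le, mul_left_comm, ← Real.rpow_add h0]
  simp

theorem hSymbol_mem {a : H → D → ℂ} (hH : ∀ h ∈ H, 0 < h) (ha : a ∈ hSymbolsOfInt D H c δ n)
    (h : H) : a h ∈ symbolsOfInt D n := by
  refine ⟨ha.1 h, fun k => ?_⟩
  have h2 := (le_hSymbolSeminorm H c δ (n, k) a h).trans_lt (ha.2 k)
  refine lt_top_iff_ne_top.2 fun h3 => ?_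
  rw [h3, ENNReal.mul_top] at h2
  · exact lt_irrefl _ h2
  · simpa using Real.rpow_pos_of_pos (hH h h.2) (δ * k - c)

/-- This is where θ = h^(-δ) comes from: each derivative costs that factor, with an amplitude
constant that is uniform in h. -/
theorem hSymBound_of_mem {a : H → D → ℂ} (hH : ∀ h ∈ H, 0 < h)
    (ha : a ∈ hSymbolsOfInt D H 0 δ n) (κ : ℕ) (h : H) :
    SymBound ((h : ℝ) ^ (-δ)) (∑ j ∈ Finset.range (κ + 1), hSymbolSeminorm H 0 δ (n, j) a).toReal
      n κ (a h) := by
  refine ⟨symbol_temperate (hSymbol_mem hH ha h), ENNReal.toReal_nonneg, fun k hk ξ => ?_⟩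
  have h0 := hH h h.2
  have p := Real.rpow_pos_of_pos h0 (δ * k)
  have e : ((h : ℝ) ^ (-δ)) ^ k = ((h : ℝ) ^ (δ * k))⁻¹ := by
    rw [← Real.rpow_natCast, ← Real.rpow_mul h0.le, ← Real.rpow_neg h0.le]
    ring_nf
  rw [e]
  refine le_mul_of_symbolSeminorm_le (by positivity) ?_ ξ
  rw [ENNReal.ofReal_mul ENNReal.toReal_nonneg, ENNReal.ofReal_inv_of_pos p,
    ENNReal.ofReal_toReal (ENNReal.sum_lt_top.2 fun j _ => ha.2 j).ne, ← div_eq_mul_inv,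
    ENNReal.le_div_iff_mul_le (.inl (by simpa using p)) (.inl ENNReal.ofReal_ne_top), mul_comm]
  have h1 := le_hSymbolSeminorm H 0 δ (n, k) a h
  rw [sub_zero] at h1
  exact h1.trans (Finset.single_le_sum (f := fun j => hSymbolSeminorm H 0 δ (n, j) a)
    (fun _ _ => zero_le) (Finset.mem_range.2 (by omega)))

end Semiclassical

/-- Used to identify limits of symbols pointwise in the uniqueness proof. -/
theorem continuous_eval {m : Order} (hm : m ≠ ⊤) (ζ : D) :
    @Continuous _ _ (scaleTopology (symbolsOfInt D) symbolSeminorm m) _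
      (fun a : Symbols D m => (a : D → ℂ) ζ) := by
  let := scaleTopology (symbolsOfInt D) symbolSeminorm m
  refine continuous_iff_continuousAt.2 fun v => ?_
  obtain ⟨l, hl⟩ := SeminormScale.exists_le_ofInt hm
  have h1 := ENNReal.Tendsto.const_mul (symbolScale.tendsto_seminorm hm v hl 0)
    (.inr (ENNReal.ofReal_ne_top (r := japaneseBracket ζ ^ l)))
  rw [mul_zero] at h1
  refine tendsto_iff_edist_tendsto_0.2
    (tendsto_of_tendsto_of_tendsto_of_le_of_le tendsto_const_nhds h1 (fun _ => zero_le) fun y => ?_)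
  have p := zpow_pos (japaneseBracket_pos ζ) l
  have h2 := le_symbolSeminorm (l, 0) ((y : D → ℂ) - (v : D → ℂ)) ζ
  refine le_trans ?_ (mul_le_mul_right h2 _)
  rw [← ENNReal.ofReal_mul p.le, ← mul_assoc, ← zpow_add₀ (japaneseBracket_pos ζ).ne', edist_dist,
    dist_eq_norm]
  simp

/-! ### Approximation by Schwartz functions -/

section Approximation

variable [FiniteDimensional ℝ D]

theorem continuous_japaneseBracket : Continuous (japaneseBracket : D → ℝ) := by
  unfold japaneseBracket
  fun_prop

theorem symbol_of_hasCompactSupport {f : D → ℂ} (hf : ContDiff ℝ ∞ f) (hc : HasCompactSupport f)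
    (n : ℤ) : f ∈ symbolsOfInt D n := by
  refine ⟨hf, fun k => ?_⟩
  have c1 : Continuous fun ξ => japaneseBracket ξ ^ ((k : ℤ) - n) * ‖iteratedFDeriv ℝ k f ξ‖ :=
    (continuous_japaneseBracket.zpow₀ _ fun ξ => .inl (japaneseBracket_pos ξ).ne').mul
      (hf.continuous_iteratedFDeriv (by exact_mod_cast le_top)).norm
  obtain ⟨C, hC⟩ := c1.bounded_above_of_compact_support ((hc.iteratedFDeriv k).norm.mul_left)
  refine lt_of_le_of_lt (iSup_le fun ξ => ?_) (ENNReal.ofReal_lt_top (r := C))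
  exact ENNReal.ofReal_le_ofReal ((le_abs_self _).trans (hC ξ))

theorem symbol_const (c : ℂ) : (fun _ => c : D → ℂ) ∈ symbolsOfInt D 0 := by
  refine ⟨contDiff_const, fun k => ?_⟩
  refine (symbolSeminorm_le (M := ‖c‖) fun ξ => ?_).trans_lt ENNReal.ofReal_lt_top
  rcases Nat.eq_zero_or_pos k with rfl | hk
  · simp
  · rw [iteratedFDeriv_const_of_ne hk.ne', Pi.zero_apply, norm_zero]
    have := zpow_pos (japaneseBracket_pos ξ) (0 - (k : ℤ))
    positivity

/-- A symbol of order zero which vanishes on the unit ball bounds its dilates. -/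
theorem norm_iteratedFDeriv_dilate_le {ψ : D → ℂ} (hψ : ψ ∈ symbolsOfInt D 0)
    (h0 : ∀ y, ‖y‖ < 1 → ψ y = 0) (i : ℕ) : ∃ C : ℝ, 0 ≤ C ∧ ∀ t : ℝ, 0 < t → t ≤ 1 → ∀ x,
      ‖iteratedFDeriv ℝ i (fun x => ψ (t • x)) x‖ ≤ C * t * japaneseBracket x ^ (1 - (i : ℤ)) := by
  obtain ⟨C, hC0, hC⟩ := symbol_bound hψ i
  refine ⟨C, hC0, fun t ht ht1 x => ?_⟩
  have hi : ((i : ℕ) : ℕ∞ω) ≤ (∞ : ℕ∞ω) := by exact_mod_cast le_top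
  have e1 : iteratedFDeriv ℝ i (fun x => ψ (t • x)) x = t ^ i • iteratedFDeriv ℝ i ψ (t • x) :=
    congrFun (iteratedFDeriv_comp_const_smul t (hψ.1.of_le hi)) x
  have jx := japaneseBracket_pos x
  have jt := japaneseBracket_pos (t • x)
  rw [e1, norm_smul, Real.norm_of_nonneg (by positivity)]
  by_cases hx : ‖t • x‖ < 1
  · have h1 : ψ =ᶠ[𝓝 (t • x)] fun _ => (0 : ℂ) := by
      have : Metric.ball (0 : D) 1 ∈ 𝓝 (t • x) :=
        Metric.isOpen_ball.mem_nhds (by simpa using hx)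
      filter_upwards [this] with y hy
      exact h0 y (by simpa using hy)
    rw [(h1.iteratedFDeriv ℝ i).eq_of_nhds, iteratedFDeriv_fun_zero]
    have := zpow_pos jx (1 - (i : ℤ))
    simp only [Pi.zero_apply, norm_zero, mul_zero]
    positivity
  -- Where ψ(tx) need not vanish, t⟨x⟩ ≥ 1: giving up one order of decay buys the factor t.
  · have h1 : 1 ≤ t * japaneseBracket x := by
      rw [not_lt, norm_smul, Real.norm_of_nonneg ht.le] at hx
      exact hx.trans (by gcongr; exact norm_le_japaneseBracket x)
    have h2 : t ^ i * japaneseBracket (t • x) ^ (0 - (i : ℤ)) ≤ japaneseBracket x ^ (-(i : ℤ)) := by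
      rw [zero_sub, zpow_neg, zpow_neg, zpow_natCast, zpow_natCast, ← div_eq_mul_inv,
        div_le_iff₀ (by positivity), ← div_eq_inv_mul, le_div_iff₀ (by positivity), ← mul_pow]
      gcongr
      exact mul_japaneseBracket_le ht ht1 x
    calc _ ≤ t ^ i * (C * japaneseBracket (t • x) ^ (0 - (i : ℤ))) := by
          gcongr
          exact hC _
      _ = C * (t ^ i * japaneseBracket (t • x) ^ (0 - (i : ℤ))) := by ring
      _ ≤ C * (1 * japaneseBracket x ^ (-(i : ℤ))) := by rw [one_mul]; gcongr
      _ ≤ C * (t * japaneseBracket x * japaneseBracket x ^ (-(i : ℤ))) := by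
          have := zpow_pos jx (-(i : ℤ))
          gcongr
      _ = _ := by
          rw [sub_eq_add_neg, zpow_add₀ jx.ne', zpow_one]
          ring

/-- Cut a off at radius about 1/t. The error is ψ(tx)a(x) with ψ of order 0 vanishing on the unit
ball, which is O(t) in order n + 1. In order n itself convergence fails in general, for instance for
a = ⟨ξ⟩^n. -/
theorem exists_tendsto_symbolSeminorm {n : ℤ} {a : D → ℂ} (ha : a ∈ symbolsOfInt D n) :
    ∃ u : ℕ → D → ℂ, (∀ j l, u j ∈ symbolsOfInt D l) ∧
      ∀ k, Tendsto (fun j => symbolSeminorm (n + 1, k) (u j - a)) atTop (𝓝 0) := by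
  let φ : ContDiffBump (0 : D) := ⟨1, 2, one_pos, one_lt_two⟩
  have hφs : ContDiff ℝ ∞ fun y => (φ y : ℂ) := Complex.ofRealCLM.contDiff.comp φ.contDiff
  have hφc : HasCompactSupport fun y => (φ y : ℂ) :=
    φ.hasCompactSupport.comp_left (g := fun x : ℝ => (x : ℂ)) Complex.ofReal_zero
  set ψ : D → ℂ := (fun y => (φ y : ℂ)) - fun _ => 1 with hψdef
  have hψ : ψ ∈ symbolsOfInt D 0 :=
    (symbolsOfInt D 0).sub_mem (symbol_of_hasCompactSupport hφs hφc 0) (symbol_const 1)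
  have hψ0 : ∀ y, ‖y‖ < 1 → ψ y = 0 := fun y hy => by
    have : φ y = 1 := φ.one_of_mem_closedBall (by simpa using hy.le)
    simp [hψdef, this]
  set t : ℕ → ℝ := fun j => ((j : ℝ) + 1)⁻¹ with ht
  have t0 : ∀ j, 0 < t j := fun j => by positivity
  have t1 : ∀ j, t j ≤ 1 := fun j => inv_le_one_of_one_le₀ (by linarith [j.cast_nonneg (α := ℝ)])
  refine ⟨fun j x => (φ (t j • x) : ℂ) * a x, fun j l => ?_, fun k => ?_⟩
  · refine symbol_of_hasCompactSupport
      ((hφs.comp (contDiff_id.const_smul (t j))).mul ha.1) ?_ l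
    have : HasCompactSupport fun x => (φ (t j • x) : ℂ) :=
      hφc.comp_homeomorph (Homeomorph.smulOfNeZero (t j) (t0 j).ne')
    exact this.mul_right
  · choose C hC0 hC using fun i => norm_iteratedFDeriv_dilate_le hψ hψ0 i
    choose A hA0 hA using fun i => symbol_bound ha i
    set M : ℝ := ∑ i ∈ Finset.range (k + 1), (k.choose i : ℝ) * C i * A (k - i) with hM
    have hle : ∀ j, symbolSeminorm (n + 1, k) ((fun x => (φ (t j • x) : ℂ) * a x) - a) ≤
        ENNReal.ofReal (M * t j) := by
      intro j
      have e : (fun x => (φ (t j • x) : ℂ) * a x) - a = fun x => ψ (t j • x) * a x := by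
        funext x
        simp only [hψdef, Pi.sub_apply]
        ring
      rw [e]
      refine symbolSeminorm_le fun ξ => ?_
      have jξ := japaneseBracket_pos ξ
      refine (norm_iteratedFDeriv_mul_le (n := k) (N := (∞ : ℕ∞ω))
        (hψ.1.comp (contDiff_id.const_smul (t j))) ha.1 ξ (by exact_mod_cast le_top)).trans ?_
      rw [hM, Finset.sum_mul, Finset.sum_mul]
      refine Finset.sum_le_sum fun i hi => ?_
      have hik : i ≤ k := Nat.lt_succ_iff.1 (Finset.mem_range.1 hi)
      have b1 := hC i (t j) (t0 j) (t1 j) ξ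
      have b2 := hA (k - i) ξ
      have p1 := zpow_pos jξ (1 - (i : ℤ))
      have p2 := hC0 i
      have p3 := t0 j
      calc _ ≤ (k.choose i : ℝ) * (C i * t j * japaneseBracket ξ ^ (1 - (i : ℤ))) *
            (A (k - i) * japaneseBracket ξ ^ (n - (k - i : ℕ))) := by
              gcongr
              exact b1
        _ = (k.choose i : ℝ) * C i * A (k - i) * t j *
            (japaneseBracket ξ ^ (1 - (i : ℤ)) * japaneseBracket ξ ^ (n - (k - i : ℕ))) := by ring
        _ = _ := by
          rw [← zpow_add₀ jξ.ne', Nat.cast_sub hik]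
          congr 2
          ring
    refine tendsto_of_tendsto_of_tendsto_of_le_of_le tendsto_const_nhds ?_ (fun _ => zero_le) hle
    have h1 : Tendsto t atTop (𝓝 0) := by
      have := tendsto_one_div_add_atTop_nhds_zero_nat (𝕜 := ℝ)
      simpa [ht] using this
    have h2 := ENNReal.tendsto_ofReal (h1.const_mul M)
    simpa using h2

/-- Symbols are limits of Schwartz functions in a symbol class of larger order. -/
theorem exists_approximation {m : Order} (hm : m ≠ ⊤) (a : Symbols D m) :
    ∃ (m' : Order) (hm' : m ≤ m') (u : ℕ → Symbols D ⊥), m' ≠ ⊤ ∧ (m = ⊥ → m' = ⊥) ∧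
      Tendsto (fun j => Submodule.inclusion (scaleSpace_mono (symbolsOfInt_mono D) bot_le) (u j))
        atTop (@nhds _ (scaleTopology (symbolsOfInt D) symbolSeminorm m')
          (Submodule.inclusion (scaleSpace_mono (symbolsOfInt_mono D) hm') a)) := by
  rcases eq_bot_or_eq_ofInt hm with rfl | ⟨n, rfl⟩
  -- In order −∞ there is nothing to approximate, and the order must not be raised, since this would
  -- destroy admissibility.
  · refine ⟨⊥, le_rfl, fun _ => a, hm, id, ?_⟩
    rw [symbolScale.tendsto_nhds_iff hm]
    intro l k _
    simp only [Submodule.coe_inclusion, sub_self]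
    simp [symbolSeminorm_zero]
  · obtain ⟨u, hu, hlim⟩ := exists_tendsto_symbolSeminorm (n := n) a.2
    refine ⟨ofInt (n + 1), ofInt_le_ofInt.2 (by omega),
      fun j => ⟨u j, (Submodule.mem_iInf _).2 fun l => hu j l⟩, ofInt_ne_top _,
      fun h => absurd h (by simp [ofInt]), ?_⟩
    rw [symbolScale.tendsto_nhds_iff (ofInt_ne_top _)]
    intro l k hl
    exact tendsto_of_tendsto_of_tendsto_of_le_of_le tendsto_const_nhds (hlim k)
      (fun _ => zero_le) fun j => symbolSeminorm_mono (ofInt_le_ofInt.1 hl) k _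

end Approximation

end SymbolScales

end StarProduct

namespace StarProduct

open MeasureTheory

set_option linter.unusedSectionVars false

/-! ### The star product and its remainders as bilinear maps between scales -/

section Bilinearity

variable {X Y V : Type*} [NormedAddCommGroup X] [NormedSpace ℝ X] [FiniteDimensional ℝ X]
  [NormedAddCommGroup Y] [NormedSpace ℝ Y] [FiniteDimensional ℝ Y]
  [NormedAddCommGroup V] [NormedSpace ℝ V] [FiniteDimensional ℝ V]
  {K : Set (X × Y)} {β : X × Y → V} {f : X × Y → ℂ}
  {a a' : StrongDual ℝ X → ℂ} {b b' : StrongDual ℝ Y → ℂ}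

theorem gradedPart_linear (T T' : ℕ → ℕ → ℕ → ℂ) (c : ℂ) (j : ℕ) :
    gradedPart (fun p q r => c * T p q r + T' p q r) j =
      c * gradedPart T j + gradedPart T' j := by
  simp only [gradedPart, Finset.mul_sum, ← Finset.sum_add_distrib]
  refine Finset.sum_congr rfl fun p _ => Finset.sum_congr rfl fun q _ =>
    Finset.sum_congr rfl fun r _ => ?_
  split_ifs <;> simp

theorem pds_linear {D : Type*} [NormedAddCommGroup D] [NormedSpace ℝ D] {a a' : D → ℂ}
    (ha : ContDiff ℝ ∞ a) (ha' : ContDiff ℝ ∞ a') (c : ℂ) (l : List D) (ξ : D) :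
    pds l (c • a + a') ξ = c * pds l a ξ + pds l a' ξ := by
  have h1 : c • a + a' = fun ξ => c * a ξ + a' ξ := rfl
  rw [h1, pds_add (contDiff_const.mul ha) ha', pds_const_mul ha]

variable (r₁ : StrongDual ℝ V →L[ℝ] StrongDual ℝ X) (r₂ : StrongDual ℝ V →L[ℝ] StrongDual ℝ Y)

theorem termOf_left (ha : ContDiff ℝ ∞ a) (ha' : ContDiff ℝ ∞ a') (c : ℂ) (p q r : ℕ)
    (ζ : StrongDual ℝ V) : termOf r₁ r₂ β f p q r (c • a + a') b ζ =
      c * termOf r₁ r₂ β f p q r a b ζ + termOf r₁ r₂ β f p q r a' b ζ := by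
  simp only [termOf, Finset.mul_sum, ← Finset.sum_add_distrib, pds_linear ha ha']
  refine Finset.sum_congr rfl fun i _ => Finset.sum_congr rfl fun j _ => ?_
  ring

theorem termOf_right (hb : ContDiff ℝ ∞ b) (hb' : ContDiff ℝ ∞ b') (c : ℂ) (p q r : ℕ)
    (ζ : StrongDual ℝ V) : termOf r₁ r₂ β f p q r a (c • b + b') ζ =
      c * termOf r₁ r₂ β f p q r a b ζ + termOf r₁ r₂ β f p q r a b' ζ := by
  simp only [termOf, Finset.mul_sum, ← Finset.sum_add_distrib, pds_linear hb hb']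
  refine Finset.sum_congr rfl fun i _ => Finset.sum_congr rfl fun j _ => ?_
  ring

variable [MeasurableSpace X] [BorelSpace X] [MeasurableSpace Y] [BorelSpace Y]
  (μ : Measure (X × Y)) [μ.IsAddHaarMeasure]
  (ν : Measure (StrongDual ℝ X × StrongDual ℝ Y)) [ν.IsAddHaarMeasure]

theorem temperate_const_mul {D : Type*} [NormedAddCommGroup D] [NormedSpace ℝ D] {u : D → ℂ}
    (hu : u.HasTemperateGrowth) (c : ℂ) : Function.HasTemperateGrowth fun x => c * u x :=
  (Function.HasTemperateGrowth.const c).fun_mul hu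

theorem fullRemainder_left (hβ : ContDiff ℝ ∞ β) (hK : IsCompact K) (hf : TestOn K f)
    (ha : a.HasTemperateGrowth) (ha' : a'.HasTemperateGrowth) (hb : b.HasTemperateGrowth) (c : ℂ)
    (J : ℕ) (h : ℝ) : fullRemainder μ ν r₁ r₂ β f J h (c • a + a') b =
      c • fullRemainder μ ν r₁ r₂ β f J h a b + fullRemainder μ ν r₁ r₂ β f J h a' b := by
  funext ζ
  have e : cpair (c • a + a') b h h (r₁ ζ, r₂ ζ) =
      fun w => c * cpair a b h h (r₁ ζ, r₂ ζ) w + cpair a' b h h (r₁ ζ, r₂ ζ) w := by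
    funext w
    simp only [cpair, Pi.add_apply, Pi.smul_apply, smul_eq_mul]
    ring
  simp only [fullRemainder, Pi.add_apply, Pi.smul_apply, smul_eq_mul]
  rw [e, osc_add_right _ μ ν pairing_injective hK (testOn_amp hβ hf _)
    (temperate_const_mul (cpair_temperate ha hb h h _) c) (cpair_temperate ha' hb h h _),
    osc_const_mul_right]
  simp only [termOf_left r₁ r₂ ha.1 ha'.1, gradedPart_linear, mul_add, Finset.sum_add_distrib,
    mul_left_comm _ c, ← Finset.mul_sum]
  ring

theorem fullRemainder_right (hβ : ContDiff ℝ ∞ β) (hK : IsCompact K) (hf : TestOn K f)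
    (ha : a.HasTemperateGrowth) (hb : b.HasTemperateGrowth) (hb' : b'.HasTemperateGrowth) (c : ℂ)
    (J : ℕ) (h : ℝ) : fullRemainder μ ν r₁ r₂ β f J h a (c • b + b') =
      c • fullRemainder μ ν r₁ r₂ β f J h a b + fullRemainder μ ν r₁ r₂ β f J h a b' := by
  funext ζ
  have e : cpair a (c • b + b') h h (r₁ ζ, r₂ ζ) =
      fun w => c * cpair a b h h (r₁ ζ, r₂ ζ) w + cpair a b' h h (r₁ ζ, r₂ ζ) w := by
    funext w
    simp only [cpair, Pi.add_apply, Pi.smul_apply, smul_eq_mul]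
    ring
  simp only [fullRemainder, Pi.add_apply, Pi.smul_apply, smul_eq_mul]
  rw [e, osc_add_right _ μ ν pairing_injective hK (testOn_amp hβ hf _)
    (temperate_const_mul (cpair_temperate ha hb h h _) c) (cpair_temperate ha hb' h h _),
    osc_const_mul_right]
  simp only [termOf_right r₁ r₂ hb.1 hb'.1, gradedPart_linear, mul_add, Finset.sum_add_distrib,
    mul_left_comm _ c, ← Finset.mul_sum]
  ring

end Bilinearity

/-! ### Arithmetic of orders and stability of admissibility. -/

section Orders

theorem add_ne_top_of_ne_top {m₁ m₂ : Order} (h₁ : m₁ ≠ ⊤) (h₂ : m₂ ≠ ⊤) : m₁ + m₂ ≠ ⊤ := by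
  rcases eq_bot_or_eq_ofInt h₁ with rfl | ⟨k, rfl⟩
  · rwa [WithBot.bot_add]
  · rcases eq_bot_or_eq_ofInt h₂ with rfl | ⟨l, rfl⟩
    · exact h₂
    · exact ofInt_ne_top (k + l)

theorem le_ofInt_add {m : Order} (hm : m ≠ ⊤) {n : ℤ} {J : ℕ}
    (h : m + ofInt (-(J : ℤ)) ≤ ofInt n) : m ≤ ofInt (n + J) := by
  rcases eq_bot_or_eq_ofInt hm with rfl | ⟨k, rfl⟩
  · exact bot_le
  · have h' : ofInt (k + -(J : ℤ)) ≤ ofInt n := h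
    rw [ofInt_le_ofInt] at h' ⊢
    omega

variable {V : Type*} [NormedAddCommGroup V] [NormedSpace ℝ V] {W₁ W₂ : Submodule ℝ V}

theorem Admissible.of_le {m₁ m₂ n₁ n₂ : Order} (h : Admissible W₁ W₂ m₁ m₂) (h₁ : n₁ ≤ m₁)
    (h₂ : n₂ ≤ m₂) : Admissible W₁ W₂ n₁ n₂ :=
  ⟨fun hW => le_bot_iff.1 (h.1 hW ▸ h₂), fun hW => le_bot_iff.1 (h.2 hW ▸ h₁)⟩

end Orders

/-! ### The star product and its remainders as estimated bilinear maps. -/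

section Estimates

variable {V : Type*} [NormedAddCommGroup V] [NormedSpace ℝ V] [FiniteDimensional ℝ V]
  [MeasurableSpace V] [BorelSpace V] {W₁ W₂ : Submodule ℝ V}

/-- The properties of the phase function, the amplitude and the measures which are needed to extend
the star product to symbols. -/
structure AdaptedPhase (W₁ W₂ : Submodule ℝ V) (μ : Measure (W₁ × W₂))
    (ν : Measure (StrongDual ℝ W₁ × StrongDual ℝ W₂)) (ε : ℝ) (K : Set (W₁ × W₂))
    (β : W₁ × W₂ → V) (f : W₁ × W₂ → ℂ) : Prop where
  smooth : ContDiff ℝ ∞ β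
  zero_right : ∀ x, β (x, 0) = 0
  zero_left : ∀ y, β (0, y) = 0
  compact : IsCompact K
  pos : 0 < ε
  small : SmallParameter W₁ W₂ ε
  decay : ∀ f, TestOn K f → ∀ N : ℕ, ∃ C : ℝ, 0 ≤ C ∧ ∀ (l : StrongDual ℝ V) w,
    ‖fhat (pairing W₁ W₂) μ (amp f β l) w‖ ≤ C ∧
    (ε * ‖l‖ ≤ ‖w‖ → ‖fhat (pairing W₁ W₂) μ (amp f β l) w‖ * (1 + ‖w‖) ^ N ≤ C)
  inversion : ∀ G : W₁ × W₂ → ℂ, TestOn K G → ∫ w, fhat (pairing W₁ W₂) μ G w ∂ν = G 0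
  test : TestOn K f

variable {μ : Measure (W₁ × W₂)} [μ.IsAddHaarMeasure]
  {ν : Measure (StrongDual ℝ W₁ × StrongDual ℝ W₂)} [ν.IsAddHaarMeasure] {ε : ℝ}
  {K : Set (W₁ × W₂)} {β : W₁ × W₂ → V} {f : W₁ × W₂ → ℂ}

theorem AdaptedPhase.semiBound (P : AdaptedPhase W₁ W₂ μ ν ε K β f) (J L k : ℕ) :
    SemiBound (Λ := StrongDual ℝ V) (D₁ := StrongDual ℝ W₁) (D₂ := StrongDual ℝ W₂)
      (restrictL W₁) (restrictL W₂) ε J L k fun h a b ζ =>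
      ‖iteratedFDeriv ℝ k (fullRemainder μ ν (restrictL W₁) (restrictL W₂) β f J h a b) ζ‖ := by
  obtain ⟨M, hM⟩ := exists_integrable_weight ν
  exact semiBound_fullRemainder μ ν (restrictL W₁) (restrictL W₂) P.smooth P.zero_right P.zero_left
    P.compact P.pos hM P.decay P.inversion P.test J L k

/-- The extended star product. -/
def starExt (μ : Measure (W₁ × W₂)) (ν : Measure (StrongDual ℝ W₁ × StrongDual ℝ W₂))
    (β : W₁ × W₂ → V) (f : W₁ × W₂ → ℂ) (a : StrongDual ℝ W₁ → ℂ) (b : StrongDual ℝ W₂ → ℂ) :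
    StrongDual ℝ V → ℂ :=
  fullRemainder μ ν (restrictL W₁) (restrictL W₂) β f 0 1 a b

theorem starExt_apply (a : StrongDual ℝ W₁ → ℂ) (b : StrongDual ℝ W₂ → ℂ) (ζ : StrongDual ℝ V) :
    starExt μ ν β f a b ζ = osc (pairing W₁ W₂) μ ν (amp f β ζ)
      (cpair a b 1 1 (restrictL W₁ ζ, restrictL W₂ ζ)) := by
  simp [starExt, fullRemainder]

theorem ofReal_mul_toReal_mul {C : ℝ} (hC : 0 ≤ C) {A B : ℝ≥0∞} (hA : A ≠ ⊤) (hB : B ≠ ⊤) :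
    ENNReal.ofReal (C * A.toReal * B.toReal) = ENNReal.ofReal C * A * B := by
  rw [ENNReal.ofReal_mul (by positivity), ENNReal.ofReal_mul hC, ENNReal.ofReal_toReal hA,
    ENNReal.ofReal_toReal hB]

/-- The semiclassical bound for h = θ₁ = θ₂ = Θ = 1 and J = 0, where nothing is subtracted and no
power of h has to be recovered, so L = 0 will do. -/
theorem scaleBilinear_star (P : AdaptedPhase W₁ W₂ μ ν ε K β f) :
    ScaleBilinear (symbolsOfInt (StrongDual ℝ W₁)) symbolSeminorm
      (symbolsOfInt (StrongDual ℝ W₂)) symbolSeminorm (smoothFunctions (StrongDual ℝ V))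
      symbolSeminorm (Admissible W₁ W₂) (fun m₁ m₂ => m₁ + m₂) (starExt μ ν β f) where
  lower h := h.of_le
  monotone h₁ h₂ := add_le_add h₁ h₂
  ne_top := add_ne_top_of_ne_top
  mem ha hb := fullRemainder_smooth μ ν _ _ P.smooth P.compact P.test (symbol_temperate ha)
    (symbol_temperate hb) 0 1
  left c ha ha' hb := fullRemainder_left _ _ μ ν P.smooth P.compact P.test (symbol_temperate ha)
    (symbol_temperate ha') (symbol_temperate hb) c 0 1
  right c ha hb hb' := fullRemainder_right _ _ μ ν P.smooth P.compact P.test (symbol_temperate ha)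
    (symbol_temperate hb) (symbol_temperate hb') c 0 1
  estimate := by
    intro m₁ m₂ n k hm t₁ t₂ hn
    obtain ⟨κ, hκ⟩ := P.semiBound 0 0 k
    obtain ⟨l₁, l₂, q₁, q₂, hW⟩ := exists_weights P.small hm t₁ t₂ hn κ
    obtain ⟨C, hC0, hC⟩ := hκ l₁ l₂ n hW
    refine ⟨l₁, l₂, κ, ENNReal.ofReal C, ENNReal.ofReal_ne_top, q₁, q₂, fun {a b} ha hb => ?_⟩
    rw [← ofReal_mul_toReal_mul hC0 (ENNReal.sum_lt_top.2 fun j _ => ha.2 j).ne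
      (ENNReal.sum_lt_top.2 fun j _ => hb.2 j).ne]
    refine symbolSeminorm_le fun ξ => ?_
    have := hC (h := 1) (θ₁ := 1) (θ₂ := 1) (Θ := 1) ⟨one_pos, le_rfl, le_rfl, le_rfl, by simp⟩
      (by simp) le_rfl le_rfl (symBound_of_mem ha κ) (symBound_of_mem hb κ) ξ
    simpa [starExt] using this

/-- The semiclassical bound is applied with θᵢ = h^(-δᵢ) and Θ = h^(-max(δ₁, δ₂)). Then hθ₁θ₂ =
h^(1-δ₁-δ₂), whose J-th power is the gain claimed, and the k-th power of Θ is the cost of k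
derivatives in the target class. -/
theorem scaleBilinear_remainder (P : AdaptedPhase W₁ W₂ μ ν ε K β f) {H : Set ℝ}
    (hH : H ⊆ Set.Ioc 0 1) {δ₁ δ₂ : ℝ} (h₁ : 0 ≤ δ₁) (h₂ : 0 ≤ δ₂) (h₁₂ : δ₁ + δ₂ < 1) (J : ℕ) :
    ScaleBilinear (hSymbolsOfInt (StrongDual ℝ W₁) H 0 δ₁) (hSymbolSeminorm H 0 δ₁)
      (hSymbolsOfInt (StrongDual ℝ W₂) H 0 δ₂) (hSymbolSeminorm H 0 δ₂)
      (hSmoothFunctions (StrongDual ℝ V) H)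
      (hSymbolSeminorm H ((1 - δ₁ - δ₂) * J) (max δ₁ δ₂)) (Admissible W₁ W₂)
      (fun m₁ m₂ => m₁ + m₂ + ofInt (-(J : ℤ)))
      (fun a b h => fullRemainder μ ν (restrictL W₁) (restrictL W₂) β f J h (a h) (b h)) := by
  have hpos : ∀ h ∈ H, 0 < h := fun h hh => (hH hh).1
  have tp : ∀ {W : Submodule ℝ V} {δ : ℝ} {n : ℤ} {a : H → StrongDual ℝ W → ℂ},
      a ∈ hSymbolsOfInt (StrongDual ℝ W) H 0 δ n → ∀ h, (a h).HasTemperateGrowth :=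
    fun ha h => symbol_temperate (hSymbol_mem hpos ha h)
  refine
    { lower := fun h => h.of_le
      monotone := fun h₁ h₂ => add_le_add (add_le_add h₁ h₂) le_rfl
      ne_top := fun t₁ t₂ => add_ne_top_of_ne_top (add_ne_top_of_ne_top t₁ t₂) (ofInt_ne_top _)
      mem := fun ha hb h => fullRemainder_smooth μ ν _ _ P.smooth P.compact P.test (tp ha h)
        (tp hb h) J h
      left := fun c ha ha' hb => funext fun h => fullRemainder_left _ _ μ ν P.smooth P.compact
        P.test (tp ha h) (tp ha' h) (tp hb h) c J h
      right := fun c ha hb hb' => funext fun h => fullRemainder_right _ _ μ ν P.smooth P.compact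
        P.test (tp ha h) (tp hb h) (tp hb' h) c J h
      estimate := ?_ }
  intro m₁ m₂ n k hm t₁ t₂ hn
  have hd : 0 < 1 - δ₁ - δ₂ := by linarith
  -- Since 1 − δ₁ − δ₂ is positive, some power L of hθ₁θ₂ is at most h, so powers of h lost in the
  -- crude estimate can be bought back.
  obtain ⟨L, hL⟩ := exists_nat_ge (1 - δ₁ - δ₂)⁻¹
  have hL' : 1 ≤ (1 - δ₁ - δ₂) * L := by
    have := mul_le_mul_of_nonneg_left hL hd.le
    rwa [mul_inv_cancel₀ hd.ne'] at this
  obtain ⟨κ, hκ⟩ := P.semiBound J L k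
  obtain ⟨l₁, l₂, q₁, q₂, hW⟩ := exists_weights P.small hm t₁ t₂
    (le_ofInt_add (add_ne_top_of_ne_top t₁ t₂) hn) κ
  obtain ⟨C, hC0, hC⟩ := hκ l₁ l₂ (n + J) hW
  refine ⟨l₁, l₂, κ, ENNReal.ofReal C, ENNReal.ofReal_ne_top, q₁, q₂, fun {a b} ha hb => ?_⟩
  rw [← ofReal_mul_toReal_mul hC0 (ENNReal.sum_lt_top.2 fun j _ => ha.2 j).ne
    (ENNReal.sum_lt_top.2 fun j _ => hb.2 j).ne]
  refine hSymbolSeminorm_le hpos fun h ξ => ?_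
  have h0 : 0 < (h : ℝ) := (hH h.2).1
  have h1 : (h : ℝ) ≤ 1 := (hH h.2).2
  have eτ : (h : ℝ) * (h : ℝ) ^ (-δ₁) * (h : ℝ) ^ (-δ₂) = (h : ℝ) ^ (1 - δ₁ - δ₂) := by
    nth_rewrite 1 [← Real.rpow_one (h : ℝ)]
    rw [← Real.rpow_add h0, ← Real.rpow_add h0]
    congr 1
  have anti : ∀ {s t : ℝ}, s ≤ t → (h : ℝ) ^ t ≤ (h : ℝ) ^ s := fun hst =>
    Real.rpow_le_rpow_of_exponent_ge h0 h1 hst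
  have hone : ∀ {δ : ℝ}, 0 ≤ δ → 1 ≤ (h : ℝ) ^ (-δ) := fun hδ =>
    Real.one_le_rpow_of_pos_of_le_one_of_nonpos h0 h1 (by linarith)
  have reg : Regime (h : ℝ) ((h : ℝ) ^ (-δ₁)) ((h : ℝ) ^ (-δ₂)) :=
    ⟨h0, h1, hone h₁, hone h₂, by rw [eτ]; exact Real.rpow_le_one h0.le h1 hd.le⟩
  have hτL : ((h : ℝ) * (h : ℝ) ^ (-δ₁) * (h : ℝ) ^ (-δ₂)) ^ L ≤ h := by
    rw [eτ, ← Real.rpow_natCast, ← Real.rpow_mul h0.le]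
    simpa using anti hL'
  have := hC reg hτL (anti (neg_le_neg (le_max_left δ₁ δ₂))) (anti (neg_le_neg (le_max_right δ₁ δ₂)))
    (hSymBound_of_mem hpos ha κ h) (hSymBound_of_mem hpos hb κ h) ξ
  refine this.trans (le_of_eq ?_)
  have e1 : ((h : ℝ) * (h : ℝ) ^ (-δ₁) * (h : ℝ) ^ (-δ₂)) ^ J * ((h : ℝ) ^ (-max δ₁ δ₂)) ^ k =
      (h : ℝ) ^ ((1 - δ₁ - δ₂) * J - max δ₁ δ₂ * k) := by
    rw [eτ, ← Real.rpow_natCast, ← Real.rpow_mul h0.le, ← Real.rpow_natCast, ← Real.rpow_mul h0.le,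
      ← Real.rpow_add h0]
    congr 1
    ring
  rw [← e1, show n + (J : ℤ) - J - k = n - k by ring]
  ring

end Estimates

/-! ### Uniqueness of the extension. -/

section Uniqueness

variable {V : Type*} [NormedAddCommGroup V] [NormedSpace ℝ V] [FiniteDimensional ℝ V]
  {W₁ W₂ : Submodule ℝ V}
  {star : (StrongDual ℝ W₁ → ℂ) → (StrongDual ℝ W₂ → ℂ) → StrongDual ℝ V → ℂ}

/-- Continuous extensions of a product of Schwartz functions are unique. -/
theorem IsContinuousExtension.unique {T T' : StarFamily W₁ W₂} (hT : IsContinuousExtension star T)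
    (hT' : IsContinuousExtension star T') : T' = T := by
  funext m₁ m₂ hm a b
  refine Subtype.ext (funext fun ζ => ?_)
  obtain ⟨n₁, h₁, t₁, ha⟩ := symbolScale.exists_step a.2
  obtain ⟨n₂, h₂, t₂, hb⟩ := symbolScale.exists_step b.2
  obtain ⟨m₁', q₁, u, s₁, b₁, hu⟩ := exists_approximation t₁
    (⟨(a : StrongDual ℝ W₁ → ℂ), ha⟩ : Symbols (StrongDual ℝ W₁) n₁)
  obtain ⟨m₂', q₂, v, s₂, b₂, hv⟩ := exists_approximation t₂
    (⟨(b : StrongDual ℝ W₂ → ℂ), hb⟩ : Symbols (StrongDual ℝ W₂) n₂)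
  -- Approximation raises integer orders by one but leaves −∞ alone, so the pair stays admissible.
  have hm' : Admissible W₁ W₂ m₁' m₂' := by
    have h := hm.of_le h₁ h₂
    exact ⟨fun hW => b₂ (h.1 hW), fun hW => b₁ (h.2 hW)⟩
  -- The approximating Schwartz functions do not depend on the extension. Compatibility transports
  -- the values to the orders in which the sequences converge, and continuity there makes every
  -- extension the pointwise limit of the same numbers.
  have lim : ∀ {S : StarFamily W₁ W₂}, IsContinuousExtension star S → Filter.Tendsto
      (fun j => star (u j : StrongDual ℝ W₁ → ℂ) (v j : StrongDual ℝ W₂ → ℂ) ζ) Filter.atTop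
      (𝓝 ((S m₁ m₂ hm a b : StrongDual ℝ V → ℂ) ζ)) := by
    intro S hS
    let := scaleTopology (symbolsOfInt (StrongDual ℝ W₁)) symbolSeminorm m₁'
    let := scaleTopology (symbolsOfInt (StrongDual ℝ W₂)) symbolSeminorm m₂'
    let := scaleTopology (symbolsOfInt (StrongDual ℝ V)) symbolSeminorm (m₁' + m₂')
    have c1 := hS.continuous m₁' m₂' hm' m₁' m₂' le_rfl le_rfl s₁ s₂
    have c2 := (continuous_eval (add_ne_top_of_ne_top s₁ s₂) ζ).comp c1
    have c3 := (c2.tendsto _).comp (hu.prodMk_nhds hv)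
    have e1 : (S m₁ m₂ hm a b : StrongDual ℝ V → ℂ) = S m₁' m₂' hm'
        (Submodule.inclusion (scaleSpace_mono (symbolsOfInt_mono _) q₁)
          (⟨(a : StrongDual ℝ W₁ → ℂ), ha⟩ : Symbols (StrongDual ℝ W₁) n₁))
        (Submodule.inclusion (scaleSpace_mono (symbolsOfInt_mono _) q₂)
          (⟨(b : StrongDual ℝ W₂ → ℂ), hb⟩ : Symbols (StrongDual ℝ W₂) n₂)) :=
      hS.compatible _ _ _ _ hm hm' _ _ _ _ rfl rfl
    rw [e1]
    refine c3.congr fun j => ?_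
    have e2 := hS.extends_star (u j) (v j)
    rw [← e2]
    exact congrFun (hS.compatible _ _ _ _ hm' (admissible_bot W₁ W₂) _ _ _ _ rfl rfl) ζ
  exact tendsto_nhds_unique (lim hT') (lim hT)

end Uniqueness

end StarProduct

namespace StarProduct

open MeasureTheory

set_option linter.unusedSectionVars false

/-! ### Phases and amplitudes coming from cutoffs -/

section Cutoffs

variable {V : Type*} [NormedAddCommGroup V] [NormedSpace ℝ V] [FiniteDimensional ℝ V]
  [MeasurableSpace V] [BorelSpace V] {W₁ W₂ : Submodule ℝ V}

/-- β is constant on both axes, and these span the product. -/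
theorem pd_zero_of_vanishing {β : W₁ × W₂ → V} (hβ : ContDiff ℝ ∞ β) (hβ1 : ∀ x, β (x, 0) = 0)
    (hβ2 : ∀ y, β (0, y) = 0) (v : W₁ × W₂) : pd v β 0 = 0 := by
  have hd : ∀ z, HasFDerivAt β (fderiv ℝ β z) z := fun z =>
    (hβ.differentiable (by simp) z).hasFDerivAt
  have h1 : (fderiv ℝ β 0).comp (ContinuousLinearMap.inl ℝ W₁ W₂) = 0 := by
    refine ((hd _).comp (0 : W₁) (ContinuousLinearMap.inl ℝ W₁ W₂).hasFDerivAt).unique ?_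
    refine (hasFDerivAt_const (0 : V) (0 : W₁)).congr_of_eventuallyEq (.of_forall fun x => ?_)
    exact hβ1 x
  have h2 : (fderiv ℝ β 0).comp (ContinuousLinearMap.inr ℝ W₁ W₂) = 0 := by
    refine ((hd _).comp (0 : W₂) (ContinuousLinearMap.inr ℝ W₁ W₂).hasFDerivAt).unique ?_
    refine (hasFDerivAt_const (0 : V) (0 : W₂)).congr_of_eventuallyEq (.of_forall fun y => ?_)
    exact hβ2 y
  have h3 := congrArg (fun A : W₁ →L[ℝ] V => A v.1) h1
  have h4 := congrArg (fun A : W₂ →L[ℝ] V => A v.2) h2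
  have e : v = ContinuousLinearMap.inl ℝ W₁ W₂ v.1 + ContinuousLinearMap.inr ℝ W₁ W₂ v.2 := by
    ext <;> simp
  unfold pd
  rw [e, map_add]
  simpa using congrArg₂ (· + ·) h3 h4

/-- Amplitudes supported in a small ball are adapted to a phase vanishing along the axes. -/
theorem exists_adaptedPhase (hW : W₁ ⊔ W₂ = ⊤) {β : W₁ × W₂ → V} (hβ : ContDiff ℝ ∞ β)
    (hβ1 : ∀ x, β (x, 0) = 0) (hβ2 : ∀ y, β (0, y) = 0) {Q : W₁ × W₂ → Prop}
    (hQ : ∀ᶠ z in 𝓝 0, Q z) : ∃ ε ρ : ℝ, 0 < ρ ∧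
      (∀ z ∈ Metric.closedBall (0 : W₁ × W₂) ρ, Q z) ∧
      ∀ (μ₁ : Measure W₁) (μ₂ : Measure W₂) [μ₁.IsAddHaarMeasure] [μ₂.IsAddHaarMeasure]
        (f : W₁ × W₂ → ℂ), TestOn (Metric.closedBall 0 ρ) f →
        AdaptedPhase W₁ W₂ (μ₁.prod μ₂) ((dualHaar μ₁).prod (dualHaar μ₂)) ε
          (Metric.closedBall 0 ρ) β f := by
  obtain ⟨ε, hε, hsmall⟩ := exists_smallParameter hW
  obtain ⟨c, hc, hcB⟩ := exists_pairing_lower (pairing W₁ W₂) pairing_injective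
  -- The derivatives of β are continuous and vanish at the origin, so a small ball makes them
  -- smaller than εc/2, the threshold below which frequencies of size at least ε‖l‖ dominate the
  -- phase. This, along with the domain where β represents {x, y}, determines how close to the
  -- origin the cutoffs must be supported.
  have hev : ∀ᶠ z in 𝓝 (0 : W₁ × W₂), Q z ∧ ∀ i,
      ‖pd (Module.finBasis ℝ (W₁ × W₂) i) β z‖ ≤ ε * c / 2 := by
    refine hQ.and (Filter.eventually_all.2 fun i => ?_)
    have h1 : Continuous fun z => ‖pd (Module.finBasis ℝ (W₁ × W₂) i) β z‖ :=
      (ContDiff.pd hβ _).continuous.norm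
    have h2 := h1.tendsto 0
    rw [pd_zero_of_vanishing hβ hβ1 hβ2, norm_zero] at h2
    exact (h2.eventually_lt_const (by positivity)).mono fun z hz => hz.le
  obtain ⟨ρ, hρ, hsub⟩ := Metric.nhds_basis_closedBall.mem_iff.1 hev
  refine ⟨ε, ρ, hρ, fun z hz => (hsub hz).1, fun μ₁ μ₂ _ _ f hf => ?_⟩
  have hK : IsCompact (Metric.closedBall (0 : W₁ × W₂) ρ) := isCompact_closedBall 0 ρ
  exact
    { smooth := hβ
      zero_right := hβ1
      zero_left := hβ2
      compact := hK
      pos := hε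
      small := hsmall
      decay := fun f hf N => fhat_phase_decay (pairing W₁ W₂) (μ₁.prod μ₂) hK hβ hc hcB hε
        (fun i z hz => (hsub hz).2 i) hf N
      inversion := fun G hG => integral_fhat_pairing μ₁ μ₂ hK hG
      test := hf }

theorem integrable_of_schwartz {D : Type*} [NormedAddCommGroup D] [NormedSpace ℝ D]
    [FiniteDimensional ℝ D] [MeasurableSpace D] [BorelSpace D] (ν : Measure D) [ν.IsAddHaarMeasure]
    {a : D → ℂ} (ha : a ∈ Symbols D ⊥) : Integrable a ν := by
  obtain ⟨M, hM⟩ := exists_integrable_weight ν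
  have ha' : a ∈ symbolsOfInt D (-(M : ℤ)) := symbolScale.mem_step bot_le ha
  obtain ⟨C, h0, hC⟩ := symbol_bound ha' 0
  refine integrable_of_decay ν hM ha'.1.continuous (C := C * 2 ^ M) fun w => ?_
  have h1 := hC w
  have j1 := one_le_japaneseBracket w
  have h2 : (1 + ‖w‖) ^ M ≤ (2 * japaneseBracket w) ^ M := by
    gcongr
    linarith [norm_le_japaneseBracket w]
  rw [norm_iteratedFDeriv_zero, Nat.cast_zero, sub_zero, zpow_neg, zpow_natCast] at h1
  calc _ ≤ C * (japaneseBracket w ^ M)⁻¹ * (2 * japaneseBracket w) ^ M := by gcongr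
    _ = C * 2 ^ M := by
      rw [mul_pow]
      field_simp

/-- The amplitude determined by two cutoffs. -/
def cutoffProduct (χ₁ : W₁ → ℝ) (χ₂ : W₂ → ℝ) (z : W₁ × W₂) : ℂ := (χ₁ z.1 : ℂ) * (χ₂ z.2 : ℂ)

variable {χ₁ : W₁ → ℝ} {χ₂ : W₂ → ℝ} {ρ : ℝ}

theorem testOn_cutoffProduct (h₁ : IsCutoff χ₁ {x | (x : V) ∈ Metric.ball (0 : V) ρ})
    (h₂ : IsCutoff χ₂ {x | (x : V) ∈ Metric.ball (0 : V) ρ}) :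
    TestOn (Metric.closedBall 0 ρ) (cutoffProduct χ₁ χ₂) := by
  refine ⟨(Complex.ofRealCLM.contDiff.comp (h₁.smooth.comp contDiff_fst)).mul
    (Complex.ofRealCLM.contDiff.comp (h₂.smooth.comp contDiff_snd)), fun z hz => ?_⟩
  by_contra hne
  rw [cutoffProduct, mul_eq_zero, not_or, Complex.ofReal_eq_zero, Complex.ofReal_eq_zero] at hne
  have b1 : (z.1 : V) ∈ Metric.ball (0 : V) ρ := h₁.tsupport_subset (subset_tsupport _ hne.1)
  have b2 : (z.2 : V) ∈ Metric.ball (0 : V) ρ := h₂.tsupport_subset (subset_tsupport _ hne.2)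
  rw [mem_ball_zero_iff] at b1 b2
  rw [mem_closedBall_zero_iff, Prod.norm_def] at hz
  exact hz (max_le b1.le b2.le)

theorem cutoffProduct_eventually_eq_one {U : Set V} (h₁ : IsCutoff χ₁ {x | (x : V) ∈ U})
    (h₂ : IsCutoff χ₂ {x | (x : V) ∈ U}) : ∀ᶠ z in 𝓝 0, cutoffProduct χ₁ χ₂ z = 1 := by
  have e1 := (continuous_fst.tendsto (0 : W₁ × W₂)).eventually h₁.eventually_eq_one
  have e2 := (continuous_snd.tendsto (0 : W₁ × W₂)).eventually h₂.eventually_eq_one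
  filter_upwards [e1, e2] with z hz1 hz2
  simp [cutoffProduct, hz1, hz2]

variable {br : V → V → V} {β : W₁ × W₂ → V} {K : Set (W₁ × W₂)}

/-- On the support of the cutoffs β equals {x, y}, and elsewhere both integrands vanish; the rest is
Fubini. -/
theorem starSchwartz_eq_starExt (μ₁ : Measure W₁) (μ₂ : Measure W₂) [μ₁.IsAddHaarMeasure]
    [μ₂.IsAddHaarMeasure] (hβ : ContDiff ℝ ∞ β) (hK : IsCompact K)
    (hbr : ∀ z ∈ K, br z.1 z.2 = β z) (hf : TestOn K (cutoffProduct χ₁ χ₂))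
    {a : StrongDual ℝ W₁ → ℂ} {b : StrongDual ℝ W₂ → ℂ} (ha : a ∈ Symbols (StrongDual ℝ W₁) ⊥)
    (hb : b ∈ Symbols (StrongDual ℝ W₂) ⊥) :
    starExt (μ₁.prod μ₂) ((dualHaar μ₁).prod (dualHaar μ₂)) β (cutoffProduct χ₁ χ₂) a b =
      starSchwartz W₁ W₂ br μ₁ μ₂ χ₁ χ₂ a b := by
  funext ζ
  rw [starExt_apply, ← integral_invFourier_mul μ₁ μ₂ (integrable_of_schwartz _ ha)
    (integrable_of_schwartz _ hb) hK (testOn_amp hβ hf ζ), starSchwartz]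
  refine integral_congr_ae (.of_forall fun z => ?_)
  have e : amp (cutoffProduct χ₁ χ₂) β ζ z =
      Omega W₁ W₂ br (z.1, z.2, ζ) * (χ₁ z.1 : ℂ) * (χ₂ z.2 : ℂ) := by
    by_cases hz : z ∈ K
    · simp only [amp, cutoffProduct, Omega, hbr z hz]
      ring
    · have h0 := hf.zero z hz
      rw [amp, h0, zero_mul, mul_assoc, ← cutoffProduct, h0, mul_zero]
  dsimp only
  rw [e, restrictL_apply, restrictL_apply]
  ring

theorem omega_eventuallyEq (hbr : ∀ᶠ z : W₁ × W₂ in 𝓝 0, br z.1 z.2 = β z)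
    (hone : ∀ᶠ z in 𝓝 0, cutoffProduct χ₁ χ₂ z = 1) :
    Omega W₁ W₂ br =ᶠ[𝓝 0] fun p => amp (cutoffProduct χ₁ χ₂) β p.2.2 (p.1, p.2.1) := by
  have hc : Filter.Tendsto (fun p : W₁ × W₂ × StrongDual ℝ V => (p.1, p.2.1)) (𝓝 0) (𝓝 0) := by
    have : Continuous fun p : W₁ × W₂ × StrongDual ℝ V => (p.1, p.2.1) := by fun_prop
    exact this.tendsto 0
  filter_upwards [hc.eventually hbr, hc.eventually hone] with p h1 h2
  rw [amp, h2, one_mul, Omega]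
  rw [h1]

/-- Only the germ of Ω at the origin enters the Taylor coefficients, and there the cutoffs are 1.
The formal expansion therefore does not depend on them. -/
theorem starComponent_eq_gradedPart (hβ : ContDiff ℝ ∞ β)
    (hbr : ∀ᶠ z : W₁ × W₂ in 𝓝 0, br z.1 z.2 = β z) (hf : TestOn K (cutoffProduct χ₁ χ₂))
    (hone : ∀ᶠ z in 𝓝 0, cutoffProduct χ₁ χ₂ z = 1) {a : StrongDual ℝ W₁ → ℂ}
    {b : StrongDual ℝ W₂ → ℂ} (ha : ContDiff ℝ ∞ a) (hb : ContDiff ℝ ∞ b) (j : ℕ)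
    (ζ : StrongDual ℝ V) :
    starComponent W₁ W₂ br j a b ζ = gradedPart (fun p q r => termOf (restrictL W₁) (restrictL W₂) β
      (cutoffProduct χ₁ χ₂) p q r a b ζ) j := by
  have h : ∀ p q r, starTerm W₁ W₂ br p q r a b ζ = termOf (restrictL W₁) (restrictL W₂) β
      (cutoffProduct χ₁ χ₂) p q r a b ζ := by
    intro p q r
    unfold starTerm termOf
    congr 1
    refine Finset.sum_congr rfl fun i _ => Finset.sum_congr rfl fun k _ => ?_
    rw [iteratedFDeriv_joint_eq hβ hf (omega_eventuallyEq hbr hone) r i k ζ,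
      iteratedFDeriv_eq_pds ha, iteratedFDeriv_eq_pds hb, mul_assoc]
    rfl
  unfold starComponent gradedPart
  simp only [h]

/-- Since a(h(h⁻¹ζ₁ + ξ)) = a(ζ₁ + hξ), rescaling moves h from the symbols to the scaling of the
frequencies and changes the phase parameter to h⁻¹ζ. -/
theorem starExt_rescale {μ : Measure (W₁ × W₂)} [μ.IsAddHaarMeasure]
    {ν : Measure (StrongDual ℝ W₁ × StrongDual ℝ W₂)} [ν.IsAddHaarMeasure] {f : W₁ × W₂ → ℂ} {h : ℝ} (hh : h ≠ 0)
    (a : StrongDual ℝ W₁ → ℂ) (b : StrongDual ℝ W₂ → ℂ) (ζ : StrongDual ℝ V) :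
    starExt μ ν β f (fun ξ => a (h • ξ)) (fun η => b (h • η)) (h⁻¹ • ζ) =
      osc (pairing W₁ W₂) μ ν (amp f β (h⁻¹ • ζ))
        (cpair a b h h (restrictL W₁ ζ, restrictL W₂ ζ)) := by
  rw [starExt_apply]
  congr 1
  funext w
  simp only [cpair, map_smul, one_smul, smul_add, smul_inv_smul₀ hh]

end Cutoffs

end StarProduct

end

/-! ### Assembly of the theorem. -/

open StarProduct in
theorem mainTheorem12
    -- a Lie group `G`, and its Lie algebra, normed by means of `L : V ≃ Lie(G)`
    {E : Type*} [NormedAddCommGroup E] [NormedSpace ℝ E] [FiniteDimensional ℝ E]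
    {G : Type*} [TopologicalSpace G] [T2Space G] [ChartedSpace E G] [Group G]
    [LieGroup 𝓘(ℝ, E) ω G]
    {V : Type*} [NormedAddCommGroup V] [NormedSpace ℝ V] [FiniteDimensional ℝ V]
    [MeasurableSpace V] [BorelSpace V]
    (L : V ≃L[ℝ] GroupLieAlgebra 𝓘(ℝ, E) G)
    -- a neighborhood of the origin on which `exp` is an analytic isomorphism onto its image
    (𝒢 : Set V) (h𝒢 : IsExpNeighborhood L 𝒢)
    -- subalgebras which together span the Lie algebra, and their preimages in `V`
    (𝔤₁ 𝔤₂ : LieSubalgebra ℝ (GroupLieAlgebra 𝓘(ℝ, E) G))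
    (hsum : 𝔤₁.toSubmodule ⊔ 𝔤₂.toSubmodule = ⊤)
    (W₁ W₂ : Submodule ℝ V)
    (hW₁ : W₁ = 𝔤₁.toSubmodule.comap (L : V →ₗ[ℝ] GroupLieAlgebra 𝓘(ℝ, E) G))
    (hW₂ : W₂ = 𝔤₂.toSubmodule.comap (L : V →ₗ[ℝ] GroupLieAlgebra 𝓘(ℝ, E) G)) :
    -- for all Haar measures and all cutoffs supported sufficiently close to the origin
    ∃ U ∈ 𝓝 (0 : V),
    ∀ (μ₁ : MeasureTheory.Measure W₁) (μ₂ : MeasureTheory.Measure W₂)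
      [μ₁.IsAddHaarMeasure] [μ₂.IsAddHaarMeasure] (χ₁ : W₁ → ℝ) (χ₂ : W₂ → ℝ),
      IsCutoff χ₁ {x | (x : V) ∈ U} → IsCutoff χ₂ {y | (y : V) ∈ U} →
    ∃ T : StarFamily W₁ W₂,
      -- the star product extends uniquely to a compatible family of continuous maps
      IsContinuousExtension (starSchwartz W₁ W₂ (bchRemainder L 𝒢) μ₁ μ₂ χ₁ χ₂) T ∧
      IsBilinearFamily T ∧
      (∀ T' : StarFamily W₁ W₂,
        IsContinuousExtension (starSchwartz W₁ W₂ (bchRemainder L 𝒢) μ₁ μ₂ χ₁ χ₂) T' → T' = T) ∧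
      -- the asymptotic expansion, with continuously varying remainder
      ∀ (H : Set ℝ) (hH : H ⊆ Set.Ioc 0 1) (δ₁ δ₂ : ℝ),
        δ₁ ∈ Set.Ico (0 : ℝ) 1 → δ₂ ∈ Set.Ico (0 : ℝ) 1 → δ₁ + δ₂ < 1 →
        ∀ (J : ℕ) (m₁ m₂ : StarProduct.Order) (hm : Admissible W₁ W₂ m₁ m₂),
        ∃ R : HSymbols (StrongDual ℝ W₁) H 0 δ₁ m₁ → HSymbols (StrongDual ℝ W₂) H 0 δ₂ m₂ →
            HSymbols (StrongDual ℝ V) H ((1 - δ₁ - δ₂) * J) (max δ₁ δ₂)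
              (m₁ + m₂ + ofInt (-(J : ℤ))),
          (∀ a b, (R a b : H → StrongDual ℝ V → ℂ) =
            starRemainder (bchRemainder L 𝒢) T hH hm J a b) ∧
          ContinuousOnSteps
            (hSymbolsOfInt_mono (StrongDual ℝ W₁) H 0 δ₁) (hSymbolSeminorm H 0 δ₁)
            (hSymbolsOfInt_mono (StrongDual ℝ W₂) H 0 δ₂) (hSymbolSeminorm H 0 δ₂)
            (hSymbolsOfInt (StrongDual ℝ V) H ((1 - δ₁ - δ₂) * J) (max δ₁ δ₂))
            (hSymbolSeminorm H ((1 - δ₁ - δ₂) * J) (max δ₁ δ₂)) R := by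
  have hW : W₁ ⊔ W₂ = ⊤ := by
    have hle : (⊤ : Submodule ℝ (GroupLieAlgebra 𝓘(ℝ, E) G)) ≤ 𝔤₁.toSubmodule ⊔ 𝔤₂.toSubmodule :=
      hsum.ge
    refine eq_top_iff.2 fun v _ => ?_
    obtain ⟨y, hy, z, hz, hyz⟩ := Submodule.mem_sup.1 (hle (Submodule.mem_top (x := L v)))
    refine Submodule.mem_sup.2 ⟨L.symm y, ?_, L.symm z, ?_, ?_⟩
    · rw [hW₁]
      simpa using hy
    · rw [hW₂]
      simpa using hz
    · rw [← map_add, hyz, L.symm_apply_apply]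
  obtain ⟨β, hβ, hβ1, hβ2, hbr⟩ := exists_smooth_phase h𝒢 W₁ W₂
  obtain ⟨ε, ρ, hρ, hQ, hP⟩ := exists_adaptedPhase hW hβ hβ1 hβ2 hbr
  -- The radius was fixed by the phase alone, before the measures and the cutoffs. In the maximum
  -- norm on the product, cutoffs supported in this ball have their product supported in the closed
  -- ball where the phase is controlled.
  refine ⟨Metric.ball 0 ρ, Metric.ball_mem_nhds 0 hρ, fun μ₁ μ₂ _ _ χ₁ χ₂ hχ₁ hχ₂ => ?_⟩
  have hf := testOn_cutoffProduct hχ₁ hχ₂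
  have hone := cutoffProduct_eventually_eq_one hχ₁ hχ₂
  have P := hP μ₁ μ₂ _ hf
  have hS := scaleBilinear_star P
  -- All members are given by one formula in the underlying functions, which makes compatibility
  -- automatic.
  let T : StarFamily W₁ W₂ := fun m₁ m₂ hm a b =>
    ⟨starExt (μ₁.prod μ₂) ((dualHaar μ₁).prod (dualHaar μ₂)) β (cutoffProduct χ₁ χ₂) a b,
      hS.mem_scaleSpace symbolScale symbolScale symbolScale hm a.2 b.2⟩
  have hT : IsContinuousExtension (starSchwartz W₁ W₂ (bchRemainder L 𝒢) μ₁ μ₂ χ₁ χ₂) T :=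
    { extends_star := fun a b => starSchwartz_eq_starExt μ₁ μ₂ hβ P.compact hQ hf a.2 b.2
      compatible := fun m₁ m₂ m₁' m₂' hm hm' a b a' b' ha hb => by
        change starExt _ _ _ _ (a : StrongDual ℝ W₁ → ℂ) (b : StrongDual ℝ W₂ → ℂ) = _
        rw [ha, hb]
      continuous := fun m₁ m₂ hm => hS.continuousOnSteps symbolScale symbolScale symbolScale hm
        (T m₁ m₂ hm) (fun _ _ => rfl) _ _ }
  refine ⟨T, hT, fun m₁ m₂ hm => ?_, fun T' hT' => hT.unique hT', ?_⟩
  · obtain ⟨B, hB⟩ := hS.exists_bilinear symbolScale symbolScale symbolScale hm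
    exact ⟨B, fun a b => Subtype.ext (hB a b).symm⟩
  intro H hH δ₁ δ₂ hδ₁ hδ₂ hδ J m₁ m₂ hm
  have hR := scaleBilinear_remainder P hH hδ₁.1 hδ₂.1 hδ J
  refine ⟨fun a b => ⟨_, hR.mem_scaleSpace (hSymbolScale H 0 δ₁) (hSymbolScale H 0 δ₂)
    (hSymbolScale H _ _) hm a.2 b.2⟩, fun a b => ?_, hR.continuousOnSteps (hSymbolScale H 0 δ₁)
    (hSymbolScale H 0 δ₂) (hSymbolScale H _ _) hm _ (fun _ _ => rfl) _ _⟩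
  funext h ζ
  have sa := (hSymbolScale H 0 δ₁).mem_base a.2 h
  have sb := (hSymbolScale H 0 δ₂).mem_base b.2 h
  unfold starRemainder
  simp only [starComponent_eq_gradedPart hβ hbr hf hone sa sb]
  exact congrArg (· - _) (starExt_rescale (hH h.2).1.ne' _ _ ζ).symm
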